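/- There are a program for the real RAM (unit-cost exact real arithmetic $+,-,\times,\div,\sqrt{\cdot}$ and comparisons; natural-number registers with addition, truncated subtraction and comparisons, used for indices and control; indirectly addressed memory) and a constant $C$ such that for all integers $0<k<n$ and every sequence $p_0,\dots,p_{n-1}$ of $n$ points in the Euclidean plane in convex position (each point is a vertex of their convex hull, and no two coincide; they may be given in any order), the program, on input $n$, $k$ and the coordinates of the points, halts after at most $$C\cdot 2^k\bigl(n^2\log n+n(\log n)^2\log k\bigr)$$ steps. It then outputs the indices of a set $S'$ of exactly $k$ of the points whose minimum pairwise distance is the largest among all $k$-element subsets of the points (for $k=1$ every single point counts as optimal). If $k\ge 2$, it also outputs the optimal radius $r_{\max}$, which is half of that largest minimum distance. Thus the max-min $k$-dispersion problem for points in convex position is solved exactly in $O\bigl(2^k(n^2\log n+n(\log n)^2\log k)\bigr)$ time. -/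

import Mathlib

/-! ### A real RAM

A real RAM has natural-number registers and a natural-number memory (for indices and control), and
real-number registers and a real-number memory (exact real numbers). A register is named directly
in an instruction; a memory cell is addressed through the content of a natural-number register.
Every instruction costs one unit of time. There is no rounding and no other passage from reals to
natural numbers: real data influence the control only through comparisons. -/

namespace RealRAM

/-- Instructions. `d` is a destination register, `a`, `b` are source registers and `l` is a
jump target. -/
inductive Instr where
  /-- natural register `d` becomes the constant `c` -/
  | natConst (d c : ℕ)
  /-- natural register `d` becomes the sum of natural registers `a` and `b` -/
  | natAdd (d a b : ℕ)
  /-- natural register `d` becomes the truncated difference of natural registers `a` and `b` -/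
  | natSub (d a b : ℕ)
  /-- natural register `d` becomes the natural memory cell addressed by natural register `a` -/
  | natLoad (d a : ℕ)
  /-- the natural memory cell addressed by natural register `a` becomes natural register `b` -/
  | natStore (a b : ℕ)
  /-- real register `d` becomes the rational constant `q` -/
  | realConst (d : ℕ) (q : ℚ)
  /-- real register `d` becomes the sum of real registers `a` and `b` -/
  | realAdd (d a b : ℕ)
  /-- real register `d` becomes the difference of real registers `a` and `b` -/
  | realSub (d a b : ℕ)
  /-- real register `d` becomes the product of real registers `a` and `b` -/
  | realMul (d a b : ℕ)
  /-- real register `d` becomes the quotient of real registers `a` and `b`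
  (zero if the divisor is zero) -/
  | realDiv (d a b : ℕ)
  /-- real register `d` becomes the square root of real register `a`
  (zero if that is negative) -/
  | realSqrt (d a : ℕ)
  /-- real register `d` becomes the real memory cell addressed by natural register `a` -/
  | realLoad (d a : ℕ)
  /-- the real memory cell addressed by natural register `a` becomes real register `b` -/
  | realStore (a b : ℕ)
  /-- go to instruction `l` -/
  | jump (l : ℕ)
  /-- go to instruction `l` if natural register `a` is at most natural register `b` -/
  | jumpNatLe (a b l : ℕ)
  /-- go to instruction `l` if real register `a` is at most real register `b` -/
  | jumpRealLe (a b l : ℕ)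

/-- A program is a finite list of instructions. -/
abbrev Program := List Instr

/-- A configuration of the machine. -/
@[ext]
structure State where
  /-- program counter -/
  pc : ℕ
  /-- natural-number registers -/
  natReg : ℕ → ℕ
  /-- natural-number memory -/
  natMem : ℕ → ℕ
  /-- real-number registers -/
  realReg : ℕ → ℝ
  /-- real-number memory -/
  realMem : ℕ → ℝ

namespace State

/-- Write a natural register and advance the program counter. -/
def setNat (σ : State) (d v : ℕ) : State :=
  { σ with pc := σ.pc + 1, natReg := Function.update σ.natReg d v }

/-- Write a real register and advance the program counter. -/
noncomputable def setReal (σ : State) (d : ℕ) (v : ℝ) : State :=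
  { σ with pc := σ.pc + 1, realReg := Function.update σ.realReg d v }

/-- Jump to `l` if `p` holds, and advance the program counter otherwise. -/
noncomputable def branch (σ : State) (p : Prop) [Decidable p] (l : ℕ) : State :=
  { σ with pc := if p then l else σ.pc + 1 }

end State

/-- The effect of one instruction. -/
noncomputable def Instr.exec (σ : State) : Instr → State
  | natConst d c => σ.setNat d c
  | natAdd d a b => σ.setNat d (σ.natReg a + σ.natReg b)
  | natSub d a b => σ.setNat d (σ.natReg a - σ.natReg b)
  | natLoad d a => σ.setNat d (σ.natMem (σ.natReg a))
  | natStore a b =>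
      { σ with pc := σ.pc + 1
               natMem := Function.update σ.natMem (σ.natReg a) (σ.natReg b) }
  | realConst d q => σ.setReal d (q : ℝ)
  | realAdd d a b => σ.setReal d (σ.realReg a + σ.realReg b)
  | realSub d a b => σ.setReal d (σ.realReg a - σ.realReg b)
  | realMul d a b => σ.setReal d (σ.realReg a * σ.realReg b)
  | realDiv d a b => σ.setReal d (σ.realReg a / σ.realReg b)
  | realSqrt d a => σ.setReal d (Real.sqrt (σ.realReg a))
  | realLoad d a => σ.setReal d (σ.realMem (σ.natReg a))
  | realStore a b =>
      { σ with pc := σ.pc + 1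
               realMem := Function.update σ.realMem (σ.natReg a) (σ.realReg b) }
  | jump l => { σ with pc := l }
  | jumpNatLe a b l => σ.branch (σ.natReg a ≤ σ.natReg b) l
  | jumpRealLe a b l => σ.branch (σ.realReg a ≤ σ.realReg b) l

/-- One step of a program: execute the instruction at the program counter. The machine has halted
when the program counter has left the program. -/
noncomputable def step (prog : Program) (σ : State) : State :=
  match prog[σ.pc]? with
  | some i => i.exec σ
  | none => σ

/-- The program, started in `σ`, has halted after executing at most `t` instructions, with final
configuration `τ`. -/
def HaltsWithin (prog : Program) (σ : State) (t : ℕ) (τ : State) : Prop :=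
  (step prog)^[t] σ = τ ∧ prog.length ≤ τ.pc

end RealRAM

/-! ### The max-min `k`-dispersion problem in the plane -/

namespace Dispersion

/-- The input configuration for the points `P 0, …, P (n - 1)` (in the given order) and the
integer `k`: natural registers 0 and 1 hold `n` and `k`, the real memory cells `2 * i` and
`2 * i + 1` hold the two coordinates of `P i`, and everything else is zero. -/
noncomputable def input {n : ℕ} (P : Fin n → EuclideanSpace ℝ (Fin 2)) (k : ℕ) :
    RealRAM.State where
  pc := 0
  natReg := fun r => if r = 0 then n else if r = 1 then k else 0
  natMem := fun _ => 0
  realReg := fun _ => 0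
  realMem := fun a =>
    if h : a / 2 < n then (if a % 2 = 0 then P ⟨a / 2, h⟩ 0 else P ⟨a / 2, h⟩ 1) else 0

/-- `S` is an optimal solution among the sets of `k` points: it has `k` points, and no set of `k`
points has a larger minimum pairwise distance. (The minimum over no pair at all is `∞`, so for
`k = 1` every single point is optimal.) -/
def IsOptimal {n : ℕ} (P : Fin n → EuclideanSpace ℝ (Fin 2)) (k : ℕ) (S : Finset (Fin n)) :
    Prop :=
  S.card = k ∧
    ∀ T : Finset (Fin n), T.card = k →
      (P '' (T : Set (Fin n))).einfsep ≤ (P '' (S : Set (Fin n))).einfsep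

/-- The configuration `τ` presents a solution: the natural memory cells `0, …, k - 1` list the
indices of an optimal set of `k` points and, if `k ≥ 2`, real register 0 holds the optimal radius,
which is half the minimum pairwise distance of that set. -/
def IsSolution {n : ℕ} (P : Fin n → EuclideanSpace ℝ (Fin 2)) (k : ℕ) (τ : RealRAM.State) :
    Prop :=
  ∃ S : Finset (Fin n), IsOptimal P k S ∧
    (Finset.range k).image τ.natMem = S.image (fun i : Fin n => (i : ℕ)) ∧
    (2 ≤ k → τ.realReg 0 = (P '' (S : Set (Fin n))).infsep / 2)

end Dispersion

/-!
Real RAM programs are written in a small structured language, `Structured.Cmd`, in which the number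
of rounds of a loop is fixed when the loop is entered. Its compiler is verified once and for all:
by `Structured.correct`, the compiled code has the effect `Cmd.eval` and takes exactly `Cmd.cost`
steps. Since the loop bounds of the program are `n`, `n + 1`, `k`, `n ^ 2`, a power of two of order
`n ^ 2` and its exponent `L`, the cost can be read off the nesting of the loops: by
`Cmd.costBound_le` it is at most a constant times `n ^ 2 * k ^ 3 * L`, which is within the required
bound because `k ^ 3 ≤ 8 * 2 ^ k` and `L` is of order `log n`.

The points are sorted into cyclic order by angle, an edge over which the polygon has minimum width is
taken as base, and the vertices are numbered from the right end of the base on. The last highest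
vertex `t` over the base divides them into a right and a left side (`Frame`, `Frame.Top`). The
optimal value is one of the squared distances, so these are merge-sorted, and a binary search calls
a procedure that decides whether there are `k` vertices with squared distances at least a
threshold `ρ`; such vertices are called far from one another.

The geometric facts on which this decision relies are collected in `Split`. Along a side the distance
from a vertical axis has no inner minimum, so that a part of a side along which one moves away from
the axis behaves like a monotone chain: if two neighbours among three successive vertices are far
from each other, so are the outer two. The diagonals of a quadrilateral are not both short if two
opposite sides are not. The deeper fact is `Split.opposite`: if `i`, `j`, `l` follow one
another on one side and `m` lies on the other one, the diagonal from `j` to `m` cannot be the only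
short one among the distances of neighbours in the quadrilateral and this diagonal. It is here that
minimality of the width is used: the polygon is at least as wide in the directions of the supporting
lines at `j` and `m` as over the base, and together with the law of cosines in the triangle that
the short diagonal cuts off this is contradictory (`ShortDiagonal.false_of_unit_diagonal`).

It follows that a far-apart set may be rebuilt greedily. Call its first and last members on the left
side the gates. On each side, a member that is nearest to the axis is followed by members farther
from it; this part can be replaced by a chain that always goes on to the nearest far vertex
(`Split.advance`), until it reaches a gate, or, on the right side, the farthest vertex that is
compatible with both gates. Between the last two vertices of this chain, which are nearer to the axis
than what lies between them, `Split.inner` takes the first or the last candidate, whichever gives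
more in the end. Such a family, `Split.candidate`, is determined by two gates, two directions and
the sizes of two chains. Its members are always far from one another (`Split.candidate_sound`), and
every far-apart set is matched in size by one of them (`Split.exists_candidate`). Given tables of the
next and previous far vertices and of the sizes of the families between two gates, which take
`O(n ^ 2)` steps, each of the `O(n ^ 2 * k ^ 2)` candidates is checked in `O(k)` steps.

The program uses the real arrays 0 and 1 for the points, 2 and 3 for the coordinates over the base,
4 for the distances from the axis, 5 for the squared distances, 6 and 7 for sorting them. The arrays
of natural numbers are 0 for the offsets of the rows of tables, 1 and 2 for the cyclic order before
and after the choice of the base, 3 and 4 for `Split.firstFar` and `Split.lastFar`, 5 and 6 for the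
next and previous far vertices, 7 for the sizes of greedy families, 8 for the family under
construction, 9 for the result and 10 for powers of two. Registers 0 to 5 hold the loop bounds.
-/

/-! ### A structured language for the real RAM -/

namespace Structured

open RealRAM

/-- The data of a configuration of the machine, without the program counter. Both memories are
split into sixteen arrays: cell `i` of array `a` is the memory cell `16 * i + a`. -/
@[ext]
structure Store where
  /-- natural-number registers -/
  v : ℕ → ℕ
  /-- real-number registers -/
  x : ℕ → ℝ
  /-- arrays of natural numbers -/
  A : ℕ → ℕ → ℕ
  /-- arrays of real numbers -/
  B : ℕ → ℕ → ℝ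

namespace Store

/-- Write a natural register. -/
def setV (σ : Store) (d c : ℕ) : Store := { σ with v := Function.update σ.v d c }

/-- Write a real register. -/
def setX (σ : Store) (d : ℕ) (c : ℝ) : Store := { σ with x := Function.update σ.x d c }

/-- Write a cell of an array of natural numbers. -/
def setA (σ : Store) (a i c : ℕ) : Store :=
  { σ with A := Function.update σ.A a (Function.update (σ.A a) i c) }

/-- Write a cell of an array of real numbers. -/
def setB (σ : Store) (a i : ℕ) (c : ℝ) : Store :=
  { σ with B := Function.update σ.B a (Function.update (σ.B a) i c) }

variable (σ : Store) (a d i c r : ℕ) (z : ℝ)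

@[simp] lemma setV_v :
    (σ.setV d c).v r = if r = d then c else σ.v r := by simp [setV, Function.update_apply]
@[simp] lemma setV_x : (σ.setV d c).x = σ.x := rfl
@[simp] lemma setV_A : (σ.setV d c).A = σ.A := rfl
@[simp] lemma setV_B : (σ.setV d c).B = σ.B := rfl
@[simp] lemma setX_v : (σ.setX d z).v = σ.v := rfl
@[simp] lemma setX_x :
    (σ.setX d z).x r = if r = d then z else σ.x r := by simp [setX, Function.update_apply]
@[simp] lemma setX_A : (σ.setX d z).A = σ.A := rfl
@[simp] lemma setX_B : (σ.setX d z).B = σ.B := rfl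
@[simp] lemma setA_v : (σ.setA a i c).v = σ.v := rfl
@[simp] lemma setA_x : (σ.setA a i c).x = σ.x := rfl
@[simp] lemma setA_A (a' i' : ℕ) :
    (σ.setA a i c).A a' i' = if a' = a ∧ i' = i then c else σ.A a' i' := by
  by_cases h : a' = a <;> by_cases h' : i' = i <;> simp [setA, h, h']
@[simp] lemma setA_B : (σ.setA a i c).B = σ.B := rfl
@[simp] lemma setB_v : (σ.setB a i z).v = σ.v := rfl
@[simp] lemma setB_x : (σ.setB a i z).x = σ.x := rfl
@[simp] lemma setB_A : (σ.setB a i z).A = σ.A := rfl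
@[simp] lemma setB_B (a' i' : ℕ) :
    (σ.setB a i z).B a' i' = if a' = a ∧ i' = i then z else σ.B a' i' := by
  by_cases h : a' = a <;> by_cases h' : i' = i <;> simp [setB, h, h']

end Store

/-- Expressions for natural numbers. -/
inductive NExp where
  | reg (r : ℕ)
  | con (c : ℕ)
  | add (a b : NExp)
  | sub (a b : NExp)
  /-- the cell of array `a` with index `i` -/
  | ld (a : ℕ) (i : NExp)

/-- Expressions for real numbers. -/
inductive RExp where
  | reg (r : ℕ)
  | con (q : ℚ)
  | add (a b : RExp)
  | sub (a b : RExp)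
  | mul (a b : RExp)
  | div (a b : RExp)
  | sqrt (a : RExp)
  /-- the cell of array `a` with index `i` -/
  | ld (a : ℕ) (i : NExp)
  /-- the real memory cell with address `i` -/
  | raw (i : NExp)

/-- Structured programs. The only loops are bounded ones, so that every program terminates. -/
inductive Cmd where
  | skip
  | setV (d : ℕ) (e : NExp)
  | setX (d : ℕ) (e : RExp)
  | stA (a : ℕ) (i e : NExp)
  | stB (a : ℕ) (i : NExp) (e : RExp)
  /-- write the natural memory cell with address `i` -/
  | rawSt (i e : NExp)
  | seq (c₁ c₂ : Cmd)
  | ifN (a b : NExp) (c₁ c₂ : Cmd)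
  | ifR (a b : RExp) (c₁ c₂ : Cmd)
  /-- with `N` the content of register `b` at the start, run the body for `d = 0, …, N - 1` -/
  | loop (d b : ℕ) (body : Cmd)

/-- Iteration with access to the number of the round. -/
def iter (f : ℕ → Store → Store) (σ : Store) : ℕ → Store
  | 0 => σ
  | i + 1 => f i (iter f σ i)

lemma iter_induction {f : ℕ → Store → Store} {σ : Store} (P : ℕ → Store → Prop) {N : ℕ}
    (h0 : P 0 σ) (hs : ∀ i < N, ∀ τ, P i τ → P (i + 1) (f i τ)) : P N (iter f σ N) := by
  have : ∀ j ≤ N, P j (iter f σ j) := by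
    intro j
    induction j with
    | zero => intro _; exact h0
    | succ j ih => intro h; exact hs j (by omega) _ (ih (by omega))
  exact this N le_rfl

namespace NExp

/-- The value of an expression. -/
@[simp] def eval (σ : Store) : NExp → ℕ
  | reg r => σ.v r
  | con c => c
  | add a b => a.eval σ + b.eval σ
  | sub a b => a.eval σ - b.eval σ
  | ld a i => σ.A a (i.eval σ)

/-- All registers are among the first hundred (the others are used by the compiled code), and all
arrays among the sixteen. -/
def wf : NExp → Bool
  | reg r => r < 100
  | con _ => true
  | add a b | sub a b => a.wf && b.wf
  | ld a i => a < 16 && i.wf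

/-- Code that turns the index in register `101 + 2 * t` into the address of that cell of array
`a`. -/
def address (a t : ℕ) : List Instr :=
  [.natAdd (101 + 2 * t) (101 + 2 * t) (101 + 2 * t),
    .natAdd (101 + 2 * t) (101 + 2 * t) (101 + 2 * t),
    .natAdd (101 + 2 * t) (101 + 2 * t) (101 + 2 * t),
    .natAdd (101 + 2 * t) (101 + 2 * t) (101 + 2 * t),
    .natConst (103 + 2 * t) a, .natAdd (101 + 2 * t) (101 + 2 * t) (103 + 2 * t)]

/-- Code that puts the value of an expression into register `101 + 2 * t`. Temporary values are kept
in registers of odd number. -/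
def code : NExp → ℕ → List Instr
  | reg r, t => [.natConst (101 + 2 * t) 0, .natAdd (101 + 2 * t) r (101 + 2 * t)]
  | con c, t => [.natConst (101 + 2 * t) c]
  | add a b, t => a.code t ++ (b.code (t + 1) ++
      [.natAdd (101 + 2 * t) (101 + 2 * t) (103 + 2 * t)])
  | sub a b, t => a.code t ++ (b.code (t + 1) ++
      [.natSub (101 + 2 * t) (101 + 2 * t) (103 + 2 * t)])
  | ld a i, t => i.code t ++ (address a t ++ [.natLoad (101 + 2 * t) (101 + 2 * t)])

end NExp

namespace RExp

/-- The value of an expression. -/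
@[simp] noncomputable def eval (σ : Store) : RExp → ℝ
  | reg r => σ.x r
  | con q => q
  | add a b => a.eval σ + b.eval σ
  | sub a b => a.eval σ - b.eval σ
  | mul a b => a.eval σ * b.eval σ
  | div a b => a.eval σ / b.eval σ
  | sqrt a => Real.sqrt (a.eval σ)
  | ld a i => σ.B a (i.eval σ)
  | raw i => σ.B (i.eval σ % 16) (i.eval σ / 16)

/-- All registers are among the first hundred, and all arrays among the sixteen. -/
def wf : RExp → Bool
  | reg r => r < 100
  | con _ => true
  | add a b | sub a b | mul a b | div a b => a.wf && b.wf
  | sqrt a => a.wf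
  | ld a i => a < 16 && i.wf
  | raw i => i.wf

/-- Code that puts the value of an expression into real register `100 + t`; the natural registers
that it uses are those of odd number from `101 + 2 * s` on. -/
def code (s : ℕ) : RExp → ℕ → List Instr
  | reg r, t => [.realConst (100 + t) 0, .realAdd (100 + t) r (100 + t)]
  | con q, t => [.realConst (100 + t) q]
  | add a b, t => a.code s t ++ (b.code s (t + 1) ++ [.realAdd (100 + t) (100 + t) (101 + t)])
  | sub a b, t => a.code s t ++ (b.code s (t + 1) ++ [.realSub (100 + t) (100 + t) (101 + t)])
  | mul a b, t => a.code s t ++ (b.code s (t + 1) ++ [.realMul (100 + t) (100 + t) (101 + t)])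
  | div a b, t => a.code s t ++ (b.code s (t + 1) ++ [.realDiv (100 + t) (100 + t) (101 + t)])
  | sqrt a, t => a.code s t ++ [.realSqrt (100 + t) (100 + t)]
  | ld a i, t => i.code s ++ (NExp.address a s ++ [.realLoad (100 + t) (101 + 2 * s)])
  | raw i, t => i.code s ++ [.realLoad (100 + t) (101 + 2 * s)]

end RExp

namespace Cmd

/-- The effect of a structured program. -/
noncomputable def eval : Cmd → Store → Store
  | skip, σ => σ
  | setV d e, σ => σ.setV d (e.eval σ)
  | setX d e, σ => σ.setX d (e.eval σ)
  | stA a i e, σ => σ.setA a (i.eval σ) (e.eval σ)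
  | stB a i e, σ => σ.setB a (i.eval σ) (e.eval σ)
  | rawSt i e, σ => σ.setA (i.eval σ % 16) (i.eval σ / 16) (e.eval σ)
  | seq c₁ c₂, σ => c₂.eval (c₁.eval σ)
  | ifN a b c₁ c₂, σ => if a.eval σ ≤ b.eval σ then c₁.eval σ else c₂.eval σ
  | ifR a b c₁ c₂, σ => if a.eval σ ≤ b.eval σ then c₁.eval σ else c₂.eval σ
  | loop d b body, σ => iter (fun i τ => body.eval (τ.setV d i)) σ (σ.v b)

/-- All registers are among the first hundred (the others are used by the compiled code), and all
arrays among the sixteen. -/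
def wf : Cmd → Bool
  | skip => true
  | setV d e => d < 100 && e.wf
  | setX d e => d < 100 && e.wf
  | stA a i e => a < 16 && i.wf && e.wf
  | stB a i e => a < 16 && i.wf && e.wf
  | rawSt i e => i.wf && e.wf
  | seq c₁ c₂ => c₁.wf && c₂.wf
  | ifN a b c₁ c₂ => a.wf && b.wf && c₁.wf && c₂.wf
  | ifR a b c₁ c₂ => a.wf && b.wf && c₁.wf && c₂.wf
  | loop d b body => d < 100 && b < 100 && body.wf

/-- The compiled code, to be placed at address `p`; `e` is the nesting depth of loops, which
determines the registers (of even number) that hold the counter and the bound of a loop. -/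
def code : Cmd → ℕ → ℕ → List Instr
  | skip, _, _ => []
  | setV d e, _, _ => e.code 0 ++ [.natConst 103 0, .natAdd d 101 103]
  | setX d e, _, _ => e.code 0 0 ++ [.realConst 101 0, .realAdd d 100 101]
  | stA a i e, _, _ => i.code 0 ++ (NExp.address a 0 ++ (e.code 1 ++ [.natStore 101 103]))
  | stB a i e, _, _ => i.code 0 ++ (NExp.address a 0 ++ (e.code 1 0 ++ [.realStore 101 100]))
  | rawSt i e, _, _ => i.code 0 ++ (e.code 1 ++ [.natStore 101 103])
  | seq c₁ c₂, e, p => c₁.code e p ++ c₂.code e (p + (c₁.code e p).length)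
  | ifN a b c₁ c₂, e, p =>
      let q := p + (a.code 0 ++ b.code 1).length
      let l₂ := (c₂.code e (q + 1)).length
      let l₁ := (c₁.code e (q + 1 + l₂ + 1)).length
      (a.code 0 ++ b.code 1) ++ .jumpNatLe 101 103 (q + 1 + l₂ + 1) :: (c₂.code e (q + 1) ++
        .jump (q + 1 + l₂ + 1 + l₁) :: c₁.code e (q + 1 + l₂ + 1))
  | ifR a b c₁ c₂, e, p =>
      let q := p + (a.code 0 0 ++ b.code 0 1).length
      let l₂ := (c₂.code e (q + 1)).length
      let l₁ := (c₁.code e (q + 1 + l₂ + 1)).length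
      (a.code 0 0 ++ b.code 0 1) ++ .jumpRealLe 100 101 (q + 1 + l₂ + 1) ::
        (c₂.code e (q + 1) ++
        .jump (q + 1 + l₂ + 1 + l₁) :: c₁.code e (q + 1 + l₂ + 1))
  | loop d b body, e, p =>
      let c := body.code (e + 1) (p + 6)
      [.natConst 101 0, .natAdd (102 + 4 * e) b 101, .natConst (100 + 4 * e) 0] ++
        .jumpNatLe (102 + 4 * e) (100 + 4 * e) (p + 9 + c.length) ::
        ([.natConst 101 0, .natAdd d (100 + 4 * e) 101] ++ (c ++
        ([.natConst 101 1, .natAdd (100 + 4 * e) (100 + 4 * e) 101] ++ [.jump (p + 3)])))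

/-- The number of machine steps of the compiled program. -/
noncomputable def cost : Cmd → Store → ℕ
  | seq c₁ c₂, σ => c₁.cost σ + c₂.cost (c₁.eval σ)
  | ifN a b c₁ c₂, σ => (a.code 0 ++ b.code 1).length +
      if a.eval σ ≤ b.eval σ then c₁.cost σ + 1 else c₂.cost σ + 2
  | ifR a b c₁ c₂, σ => (a.code 0 0 ++ b.code 0 1).length +
      if a.eval σ ≤ b.eval σ then c₁.cost σ + 1 else c₂.cost σ + 2
  | loop d b body, σ => 4 + ∑ i ∈ Finset.range (σ.v b),
      (6 + body.cost ((iter (fun i τ => body.eval (τ.setV d i)) σ i).setV d i))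
  | c, _ => (c.code 0 0).length

end Cmd

/-- The machine configuration `m` holds the data `σ`. -/
structure Rel (σ : Store) (m : State) : Prop where
  nat : ∀ r < 100, m.natReg r = σ.v r
  real : ∀ r < 100, m.realReg r = σ.x r
  natMem : ∀ a < 16, ∀ i, m.natMem (16 * i + a) = σ.A a i
  realMem : ∀ a < 16, ∀ i, m.realMem (16 * i + a) = σ.B a i

/-- The code `c` stands in the program at address `p`. -/
def CodeAt (prog : Program) (p : ℕ) (l : List Instr) : Prop :=
  ∀ i, i < l.length → prog[p + i]? = l[i]?

lemma CodeAt.left {prog : Program} {p : ℕ} {c d : List Instr} (h : CodeAt prog p (c ++ d)) :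
    CodeAt prog p c := fun i hi => by
  rw [h i (by simp; omega), List.getElem?_append_left hi]

lemma CodeAt.right {prog : Program} {p : ℕ} {c d : List Instr} (h : CodeAt prog p (c ++ d)) :
    CodeAt prog (p + c.length) d := fun i hi => by
  have := h (c.length + i) (by simp; omega)
  rw [add_assoc, this, List.getElem?_append_right (by omega)]
  simp

lemma CodeAt.head {prog : Program} {p : ℕ} {a : Instr} {d : List Instr}
    (h : CodeAt prog p (a :: d)) : prog[p]? = some a := by simpa using h 0 (by simp)

lemma CodeAt.tail {prog : Program} {p : ℕ} {a : Instr} {d : List Instr}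
    (h : CodeAt prog p (a :: d)) : CodeAt prog (p + 1) d := fun i hi => by
  have := h (i + 1) (by simpa using hi)
  rw [show p + 1 + i = p + (i + 1) by omega, this]; simp

/-- The program leads from `m` to `m'` in exactly `t` steps. -/
def Runs (prog : Program) (m : State) (t : ℕ) (m' : State) : Prop := (step prog)^[t] m = m'

lemma Runs.refl (prog : Program) (m : State) : Runs prog m 0 m := rfl

lemma Runs.trans {prog : Program} {m m' m'' : State} {s t : ℕ} (h : Runs prog m s m')
    (h' : Runs prog m' t m'') : Runs prog m (s + t) m'' := by
  unfold Runs at *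
  rw [add_comm, Function.iterate_add_apply, h, h']

lemma Runs.one {prog : Program} {m : State} {i : Instr} (h : prog[m.pc]? = some i) :
    Runs prog m 1 (i.exec m) := by
  simp [Runs, step, h]

lemma Runs.cons {prog : Program} {m m' : State} {i : Instr} {t : ℕ}
    (h : prog[m.pc]? = some i) (h' : Runs prog (i.exec m) t m') : Runs prog m (t + 1) m' := by
  rw [add_comm]; exact (Runs.one h).trans h'

/-- Instructions other than jumps. -/
def Straight : Instr → Prop
  | .jump _ => False
  | .jumpNatLe .. => False
  | .jumpRealLe .. => False
  | _ => True

lemma Straight.pc {i : Instr} (h : Straight i) (m : State) : (i.exec m).pc = m.pc + 1 := by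
  cases i <;> simp_all [Straight, Instr.exec, State.setNat, State.setReal]

/-- The effect of code without jumps. -/
noncomputable def run (c : List Instr) (m : State) : State := c.foldl Instr.exec m

lemma run_nil (m : State) : run [] m = m := rfl

lemma run_cons (i : Instr) (c : List Instr) (m : State) : run (i :: c) m = run c (i.exec m) :=
  rfl

lemma run_append (c d : List Instr) (m : State) : run (c ++ d) m = run d (run c m) :=
  List.foldl_append ..

lemma Runs.straight {prog : Program} (c : List Instr) (hc : ∀ i ∈ c, Straight i) (m : State)
    (h : CodeAt prog m.pc c) : Runs prog m c.length (run c m) ∧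
      (run c m).pc = m.pc + c.length := by
  induction c generalizing m with
  | nil => exact ⟨rfl, rfl⟩
  | cons a c ih =>
    have ha := (hc a (by simp)).pc m
    obtain ⟨h1, h2⟩ := ih (fun i hi => hc i (by simp [hi])) (a.exec m) (by rw [ha]; exact h.tail)
    refine ⟨Runs.cons h.head h1, ?_⟩
    simp only [run, List.foldl_cons, List.length_cons] at h2 ⊢
    rw [h2, ha]; omega

/-- Code that writes only temporary registers: natural ones of odd number from `101 + 2 * s` on, and
real ones from `100 + t` on. -/
structure Temp (s t : ℕ) (m m' : State) : Prop where
  nat : ∀ r, (r < 101 + 2 * s ∨ r % 2 = 0) → m'.natReg r = m.natReg r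
  real : ∀ r, r < 100 + t → m'.realReg r = m.realReg r
  natMem : m'.natMem = m.natMem
  realMem : m'.realMem = m.realMem

lemma Temp.trans {s t s' t' : ℕ} {m m' m'' : State} (h : Temp s t m m') (h' : Temp s' t' m' m'')
    (hs : s ≤ s') (ht : t ≤ t') : Temp s t m m'' where
  nat r hr := (h'.nat r (by omega)).trans (h.nat r hr)
  real r hr := (h'.real r (by omega)).trans (h.real r hr)
  natMem := h'.natMem.trans h.natMem
  realMem := h'.realMem.trans h.realMem

lemma Temp.rel {s t : ℕ} {σ : Store} {m m' : State} (h : Temp s t m m') (hr : Rel σ m) :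
    Rel σ m' where
  nat r hlt := (h.nat r (by omega)).trans (hr.nat r hlt)
  real r hlt := (h.real r (by omega)).trans (hr.real r hlt)
  natMem := by rw [h.natMem]; exact hr.natMem
  realMem := by rw [h.realMem]; exact hr.realMem

lemma Temp.setNat (s t : ℕ) (m : State) (v : ℕ) : Temp s t m (m.setNat (101 + 2 * s) v) where
  nat r hr := Function.update_of_ne (by omega) _ _
  real _ _ := rfl
  natMem := rfl
  realMem := rfl

lemma Temp.setReal (s t : ℕ) (m : State) (v : ℝ) : Temp s t m (m.setReal (100 + t) v) where
  nat _ _ := rfl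
  real r hr := Function.update_of_ne (by omega) _ _
  natMem := rfl
  realMem := rfl

lemma run_address {s t v : ℕ} {m m' : State}
    (h : Temp s t m m' ∧ m'.natReg (101 + 2 * s) = v) (a : ℕ) :
    Temp s t m (run (NExp.address a s) m') ∧
      (run (NExp.address a s) m').natReg (101 + 2 * s) = 16 * v + a := by
  refine ⟨h.1.trans ⟨fun r hr => ?_, fun r _ => rfl, rfl, rfl⟩ le_rfl le_rfl, ?_⟩
  · have h1 : r ≠ 101 + 2 * s := by omega
    have h2 : r ≠ 103 + 2 * s := by omega
    simp [run_cons, run_nil, NExp.address, Instr.exec, State.setNat, h1, h2]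
  · simp [run_cons, run_nil, NExp.address, Instr.exec, State.setNat, h.2]; ring

lemma NExp.run_code (e : NExp) (he : e.wf = true) (t u : ℕ) (σ : Store) (m : State)
    (hr : Rel σ m) :
    Temp t u m (run (e.code t) m) ∧ (run (e.code t) m).natReg (101 + 2 * t) = e.eval σ := by
  induction e generalizing t m with
  | reg r =>
    simp only [NExp.wf, decide_eq_true_eq] at he
    refine ⟨(Temp.setNat t u m _).trans (.setNat t u _ _) le_rfl le_rfl, ?_⟩
    have h1 : r ≠ 101 + 2 * t := by omega
    simp [run_cons, run_nil, NExp.code, Instr.exec, State.setNat, h1, hr.nat r he]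
  | con c =>
    refine ⟨.setNat t u m _, ?_⟩
    simp [run_cons, run_nil, NExp.code, Instr.exec, State.setNat]
  | add a b iha ihb | sub a b iha ihb =>
    simp only [NExp.wf, Bool.and_eq_true] at he
    obtain ⟨h1, h2⟩ := iha he.1 t m hr
    obtain ⟨h3, h4⟩ := ihb he.2 (t + 1) _ (h1.rel hr)
    simp only [NExp.code, run_append]
    refine ⟨(h1.trans h3 (by omega) le_rfl).trans (.setNat t u _ _) le_rfl le_rfl, ?_⟩
    have h6 := h3.nat (101 + 2 * t) (by omega)
    rw [show 101 + 2 * (t + 1) = 103 + 2 * t by ring] at h4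
    simp [run_cons, run_nil, Instr.exec, State.setNat, h4, h6, h2]
  | ld a i ih =>
    simp only [NExp.wf, Bool.and_eq_true, decide_eq_true_eq] at he
    obtain ⟨h1, h2⟩ := run_address (ih he.2 t m hr) a
    simp only [NExp.code, run_append]
    refine ⟨h1.trans (.setNat t u _ _) le_rfl le_rfl, ?_⟩
    simp [run_cons, run_nil, Instr.exec, State.setNat, h2, h1.natMem, hr.natMem a he.1]

lemma mem_of_address {s : ℕ} {f : ℕ → ℝ} {g : ℕ → ℕ → ℝ}
    (h : ∀ a < 16, ∀ i, f (16 * i + a) = g a i) : f s = g (s % 16) (s / 16) := by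
  rw [← h _ (Nat.mod_lt _ (by norm_num)), Nat.div_add_mod]

lemma RExp.run_binary {f : ℝ → ℝ → ℝ} {I : ℕ → ℕ → ℕ → Instr}
    (hI : ∀ m d a b, (I d a b).exec m = m.setReal d (f (m.realReg a) (m.realReg b)))
    {s t : ℕ} {σ : Store} {m : State} {a b : RExp} (hr : Rel σ m)
    (ha : ∀ t m, Rel σ m → Temp s t m (run (a.code s t) m) ∧
      (run (a.code s t) m).realReg (100 + t) = a.eval σ)
    (hb : ∀ t m, Rel σ m → Temp s t m (run (b.code s t) m) ∧
      (run (b.code s t) m).realReg (100 + t) = b.eval σ) :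
    Temp s t m (run (a.code s t ++ (b.code s (t + 1) ++ [I (100 + t) (100 + t) (101 + t)])) m) ∧
      (run (a.code s t ++ (b.code s (t + 1) ++ [I (100 + t) (100 + t) (101 + t)])) m).realReg
        (100 + t) = f (a.eval σ) (b.eval σ) := by
  obtain ⟨h1, h2⟩ := ha t m hr
  obtain ⟨h3, h4⟩ := hb (t + 1) _ (h1.rel hr)
  have h6 := h3.real (100 + t) (by omega)
  rw [show 100 + (t + 1) = 101 + t by ring] at h4
  simp only [run_append, run_cons, run_nil, hI]
  refine ⟨(h1.trans h3 le_rfl (by omega)).trans (.setReal s t _ _) le_rfl le_rfl, ?_⟩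
  simp [State.setReal, h4, h6, h2]

lemma RExp.run_code (e : RExp) (he : e.wf = true) (s t : ℕ) (σ : Store) (m : State)
    (hr : Rel σ m) :
    Temp s t m (run (e.code s t) m) ∧ (run (e.code s t) m).realReg (100 + t) = e.eval σ := by
  induction e generalizing t m with
  | reg r =>
    simp only [RExp.wf, decide_eq_true_eq] at he
    refine ⟨(Temp.setReal s t m _).trans (.setReal s t _ _) le_rfl le_rfl, ?_⟩
    have h1 : r ≠ 100 + t := by omega
    simp [run_cons, run_nil, RExp.code, Instr.exec, State.setReal, h1, hr.real r he]
  | con c =>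
    refine ⟨.setReal s t m _, ?_⟩
    simp [run_cons, run_nil, RExp.code, Instr.exec, State.setReal]
  | add a b iha ihb | sub a b iha ihb | mul a b iha ihb | div a b iha ihb =>
    simp only [RExp.wf, Bool.and_eq_true] at he
    exact run_binary (fun _ _ _ _ => rfl) hr (iha he.1) (ihb he.2)
  | sqrt a ih =>
    obtain ⟨h1, h2⟩ := ih he t m hr
    simp only [RExp.code, run_append]
    refine ⟨h1.trans (.setReal s t _ _) le_rfl le_rfl, ?_⟩
    simp [run_cons, run_nil, Instr.exec, State.setReal, h2]
  | ld a i =>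
    simp only [RExp.wf, Bool.and_eq_true, decide_eq_true_eq] at he
    obtain ⟨h1, h2⟩ := run_address (i.run_code he.2 s t σ m hr) a
    simp only [RExp.code, run_append]
    refine ⟨h1.trans (.setReal s t _ _) le_rfl le_rfl, ?_⟩
    simp [run_cons, run_nil, Instr.exec, State.setReal, h2, h1.realMem, hr.realMem a he.1]
  | raw i =>
    obtain ⟨h1, h2⟩ := i.run_code he s t σ m hr
    simp only [RExp.code, run_append]
    refine ⟨h1.trans (.setReal s t _ _) le_rfl le_rfl, ?_⟩
    simp [run_cons, run_nil, Instr.exec, State.setReal, h1.realMem, h2, mem_of_address hr.realMem]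

lemma straight_append {c d : List Instr} (hc : ∀ i ∈ c, Straight i) (hd : ∀ i ∈ d, Straight i) :
    ∀ i ∈ c ++ d, Straight i := by
  intro i hi
  rcases List.mem_append.1 hi with h | h
  exacts [hc i h, hd i h]

lemma straight_address (a t : ℕ) : ∀ i ∈ NExp.address a t, Straight i := by
  simp [NExp.address, Straight]

lemma NExp.straight (e : NExp) (t : ℕ) : ∀ i ∈ e.code t, Straight i := by
  induction e generalizing t with
  | add a b iha ihb | sub a b iha ihb =>
    exact straight_append (iha _) (straight_append (ihb _) (by simp [Straight]))
  | ld a i ih =>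
    exact straight_append (ih _) (straight_append (straight_address _ _) (by simp [Straight]))
  | _ => simp [NExp.code, Straight]

lemma RExp.straight (e : RExp) (s t : ℕ) : ∀ i ∈ e.code s t, Straight i := by
  induction e generalizing t with
  | add a b iha ihb | sub a b iha ihb | mul a b iha ihb | div a b iha ihb =>
    exact straight_append (iha _) (straight_append (ihb _) (by simp [Straight]))
  | sqrt a ih => exact straight_append (ih _) (by simp [Straight])
  | ld a i =>
    exact straight_append (i.straight _)
      (straight_append (straight_address _ _) (by simp [Straight]))
  | raw i => exact straight_append (i.straight _) (by simp [Straight])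
  | _ => simp [RExp.code, Straight]

/-- Placed anywhere in a program, the compiled code runs to its end in `Cmd.cost` steps with the
effect `Cmd.eval`, and it keeps the registers that belong to the loops around it. -/
def Correct (c : Cmd) : Prop :=
  c.wf = true → ∀ (prog : Program) (e p : ℕ) (σ : Store) (m : State),
    CodeAt prog p (c.code e p) → m.pc = p → Rel σ m →
    ∃ m', Runs prog m (c.cost σ) m' ∧ m'.pc = p + (c.code e p).length ∧ Rel (c.eval σ) m' ∧
      ∀ r, 100 ≤ r → r < 100 + 4 * e → r % 2 = 0 → m'.natReg r = m.natReg r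

lemma correct_of_straight (c : Cmd) (l : List Instr) (hl : ∀ e p, c.code e p = l)
    (hs : ∀ i ∈ l, Straight i) (hcost : ∀ σ, c.cost σ = l.length)
    (h : c.wf = true → ∀ σ m, Rel σ m → Rel (c.eval σ) (run l m) ∧
      ∀ r, 100 ≤ r → r % 2 = 0 → (run l m).natReg r = m.natReg r) : Correct c := by
  intro hwf prog e p σ m hc hp hr
  subst hp
  rw [hl] at hc ⊢
  obtain ⟨h1, h2⟩ := Runs.straight l hs m hc
  exact ⟨_, by rw [hcost σ]; exact h1, h2, (h hwf σ m hr).1, fun r h3 _ h4 =>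
    (h hwf σ m hr).2 r h3 h4⟩

lemma split_address {a b i j : ℕ} (ha : a < 16) (hb : b < 16) :
    16 * i + a = 16 * j + b ↔ i = j ∧ a = b := by omega

lemma address_div_mod {a i s : ℕ} (ha : a < 16) :
    16 * i + a = s ↔ i = s / 16 ∧ a = s % 16 := by omega

/-- A conditional of either kind: `l` evaluates the two sides of the comparison, and `J a` is the
conditional jump to address `a`. -/
lemma correct_branch {c c₁ c₂ : Cmd} {l : List Instr} {J : ℕ → Instr} {P : Store → Prop}
    [∀ σ, Decidable (P σ)] {q : ℕ → ℕ} (hq : ∀ p, q p = p + l.length)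
    (hcode : ∀ e p, c.code e p = l ++ J (q p + 1 + (c₂.code e (q p + 1)).length + 1) ::
      (c₂.code e (q p + 1) ++
        .jump (q p + 1 + (c₂.code e (q p + 1)).length + 1 +
          (c₁.code e (q p + 1 + (c₂.code e (q p + 1)).length + 1)).length) ::
        c₁.code e (q p + 1 + (c₂.code e (q p + 1)).length + 1)))
    (heval : ∀ σ, c.eval σ = if P σ then c₁.eval σ else c₂.eval σ)
    (hcost : ∀ σ, c.cost σ = l.length + if P σ then c₁.cost σ + 1 else c₂.cost σ + 2)
    (hw : c.wf = true → c₁.wf = true ∧ c₂.wf = true)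
    (hs : ∀ i ∈ l, Straight i)
    (hJ : c.wf = true → ∀ σ m, Rel σ m → Temp 0 0 m (run l m) ∧
      ∀ a, (J a).exec (run l m) =
        { run l m with pc := if P σ then a else (run l m).pc + 1 })
    (ih₁ : Correct c₁) (ih₂ : Correct c₂) : Correct c := by
  intro hwf prog e p σ m hc hp hr
  subst hp
  rw [hcode] at hc ⊢
  obtain ⟨r1, r2⟩ := Runs.straight l hs m hc.left
  obtain ⟨t1, t2⟩ := hJ hwf σ m hr
  have hr' := t1.rel hr
  rw [hq] at hc ⊢
  set l₂ := (c₂.code e (m.pc + l.length + 1)).length with hl₂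
  have hh := hc.right.head
  have hcr := hc.right.tail
  have hc2 := hcr.left
  have hc1 := hcr.right.tail
  have hhj := hcr.right.head
  rw [← hl₂] at hc1 hhj
  set m₀ := run l m with hm₀
  have ex := t2 (m.pc + l.length + 1 + l₂ + 1)
  have rel' : ∀ a, Rel σ { m₀ with pc := a } := fun a =>
    ⟨hr'.nat, hr'.real, hr'.natMem, hr'.realMem⟩
  have keep : ∀ r, 100 ≤ r → r % 2 = 0 → m₀.natReg r = m.natReg r :=
    fun r _ h => t1.nat r (Or.inr h)
  by_cases hab : P σ
  · rw [if_pos hab] at ex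
    obtain ⟨m1, h1, hp1, hr1, hk1⟩ := ih₁ (hw hwf).1 prog e _ σ
      { m₀ with pc := m.pc + l.length + 1 + l₂ + 1 } hc1 rfl (rel' _)
    refine ⟨m1, ?_, ?_, ?_, fun r a b d => (hk1 r a b d).trans (keep r a d)⟩
    · rw [hcost, if_pos hab]
      exact r1.trans (Runs.cons (by rw [r2]; exact hh) (by rw [ex]; exact h1))
    · rw [hp1]; simp [← hl₂]; omega
    · rw [heval, if_pos hab]; exact hr1
  · rw [if_neg hab, r2] at ex
    obtain ⟨m1, h1, hp1, hr1, hk1⟩ := ih₂ (hw hwf).2 prog e _ σ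
      { m₀ with pc := m.pc + l.length + 1 } hc2 rfl (rel' _)
    refine ⟨{ m1 with pc := m.pc + l.length + 1 + l₂ + 1 +
      (c₁.code e (m.pc + l.length + 1 + l₂ + 1)).length }, ?_, ?_, ?_, ?_⟩
    · rw [hcost, if_neg hab]
      rw [← hl₂] at hp1
      have hhj' : prog[m1.pc]? = some (.jump (m.pc + l.length + 1 + l₂ + 1 +
          (c₁.code e (m.pc + l.length + 1 + l₂ + 1)).length)) := by rw [hp1]; exact hhj
      exact r1.trans (Runs.cons (by rw [r2]; exact hh) (by
        rw [ex]; exact h1.trans (Runs.one hhj')))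
    · simp [← hl₂]; omega
    · rw [heval, if_neg hab]; exact ⟨hr1.nat, hr1.real, hr1.natMem, hr1.realMem⟩
    · exact fun r a b d => (hk1 r a b d).trans (keep r a d)

lemma correct_loop (d b : ℕ) (body : Cmd) (ih : Correct body) : Correct (.loop d b body) := by
  intro hwf prog e p σ m hc hp hr
  subst hp
  simp only [Cmd.wf, Bool.and_eq_true, decide_eq_true_eq] at hwf
  obtain ⟨⟨hd, hb⟩, hbody⟩ := hwf
  simp only [Cmd.code] at hc ⊢
  set l := (body.code (e + 1) (m.pc + 6)).length with hl
  have hj : prog[m.pc + 3]? = some (.jumpNatLe (102 + 4 * e) (100 + 4 * e) (m.pc + 9 + l)) :=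
    hc.right.head
  have h1 := hc.right.tail.left
  have hcb : CodeAt prog (m.pc + 6) _ := hc.right.tail.right.left
  have h2 : CodeAt prog (m.pc + 6 + l) _ := hc.right.tail.right.right.left
  have hj' : prog[m.pc + 6 + l + 2]? = some (.jump (m.pc + 3)) :=
    hc.right.tail.right.right.right.head
  obtain ⟨s1, s2⟩ := Runs.straight _ (by simp [Straight]) m hc.left
  have z1 : (102 + 4 * e) ≠ 101 := by omega
  have z2 : (100 + 4 * e) ≠ 101 := by omega
  have z3 : (102 + 4 * e) ≠ 100 + 4 * e := by omega
  have z4 : b ≠ 101 := by omega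
  set F : ℕ → Store → Store := fun i τ => body.eval (τ.setV d i) with hF
  have key : ∀ j ≤ σ.v b, ∃ m', Runs prog m (3 + ∑ i ∈ Finset.range j,
      (6 + body.cost ((iter F σ i).setV d i))) m' ∧ m'.pc = m.pc + 3 ∧ Rel (iter F σ j) m' ∧
      m'.natReg (100 + 4 * e) = j ∧ m'.natReg (102 + 4 * e) = σ.v b ∧
      ∀ r, 100 ≤ r → r < 100 + 4 * e → r % 2 = 0 → m'.natReg r = m.natReg r := by
    intro j
    induction j with
    | zero =>
      refine fun _ => ⟨_, s1, s2, ⟨fun r h => ?_, hr.real, hr.natMem, hr.realMem⟩, ?_, ?_,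
        fun r h h' h'' => ?_⟩
      · have h1 : r ≠ 101 := by omega
        have h2 : r ≠ 102 + 4 * e := by omega
        have h3 : r ≠ 100 + 4 * e := by omega
        simp [run, Instr.exec, State.setNat, h1, h2, h3, hr.nat r h, iter]
      · simp [run, Instr.exec, State.setNat]
      · simp [run, Instr.exec, State.setNat, z4, hr.nat b hb]
      · have h1 : r ≠ 101 := by omega
        have h2 : r ≠ 102 + 4 * e := by omega
        have h3 : r ≠ 100 + 4 * e := by omega
        simp [run, Instr.exec, State.setNat, h1, h2, h3]
    | succ j ihj =>
      intro hj1
      obtain ⟨m1, r1, hp1, hr1, hcnt, hbd, hk1⟩ := ihj (by omega)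
      have r2 := Runs.one (prog := prog) (m := m1) (by rw [hp1]; exact hj)
      simp only [Instr.exec, State.branch, hcnt, hbd, hp1, if_neg (by omega : ¬ σ.v b ≤ j)] at r2
      obtain ⟨r3, -⟩ := Runs.straight _ (by simp [Straight]) { m1 with pc := m.pc + 3 + 1 } h1
      obtain ⟨m3, r4, hp3, hr3, hk3⟩ := ih hbody prog (e + 1) (m.pc + 6) ((iter F σ j).setV d j)
        (run [.natConst 101 0, .natAdd d (100 + 4 * e) 101] { m1 with pc := m.pc + 3 + 1 }) hcb rfl
        ⟨fun r h => by
          have h3 : r ≠ 101 := by omega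
          by_cases h4 : r = d
          · subst h4; simp [run, Instr.exec, State.setNat, z2, hcnt]
          · simp [run, Instr.exec, State.setNat, h3, h4, hr1.nat r h], hr1.real, hr1.natMem,
          hr1.realMem⟩
      have hn2 : ∀ r, 100 ≤ r → r < 100 + 4 * (e + 1) → r % 2 = 0 →
          m3.natReg r = m1.natReg r := by
        intro r h h' h''
        have h3 : r ≠ 101 := by omega
        have h4 : r ≠ d := by omega
        rw [hk3 r h h' h'']
        simp [run, Instr.exec, State.setNat, h3, h4]
      rw [← hl] at hp3
      rw [← hp3] at h2 hj'
      obtain ⟨r5, hp5⟩ := Runs.straight _ (by simp [Straight]) m3 h2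
      have r6 := Runs.one (by rw [hp5]; exact hj')
      refine ⟨(Instr.jump (m.pc + 3)).exec
        (run [.natConst 101 1, .natAdd (100 + 4 * e) (100 + 4 * e) 101] m3), ?_, rfl,
        ⟨fun r h => ?_, hr3.real, hr3.natMem, hr3.realMem⟩, ?_, ?_,
        fun r h5 h6 h7 => ?_⟩
      · have := r1.trans (r2.trans (r3.trans (r4.trans (r5.trans r6))))
        rw [Finset.sum_range_succ]
        convert this using 1
        simp only [List.length_cons, List.length_nil]
        ring
      · have h3 : r ≠ 101 := by omega
        have h4 : r ≠ 100 + 4 * e := by omega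
        simp [run, Instr.exec, State.setNat, h3, h4, hr3.nat r h, iter, hF]
      · simp [run, Instr.exec, State.setNat, z2, hn2 (100 + 4 * e) (by omega) (by omega) (by omega),
          hcnt]
      · simp [run, Instr.exec, State.setNat, z1,
          hn2 (102 + 4 * e) (by omega) (by omega) (by omega), hbd]
      · have h3 : r ≠ 101 := by omega
        have h4 : r ≠ 100 + 4 * e := by omega
        simp [run, Instr.exec, State.setNat, h3, h4, hn2 r h5 (by omega) h7, hk1 r h5 h6 h7]
  obtain ⟨m1, h1, hp1, hr1, hcnt, hbd, hk1⟩ := key (σ.v b) le_rfl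
  have r1 := Runs.one (prog := prog) (m := m1) (by rw [hp1]; exact hj)
  simp only [Instr.exec, State.branch, hcnt, hbd, le_refl, if_true] at r1
  refine ⟨{ m1 with pc := m.pc + 9 + l }, ?_, ?_, ⟨hr1.nat, hr1.real, hr1.natMem, hr1.realMem⟩, hk1⟩
  · convert h1.trans r1 using 1
    simp only [Cmd.cost]; ring
  · simp [← hl]; omega

/-- The compiled code does what the structured program says, in the stated number of steps. -/
lemma correct (c : Cmd) : Correct c := by
  induction c with
  | skip =>
    intro _ prog e p σ m _ hp hr
    exact ⟨m, Runs.refl _ _, by simp [Cmd.code, hp], hr, fun _ _ _ _ => rfl⟩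
  | seq c₁ c₂ ih₁ ih₂ =>
    intro hwf prog e p σ m hc hp hr
    simp only [Cmd.wf, Bool.and_eq_true] at hwf
    obtain ⟨m1, h1, hp1, hr1, hk1⟩ := ih₁ hwf.1 prog e p σ m hc.left hp hr
    obtain ⟨m2, h2, hp2, hr2, hk2⟩ := ih₂ hwf.2 prog e _ _ m1 hc.right hp1 hr1
    refine ⟨m2, h1.trans h2, ?_, hr2, fun r h3 h4 h5 => (hk2 r h3 h4 h5).trans (hk1 r h3 h4 h5)⟩
    rw [hp2]; simp [Cmd.code]; omega
  | ifN a b c₁ c₂ ih₁ ih₂ =>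
    refine correct_branch (l := a.code 0 ++ b.code 1) (J := .jumpNatLe 101 103)
      (P := fun σ => a.eval σ ≤ b.eval σ)
      (fun p => rfl) (fun e p => rfl) (fun σ => rfl) (fun σ => rfl) ?_
      (straight_append (a.straight _) (b.straight _)) ?_ ih₁ ih₂
    · simp only [Cmd.wf, Bool.and_eq_true]; tauto
    · simp only [Cmd.wf, Bool.and_eq_true]
      intro hwf σ m hr
      obtain ⟨h1, h2⟩ := a.run_code hwf.1.1.1 0 0 σ m hr
      obtain ⟨h3, h4⟩ := b.run_code hwf.1.1.2 1 0 σ _ (h1.rel hr)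
      rw [run_append]
      refine ⟨h1.trans h3 (by omega) le_rfl, fun x => ?_⟩
      have h5 := h3.nat 101 (by omega)
      simp only [Instr.exec, State.branch, h5]
      simp only [Nat.mul_zero, Nat.add_zero, Nat.mul_one, Nat.reduceAdd] at h2 h4
      simp only [h2, h4]
  | ifR a b c₁ c₂ ih₁ ih₂ =>
    refine correct_branch (l := a.code 0 0 ++ b.code 0 1) (J := .jumpRealLe 100 101)
      (P := fun σ => a.eval σ ≤ b.eval σ)
      (fun p => rfl) (fun e p => rfl) (fun σ => rfl) (fun σ => rfl) ?_
      (straight_append (a.straight _ _) (b.straight _ _)) ?_ ih₁ ih₂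
    · simp only [Cmd.wf, Bool.and_eq_true]; tauto
    · simp only [Cmd.wf, Bool.and_eq_true]
      intro hwf σ m hr
      obtain ⟨h1, h2⟩ := a.run_code hwf.1.1.1 0 0 σ m hr
      obtain ⟨h3, h4⟩ := b.run_code hwf.1.1.2 0 1 σ _ (h1.rel hr)
      rw [run_append]
      refine ⟨h1.trans h3 le_rfl (by omega), fun x => ?_⟩
      have h5 := h3.real 100 (by omega)
      simp only [Instr.exec, State.branch, h5]
      simp only [Nat.add_zero, Nat.reduceAdd] at h2 h4
      simp only [h2, h4]
  | loop d b body ih => exact correct_loop d b body ih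
  | setV d e =>
    refine correct_of_straight _ _ (fun _ _ => rfl)
      (straight_append (e.straight _) (by simp [Straight])) (fun _ => rfl) ?_
    intro hwf σ m hr
    simp only [Cmd.wf, Bool.and_eq_true, decide_eq_true_eq] at hwf
    obtain ⟨h1, h2⟩ := e.run_code hwf.2 0 0 σ m hr
    have hr' := h1.rel hr
    simp only [List.append_eq, run_append]
    refine ⟨⟨fun r h => ?_, hr'.real, hr'.natMem, hr'.realMem⟩, fun r h h' => ?_⟩
    · have h3 : r ≠ 103 := by omega
      by_cases h4 : r = d
      · subst h4; simpa [run_cons, run_nil, Instr.exec, State.setNat, Cmd.eval] using h2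
      · simp [run_cons, run_nil, Instr.exec, State.setNat, Cmd.eval, h3, h4]
        exact hr'.nat r h
    · have h3 : r ≠ 103 := by omega
      have h4 : r ≠ d := by omega
      simp [run_cons, run_nil, Instr.exec, State.setNat, h3, h4]
      exact h1.nat r (Or.inr h')
  | setX d e =>
    refine correct_of_straight _ _ (fun _ _ => rfl)
      (straight_append (e.straight _ _) (by simp [Straight])) (fun _ => rfl) ?_
    intro hwf σ m hr
    simp only [Cmd.wf, Bool.and_eq_true, decide_eq_true_eq] at hwf
    obtain ⟨h1, h2⟩ := e.run_code hwf.2 0 0 σ m hr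
    have hr' := h1.rel hr
    simp only [List.append_eq, run_append]
    refine ⟨⟨hr'.nat, fun r h => ?_, hr'.natMem, hr'.realMem⟩, fun r h h' => h1.nat r (Or.inr h')⟩
    have h3 : r ≠ 101 := by omega
    by_cases h4 : r = d
    · subst h4; simpa [run_cons, run_nil, Instr.exec, State.setReal, Cmd.eval] using h2
    · simp [run_cons, run_nil, Instr.exec, State.setReal, Cmd.eval, h3, h4]
      exact hr'.real r h
  | stA a i e =>
    refine correct_of_straight _ _ (fun _ _ => rfl) (straight_append (i.straight _)
      (straight_append (straight_address _ _)
        (straight_append (e.straight _) (by simp [Straight]))))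
      (fun _ => rfl) ?_
    intro hwf σ m hr
    simp only [Cmd.wf, Bool.and_eq_true, decide_eq_true_eq] at hwf
    obtain ⟨h1, h2⟩ := run_address (i.run_code hwf.1.2 0 0 σ m hr) a
    obtain ⟨h6, h7⟩ := e.run_code hwf.2 1 0 σ _ (h1.rel hr)
    have h8 := h1.trans h6 (by omega) le_rfl
    simp only [List.append_eq, run_append]
    have h9 := (h6.nat 101 (by omega)).trans h2
    have hr' := h8.rel hr
    simp only [Nat.mul_one, Nat.reduceAdd] at h7 h9
    refine ⟨⟨hr'.nat, hr'.real, fun a' ha' i' => ?_, hr'.realMem⟩,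
      fun r h h' => h8.nat r (Or.inr h')⟩
    simp only [run_cons, run_nil, Instr.exec, h9, h7, Cmd.eval,
      Store.setA_A, Function.update_apply, split_address ha' hwf.1.1, hr'.natMem a' ha',
      and_comm (a := a' = a)]
  | stB a i e =>
    refine correct_of_straight _ _ (fun _ _ => rfl) (straight_append (i.straight _)
      (straight_append (straight_address _ _)
        (straight_append (e.straight _ _) (by simp [Straight]))))
      (fun _ => rfl) ?_
    intro hwf σ m hr
    simp only [Cmd.wf, Bool.and_eq_true, decide_eq_true_eq] at hwf
    obtain ⟨h1, h2⟩ := run_address (i.run_code hwf.1.2 0 0 σ m hr) a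
    obtain ⟨h6, h7⟩ := e.run_code hwf.2 1 0 σ _ (h1.rel hr)
    have h8 := h1.trans h6 (by omega) le_rfl
    simp only [List.append_eq, run_append]
    have h9 := (h6.nat 101 (by omega)).trans h2
    have hr' := h8.rel hr
    simp only [Nat.add_zero] at h7 h9
    refine ⟨⟨hr'.nat, hr'.real, hr'.natMem, fun a' ha' i' => ?_⟩,
      fun r h h' => h8.nat r (Or.inr h')⟩
    simp only [run_cons, run_nil, Instr.exec, h9, h7, Cmd.eval,
      Store.setB_B, Function.update_apply, split_address ha' hwf.1.1, hr'.realMem a' ha',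
      and_comm (a := a' = a)]
  | rawSt i e =>
    refine correct_of_straight _ _ (fun _ _ => rfl) (straight_append (i.straight _)
      (straight_append (e.straight _) (by simp [Straight]))) (fun _ => rfl) ?_
    intro hwf σ m hr
    simp only [Cmd.wf, Bool.and_eq_true] at hwf
    obtain ⟨h1, h2⟩ := i.run_code hwf.1 0 0 σ m hr
    obtain ⟨h6, h7⟩ := e.run_code hwf.2 1 0 σ _ (h1.rel hr)
    have h8 := h1.trans h6 (by omega) le_rfl
    simp only [List.append_eq, run_append]
    have h9 := h6.nat 101 (by omega)
    set m' := run (e.code 1) (run (i.code 0) m)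
    have hr' := h8.rel hr
    simp only [Nat.mul_zero, Nat.add_zero, Nat.mul_one, Nat.reduceAdd] at h2 h7 h9
    refine ⟨⟨hr'.nat, hr'.real, fun a' ha' i' => ?_, hr'.realMem⟩,
      fun r h h' => h8.nat r (Or.inr h')⟩
    simp only [run_cons, run_nil, Instr.exec, h9, h7, h2, Cmd.eval,
      Store.setA_A, Function.update_apply, address_div_mod ha', hr'.natMem a' ha',
      and_comm (a := a' = _)]

/-- The data of a configuration. -/
def dataOf (m : State) : Store where
  v := m.natReg
  x := m.realReg
  A := fun a i => m.natMem (16 * i + a)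
  B := fun a i => m.realMem (16 * i + a)

lemma halts (c : Cmd) (hwf : c.wf = true) (m : State) (hm : m.pc = 0) :
    ∃ τ, HaltsWithin (c.code 0 0) m (c.cost (dataOf m)) τ ∧ Rel (c.eval (dataOf m)) τ := by
  obtain ⟨τ, h1, h2, h3, -⟩ := correct c hwf (c.code 0 0) 0 0 (dataOf m) m
    (fun i _ => by simp) hm ⟨fun _ _ => rfl, fun _ _ => rfl, fun _ _ _ => rfl, fun _ _ _ => rfl⟩
  exact ⟨τ, ⟨h1, by omega⟩, h3⟩

/-- Places of a store: registers and arrays. -/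
inductive Place where
  | v (r : ℕ)
  | x (r : ℕ)
  | A (a : ℕ)
  | B (a : ℕ)

/-- Two stores agree at a place. -/
def Place.Same (σ τ : Store) : Place → Prop
  | v r => τ.v r = σ.v r
  | x r => τ.x r = σ.x r
  | A a => τ.A a = σ.A a
  | B a => τ.B a = σ.B a

lemma Place.Same.trans {l : Place} {σ τ υ : Store} (h : l.Same σ τ) (h' : l.Same τ υ) :
    l.Same σ υ := by
  cases l <;> exact Eq.trans h' h

namespace Cmd

/-- Does the program write to the place? -/
def mods : Cmd → Place → Bool
  | setV d _, .v r => d == r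
  | setX d _, .x r => d == r
  | stA b _ _, .A a => b == a
  | stB b _ _, .B a => b == a
  | rawSt _ _, .A _ => true
  | seq c₁ c₂, l | ifN _ _ c₁ c₂, l | ifR _ _ c₁ c₂, l => c₁.mods l || c₂.mods l
  | loop d _ c, .v r => d == r || c.mods (.v r)
  | loop _ _ c, l => c.mods l
  | _, _ => false

lemma same_eval {c : Cmd} {l : Place} (h : c.mods l = false) (σ : Store) :
    l.Same σ (c.eval σ) := by
  induction c generalizing σ with
  | seq c₁ c₂ ih₁ ih₂ =>
    simp only [mods, Bool.or_eq_false_iff] at h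
    exact (ih₁ h.1 σ).trans (ih₂ h.2 _)
  | ifN a b c₁ c₂ ih₁ ih₂ | ifR a b c₁ c₂ ih₁ ih₂ =>
    simp only [mods, Bool.or_eq_false_iff] at h
    rw [eval]; split_ifs
    exacts [ih₁ h.1 σ, ih₂ h.2 σ]
  | loop d b c ih =>
    rw [eval]
    refine iter_induction (fun _ τ => l.Same σ τ) (by cases l <;> rfl) fun i _ τ hτ => ?_
    cases l with
    | v r =>
      simp only [mods, Bool.or_eq_false_iff, beq_eq_false_iff_ne] at h
      refine hτ.trans (.trans ?_ (ih h.2 _))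
      simp [Place.Same, h.1.symm]
    | _ => exact hτ.trans (ih h _)
  | _ =>
    cases l <;> first
      | rfl
      | simp [mods] at h <;> simp [eval, Place.Same, funext_iff, Ne.symm h]

/-- The bounds of all loops are in registers below ten, which the program does not write. -/
def fixedBounds : Cmd → Bool
  | setV d _ => 10 ≤ d
  | seq c₁ c₂ | ifN _ _ c₁ c₂ | ifR _ _ c₁ c₂ => c₁.fixedBounds && c₂.fixedBounds
  | loop d b c => 10 ≤ d && b < 10 && c.fixedBounds
  | _ => true

/-- A bound for the cost of a program whose loop bounds are fixed. -/
def costBound (w : ℕ → ℕ) : Cmd → ℕ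
  | seq c₁ c₂ => c₁.costBound w + c₂.costBound w
  | ifN a b c₁ c₂ => (a.code 0 ++ b.code 1).length + (c₁.costBound w + c₂.costBound w + 2)
  | ifR a b c₁ c₂ => (a.code 0 0 ++ b.code 0 1).length + (c₁.costBound w + c₂.costBound w + 2)
  | loop _ b c => 4 + w b * (6 + c.costBound w)
  | c => (c.code 0 0).length

lemma fixedBounds_mods {c : Cmd} (h : c.fixedBounds = true) {r : ℕ} (hr : r < 10) :
    c.mods (.v r) = false := by
  induction c with
  | seq c₁ c₂ ih₁ ih₂ | ifN a b c₁ c₂ ih₁ ih₂ | ifR a b c₁ c₂ ih₁ ih₂ =>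
    simp only [fixedBounds, Bool.and_eq_true] at h
    simp [mods, ih₁ h.1, ih₂ h.2]
  | loop d b c ih =>
    simp only [fixedBounds, Bool.and_eq_true, decide_eq_true_eq] at h
    simp [mods, ih h.2]; omega
  | setV d e =>
    simp only [fixedBounds, decide_eq_true_eq] at h
    simp [mods]; omega
  | _ => rfl

lemma cost_le {c : Cmd} (h : c.fixedBounds = true) (w : ℕ → ℕ) (σ : Store)
    (hw : ∀ r < 10, σ.v r = w r) : c.cost σ ≤ c.costBound w := by
  induction c generalizing σ with
  | seq c₁ c₂ ih₁ ih₂ =>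
    simp only [fixedBounds, Bool.and_eq_true] at h
    simp only [cost, costBound]
    exact add_le_add (ih₁ h.1 σ hw) (ih₂ h.2 _ fun r hr => by
      rw [same_eval (fixedBounds_mods h.1 hr), hw r hr])
  | ifN a b c₁ c₂ ih₁ ih₂ | ifR a b c₁ c₂ ih₁ ih₂ =>
    simp only [fixedBounds, Bool.and_eq_true] at h
    simp only [cost, costBound]
    have h1 := ih₁ h.1 σ hw
    have h2 := ih₂ h.2 σ hw
    split_ifs <;> omega
  | loop d b c ih =>
    simp only [fixedBounds, Bool.and_eq_true, decide_eq_true_eq] at h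
    simp only [cost, costBound]
    have : ∀ i ∈ Finset.range (σ.v b), (6 + c.cost ((iter (fun i τ => c.eval (τ.setV d i)) σ i).setV
        d i)) ≤ 6 + c.costBound w := by
      intro i _
      refine Nat.add_le_add_left (ih h.2 _ fun r hr => ?_) _
      have : r ≠ d := by omega
      simp only [Store.setV_v, this, if_false]
      rw [← hw r hr]
      refine iter_induction (fun _ τ => τ.v r = σ.v r) rfl fun i _ τ hτ => ?_
      rw [same_eval (fixedBounds_mods h.2 hr)]
      simp [hτ, this]
    have h2 := Finset.sum_le_card_nsmul _ _ _ this
    simp only [Finset.card_range, smul_eq_mul, hw b h.1.2] at h2 ⊢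
    omega
  | _ => exact le_rfl

end Cmd

end Structured

/-! ### Quadrilaterals with a short diagonal in a strip of minimum width -/

namespace ShortDiagonal

open Real

/-- In a triangle whose third side is `1` and whose other sides are longer than `1`, the angle
opposite to the third side is less than `60` degrees. -/
lemma half_lt_of_law_of_cosines {ρ ρ' c : ℝ} (h1 : 1 < ρ) (h2 : 1 < ρ')
    (h : ρ ^ 2 + ρ' ^ 2 - 2 * ρ * ρ' * c = 1) : 1 / 2 < c := by
  have h3 : 0 < ρ * ρ' := by positivity
  rcases le_total ρ ρ' with h4 | h4
  · have : ρ * ρ' < 2 * (ρ * ρ') * c := by nlinarith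
    nlinarith
  · have : ρ * ρ' < 2 * (ρ * ρ') * c := by nlinarith
    nlinarith

lemma le_two_mul_cos {ρ ρ' c s : ℝ} (h1 : 1 < ρ) (h2 : 1 < ρ')
    (h : ρ ^ 2 + ρ' ^ 2 - 2 * ρ * ρ' * c = 1) (hcs : c ^ 2 + s ^ 2 = 1) (hc : 0 < c)
    (hle : c ≤ s) : ρ ≤ 2 * c := by
  by_contra! hlt
  have e1 : (ρ' - ρ * c) ^ 2 = 1 - ρ ^ 2 * s ^ 2 := by
    linear_combination h + ρ ^ 2 * hcs
  have e2 : ρ ^ 2 * s ^ 2 ≤ 1 := by nlinarith [sq_nonneg (ρ' - ρ * c)]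
  have e3 : (ρ' - 1) * (ρ' + 1 - 2 * ρ * c) + ρ * (ρ - 2 * c) = 0 := by linear_combination h
  have e4 : 0 < ρ * (ρ - 2 * c) := by apply mul_pos <;> linarith
  have e5 : ρ' + 1 - 2 * ρ * c < 0 := by
    by_contra! h5
    nlinarith [mul_nonneg (by linarith : (0 : ℝ) ≤ ρ' - 1) h5]
  have e6 : 1 < ρ * c := by linarith
  have e7 : ρ * c ≤ ρ * s := by nlinarith
  nlinarith

/-- The values at `A = m` and `A = 2 * m` control those between, by concavity of the sine. -/
lemma certificate_long {m e : ℝ} (he : 0 ≤ e) (hem : e ≤ m) (hm : m ≤ π / 6) :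
    0 ≤ 2 * cos (2 * m) * (cos (m + e) - sin (2 * m)) + sin (m + e) + cos (2 * m) - 1 := by
  have hpi := pi_pos
  rcases (he.trans hem).eq_or_lt with h0 | h0
  · obtain rfl : m = 0 := h0.symm
    obtain rfl : e = 0 := le_antisymm hem he
    simp
  have hsm : 0 < sin m := sin_pos_of_pos_of_lt_pi h0 (by linarith)
  have hcm : 0 < cos m := cos_pos_of_mem_Ioo ⟨by linarith, by linarith⟩
  have hse : 0 ≤ sin e := sin_nonneg_of_nonneg_of_le_pi he (by linarith)
  have hsB : 0 ≤ sin (m - e) := sin_nonneg_of_nonneg_of_le_pi (by linarith) (by linarith)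
  have hs2 : sin m ≤ 1 / 2 := by
    rw [← sin_pi_div_six]
    exact sin_le_sin_of_le_of_le_pi_div_two (by linarith) (by linarith) hm
  have hc2 : 1 / 2 ≤ cos (2 * m) := by
    rw [cos_two_mul, cos_sq']; nlinarith
  have i1 : sin m * cos (m + e) = sin (m - e) * cos m + sin e * cos (2 * m) := by
    rw [sin_sub, cos_add, cos_two_mul]
    linear_combination (-sin e) * sin_sq_add_cos_sq m
  have i2 : sin m * sin (m + e) = sin (m - e) * sin m + sin e * sin (2 * m) := by
    rw [sin_sub, sin_add, sin_two_mul]; ring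
  have i3 : sin m ≤ sin (m - e) + sin e := by
    have : sin m = sin (m - e) * cos e + cos (m - e) * sin e := by rw [← sin_add]; ring_nf
    rw [this]
    nlinarith [cos_le_one e, cos_le_one (m - e)]
  have k1 : 2 * cos (2 * m) * cos m + sin m - (1 - cos (2 * m) + 2 * cos (2 * m) * sin (2 * m)) =
      (1 - 2 * sin m) * (2 * cos (2 * m) * cos m + sin m) := by
    rw [sin_two_mul, show cos (2 * m) = 1 - 2 * sin m ^ 2 by rw [cos_two_mul, cos_sq']; ring]; ring
  have k1' : 0 ≤ (1 - 2 * sin m) * (2 * cos (2 * m) * cos m + sin m) :=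
    mul_nonneg (by linarith) (by positivity)
  have hs2m : 0 ≤ sin (2 * m) := sin_nonneg_of_nonneg_of_le_pi (by linarith) (by linarith)
  have k2 : 2 * cos (2 * m) * cos (2 * m) + sin (2 * m) -
      (1 - cos (2 * m) + 2 * cos (2 * m) * sin (2 * m)) =
      (2 * cos (2 * m) - 1) * (1 + cos (2 * m) - sin (2 * m)) := by ring
  have k2' : 0 ≤ (2 * cos (2 * m) - 1) * (1 + cos (2 * m) - sin (2 * m)) :=
    mul_nonneg (by linarith) (by linarith [sin_le_one (2 * m)])
  have k3 : 0 ≤ 1 - cos (2 * m) + 2 * cos (2 * m) * sin (2 * m) := by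
    have := cos_le_one (2 * m); positivity
  have key : 0 ≤ sin m * (2 * cos (2 * m) * (cos (m + e) - sin (2 * m)) + sin (m + e) +
      cos (2 * m) - 1) := by
    have : sin m * (2 * cos (2 * m) * (cos (m + e) - sin (2 * m)) + sin (m + e) +
      cos (2 * m) - 1) =
      sin (m - e) * ((1 - 2 * sin m) * (2 * cos (2 * m) * cos m + sin m)) +
      sin e * ((2 * cos (2 * m) - 1) * (1 + cos (2 * m) - sin (2 * m))) +
      (sin (m - e) + sin e - sin m) * (1 - cos (2 * m) + 2 * cos (2 * m) * sin (2 * m)) := by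
      rw [← k1, ← k2]
      linear_combination 2 * cos (2 * m) * i1 + i2
    rw [this]
    have := mul_nonneg hsB k1'
    have := mul_nonneg hse k2'
    have := mul_nonneg (sub_nonneg.2 i3) k3
    linarith
  exact nonneg_of_mul_nonneg_right key hsm

lemma sin_add_sin_lt_one {A B : ℝ} (hA : 0 ≤ sin A) (hB : 0 ≤ sin B) (h : 1 / 2 < cos (A + B)) :
    sin A + sin B < 1 := by
  rw [cos_add] at h
  have h3 : 1 / 2 + sin A * sin B < cos A * cos B := by linarith
  have h4 : (1 / 2 + sin A * sin B) ^ 2 < (cos A * cos B) ^ 2 :=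
    pow_lt_pow_left₀ h3 (by positivity) (by norm_num)
  have h6 : (cos A * cos B) ^ 2 = (1 - sin A ^ 2) * (1 - sin B ^ 2) := by
    rw [mul_pow, cos_sq', cos_sq']
  rw [h6] at h4
  have h7 : (sin A + sin B) ^ 2 < 1 := by linarith [sq_nonneg (sin A - sin B)]
  by_contra! h9
  linarith [one_le_pow₀ h9 (n := 2)]

set_option maxHeartbeats 400000 in
/-- The combination of the two width conditions that excludes a short diagonal. Here `A ≥ B` are the
angles at the apex between the two sides and the vertical, `ρ` and `ρ'` the sides, and `a`, `b` the
tangents of the inclinations of the two supporting lines. -/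
lemma contradiction_of_widths {A B ρ ρ' H K a b : ℝ} (hB : 0 ≤ B) (hBA : B ≤ A)
    (hA : A < π / 2) (h1 : 1 < ρ) (h2 : 1 < ρ')
    (hlaw : ρ ^ 2 + ρ' ^ 2 - 2 * ρ * ρ' * cos (A + B) = 1)
    (hT : cos A * cos B ≤ sin (A + B)) (hH : sin A ≤ H)
    (hY : H + ρ * cos A = K + ρ' * cos B)
    (ha : a * cos A ≤ sin A) (hb : b * cos B ≤ sin B)
    (wa : (H + ρ * cos A) * √(1 + a ^ 2) ≤ ρ * sin A + ρ' * sin B + H * a + K * b)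
    (wb : (H + ρ * cos A) * √(1 + b ^ 2) ≤ ρ * sin A + ρ' * sin B + H * a + K * b) : False := by
  have hpi := pi_pos
  have cA : 0 < cos A := cos_pos_of_mem_Ioo ⟨by linarith, by linarith⟩
  have cB : 0 < cos B := cos_pos_of_mem_Ioo ⟨by linarith, by linarith⟩
  have sB : 0 ≤ sin B := sin_nonneg_of_nonneg_of_le_pi hB (by linarith)
  have sAB : sin B ≤ sin A := sin_le_sin_of_le_of_le_pi_div_two (by linarith) (by linarith) hBA
  have sA1 : sin A ≤ 1 := sin_le_one A
  have hcS := half_lt_of_law_of_cosines h1 h2 hlaw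
  have eA := sin_sq_add_cos_sq A
  have eB := sin_sq_add_cos_sq B
  have hc : cos (A + B) = cos A * cos B - sin A * sin B := cos_add A B
  have hs : sin (A + B) = sin A * cos B + cos A * sin B := sin_add A B
  have hsc := sin_sq_add_cos_sq (A + B)
  have hle : cos (A + B) ≤ sin (A + B) := by linarith [mul_nonneg (sB.trans sAB) sB]
  have ρ'le : ρ' ≤ 2 * cos (A + B) := le_two_mul_cos h2 h1 (by linarith) (by linarith)
    (by linarith) hle
  have sA : 0 < sin A := by
    rcases (sB.trans sAB).eq_or_lt with h | h
    · have h0 : sin B = 0 := by linarith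
      rw [hs, ← h, h0] at hT
      linarith [mul_pos cA cB]
    · exact h
  -- the sum of the sines is at most one because the angle at the apex is less than 60 degrees
  have hsum := sin_add_sin_lt_one (sB.trans sAB) sB hcS
  -- the main inequality
  have main : 0 < ρ * (cos A - sin (A + B)) + sin A + cos (A + B) - 1 := by
    have hcc : cos A ≤ cos B := cos_le_cos_of_nonneg_of_le_pi hB (by linarith) hBA
    have h3 : 1 < sin A + cos (A + B) := by
      have := mul_le_mul_of_nonneg_left hcc cA.le
      have : 0 < sin A * (1 - sin A - sin B) := mul_pos sA (by linarith)
      linarith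
    rcases le_or_gt (sin (A + B)) (cos A) with h4 | h4
    · linarith [mul_nonneg (by linarith : (0 : ℝ) ≤ ρ) (sub_nonneg.2 h4)]
    · have ρle := le_two_mul_cos h1 h2 hlaw (by linarith) (by linarith) hle
      have h60 : A + B ≤ π / 3 := by
        by_contra! h
        have := cos_le_cos_of_nonneg_of_le_pi (by positivity) (by linarith) h.le
        rw [cos_pi_div_three] at this
        linarith
      have h5 := certificate_long (m := (A + B) / 2) (e := (A - B) / 2) (by linarith)
        (by linarith) (by linarith)
      rw [show 2 * ((A + B) / 2) = A + B by ring, show (A + B) / 2 + (A - B) / 2 = A by ring] at h5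
      -- equality would force `ρ = 2 cos (A + B)`, and then the other side is `1`
      rcases ρle.eq_or_lt with h6 | h6
      · exfalso
        have h7 : (ρ' - 1) * (ρ' + 1 - 4 * cos (A + B) ^ 2) = 0 := by
          rw [h6] at hlaw; linear_combination hlaw
        have h8 : ρ' + 1 - 4 * cos (A + B) ^ 2 = 0 := by
          rcases mul_eq_zero.1 h7 with h | h
          · linarith
          · exact h
        linarith [mul_self_le_mul_self (by linarith) hle]
      · linarith [mul_pos_of_neg_of_neg (sub_neg.2 h6) (sub_neg.2 h4)]
  set M := ρ * cos A + sin A with hM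
  set Y := H + ρ * cos A with hYd
  have hcs1 : 1 ≤ cos A + sin A := by
    linarith [mul_le_mul_of_nonneg_left (cos_le_one A) cA.le,
      mul_le_mul_of_nonneg_left (sin_le_one A) sA.le]
  have hMcs : cos A + sin A < M := by linarith [mul_pos (sub_pos.2 h1) cA]
  have hM1 : 1 < M := by linarith
  have hYM : M ≤ Y := by linarith
  have hYp : 0 < Y := by linarith
  have c1 : 0 ≤ M * H - Y * sin A := by
    have : M * H - Y * sin A = ρ * cos A * (H - sin A) := by rw [hM, hYd]; ring
    rw [this]
    exact mul_nonneg (by positivity) (by linarith)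
  have c2 : 0 ≤ M * K - (M - 1) * Y * sin B := by
    have h3 : ρ' * cos B ≤ M * (1 - sin B) + sin B := by
      have h4 : ρ' * cos B ≤ 2 * cos (A + B) * cos B := mul_le_mul_of_nonneg_right ρ'le cB.le
      have h5 : (cos A + sin A) * (1 - sin B) ≤ M * (1 - sin B) :=
        mul_le_mul_of_nonneg_right hMcs.le (by linarith)
      have h6 : 2 * cos (A + B) * cos B ≤ (cos A + sin A) * (1 - sin B) + sin B := by
        have hsB1 : 1 ≤ sin B + cos B := by
          linarith [mul_le_mul_of_nonneg_left (cos_le_one B) cB.le,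
            mul_le_mul_of_nonneg_left (sin_le_one B) sB]
        have hb : 0 ≤ 1 - sin A - cos A + sin A * (sin B + cos B) +
            (sin (A + B) - cos A * cos B) := by
          linarith [cos_le_one A, mul_le_mul_of_nonneg_left hsB1 sA.le]
        have h7 : cos (A + B) * cos B ≤ (sin (A + B) - sin A * sin B) * cos B :=
          mul_le_mul_of_nonneg_right (by linarith) cB.le
        have h8 : 2 * cos (A + B) * cos B =
            cos A + (cos (A + B) * cos B - sin (A + B) * sin B) := by
          rw [hc, hs]; linear_combination cos A * eB
        have h9 : (cos A + sin A) * (1 - sin B) + sin B - cos A -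
            (sin (A + B) - sin A * sin B) * cos B + sin (A + B) * sin B =
            sin B * (1 - sin A - cos A + sin A * (sin B + cos B) +
            (sin (A + B) - cos A * cos B)) := by
          rw [hs]; linear_combination (-sin A) * eB
        linarith [mul_nonneg sB hb]
      linarith
    have h4 : K = Y - ρ' * cos B := by linarith
    rw [h4]
    have h5 : 0 ≤ M * (Y - M) * (1 - sin B) :=
      mul_nonneg (mul_nonneg (by linarith) (by linarith)) (by linarith)
    have h6 : 0 ≤ (Y - M) * sin B := mul_nonneg (by linarith) sB
    linarith [mul_le_mul_of_nonneg_left h3 (by linarith : 0 ≤ M)]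
  have ra : cos A + a * sin A ≤ √(1 + a ^ 2) := by
    apply le_sqrt_of_sq_le
    have : (cos A + a * sin A) ^ 2 = 1 + a ^ 2 - (a * cos A - sin A) ^ 2 := by
      linear_combination (1 + a ^ 2) * eA
    linarith [sq_nonneg (a * cos A - sin A)]
  have rb : cos B + b * sin B ≤ √(1 + b ^ 2) := by
    apply le_sqrt_of_sq_le
    have : (cos B + b * sin B) ^ 2 = 1 + b ^ 2 - (b * cos B - sin B) ^ 2 := by
      linear_combination (1 + b ^ 2) * eB
    linarith [sq_nonneg (b * cos B - sin B)]
  set x := ρ * sin A + ρ' * sin B + H * a + K * b with hx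
  have g1 : Y * (cos A + a * sin A) + (M - 1) * (Y * (cos B + b * sin B)) ≤ M * x := by
    have := mul_le_mul_of_nonneg_left ra hYp.le
    have := mul_le_mul_of_nonneg_left (mul_le_mul_of_nonneg_left rb hYp.le)
      (by linarith : 0 ≤ M - 1)
    have := mul_le_mul_of_nonneg_left wb (by linarith : 0 ≤ M - 1)
    linarith
  have g2 : Y * cos A + (M - 1) * Y * cos B ≤ M * (ρ * sin A + ρ' * sin B) +
      (M * H - Y * sin A) * a + (M * K - (M - 1) * Y * sin B) * b := by
    rw [hx] at g1; linarith
  -- multiply by the cosines and use the bounds for the inclinations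
  have g3 : (Y * cos A + (M - 1) * Y * cos B) * (cos A * cos B) ≤
      M * (ρ * sin A + ρ' * sin B) * (cos A * cos B) + (M * H - Y * sin A) * (sin A * cos B) +
      (M * K - (M - 1) * Y * sin B) * (sin B * cos A) := by
    have t1 := mul_le_mul_of_nonneg_right g2 (mul_pos cA cB).le
    have t2 := mul_le_mul_of_nonneg_left (mul_le_mul_of_nonneg_right ha cB.le) c1
    have t3 := mul_le_mul_of_nonneg_left (mul_le_mul_of_nonneg_right hb cA.le) c2
    linarith
  have g4 : Y * (cos A * (ρ * (cos A - sin (A + B)) + sin A + cos (A + B) - 1)) ≤ 0 := by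
    have hK : K = Y - ρ' * cos B := by linarith
    have hHY : H = Y - ρ * cos A := by rw [hYd]; ring
    have e1 : cos B = cos (A + B) * cos A + sin (A + B) * sin A := by
      rw [← cos_sub]; ring_nf
    have : M * (ρ * sin A + ρ' * sin B) * (cos A * cos B) +
        (M * H - Y * sin A) * (sin A * cos B) + (M * K - (M - 1) * Y * sin B) * (sin B * cos A) =
        Y * (M * sin (A + B) - sin A ^ 2 * cos B - (M - 1) * sin B ^ 2 * cos A) := by
      rw [hK, hHY, hs]; ring
    rw [this] at g3
    have e2 : Y * (cos A * (ρ * (cos A - sin (A + B)) + sin A + cos (A + B) - 1)) =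
        (Y * cos A + (M - 1) * Y * cos B) * (cos A * cos B) -
        Y * (M * sin (A + B) - sin A ^ 2 * cos B - (M - 1) * sin B ^ 2 * cos A) := by
      have e3 : (Y * cos A + (M - 1) * Y * cos B) * (cos A * cos B) -
          Y * (M * sin (A + B) - sin A ^ 2 * cos B - (M - 1) * sin B ^ 2 * cos A) =
          Y * (cos B + (M - 1) * cos A - M * sin (A + B)) := by
        linear_combination Y * cos B * eA + Y * (M - 1) * cos A * eB
      rw [e3, hM]
      linear_combination (-Y) * e1
    linarith
  have := mul_pos hYp (mul_pos cA main)
  linarith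

lemma steep_bound {c s : ℝ} (h : c ^ 2 + s ^ 2 = 1) (hc : 1 / 2 < c) :
    -0.37 < 2 * c * (c - s) := by
  by_contra! h1
  have h2 : 2 * c ^ 2 + 0.37 ≤ 2 * c * s := by linarith
  have h3 : (2 * c ^ 2 + 0.37) ^ 2 ≤ (2 * c * s) ^ 2 := pow_le_pow_left₀ (by positivity) h2 2
  have h4 : (2 * c * s) ^ 2 = 4 * c ^ 2 * (1 - c ^ 2) := by rw [← h]; ring
  rw [h4] at h3
  have h5 : 1 / 4 < c ^ 2 := by nlinarith
  nlinarith [sq_nonneg (c ^ 2 - 1 / 4)]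

set_option maxHeartbeats 400000 in
/-- The case in which the lower neighbour of the steeper vertex protrudes, so that the inclination
of the supporting line there replaces the angle in the lower bound for the height `H`. -/
lemma contradiction_of_steep {A B ρ ρ' H K a b : ℝ} (hB : 0 ≤ B) (hBA : B ≤ A)
    (hA : A < π / 2) (h1 : 1 < ρ) (h2 : 1 < ρ')
    (hlaw : ρ ^ 2 + ρ' ^ 2 - 2 * ρ * ρ' * cos (A + B) = 1)
    (hK : 0 ≤ K) (hb0 : 0 ≤ b) (hH : 1 ≤ H * √(1 + b ^ 2)) (hHA : H < sin A)
    (hY : H + ρ * cos A = K + ρ' * cos B)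
    (ha : a * cos B ≤ sin B) (hb : b * cos A ≤ sin A)
    (wb : (H + ρ * cos A) * √(1 + b ^ 2) ≤ ρ * sin A + ρ' * sin B + H * b + K * a) : False := by
  have hpi := pi_pos
  have cA : 0 < cos A := cos_pos_of_mem_Ioo ⟨by linarith, by linarith⟩
  have cB : 0 < cos B := cos_pos_of_mem_Ioo ⟨by linarith, by linarith⟩
  have sB : 0 ≤ sin B := sin_nonneg_of_nonneg_of_le_pi hB (by linarith)
  have sAB : sin B ≤ sin A := sin_le_sin_of_le_of_le_pi_div_two (by linarith) (by linarith) hBA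
  have sA0 : 0 ≤ sin A := sB.trans sAB
  have hcS := half_lt_of_law_of_cosines h1 h2 hlaw
  have eA := sin_sq_add_cos_sq A
  have eB := sin_sq_add_cos_sq B
  have hc : cos (A + B) = cos A * cos B - sin A * sin B := cos_add A B
  have hs : sin (A + B) = sin A * cos B + cos A * sin B := sin_add A B
  have hsc := sin_sq_add_cos_sq (A + B)
  have hsum := sin_add_sin_lt_one sA0 sB hcS
  set h := √(1 + b ^ 2) with hh
  have hsq : h ^ 2 = 1 + b ^ 2 := sq_sqrt (by positivity)
  have hh1 : 1 ≤ h := by rw [hh]; apply one_le_sqrt.2; linarith [sq_nonneg b]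
  have hcA1 : h * cos A ≤ 1 := by
    have h3 : (h * cos A) ^ 2 ≤ 1 ^ 2 := by
      have : (b * cos A) ^ 2 ≤ sin A ^ 2 := pow_le_pow_left₀ (by positivity) hb 2
      rw [mul_pow, hsq]; linarith
    exact le_of_sq_le_sq h3 (by norm_num) |>.trans le_rfl
  -- the inclination is at most `A`, so `A` exceeds 45 degrees
  have hAs : cos A < sin A := by
    have h3 : 1 < h * sin A := by
      have : H * h < sin A * h := mul_lt_mul_of_pos_right hHA (by linarith)
      linarith
    by_contra! h4
    linarith [mul_le_mul_of_nonneg_left h4 (by linarith : 0 ≤ h)]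
  have sA7 : 0.707 < sin A := by
    by_contra! h3
    have := pow_le_pow_left₀ sA0 h3 2
    have := pow_lt_pow_left₀ hAs cA.le (n := 2) (by norm_num)
    linarith
  have sB3 : sin B < 0.293 := by linarith
  have cB9 : 0.956 < cos B := by
    by_contra! h3
    have := pow_le_pow_left₀ cB.le h3 2
    have := pow_lt_pow_left₀ sB3 sB (n := 2) (by norm_num)
    linarith
  have cSA : cos (A + B) ≤ cos A := by
    have := mul_le_mul_of_nonneg_left (cos_le_one B) cA.le
    linarith [mul_nonneg sA0 sB]
  have hle : cos (A + B) ≤ sin (A + B) := by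
    have h3 : sin A ≤ sin (A + B) := by
      by_contra! h4
      have h5 : sin (A + B) ^ 2 < sin A ^ 2 := by
        apply pow_lt_pow_left₀ h4 _ (by norm_num)
        rw [hs]; positivity
      have := pow_le_pow_left₀ (by linarith) cSA 2
      linarith
    linarith
  have sS0 : 0 ≤ sin (A + B) := by rw [hs]; positivity
  have sScB : sin (A + B) < cos B := by
    by_contra! h3
    have := pow_lt_pow_left₀ hcS (by norm_num) (n := 2) (by norm_num)
    have h5 := pow_le_pow_left₀ cB.le h3 2
    have h6 := pow_lt_pow_left₀ cB9 (by norm_num) (n := 2) (by norm_num)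
    linarith
  -- the inequality without `K` and `a`
  have g1 : ρ * (cos A * cos B * h - sin (A + B)) + H * (h * cos B - b * cos B - sin B) ≤ 0 := by
    have t1 := mul_le_mul_of_nonneg_left ha hK
    have t2 := mul_le_mul_of_nonneg_right wb cB.le
    have hK' : K = H + ρ * cos A - ρ' * cos B := by linarith
    rw [hK'] at t1 t2
    rw [hs]
    linarith
  have slope : 0 < h * cos B - b * cos B - sin B := by
    have t1 : (1 - sin A) ≤ (h - b) * cos A := by
      -- `h - b` decreases with the inclination
      have e : (h - b) * (h + b) = 1 := by linear_combination hsq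
      have t2 : (h + b) * cos A ≤ 1 + sin A := by linarith
      have t3 : (1 - sin A) * ((h + b) * cos A) ≤ (1 - sin A) * (1 + sin A) :=
        mul_le_mul_of_nonneg_left t2 (by linarith)
      have t4 : (h - b) * cos A * ((h + b) * cos A) = cos A ^ 2 := by
        linear_combination cos A ^ 2 * e
      have t5 : 0 < (h + b) * cos A := by positivity
      have t6 : (1 - sin A) * ((h + b) * cos A) ≤ (h - b) * cos A * ((h + b) * cos A) := by
        linarith
      exact le_of_mul_le_mul_right t6 t5
    have t7 : 0 < cos A * (h * cos B - b * cos B - sin B) := by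
      have := mul_le_mul_of_nonneg_right t1 cB.le
      linarith
    exact pos_of_mul_pos_right t7 cA.le
  have g2 : ρ * h * (cos A * cos B * h - sin (A + B)) + (h * cos B - b * cos B - sin B) ≤ 0 := by
    have t1 := mul_le_mul_of_nonneg_right hH slope.le
    have t2 := mul_nonneg (by linarith : 0 ≤ h) (neg_nonneg.2 g1)
    linarith
  rcases le_or_gt (sin (A + B)) (cos A * cos B * h) with h3 | h3
  · have : 0 ≤ ρ * h * (cos A * cos B * h - sin (A + B)) :=
      mul_nonneg (by positivity) (by linarith)
    linarith
  have ρle := le_two_mul_cos h1 h2 hlaw (by linarith) (by linarith) hle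
  have g3 : 2 * cos (A + B) * h * (cos A * cos B * h - sin (A + B)) +
      (h * cos B - b * cos B - sin B) ≤ 0 := by
    have := mul_nonneg (mul_nonneg (sub_nonneg.2 ρle) (by linarith : 0 ≤ h)) (sub_nonneg.2 h3.le)
    linarith
  have k0 : 1 / 2 < 2 * cos (A + B) * cos A := by
    have := mul_lt_mul_of_pos_right hcS (by linarith : 0 < cos A)
    linarith
  have k1 : h * (2 * cos (A + B) * cos A - 1 / 2) ≤ 2 * cos (A + B) * cos A * h ^ 2 - b := by
    have t1 : 0 ≤ (2 * cos (A + B) * cos A - 1 / 2) * (h * (h - 1)) :=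
      mul_nonneg (by linarith) (mul_nonneg (by linarith) (by linarith))
    have t2 : b ≤ h ^ 2 / 2 := by rw [hsq]; linarith [sq_nonneg (b - 1)]
    linarith
  have g4 : 2 * cos (A + B) * (cos A * cos B - sin (A + B)) + cos B / 2 - sin B ≤ 0 := by
    have t1 := mul_le_mul_of_nonneg_right k1 cB.le
    have t2 : sin B ≤ h * sin B := by linarith [mul_nonneg (sub_nonneg.2 hh1) sB]
    have t3 : h * (2 * cos (A + B) * (cos A * cos B - sin (A + B)) + cos B / 2 - sin B) ≤ 0 := by
      linarith
    by_contra! t4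
    linarith [mul_pos (by linarith : 0 < h) t4]
  have k2 := steep_bound (by linarith : cos (A + B) ^ 2 + sin (A + B) ^ 2 = 1) hcS
  have k3 : cos A * cos B = cos (A + B) + sin A * sin B := by linarith
  rw [k3] at g4
  have k4 : 0.707 * sin B ≤ sin A * sin B := mul_le_mul_of_nonneg_right sA7.le sB
  have k5 : sin A * sin B ≤ 2 * cos (A + B) * (sin A * sin B) := by
    linarith [mul_nonneg (by linarith : 0 ≤ 2 * cos (A + B) - 1) (mul_nonneg sA0 sB)]
  linarith

set_option maxHeartbeats 400000 in
/-- The case in which the apex lies to the outer side of one of the two vertices: the lean of the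
supporting line there (`w / q` at least) shortens the base. -/
lemma leaning_bound {G y w q r s Q q₂ X : ℝ} (hG : 0 ≤ G) (hGy : G ^ 2 + y ^ 2 = 1) (hw : 0 < w)
    (hq : 0 < q) (hr : r = q - y) (hr0 : 0 < r) (hwq : 1 < w ^ 2 + q ^ 2) (hq₂ : |y| ≤ q₂)
    (hQ : Q = q₂ + y) (hs : s ^ 2 = (G + w) ^ 2 + r ^ 2) (hs1 : 1 < s) (hQs : G + w ≤ Q * s)
    (hX : X * q = G * q - q₂ * w) (hX0 : 0 < X) : X ^ 2 < r ^ 2 + 2 * Q * r := by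
  have hy1 := (abs_le.1 hq₂).1
  have hy2 := (le_abs_self y).trans hq₂
  have hq0 : 0 ≤ q₂ := (abs_nonneg y).trans hq₂
  have hG1 : G ≤ 1 := by nlinarith
  have hXG : X ≤ G := by
    by_contra! h
    linarith [mul_lt_mul_of_pos_right h hq, mul_nonneg hq0 hw.le]
  have hX2 : X ^ 2 ≤ 1 := by
    have := pow_le_pow_left₀ hX0.le (hXG.trans hG1) 2
    linarith
  rcases le_or_gt (G + w) (2 * r) with h1 | h1
  · have h2 : (G + w) ^ 2 ≤ 2 * r * (G + w) := by
      rw [pow_two]; exact mul_le_mul_of_nonneg_right h1 (by linarith)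
    have h3 : 2 * r * (G + w) ≤ 2 * r * (Q * s) := mul_le_mul_of_nonneg_left hQs (by linarith)
    have h4 : r ^ 2 ≤ s * r ^ 2 := by linarith [mul_pos (sub_pos.2 hs1) (pow_pos hr0 2)]
    have h5 : s * s ≤ s * (r ^ 2 + 2 * Q * r) := by linarith
    have h6 := le_of_mul_le_mul_left h5 (by linarith)
    linarith
  have hQ0 : 0 ≤ Q := by linarith
  have hQ9 : 0.89 ≤ Q := by
    by_contra! h
    have h2 : (Q * s) ^ 2 ≤ 0.89 ^ 2 * s ^ 2 := by
      rw [mul_pow]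
      exact mul_le_mul_of_nonneg_right (pow_le_pow_left₀ hQ0 h.le 2) (sq_nonneg s)
    have h3 : (G + w) ^ 2 ≤ (Q * s) ^ 2 := pow_le_pow_left₀ (by linarith) hQs 2
    have h4 : (2 * r) ^ 2 < (G + w) ^ 2 := pow_lt_pow_left₀ h1 (by linarith) (by norm_num)
    norm_num at h2
    nlinarith
  rcases le_or_gt 0.45 r with h2 | h2
  · have h3 : (0.45 : ℝ) ^ 2 ≤ r ^ 2 := pow_le_pow_left₀ (by norm_num) h2 2
    have h4 : 0.89 * 0.45 ≤ Q * r := mul_le_mul hQ9 h2 (by norm_num) hQ0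
    norm_num at h3 h4
    linarith
  have hXq : q₂ * w < G * q := by linarith [mul_pos hX0 hq]
  have hGq : G * q ≤ q := by linarith [mul_le_mul_of_nonneg_right hG1 hq.le]
  rcases le_or_gt y 0 with h3 | h3
  · exfalso
    have h4 : 0.89 * w ≤ q₂ * w := mul_le_mul_of_nonneg_right (by linarith) hw.le
    have h5 : 0.89 * w < 0.45 := by linarith
    have h6 : w < 0.51 := by linarith
    have h7 := pow_lt_pow_left₀ h6 hw.le (n := 2) (by norm_num)
    have h8 := pow_lt_pow_left₀ (show q < 0.45 by linarith) hq.le (n := 2) (by norm_num)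
    norm_num at h7 h8
    linarith
  have e1 : (G * q - y * w) * (G * q + y * w) ≤ r * (q + y) := by
    have t1 : 0 ≤ y ^ 2 * (w ^ 2 + q ^ 2 - 1) := mul_nonneg (sq_nonneg y) (by linarith)
    have t2 : G ^ 2 = 1 - y ^ 2 := by linarith
    have t3 : (G * q - y * w) * (G * q + y * w) = (1 - y ^ 2) * q ^ 2 - y ^ 2 * w ^ 2 := by
      rw [← t2]; ring
    rw [t3, hr]; linarith
  have hXy : X * q ≤ G * q - y * w := by
    rw [hX]; linarith [mul_le_mul_of_nonneg_right hy2 hw.le]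
  have hXq0 : 0 < X * q := mul_pos hX0 hq
  have hyw : 0 < y * w := mul_pos h3 hw
  suffices h : (X * q) ^ 2 < q ^ 2 * (r ^ 2 + 2 * Q * r) by
    rw [mul_pow, mul_comm] at h
    exact lt_of_mul_lt_mul_left h (sq_nonneg q)
  have e2 : (X * q) ^ 2 ≤ X * q * (G * q - y * w) := by
    rw [pow_two]; exact mul_le_mul_of_nonneg_left hXy hXq0.le
  rcases le_or_gt 0.8 q with h4 | h4
  · have e3 : X * q * (G * q - y * w) ≤ (G * q + y * w) * (G * q - y * w) :=
      mul_le_mul_of_nonneg_right (by linarith) (by linarith)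
    have e4 : q + y < q ^ 2 * (r + 2 * Q) := by
      have t1 : 0.8 * q ≤ q ^ 2 := by rw [pow_two]; exact mul_le_mul_of_nonneg_right h4 hq.le
      have t2 : 0.8 * q * (r + 2 * Q) ≤ q ^ 2 * (r + 2 * Q) :=
        mul_le_mul_of_nonneg_right t1 (by linarith)
      refine lt_of_lt_of_le ?_ t2
      rcases le_or_gt y 0.45 with h5 | h5
      · have : 0.8 * q * 2.13 ≤ 0.8 * q * (r + 2 * Q) :=
          mul_le_mul_of_nonneg_left (by linarith) (by linarith)
        linarith
      · have : 0.8 * q * (q + 3 * y) ≤ 0.8 * q * (r + 2 * Q) :=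
          mul_le_mul_of_nonneg_left (by linarith) (by linarith)
        have : 0.8 * (q + 3 * y) ≤ q * (q + 3 * y) :=
          mul_le_mul_of_nonneg_right h4 (by linarith)
        linarith
    have e5 : r * (q + y) < r * (q ^ 2 * (r + 2 * Q)) := mul_lt_mul_of_pos_left e4 hr0
    linarith
  · have hw6 : 0.6 < w := by
      by_contra! h
      have h7 := pow_le_pow_left₀ hw.le h 2
      have h8 := pow_lt_pow_left₀ h4 hq.le (n := 2) (by norm_num)
      norm_num at h7 h8
      linarith
    have e3 : 0.267 ≤ q₂ * w := by
      have := mul_le_mul (show 0.445 ≤ q₂ by linarith) hw6.le (by norm_num) hq0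
      norm_num at this ⊢
      linarith
    set g := G * q with hg
    have hg0 : 0.267 < g := by linarith
    have e4 : (X * q) * ((g - y * w) * (g + y * w)) ≤ (g - 0.267) * (r * (q + y)) :=
      mul_le_mul (by linarith) e1 (mul_nonneg (by linarith) (by linarith)) (by linarith)
    have e5 : (g - 0.267) * (q + y) < 1.78 * q ^ 2 * (g + 0.6 * y) := by
      -- linear in `y`, so it is enough to look at `y = 0` and `y = q`
      have a1 : 0 < 1.78 * q * g - (g - 0.267) := by
        linarith [mul_le_mul_of_nonneg_right hGq (by linarith : 0 ≤ g), sq_nonneg (g - 0.28)]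
      have a2 : 0 < 1.78 * q * (g + 0.6 * q) - 2 * (g - 0.267) := by
        linarith [mul_le_mul_of_nonneg_right hGq (by linarith : 0 ≤ g),
          mul_le_mul hGq hGq (by linarith : 0 ≤ g) hq.le, sq_nonneg (g - 0.36)]
      have a3 : 0 < (q - y) * (1.78 * q * g - (g - 0.267)) :=
        mul_pos (by linarith) a1
      have a4 : 0 < y * (1.78 * q * (g + 0.6 * q) - 2 * (g - 0.267)) := mul_pos h3 a2
      linarith
    have e6 : 1.78 * q ^ 2 * (g + 0.6 * y) ≤ (r + 2 * Q) * q ^ 2 * (g + y * w) := by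
      apply mul_le_mul
      · exact mul_le_mul_of_nonneg_right (by linarith) (sq_nonneg q)
      · linarith [mul_le_mul_of_nonneg_left hw6.le h3.le]
      · linarith
      · have : 0 ≤ r + 2 * Q := by linarith
        positivity
    have e7 : (X * q) ^ 2 * (g + y * w) < q ^ 2 * (r ^ 2 + 2 * Q * r) * (g + y * w) := by
      have b1 := mul_le_mul_of_nonneg_right e2 (by linarith : 0 ≤ g + y * w)
      have b2 := mul_lt_mul_of_pos_left (e5.trans_le e6) hr0
      linarith
    exact lt_of_mul_lt_mul_right e7 (by linarith)

end ShortDiagonal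

namespace ShortDiagonal

open Real

lemma exists_polar {N r : ℝ} (hN : 0 ≤ N) (hr : 0 < r) :
    ∃ A ρ : ℝ, 0 ≤ A ∧ A < π / 2 ∧ 0 < ρ ∧ N = ρ * sin A ∧ r = ρ * cos A := by
  have h0 : 0 < √(1 + (N / r) ^ 2) := sqrt_pos.2 (by positivity)
  refine ⟨arctan (N / r), r * √(1 + (N / r) ^ 2), ?_, arctan_lt_pi_div_two _, by positivity, ?_, ?_⟩
  · rw [← arctan_zero]; exact arctan_mono (by positivity)
  · rw [sin_arctan]; field_simp
  · rw [cos_arctan]; field_simp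

/-- If `g` lies beyond the segment from `u` to `v`, seen from the origin, and is closer to the
origin than to `u` and to `v`, then `u` and `v` form no acute angle. -/
lemma inner_nonpos_of_beyond {u₁ u₂ v₁ v₂ g₁ g₂ : ℝ} (hD : 0 < u₁ * v₂ - u₂ * v₁)
    (ha : 0 < g₁ * v₂ - g₂ * v₁) (hb : 0 < u₁ * g₂ - u₂ * g₁)
    (hab : u₁ * v₂ - u₂ * v₁ ≤ (g₁ * v₂ - g₂ * v₁) + (u₁ * g₂ - u₂ * g₁))
    (hu : 2 * (g₁ * u₁ + g₂ * u₂) < u₁ ^ 2 + u₂ ^ 2)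
    (hv : 2 * (g₁ * v₁ + g₂ * v₂) < v₁ ^ 2 + v₂ ^ 2) : u₁ * v₁ + u₂ * v₂ ≤ 0 := by
  by_contra! h
  set D := u₁ * v₂ - u₂ * v₁ with hDd
  set a := g₁ * v₂ - g₂ * v₁ with had
  set b := u₁ * g₂ - u₂ * g₁ with hbd
  have e1 : D * (g₁ * u₁ + g₂ * u₂) = a * (u₁ ^ 2 + u₂ ^ 2) + b * (u₁ * v₁ + u₂ * v₂) := by
    rw [hDd, had, hbd]; ring
  have e2 : D * (g₁ * v₁ + g₂ * v₂) = a * (u₁ * v₁ + u₂ * v₂) + b * (v₁ ^ 2 + v₂ ^ 2) := by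
    rw [hDd, had, hbd]; ring
  have f1 := mul_lt_mul_of_pos_left hu hD
  have f2 := mul_lt_mul_of_pos_left hv hD
  have f3 := mul_pos hb h
  have f4 := mul_pos ha h
  have hu0 : 0 ≤ u₁ ^ 2 + u₂ ^ 2 := by positivity
  have hv0 : 0 ≤ v₁ ^ 2 + v₂ ^ 2 := by positivity
  have g1 : 2 * a < D := by
    by_contra! h1
    linarith [mul_le_mul_of_nonneg_right h1 hu0]
  have g2 : 2 * b < D := by
    by_contra! h1
    linarith [mul_le_mul_of_nonneg_right h1 hv0]
  linarith

/-- If the angle between `(N, r)` and `(m, -t)` is not acute and `(m, -t)` is longer than `1`, then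
`t` is at least the sine of the angle between `(N, r)` and the vertical. -/
lemma le_mul_of_obtuse {N r m t s : ℝ} (hN : 0 ≤ N) (ht : 0 < t) (hm : 0 ≤ m)
    (hs : 0 ≤ s) (hsq : s ^ 2 = N ^ 2 + r ^ 2) (hl : 1 < m ^ 2 + t ^ 2) (hob : N * m ≤ r * t) :
    N ≤ t * s := by
  by_contra! h
  have h1 : (t * s) ^ 2 < N ^ 2 := pow_lt_pow_left₀ h (by positivity) (by norm_num)
  have h2 : (N * m) ^ 2 ≤ (r * t) ^ 2 := pow_le_pow_left₀ (by positivity) hob 2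
  have h3 : N ^ 2 ≤ N ^ 2 * (m ^ 2 + t ^ 2) := by
    linarith [mul_nonneg (sq_nonneg N) (by linarith : 0 ≤ m ^ 2 + t ^ 2 - 1)]
  rw [mul_pow, hsq] at h1
  linarith

set_option maxHeartbeats 1000000 in
/-- The vertex `z` is the origin and `g = (-G, y)` is at distance `1` from it. The points
`(-p, q)` and `(-p', -q')` are the other two vertices of a convex quadrilateral; the supporting
lines at `g` and `z` have inclinations with tangents `a` and `b`, the base line has distance `k` from `z`,
and the width of the polygon in the directions of the supporting lines is at least `W`. -/
lemma false_of_unit_diagonal {G y p q p' q' a b k W : ℝ} (hG : 0 ≤ G) (hGy : G ^ 2 + y ^ 2 = 1)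
    (hpG : p ≤ G) (hpG' : p' ≤ G) (hq : 0 < q) (hq' : 0 < q') (hk : q' ≤ k)
    (ha : a * (q - y) ≤ G - p) (hb : b * q ≤ p) (hb' : -(b * q') ≤ p')
    (hW : k + q ≤ W) (wa : W * √(1 + a ^ 2) ≤ G + (k + y) * a + k * b)
    (wb : W * √(1 + b ^ 2) ≤ G + (k + y) * a + k * b)
    (d1 : 1 < p ^ 2 + q ^ 2) (d2 : 1 < p' ^ 2 + q' ^ 2) (d3 : 1 < (G - p) ^ 2 + (q - y) ^ 2)
    (d4 : 1 < (G - p') ^ 2 + (q' + y) ^ 2)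
    (c1 : 0 < G * q' + y * p') (c2 : 0 < G * q - y * p) (c4 : 0 < p * q' + q * p')
    (c3 : p * q' + q * p' < (G * q' + y * p') + (G * q - y * p)) : False := by
  -- both neighbours are beyond the heights of `g`
  have hr : 0 < q - y := by
    by_contra! h
    have h1 : q ^ 2 ≤ y ^ 2 := pow_le_pow_left₀ hq.le (by linarith) 2
    rcases le_or_gt 0 p with h2 | h2
    · linarith [pow_le_pow_left₀ h2 hpG 2]
    · have h3 : G < -p := by
        by_contra! h4
        have := pow_le_pow_left₀ (by linarith) h4 2
        linarith [neg_sq p]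
      have h4 : 0 < -b := by
        by_contra! h5
        linarith [mul_nonneg (by linarith : 0 ≤ b) hq.le]
      have h5 : q' < q := by
        by_contra! h6
        linarith [mul_le_mul_of_nonneg_left h6 h4.le]
      have h6 : 0 < p' := by linarith [mul_pos h4 hq']
      linarith [pow_le_pow_left₀ h6.le hpG' 2, pow_le_pow_left₀ hq'.le h5.le 2]
  have hr' : 0 < q' + y := by
    by_contra! h
    have h1 : q' ^ 2 ≤ y ^ 2 := by
      rw [← neg_sq y]; exact pow_le_pow_left₀ hq'.le (by linarith) 2
    rcases le_or_gt 0 p' with h2 | h2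
    · linarith [pow_le_pow_left₀ h2 hpG' 2]
    · have h3 : G < -p' := by
        by_contra! h4
        have := pow_le_pow_left₀ (by linarith) h4 2
        linarith [neg_sq p']
      have h4 : 0 < b := by
        by_contra! h5
        linarith [mul_nonneg (by linarith : 0 ≤ -b) hq'.le]
      have h5 : q < q' := by
        by_contra! h6
        linarith [mul_le_mul_of_nonneg_left h6 h4.le]
      have h6 : 0 < p := by linarith [mul_pos h4 hq]
      linarith [pow_le_pow_left₀ h6.le hpG 2, pow_le_pow_left₀ hq.le h5.le 2]
  -- neither vertex has an acute angle
  have ob1 : p * p' ≤ q * q' := by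
    have := inner_nonpos_of_beyond (u₁ := -p) (u₂ := q) (v₁ := -p') (v₂ := -q') (g₁ := -G) (g₂ := y)
      (by linarith) (by linarith) (by linarith) (by linarith) (by linarith) (by linarith)
    linarith
  have ob2 : (G - p) * (G - p') ≤ (q - y) * (q' + y) := by
    have := inner_nonpos_of_beyond (u₁ := G - p') (u₂ := -(q' + y)) (v₁ := G - p) (v₂ := q - y)
      (g₁ := G) (g₂ := -y)
      (by linarith) (by linarith) (by linarith) (by linarith) (by linarith) (by linarith)
    linarith
  obtain ⟨A, ρ, hA0, hA1, hρ, hAs, hAc⟩ := exists_polar (sub_nonneg.2 hpG) hr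
  have hρ2 : ρ ^ 2 = (G - p) ^ 2 + (q - y) ^ 2 := by
    rw [hAs, hAc]; linear_combination (-ρ ^ 2) * sin_sq_add_cos_sq A
  have hρ1 : 1 < ρ := by
    by_contra! h
    linarith [pow_le_pow_left₀ hρ.le h 2]
  have hQ : G - p ≤ (k + y) * ρ := by
    have := le_mul_of_obtuse (sub_nonneg.2 hpG) hr' (sub_nonneg.2 hpG') hρ.le hρ2 d4 ob2
    linarith [mul_le_mul_of_nonneg_right (by linarith : q' + y ≤ k + y) hρ.le]
  have hk0 : 0 < k := by linarith
  have hQ0 : 0 < k + y := by linarith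
  have hY : 0 < k + q := by linarith
  have wa' : (k + q) * √(1 + a ^ 2) ≤ G + (k + y) * a + k * b :=
    (mul_le_mul_of_nonneg_right hW (sqrt_nonneg _)).trans wa
  have wb' : (k + q) * √(1 + b ^ 2) ≤ G + (k + y) * a + k * b :=
    (mul_le_mul_of_nonneg_right hW (sqrt_nonneg _)).trans wb
  rcases lt_or_ge p 0 with hp | hp
  · have hb0 : b < 0 := by
      by_contra! h
      linarith [mul_nonneg h hq.le]
    have hp' : 0 < p' := by linarith [mul_pos (neg_pos.2 hb0) hq']
    have hyk : |y| ≤ k := by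
      rw [← abs_of_pos hk0]
      apply sq_le_sq.1
      have := pow_le_pow_left₀ hp'.le hpG' 2
      have := pow_le_pow_left₀ hq'.le hk 2
      linarith
    set X := (G * q - k * -p) / q with hX
    have hXq : X * q = G * q - k * -p := by rw [hX]; field_simp
    have hsq : √(1 + a ^ 2) ^ 2 = 1 + a ^ 2 := sq_sqrt (by positivity)
    have h0 : 0 ≤ √(1 + a ^ 2) := sqrt_nonneg _
    have h1 : (k + q) * √(1 + a ^ 2) - (k + y) * a ≤ X := by
      have : k * (b * q) ≤ k * p := mul_le_mul_of_nonneg_left hb hk0.le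
      have : ((k + q) * √(1 + a ^ 2) - (k + y) * a) * q ≤ X * q := by
        rw [hXq]; linarith [mul_le_mul_of_nonneg_right wa' hq.le]
      exact le_of_mul_le_mul_right this hq
    have h2 : a < √(1 + a ^ 2) := lt_sqrt_of_sq_lt (by linarith)
    have h3 : 0 < (k + q) * √(1 + a ^ 2) - (k + y) * a := by
      have := mul_lt_mul_of_pos_left h2 hQ0
      linarith [mul_nonneg hr.le h0]
    have h4 := leaning_bound (G := G) (y := y) (w := -p) (q := q) (r := q - y) (s := ρ)
      (Q := k + y) (q₂ := k) (X := X) hG hGy (by linarith) hq rfl hr (by linarith) hyk rfl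
      (by rw [hρ2]; ring) hρ1 (by linarith) hXq (h3.trans_le h1)
    have h5 := pow_le_pow_left₀ h3.le h1 2
    have h6 : ((k + q) * √(1 + a ^ 2) - (k + y) * a) ^ 2 =
        (k + q) ^ 2 - (k + y) ^ 2 + ((k + q) * a - (k + y) * √(1 + a ^ 2)) ^ 2 := by
      linear_combination ((k + q) ^ 2 - (k + y) ^ 2) * hsq
    linarith [sq_nonneg ((k + q) * a - (k + y) * √(1 + a ^ 2))]
  obtain ⟨B, ρ', hB0, hB1, hρ', hBs, hBc⟩ := exists_polar hp hq
  have hρ2' : ρ' ^ 2 = p ^ 2 + q ^ 2 := by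
    rw [hBs, hBc]; linear_combination (-ρ' ^ 2) * sin_sq_add_cos_sq B
  have hρ1' : 1 < ρ' := by
    by_contra! h
    linarith [pow_le_pow_left₀ hρ'.le h 2]
  have hlaw : ρ ^ 2 + ρ' ^ 2 - 2 * ρ * ρ' * cos (A + B) = 1 := by
    have e1 : G = ρ * sin A + ρ' * sin B := by linarith
    have e2 : y = ρ' * cos B - ρ * cos A := by linarith
    rw [cos_add, ← hGy, e1, e2]
    linear_combination (-ρ ^ 2) * sin_sq_add_cos_sq A - ρ' ^ 2 * sin_sq_add_cos_sq B
  have hT : cos A * cos B ≤ sin (A + B) := by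
    by_contra! h
    have e1 : (G - p) * q + p * (q - y) < (q - y) * q := by
      rw [sin_add] at h
      have := mul_lt_mul_of_pos_left h (mul_pos hρ hρ')
      rw [hAs, hAc, hBs, hBc]
      linarith
    have e2 : k + q ≤ G + (k + y) * a + k * b := by
      have : 1 ≤ √(1 + a ^ 2) := one_le_sqrt.2 (by linarith [sq_nonneg a])
      linarith [mul_le_mul_of_nonneg_left this hY.le]
    have e3 := mul_le_mul_of_nonneg_left (mul_le_mul_of_nonneg_right ha hq.le) hQ0.le
    have e4 := mul_le_mul_of_nonneg_left (mul_le_mul_of_nonneg_right hb hr.le) hk0.le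
    have e5 := mul_le_mul_of_nonneg_right e2 (mul_pos hr hq).le
    have e6 := mul_lt_mul_of_pos_left e1 hY
    linarith
  have hSA : sin A ≤ k + y := by
    rw [hAs, mul_comm ρ] at hQ
    exact le_of_mul_le_mul_right hQ hρ
  have ha' : a * cos A ≤ sin A := by
    rw [hAs, hAc] at ha
    have : ρ * (a * cos A) ≤ ρ * sin A := by linarith
    exact le_of_mul_le_mul_left this hρ
  have hb'' : b * cos B ≤ sin B := by
    rw [hBc] at hb
    have : ρ' * (b * cos B) ≤ ρ' * sin B := by linarith
    exact le_of_mul_le_mul_left this hρ'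
  have hGe : G = ρ * sin A + ρ' * sin B := by linarith
  have hYe : k + q = k + y + ρ * cos A := by linarith
  have hYe' : k + q = k + ρ' * cos B := by linarith
  rcases le_or_gt B A with hBA | hAB
  · rw [hGe, hYe] at wa' wb'
    exact contradiction_of_widths hB0 hBA hA1 hρ1 hρ1' hlaw hT hSA (by linarith) ha' hb'' wa' wb'
  have hlaw' : ρ' ^ 2 + ρ ^ 2 - 2 * ρ' * ρ * cos (B + A) = 1 := by
    rw [add_comm B A]; linarith
  rw [hGe, hYe'] at wa' wb'
  rcases le_or_gt (sin B) k with h5 | h5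
  · exact contradiction_of_widths (K := k + y) hA0 hAB.le hB1 hρ1' hρ1 hlaw'
      (by rwa [mul_comm, add_comm])
      h5 (by linarith) hb'' ha' (by linarith) (by linarith)
  rcases le_or_gt 0 p' with h6 | h6
  · have := le_mul_of_obtuse hp hq' h6 hρ'.le hρ2' d2 ob1
    have h7 : ρ' * sin B ≤ ρ' * k := by
      rw [← hBs]; linarith [mul_le_mul_of_nonneg_right hk hρ'.le]
    linarith [le_of_mul_le_mul_left h7 hρ']
  · have hb0 : 0 ≤ b := by
      by_contra! h
      linarith [mul_pos (neg_pos.2 h) hq']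
    have h7 : 1 ≤ k * √(1 + b ^ 2) := by
      have h8 : 1 ^ 2 ≤ (q' * √(1 + b ^ 2)) ^ 2 := by
        rw [mul_pow, sq_sqrt (by positivity)]
        have := pow_le_pow_left₀ (by linarith) (by linarith : -p' ≤ b * q') 2
        linarith [neg_sq p']
      have h9 := le_of_sq_le_sq h8 (mul_nonneg hq'.le (sqrt_nonneg _))
      exact h9.trans (mul_le_mul_of_nonneg_right hk (sqrt_nonneg _))
    exact contradiction_of_steep hA0 hAB.le hB1 hρ1' hρ1 hlaw' hQ0.le hb0 h7 h5 (by linarith)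
      ha' hb'' (by linarith)

end ShortDiagonal

/-! ### Scanning for the next admissible index -/

namespace Scan

open Classical in
/-- The least `j` with `s ≤ j < n` and `p j`, and `n` if there is none. -/
noncomputable def next (p : ℕ → Prop) (n s : ℕ) : ℕ :=
  if h : ∃ j, s ≤ j ∧ j < n ∧ p j then Nat.find h else n

open Classical in
/-- One more than the largest `j < e` with `p j`, and `0` if there is none. -/
noncomputable def prev (p : ℕ → Prop) : ℕ → ℕ
  | 0 => 0
  | e + 1 => if p e then e + 1 else prev p e

variable {p : ℕ → Prop} {n s e j : ℕ}

open Classical in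
lemma next_le_of (hs : s ≤ j) (hn : j < n) (hp : p j) : next p n s ≤ j := by
  have h : ∃ j, s ≤ j ∧ j < n ∧ p j := ⟨j, hs, hn, hp⟩
  rw [next, dif_pos h]
  exact Nat.find_min' h ⟨hs, hn, hp⟩

open Classical in
lemma next_le : next p n s ≤ n := by
  rw [next]; split_ifs with h
  · exact (Nat.find_spec h).2.1.le
  · exact le_rfl

open Classical in
lemma next_spec (h : next p n s < n) : s ≤ next p n s ∧ p (next p n s) := by
  rw [next] at h ⊢
  split_ifs at h ⊢ with h1
  · exact ⟨(Nat.find_spec h1).1, (Nat.find_spec h1).2.2⟩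
  · omega

lemma le_next (hs : s ≤ n) : s ≤ next p n s := by
  rcases next_le.lt_or_eq with h | h
  · exact (next_spec h).1
  · rw [h]; exact hs

lemma not_of_lt_next (hs : s ≤ j) (hj : j < next p n s) : ¬ p j := fun hp =>
  absurd (next_le_of hs (hj.trans_le next_le) hp) (by omega)

lemma next_eq_of_le (hs : n ≤ s) : next p n s = n := by
  rw [next, dif_neg]
  rintro ⟨j, h⟩; omega

open Classical in
lemma next_step (hs : s < n) : next p n s = if p s then s else next p n (s + 1) := by
  split_ifs with h
  · exact le_antisymm (next_le_of le_rfl hs h) (le_next hs.le)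
  · apply le_antisymm
    · rcases (next_le (p := p) (n := n) (s := s + 1)).lt_or_eq with h1 | h1
      · exact next_le_of (by have := (next_spec h1).1; omega) h1 (next_spec h1).2
      · rw [h1]; exact next_le
    · rcases (next_le (p := p) (n := n) (s := s)).lt_or_eq with h1 | h1
      · refine next_le_of ?_ h1 (next_spec h1).2
        have h2 := next_spec h1
        rcases h2.1.lt_or_eq with h3 | h3
        · exact h3
        · rw [← h3] at h2; exact absurd h2.2 h
      · rw [h1]; exact next_le

lemma prev_le : prev p e ≤ e := by
  induction e with
  | zero => rfl
  | succ e ih => rw [prev]; split_ifs <;> omega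

lemma lt_prev_of (he : j < e) (hp : p j) : j < prev p e := by
  induction e with
  | zero => omega
  | succ e ih =>
    rw [prev]
    split_ifs with h
    · exact he
    · apply ih
      rcases Nat.lt_succ_iff_lt_or_eq.1 he with h1 | rfl
      · exact h1
      · exact absurd hp h

lemma prev_spec (h : 0 < prev p e) : p (prev p e - 1) := by
  induction e with
  | zero => simp [prev] at h
  | succ e ih =>
    rw [prev] at h ⊢
    split_ifs at h ⊢ with h1
    · exact h1
    · exact ih h

lemma not_of_prev_le (he : j < e) (hj : prev p e ≤ j) : ¬ p j := fun hp =>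
  absurd (lt_prev_of he hp) (by omega)

end Scan

/-! ### Separated families on the two sides of a strip -/

/-- The combinatorial properties of a strictly convex polygon over a base of minimum width on
which the search for large separated subsets relies. The vertices are numbered in cyclic order from
one end of the base, those below `t` form the right side and the others the left side; `κ` is the
distance from an axis, and `ok i j` says that the vertices `i` and `j` are far apart. The fields `up`
and `down` concern vertices that move away from or towards the axis, `cross` and `opposite` the
diagonals of quadrilaterals, and `top` and `bottom` the distances from the highest vertex and from
the left end of the base. -/
structure Split (n t : ℕ) (κ : ℕ → ℝ) (ok : ℕ → ℕ → Prop) : Prop where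
  lt : t < n
  symm : ∀ i j, ok i j → ok j i
  quasi : ∀ i j l, i < j → j < l → l < n → (i < t ↔ l < t) → min (κ i) (κ l) < κ j
  up : ∀ i j l, i < j → j < l → l < n → (i < t ↔ l < t) → κ i ≤ κ j → κ j ≤ κ l →
    (ok i j ∨ ok j l) → ok i l
  down : ∀ i j l, i < j → j < l → l < n → (i < t ↔ l < t) → κ j ≤ κ i → κ l ≤ κ j →
    (ok i j ∨ ok j l) → ok i l
  cross : ∀ i j k l, i < j → j < k → k < l → l < n →
    (ok i j ∧ ok k l ∨ ok j k ∧ ok i l) → ok i k ∨ ok j l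
  opposite : ∀ i j l m, i < j → j < l → l < n → m < n → (i < t ↔ l < t) → (m < t ↔ ¬ i < t) →
    ok i j → ok j l → ok i m → ok l m → ok j m
  top : ∀ i j, i < j → j < t → κ j ≤ κ i → ok i j → ok i t
  bottom : ∀ i j, i < j → j < t → κ i ≤ κ j → ok i j → ok j (n - 1)

namespace Split

variable {n t : ℕ} {κ : ℕ → ℝ} {ok : ℕ → ℕ → Prop}

/-- `i` comes before `j` in the direction `d` (`true` for increasing indices). -/
def Before (d : Bool) (i j : ℕ) : Prop := cond d (i < j) (j < i)

lemma Before.trans {d : Bool} {i j k : ℕ} (h : Before d i j) (h' : Before d j k) :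
    Before d i k := by cases d <;> simp only [Before, cond] at * <;> omega

lemma Before.irrefl {d : Bool} {i : ℕ} : ¬ Before d i i := by cases d <;> simp [Before]

/-- `i` and `j` are vertices of the same side. -/
def Same (n t i j : ℕ) : Prop := i < n ∧ j < n ∧ (i < t ↔ j < t)

lemma Same.symm {i j : ℕ} (h : Same n t i j) : Same n t j i := ⟨h.2.1, h.1, h.2.2.symm⟩

lemma Same.trans {i j k : ℕ} (h : Same n t i j) (h' : Same n t j k) : Same n t i k :=
  ⟨h.1, h'.2.1, h.2.2.trans h'.2.2⟩

lemma Same.of_between {i j k : ℕ} {d : Bool} (h : Same n t i k) (h1 : Before d i j)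
    (h2 : Before d j k) : Same n t i j := by
  obtain ⟨h3, h4, h5⟩ := h
  cases d <;> simp only [Before, cond] at h1 h2 <;> refine ⟨h3, by omega, by omega⟩

variable (H : Split n t κ ok)
include H

lemma quasi' {d : Bool} {i j l : ℕ} (h1 : Before d i j) (h2 : Before d j l)
    (hs : Same n t i l) : min (κ i) (κ l) < κ j := by
  cases d
  · rw [min_comm]; exact H.quasi l j i h2 h1 hs.1 hs.2.2.symm
  · exact H.quasi i j l h1 h2 hs.2.1 hs.2.2

lemma ok_comm {i j : ℕ} : ok i j ↔ ok j i := ⟨H.symm i j, H.symm j i⟩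

lemma mono {d : Bool} {i j l : ℕ} (h1 : Before d i j) (h2 : Before d j l)
    (hs : Same n t i l) (h3 : κ i ≤ κ j) (h4 : κ j ≤ κ l) (h : ok i j ∨ ok j l) : ok i l := by
  cases d
  · rw [H.ok_comm]
    exact H.down l j i h2 h1 hs.1 hs.2.2.symm h4 h3 (h.symm.imp (H.symm _ _) (H.symm _ _))
  · exact H.up i j l h1 h2 hs.2.1 hs.2.2 h3 h4 h

lemma lt_of_le_right {d : Bool} {i j l : ℕ} (h1 : Before d i j) (h2 : Before d j l)
    (hs : Same n t i l) (h : κ j ≤ κ l) : κ i < κ j := by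
  rcases min_lt_iff.1 (H.quasi' h1 h2 hs) with h3 | h3
  · exact h3
  · linarith

lemma lt_of_le_left {d : Bool} {i j l : ℕ} (h1 : Before d i j) (h2 : Before d j l)
    (hs : Same n t i l) (h : κ j ≤ κ i) : κ l < κ j := by
  rcases min_lt_iff.1 (H.quasi' h1 h2 hs) with h3 | h3
  · linarith
  · exact h3

lemma le_of_le {d : Bool} {i j l : ℕ} (h1 : Before d i j) (h2 : Before d j l)
    (hs : Same n t i l) {c : ℝ} (hi : c ≤ κ i) (hl : c ≤ κ l) : c ≤ κ j :=
  ((le_min hi hl).trans_lt (H.quasi' h1 h2 hs)).le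

omit H

/-- `j` lies strictly between the gates `lo` and `hi`, no nearer to the axis than either, and far
from both. -/
structure Inner (n t : ℕ) (κ : ℕ → ℝ) (ok : ℕ → ℕ → Prop) (lo hi j : ℕ) : Prop where
  lt_left : lo < j
  lt_right : j < hi
  le_left : κ lo ≤ κ j
  le_right : κ hi ≤ κ j
  ok_left : ok lo j
  ok_right : ok j hi

/-- The first vertex of the side of `i`. -/
noncomputable def sideStart (t i : ℕ) : ℕ := if i < t then 0 else t

/-- One past the last vertex of the side of `i`. -/
noncomputable def sideEnd (n t i : ℕ) : ℕ := if i < t then t else n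

/-- The first vertex on the side of `i` that is no nearer to the axis than `i`. -/
noncomputable def firstFar (n t : ℕ) (κ : ℕ → ℝ) (i : ℕ) : ℕ :=
  Scan.next (fun j => κ i ≤ κ j) n (sideStart t i)

/-- One past the last vertex on the side of `i` that is no nearer to the axis than `i`. -/
noncomputable def lastFar (n t : ℕ) (κ : ℕ → ℝ) (i : ℕ) : ℕ :=
  Scan.prev (fun j => κ i ≤ κ j) (sideEnd n t i)

/-- The first candidate between two gates. -/
noncomputable def candLo (n t : ℕ) (κ : ℕ → ℝ) (ok : ℕ → ℕ → Prop) (lo hi : ℕ) : ℕ :=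
  Scan.next (ok hi) n (Scan.next (ok lo) n (max (lo + 1) (firstFar n t κ hi)))

/-- One past the last candidate between two gates. -/
noncomputable def candHi (n t : ℕ) (κ : ℕ → ℝ) (ok : ℕ → ℕ → Prop) (lo hi : ℕ) : ℕ :=
  Scan.prev (ok lo) (Scan.prev (ok hi) (min hi (lastFar n t κ lo)))

/-- The first candidate between the gates is a possible vertex. -/
def ValidLo (n t : ℕ) (κ : ℕ → ℝ) (ok : ℕ → ℕ → Prop) (lo hi : ℕ) : Prop :=
  candLo n t κ ok lo hi < hi ∧ κ lo ≤ κ (candLo n t κ ok lo hi)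

/-- The last candidate between the gates is a possible vertex. -/
def ValidHi (n t : ℕ) (κ : ℕ → ℝ) (ok : ℕ → ℕ → Prop) (lo hi : ℕ) : Prop :=
  lo + 1 < candHi n t κ ok lo hi ∧ κ hi ≤ κ (candHi n t κ ok lo hi - 1)

lemma le_candLo {lo hi : ℕ} (h : lo < n) : lo + 1 ≤ candLo n t κ ok lo hi := by
  unfold candLo
  set s := max (lo + 1) (firstFar n t κ hi) with hs
  have h0 : lo + 1 ≤ s := le_max_left _ _
  by_cases h1 : s ≤ n
  · exact h0.trans ((Scan.le_next h1).trans (Scan.le_next Scan.next_le))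
  · rw [Scan.next_eq_of_le (by omega : n ≤ s), Scan.next_eq_of_le le_rfl]; exact h

lemma candHi_le {lo hi : ℕ} : candHi n t κ ok lo hi ≤ hi :=
  Scan.prev_le.trans (Scan.prev_le.trans (min_le_left _ _))

open Classical in
/-- A greedily chosen separated family between two gates: it takes the first or the last candidate
and continues between the narrower gates, whichever gives more. -/
noncomputable def inner (n t : ℕ) (κ : ℕ → ℝ) (ok : ℕ → ℕ → Prop) (lo hi : ℕ) : List ℕ :=
  let fromLo := if h : lo < n ∧ lo < hi ∧ ValidLo n t κ ok lo hi then
    candLo n t κ ok lo hi :: inner n t κ ok (candLo n t κ ok lo hi) hi else []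
  let fromHi := if h : lo < n ∧ lo < hi ∧ ValidHi n t κ ok lo hi then
    (candHi n t κ ok lo hi - 1) :: inner n t κ ok lo (candHi n t κ ok lo hi - 1) else []
  if fromHi.length ≤ fromLo.length then fromLo else fromHi
termination_by hi - lo
decreasing_by
  · have := le_candLo (t := t) (κ := κ) (ok := ok) (hi := hi) h.1
    have := h.2.2.1
    omega
  · have := candHi_le (n := n) (t := t) (κ := κ) (ok := ok) (lo := lo) (hi := hi)
    have := h.2.2.1
    omega

include H

lemma le_of_firstFar_le {hi j : ℕ} (h : firstFar n t κ hi ≤ j) (hj : j ≤ hi) (hn : hi < n) :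
    κ hi ≤ κ j := by
  unfold firstFar at h
  set f := Scan.next (fun j => κ hi ≤ κ j) n (sideStart t hi) with hf
  have h1 : f < n := by omega
  have h2 := Scan.next_spec (hf ▸ h1)
  rw [← hf] at h2
  rcases h.eq_or_lt with h3 | h3
  · rw [← h3]; exact h2.2
  rcases hj.eq_or_lt with h4 | h4
  · rw [h4]
  refine H.le_of_le (d := true) h3 h4 ⟨h1, hn, ?_⟩ h2.2 le_rfl
  have := h2.1
  unfold sideStart at this
  split_ifs at this <;> omega

lemma le_of_lt_lastFar {lo j : ℕ} (h : j < lastFar n t κ lo) (hj : lo ≤ j) (hn : lo < n) :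
    κ lo ≤ κ j := by
  unfold lastFar at h
  set f := Scan.prev (fun j => κ lo ≤ κ j) (sideEnd n t lo) with hf
  have h2 := Scan.prev_spec (hf ▸ (by omega : 0 < f))
  rw [← hf] at h2
  have h5 : f ≤ sideEnd n t lo := Scan.prev_le
  rcases (by omega : j ≤ f - 1).eq_or_lt with h3 | h3
  · rw [h3]; exact h2
  rcases hj.eq_or_lt with h4 | h4
  · rw [h4]
  have ht := H.lt
  refine H.le_of_le (d := true) h4 h3 ⟨hn, ?_, ?_⟩ le_rfl h2
  all_goals
    unfold sideEnd at h5
    split_ifs at h5 <;> omega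

omit H in
lemma firstFar_le {i j : ℕ} (hs : Same n t i j) (h : κ i ≤ κ j) : firstFar n t κ i ≤ j := by
  refine Scan.next_le_of ?_ hs.2.1 h
  have := hs.2.2
  unfold sideStart; split_ifs <;> omega

omit H in
lemma lt_lastFar {i j : ℕ} (hs : Same n t i j) (h : κ i ≤ κ j) : j < lastFar n t κ i := by
  refine Scan.lt_prev_of ?_ h
  have h1 := hs.2.2
  have h2 := hs.2.1
  unfold sideEnd; split_ifs <;> omega

lemma inner_candLo {lo hi : ℕ} (hs : Same n t lo hi)
    (h : ValidLo n t κ ok lo hi) : Inner n t κ ok lo hi (candLo n t κ ok lo hi) := by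
  have h0 := le_candLo (t := t) (κ := κ) (ok := ok) (hi := hi) hs.1
  obtain ⟨h1, h2⟩ := h
  unfold candLo at *
  set s := max (lo + 1) (firstFar n t κ hi) with hsd
  set a₁ := Scan.next (ok lo) n s with ha₁
  set a := Scan.next (ok hi) n a₁ with ha
  have hn := hs.2.1
  have h3 := Scan.next_spec (ha ▸ (by omega : a < n))
  rw [← ha] at h3
  have h4 := Scan.next_spec (ha₁ ▸ (by omega : a₁ < n))
  rw [← ha₁] at h4
  have h5 : κ hi ≤ κ a := H.le_of_firstFar_le ((le_max_right _ _).trans (h4.1.trans h3.1)) h1.le hn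
  refine ⟨h0, h1, h2, h5, ?_, H.symm _ _ h3.2⟩
  rcases h3.1.eq_or_lt with h6 | h6
  · rw [← h6]; exact h4.2
  have h7 : lo < a₁ := lt_of_lt_of_le (Nat.lt_succ_self lo) ((le_max_left _ _).trans h4.1)
  have hn1 : ¬ ok hi a₁ := Scan.not_of_lt_next le_rfl (ha ▸ h6)
  have sa := hs.of_between (d := true) h7 (h6.trans h1)
  have sb := hs.of_between (d := true) (show lo < a by omega) h1
  rcases le_or_gt (κ a₁) (κ a) with h8 | h8
  · exact H.mono (d := true) h7 h6 sb (H.lt_of_le_right (d := true) h7 h6 sb h8).le h8 (Or.inl h4.2)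
  · exact absurd (H.mono (d := false) (i := hi) (j := a) (l := a₁) h1 h6 (hs.symm.trans sa)
      h5 h8.le (Or.inl h3.2)) hn1

lemma inner_candHi {lo hi : ℕ} (hs : Same n t lo hi)
    (h : ValidHi n t κ ok lo hi) : Inner n t κ ok lo hi (candHi n t κ ok lo hi - 1) := by
  have h0 := candHi_le (n := n) (t := t) (κ := κ) (ok := ok) (lo := lo) (hi := hi)
  obtain ⟨h1, h2⟩ := h
  unfold candHi at *
  set s := min hi (lastFar n t κ lo) with hsd
  set b₁ := Scan.prev (ok hi) s with hb₁
  set b := Scan.prev (ok lo) b₁ with hb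
  have hn := hs.2.1
  have h3 := Scan.prev_spec (hb ▸ (by omega : 0 < b))
  rw [← hb] at h3
  have hbb : b ≤ b₁ := Scan.prev_le
  have hbs : b₁ ≤ s := Scan.prev_le
  have h4 := Scan.prev_spec (hb₁ ▸ (by omega : 0 < b₁))
  rw [← hb₁] at h4
  have hsl : s ≤ lastFar n t κ lo := min_le_right _ _
  have h5 : κ lo ≤ κ (b - 1) := H.le_of_lt_lastFar (by omega) (by omega) hs.1
  refine ⟨by omega, by omega, h5, h2, h3, ?_⟩
  rw [H.ok_comm]
  rcases hbb.eq_or_lt with h6 | h6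
  · rw [h6]; exact h4
  have h7 : b₁ - 1 < hi := by have : s ≤ hi := min_le_left _ _; omega
  have hn1 : ¬ ok lo (b₁ - 1) := Scan.not_of_prev_le (p := ok lo) (e := b₁) (by omega) (by omega)
  have sa := hs.of_between (d := true) (j := b₁ - 1) (show lo < b₁ - 1 by omega) h7
  have sb := hs.of_between (d := true) (j := b - 1) (show lo < b - 1 by omega)
    (show b - 1 < hi by omega)
  have h9 : b - 1 < b₁ - 1 := by omega
  rcases le_or_gt (κ (b₁ - 1)) (κ (b - 1)) with h8 | h8
  · exact H.mono (d := false) h7 h9 (hs.symm.trans sb)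
      (H.lt_of_le_right (d := false) h7 h9 (hs.symm.trans sb) h8).le h8 (Or.inl h4)
  · exact absurd (H.mono (d := true) (i := lo) (j := b - 1) (l := b₁ - 1) (by simp [Before]; omega)
      h9 sa h5 h8.le (Or.inl h3)) hn1

lemma candLo_le {lo hi x : ℕ} (hs : Same n t lo hi) (h : Inner n t κ ok lo hi x) :
    candLo n t κ ok lo hi ≤ x ∧ ValidLo n t κ ok lo hi := by
  have hn := hs.2.1
  have hx := h.lt_right
  have sx := hs.of_between (d := true) h.lt_left h.lt_right
  have h1 : candLo n t κ ok lo hi ≤ x := by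
    refine Scan.next_le_of (Scan.next_le_of (max_le h.lt_left ?_) (by omega) h.ok_left) (by omega)
      (H.symm _ _ h.ok_right)
    exact firstFar_le (hs.symm.trans sx) h.le_right
  refine ⟨h1, by omega, ?_⟩
  rcases h1.eq_or_lt with h2 | h2
  · rw [h2]; exact h.le_left
  · exact H.le_of_le (d := true) (le_candLo hs.1) h2 sx le_rfl h.le_left

lemma lt_candHi {lo hi x : ℕ} (hs : Same n t lo hi) (h : Inner n t κ ok lo hi x) :
    x < candHi n t κ ok lo hi ∧ ValidHi n t κ ok lo hi := by
  have hn := hs.2.1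
  have hx := h.lt_right
  have sx := hs.of_between (d := true) h.lt_left h.lt_right
  have h1 : x < candHi n t κ ok lo hi := by
    refine Scan.lt_prev_of (Scan.lt_prev_of (lt_min hx ?_) (H.symm _ _ h.ok_right)) h.ok_left
    exact lt_lastFar sx h.le_left
  have h3 := candHi_le (n := n) (t := t) (κ := κ) (ok := ok) (lo := lo) (hi := hi)
  have hl := h.lt_left
  refine ⟨h1, by omega, ?_⟩
  rcases (show x ≤ candHi n t κ ok lo hi - 1 by omega).eq_or_lt with h2 | h2
  · rw [← h2]; exact h.le_right
  · exact H.le_of_le (d := true) h2 (show candHi n t κ ok lo hi - 1 < hi by omega)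
      (sx.symm.trans hs) h.le_right le_rfl

omit H in
lemma inner_cases (P : List ℕ → Prop) {lo hi : ℕ} (h0 : P [])
    (h1 : lo < n → lo < hi → ValidLo n t κ ok lo hi →
      P (candLo n t κ ok lo hi :: inner n t κ ok (candLo n t κ ok lo hi) hi))
    (h2 : lo < n → lo < hi → ValidHi n t κ ok lo hi →
      P ((candHi n t κ ok lo hi - 1) :: inner n t κ ok lo (candHi n t κ ok lo hi - 1))) :
    P (inner n t κ ok lo hi) := by
  rw [inner]
  by_cases h3 : lo < n ∧ lo < hi ∧ ValidLo n t κ ok lo hi <;>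
    by_cases h4 : lo < n ∧ lo < hi ∧ ValidHi n t κ ok lo hi <;>
    simp only [h3, h4, dite_false] <;> split_ifs
  all_goals first
    | exact h0
    | exact h1 h3.1 h3.2.1 h3.2.2
    | exact h2 h4.1 h4.2.1 h4.2.2

lemma Inner.left {lo hi a j : ℕ} (hs : Same n t lo hi) (ha : Inner n t κ ok lo hi a)
    (hj : Inner n t κ ok a hi j) : Inner n t κ ok lo hi j :=
  ⟨ha.lt_left.trans hj.lt_left, hj.lt_right, ha.le_left.trans hj.le_left, hj.le_right,
    H.mono (d := true) ha.lt_left hj.lt_left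
      (hs.of_between (d := true) (ha.lt_left.trans hj.lt_left) hj.lt_right)
      ha.le_left hj.le_left (Or.inl ha.ok_left), hj.ok_right⟩

lemma Inner.right {lo hi b j : ℕ} (hs : Same n t lo hi) (hb : Inner n t κ ok lo hi b)
    (hj : Inner n t κ ok lo b j) : Inner n t κ ok lo hi j :=
  ⟨hj.lt_left, hj.lt_right.trans hb.lt_right, hj.le_left, hb.le_right.trans hj.le_right,
    hj.ok_left, H.symm _ _ (H.mono (d := false) hb.lt_right hj.lt_right
      (hs.symm.of_between (d := false) (hj.lt_right.trans hb.lt_right) hj.lt_left)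
      hb.le_right hj.le_right (Or.inl (H.symm _ _ hb.ok_right)))⟩

/-- The greedy family between two gates consists of separated inner vertices. -/
lemma inner_sound {lo hi : ℕ} (hs : Same n t lo hi) :
    (∀ j ∈ inner n t κ ok lo hi, Inner n t κ ok lo hi j) ∧
      (inner n t κ ok lo hi).Pairwise (fun a b => a ≠ b ∧ ok a b) := by
  induction h : hi - lo using Nat.strong_induction_on generalizing lo hi with
  | _ N ih =>
  apply inner_cases (P := fun l => (∀ j ∈ l, Inner n t κ ok lo hi j) ∧
    l.Pairwise (fun a b => a ≠ b ∧ ok a b)) (by simp)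
  · intro hn hlt hv
    have h1 := H.inner_candLo hs hv
    set a := candLo n t κ ok lo hi
    have h2 := h1.lt_left
    have h3 := h1.lt_right
    obtain ⟨h4, h5⟩ := ih (hi - a) (by omega)
      ((hs.of_between (d := true) h2 h3).symm.trans hs) rfl
    exact ⟨List.forall_mem_cons.2 ⟨h1, fun j hj => Inner.left H hs h1 (h4 j hj)⟩,
      List.pairwise_cons.2 ⟨fun j hj => ⟨(h4 j hj).lt_left.ne, (h4 j hj).ok_left⟩, h5⟩⟩
  · intro hn hlt hv
    have h1 := H.inner_candHi hs hv
    set b := candHi n t κ ok lo hi - 1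
    have h2 := h1.lt_left
    have h3 := h1.lt_right
    obtain ⟨h4, h5⟩ := ih (b - lo) (by omega) (hs.of_between (d := true) h2 h3) rfl
    exact ⟨List.forall_mem_cons.2 ⟨h1, fun j hj => Inner.right H hs h1 (h4 j hj)⟩,
      List.pairwise_cons.2
        ⟨fun j hj => ⟨(h4 j hj).lt_right.ne', H.symm _ _ (h4 j hj).ok_right⟩, h5⟩⟩

/-- The members of `T` are pairwise far apart. -/
def _root_.Separated (ok : ℕ → ℕ → Prop) (T : Finset ℕ) : Prop :=
  ∀ i ∈ T, ∀ j ∈ T, i ≠ j → ok i j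

omit H in
lemma length_le_inner {lo hi : ℕ} (hn : lo < n) (hlt : lo < hi) :
    (ValidLo n t κ ok lo hi →
      (inner n t κ ok (candLo n t κ ok lo hi) hi).length + 1 ≤ (inner n t κ ok lo hi).length) ∧
    (ValidHi n t κ ok lo hi →
      (inner n t κ ok lo (candHi n t κ ok lo hi - 1)).length + 1 ≤
        (inner n t κ ok lo hi).length) := by
  constructor <;> intro hv <;> rw [inner.eq_1 n t κ ok lo hi]
  · rw [dif_pos (⟨hn, hlt, hv⟩ : lo < n ∧ lo < hi ∧ ValidLo n t κ ok lo hi)]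
    split_ifs <;> simp at * <;> omega
  · rw [dif_pos (⟨hn, hlt, hv⟩ : lo < n ∧ lo < hi ∧ ValidHi n t κ ok lo hi)]
    split_ifs <;> simp at * <;> omega

/-- The greedy family between two gates is as large as any separated family of inner vertices: the
first or the last member of the latter, whichever is nearer to the axis, can be replaced by the
first or the last candidate. -/
lemma card_le_inner {lo hi : ℕ} (hs : Same n t lo hi) (T : Finset ℕ)
    (hT : ∀ j ∈ T, Inner n t κ ok lo hi j) (hsep : Separated ok T) :
    T.card ≤ (inner n t κ ok lo hi).length := by
  induction h : hi - lo using Nat.strong_induction_on generalizing lo hi T with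
  | _ N ih =>
  rcases T.eq_empty_or_nonempty with rfl | hne
  · simp
  set x := T.min' hne with hx
  set y := T.max' hne with hy
  have hxT : x ∈ T := T.min'_mem hne
  have hyT : y ∈ T := T.max'_mem hne
  have ix := hT x hxT
  have iy := hT y hyT
  have hlt : lo < hi := ix.lt_left.trans ix.lt_right
  have sx := hs.of_between (d := true) ix.lt_left ix.lt_right
  have sy := hs.of_between (d := true) iy.lt_left iy.lt_right
  have hxy : x ≤ y := T.min'_le y hyT
  rcases le_total (κ x) (κ y) with hκ | hκ
  · obtain ⟨h1, h2⟩ := H.candLo_le hs ix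
    refine le_trans ?_ ((length_le_inner hs.1 hlt).1 h2)
    have h3 := H.inner_candLo hs h2
    set a := candLo n t κ ok lo hi
    have sa := hs.of_between (d := true) h3.lt_left h3.lt_right
    rw [← Finset.card_erase_add_one hxT]
    apply Nat.add_le_add_right
    have := h3.lt_left
    have := h3.lt_right
    refine ih (hi - a) (by omega) (sa.symm.trans hs) (T.erase x) (fun j hj => ?_)
      (fun i hi j hj => hsep i (Finset.mem_of_mem_erase hi) j (Finset.mem_of_mem_erase hj)) rfl
    have hjT := Finset.mem_of_mem_erase hj
    have ij := hT j hjT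
    have hxj : x < j := lt_of_le_of_ne (T.min'_le j hjT) (Finset.ne_of_mem_erase hj).symm
    have hjy : j ≤ y := T.le_max' j hjT
    have sj := hs.of_between (d := true) ij.lt_left ij.lt_right
    have hκj : κ x ≤ κ j := by
      rcases hjy.eq_or_lt with h4 | h4
      · rw [h4]; exact hκ
      · exact H.le_of_le (d := true) hxj h4 (sx.symm.trans sy) le_rfl hκ
    have hax : κ a ≤ κ x := by
      rcases h1.eq_or_lt with h4 | h4
      · rw [h4]
      · exact (H.lt_of_le_right (d := true) h4 hxj (sa.symm.trans sj) hκj).le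
    refine ⟨by omega, ij.lt_right, hax.trans hκj, ij.le_right, ?_, ij.ok_right⟩
    rcases h1.eq_or_lt with h4 | h4
    · rw [h4]; exact hsep x hxT j hjT hxj.ne
    · exact H.mono (d := true) h4 hxj (sa.symm.trans sj) hax hκj (Or.inr (hsep x hxT j hjT hxj.ne))
  · obtain ⟨h1, h2⟩ := H.lt_candHi hs iy
    refine le_trans ?_ ((length_le_inner hs.1 hlt).2 h2)
    have h3 := H.inner_candHi hs h2
    set b := candHi n t κ ok lo hi - 1
    have hyb : y ≤ b := by have := h3.lt_left; omega
    have sb := hs.of_between (d := true) h3.lt_left h3.lt_right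
    rw [← Finset.card_erase_add_one hyT]
    apply Nat.add_le_add_right
    have := h3.lt_left
    have := h3.lt_right
    refine ih (b - lo) (by omega) sb (T.erase y) (fun j hj => ?_)
      (fun i hi j hj => hsep i (Finset.mem_of_mem_erase hi) j (Finset.mem_of_mem_erase hj)) rfl
    have hjT := Finset.mem_of_mem_erase hj
    have ij := hT j hjT
    have hjy : j < y := lt_of_le_of_ne (T.le_max' j hjT) (Finset.ne_of_mem_erase hj)
    have hxj : x ≤ j := T.min'_le j hjT
    have sj := hs.of_between (d := true) ij.lt_left ij.lt_right
    have hκj : κ y ≤ κ j := by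
      rcases hxj.eq_or_lt with h4 | h4
      · rw [← h4]; exact hκ
      · exact H.le_of_le (d := true) h4 hjy (sx.symm.trans sy) hκ le_rfl
    have hby : κ b ≤ κ y := by
      rcases hyb.eq_or_lt with h4 | h4
      · rw [h4]
      · exact (H.lt_of_le_right (d := false) h4 hjy (sb.symm.trans sj) hκj).le
    refine ⟨ij.lt_left, by omega, ij.le_left, hby.trans hκj, ij.ok_left, ?_⟩
    rcases hyb.eq_or_lt with h4 | h4
    · rw [← h4]; exact hsep j hjT y hyT hjy.ne
    · exact H.symm _ _ (H.mono (d := false) h4 hjy (sb.symm.trans sj) hby hκj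
        (Or.inr (hsep y hyT j hjT hjy.ne')))

end Split

namespace Split

open Scan Finset

variable {n t K : ℕ} {κ : ℕ → ℝ} {ok : ℕ → ℕ → Prop}

/-! ### Chains that move away from the axis -/

open Classical in
/-- The nearest vertex after `c` in the direction `d` that is far from `c`, provided that it lies on
the side of `c` and is no nearer to the axis. -/
noncomputable def advance (n t : ℕ) (κ : ℕ → ℝ) (ok : ℕ → ℕ → Prop) : Bool → ℕ → Option ℕ
  | true, c =>
    let v := next (ok c) n (c + 1)
    if v < sideEnd n t c ∧ κ c ≤ κ v then some v else none
  | false, c =>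
    let e := prev (ok c) c
    if sideStart t c < e ∧ κ c ≤ κ (e - 1) then some (e - 1) else none

/-- The first `K` members of the greedy family between `c` and `u`, where `u` comes after `c` in the
direction `d`. -/
noncomputable def innerDir (n t : ℕ) (κ : ℕ → ℝ) (ok : ℕ → ℕ → Prop) (K : ℕ) (d : Bool) (c u : ℕ) :
    List ℕ :=
  (cond d (inner n t κ ok c u) (inner n t κ ok u c)).take K

/-- A chain of `m` steps from `c` in the direction `d`, then the vertex that `rule` gives for the
end of the chain, then the greedy family between these two. -/
noncomputable def family (n t : ℕ) (κ : ℕ → ℝ) (ok : ℕ → ℕ → Prop) (K : ℕ) (d : Bool)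
    (rule : ℕ → Option ℕ) : ℕ → ℕ → Option (List ℕ)
  | 0, c => (rule c).map fun u => c :: u :: innerDir n t κ ok K d c u
  | m + 1, c => (advance n t κ ok d c).bind fun c' => (family n t κ ok K d rule m c').map (c :: ·)

/-- The family with `m` members in its chain (and just the first of them for `m = 0`). -/
noncomputable def sideFamily (n t : ℕ) (κ : ℕ → ℝ) (ok : ℕ → ℕ → Prop) (K : ℕ) (d : Bool)
    (rule : ℕ → Option ℕ) (start : Option ℕ) : ℕ → List ℕ
  | 0 => (start.map fun c => [c]).getD []
  | m + 1 => (start.bind fun c => family n t κ ok K d rule m c).getD []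

open Classical in
/-- On the left side the chain ends at the prescribed gate `g`. -/
noncomputable def leftRule (κ : ℕ → ℝ) (ok : ℕ → ℕ → Prop) (d : Bool) (g c : ℕ) : Option ℕ :=
  if (cond d (c < g) (g < c)) ∧ κ c ≤ κ g ∧ ok c g then some g else none

/-- On the right side the chain ends at the farthest vertex that is far from both left gates and
from the end of the chain, and no nearer to the axis than the latter. -/
noncomputable def rightRule (n t : ℕ) (κ : ℕ → ℝ) (ok : ℕ → ℕ → Prop) :
    Bool → ℕ → ℕ → ℕ → Option ℕ
  | true, lo, hi, c =>
    let e := prev (ok c) (prev (ok hi) (prev (ok lo) (lastFar n t κ c)))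
    if c + 1 < e then some (e - 1) else none
  | false, lo, hi, c =>
    let u := next (ok c) n (next (ok lo) n (next (ok hi) n (firstFar n t κ c)))
    if u < c then some u else none

/-- The first vertex of the right side, in the direction `d`, far from both left gates. -/
noncomputable def rightStart (n t : ℕ) (ok : ℕ → ℕ → Prop) : Bool → ℕ → ℕ → Option ℕ
  | true, lo, hi =>
    let v := next (ok lo) n (next (ok hi) n 0)
    if v < t then some v else none
  | false, lo, hi =>
    let e := prev (ok hi) (prev (ok lo) t)
    if 0 < e then some (e - 1) else none

/-- The candidate family with left gates `lo` and `hi`. -/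
noncomputable def candidate (n t : ℕ) (κ : ℕ → ℝ) (ok : ℕ → ℕ → Prop) (K : ℕ) (d d' : Bool)
    (lo hi m m' : ℕ) : List ℕ :=
  sideFamily n t κ ok K d (leftRule κ ok d (cond d hi lo)) (some (cond d lo hi)) m ++
    sideFamily n t κ ok K d' (rightRule n t κ ok d' lo hi) (rightStart n t ok d' lo hi) m'

variable (H : Split n t κ ok)
include H

lemma advance_sound {d : Bool} {c v : ℕ} (hc : c < n) (h : advance n t κ ok d c = some v) :
    Before d c v ∧ Same n t c v ∧ κ c ≤ κ v ∧ ok c v := by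
  have ht := H.lt
  cases d
  · simp only [advance, Option.ite_none_right_eq_some, Option.some.injEq] at h
    obtain ⟨⟨h1, h2⟩, rfl⟩ := h
    have h3 : prev (ok c) c ≤ c := prev_le
    refine ⟨show _ < _ by omega, ⟨hc, by omega, ?_⟩, h2, prev_spec (by omega)⟩
    unfold sideStart at h1; split_ifs at h1 <;> omega
  · simp only [advance, Option.ite_none_right_eq_some, Option.some.injEq] at h
    obtain ⟨⟨h1, h2⟩, rfl⟩ := h
    have h3 : sideEnd n t c ≤ n := by unfold sideEnd; split_ifs <;> omega
    have h4 := next_spec (h1.trans_le h3)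
    refine ⟨show _ < _ by omega, ⟨hc, by omega, ?_⟩, h2, h4.2⟩
    unfold sideEnd at h1; split_ifs at h1 <;> omega

lemma advance_complete {d : Bool} {c x : ℕ} (h1 : Before d c x) (h2 : Same n t c x)
    (h3 : κ c ≤ κ x) (h4 : ok c x) :
    ∃ v, advance n t κ ok d c = some v ∧ (v = x ∨ Before d v x) := by
  have ht := H.lt
  obtain ⟨hc, hx, hcx⟩ := h2
  cases d
  · have hx' : x < prev (ok c) c := lt_prev_of h1 h4
    have hle : prev (ok c) c ≤ c := prev_le
    refine ⟨prev (ok c) c - 1, ?_, ?_⟩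
    · simp only [advance]
      rw [if_pos]
      refine ⟨?_, ?_⟩
      · unfold sideStart; split_ifs <;> omega
      · rcases (show x ≤ prev (ok c) c - 1 by omega).eq_or_lt with h | h
        · rw [← h]; exact h3
        · exact H.le_of_le (d := false) (show prev (ok c) c - 1 < c by omega) h
            ⟨hc, hx, hcx⟩ le_rfl h3
    · simp only [Before, cond]; omega
  · have hx' : next (ok c) n (c + 1) ≤ x := next_le_of h1 hx h4
    have hle : c + 1 ≤ next (ok c) n (c + 1) := le_next (by omega)
    refine ⟨next (ok c) n (c + 1), ?_, ?_⟩
    · simp only [advance]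
      rw [if_pos]
      refine ⟨?_, ?_⟩
      · unfold sideEnd; split_ifs <;> omega
      · rcases hx'.eq_or_lt with h | h
        · rw [h]; exact h3
        · exact H.le_of_le (d := true) (show c < _ from hle) h ⟨hc, hx, hcx⟩ le_rfl h3
    · simp only [Before, cond]; omega

omit H in
/-- `rule` gives for each vertex `c` a far vertex after it that is no nearer to the axis and has
the property `p`. -/
def RuleSound (n t : ℕ) (κ : ℕ → ℝ) (ok : ℕ → ℕ → Prop) (d : Bool) (p : ℕ → Prop)
    (rule : ℕ → Option ℕ) (r : ℕ → Prop) : Prop :=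
  ∀ c u, c < n → r c → rule c = some u →
    Before d c u ∧ Same n t c u ∧ κ c ≤ κ u ∧ ok c u ∧ p u

omit H in
/-- `rule` finds for each vertex `c` a vertex at least as far along as every one that it might
choose. -/
def RuleComplete (n t : ℕ) (κ : ℕ → ℝ) (ok : ℕ → ℕ → Prop) (d : Bool) (p : ℕ → Prop)
    (rule : ℕ → Option ℕ) (r : ℕ → Prop) : Prop :=
  ∀ c y, r c → Before d c y → Same n t c y → κ c ≤ κ y → ok c y → p y →
    ∃ u, rule c = some u ∧ (u = y ∨ Before d y u)

lemma innerDir_sound {d : Bool} {c u : ℕ} (hs : Same n t c u) :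
    (∀ j ∈ innerDir n t κ ok K d c u,
      Before d c j ∧ Before d j u ∧ κ c ≤ κ j ∧ ok c j ∧ ok j u) ∧
      (innerDir n t κ ok K d c u).Pairwise (fun a b => a ≠ b ∧ ok a b) := by
  cases d
  · obtain ⟨h1, h2⟩ := H.inner_sound hs.symm
    refine ⟨fun j hj => ?_, h2.sublist (List.take_sublist _ _)⟩
    have h := h1 j (List.mem_of_mem_take hj)
    exact ⟨h.lt_right, h.lt_left, h.le_right, H.symm _ _ h.ok_right, H.symm _ _ h.ok_left⟩
  · obtain ⟨h1, h2⟩ := H.inner_sound hs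
    refine ⟨fun j hj => ?_, h2.sublist (List.take_sublist _ _)⟩
    have h := h1 j (List.mem_of_mem_take hj)
    exact ⟨h.lt_left, h.lt_right, h.le_left, h.ok_left, h.ok_right⟩

lemma family_sound {d : Bool} {p r : ℕ → Prop} {rule : ℕ → Option ℕ}
    (hr : RuleSound n t κ ok d p rule r) (hrs : ∀ i j, Same n t i j → r i → r j) (m : ℕ) {c : ℕ}
    (hc : c < n) (hrc : r c) {l : List ℕ} (h : family n t κ ok K d rule m c = some l) :
    ∃ u l', l = c :: l' ∧ u ∈ l' ∧ p u ∧ Same n t c u ∧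
      (∀ j ∈ l', Before d c j ∧ κ c ≤ κ j ∧ ok c j ∧ (j = u ∨ Before d j u ∧ ok j u)) ∧
      l'.Pairwise (fun a b => a ≠ b ∧ ok a b) := by
  induction m generalizing c l with
  | zero =>
    simp only [family, Option.map_eq_some_iff] at h
    obtain ⟨u, hu, rfl⟩ := h
    obtain ⟨h1, h2, h3, h4, h5⟩ := hr c u hc hrc hu
    obtain ⟨h6, h7⟩ := H.innerDir_sound (d := d) h2
    refine ⟨u, _, rfl, by simp, h5, h2, ?_, List.pairwise_cons.2 ⟨?_, h7⟩⟩
    · intro j hj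
      rcases List.mem_cons.1 hj with rfl | hj
      · exact ⟨h1, h3, h4, Or.inl rfl⟩
      · obtain ⟨g1, g2, g3, g4, g5⟩ := h6 j hj
        exact ⟨g1, g3, g4, Or.inr ⟨g2, g5⟩⟩
    · intro j hj
      obtain ⟨g1, g2, g3, g4, g5⟩ := h6 j hj
      refine ⟨?_, H.symm _ _ g5⟩
      rintro rfl
      exact Before.irrefl g2
  | succ m ih =>
    simp only [family, Option.bind_eq_some_iff, Option.map_eq_some_iff] at h
    obtain ⟨c', h1, l₁, h2, rfl⟩ := h
    obtain ⟨g1, g2, g3, g4⟩ := H.advance_sound hc h1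
    obtain ⟨u, l', rfl, hu, hpu, hs, h5, h6⟩ := ih g2.2.1 (hrs _ _ g2 hrc) h2
    have hcu := h5 u hu
    refine ⟨u, _, rfl, by simp [hu], hpu, g2.trans hs, ?_, List.pairwise_cons.2 ⟨?_, h6⟩⟩
    · intro j hj
      rcases List.mem_cons.1 hj with rfl | hj
      · exact ⟨g1, g3, g4, Or.inr ⟨hcu.1, hcu.2.2.1⟩⟩
      · obtain ⟨k1, k2, k3, k4⟩ := h5 j hj
        refine ⟨g1.trans k1, g3.trans k2, H.mono g1 k1 ?_ g3 k2 (Or.inl g4), k4⟩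
        rcases k4 with rfl | k4
        · exact g2.trans hs
        · exact (g2.trans hs).of_between (g1.trans k1) k4.1
    · intro j hj
      obtain ⟨k1, k2, k3, k4⟩ := h5 j hj
      refine ⟨?_, k3⟩
      rintro rfl
      exact Before.irrefl k1

omit H in
lemma exists_first (d : Bool) {T : Finset ℕ} (hT : T.Nonempty) :
    ∃ x ∈ T, ∀ j ∈ T, j = x ∨ Before d x j := by
  cases d
  · refine ⟨T.max' hT, T.max'_mem hT, fun j hj => ?_⟩
    have := T.le_max' j hj
    simp only [Before, cond]; omega
  · refine ⟨T.min' hT, T.min'_mem hT, fun j hj => ?_⟩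
    have := T.min'_le j hj
    simp only [Before, cond]; omega

omit H in
lemma before_not {d : Bool} {i j : ℕ} : Before (!d) i j ↔ Before d j i := by
  cases d <;> rfl

lemma card_le_innerDir {d : Bool} {c u : ℕ} (hs : Same n t c u) (T : Finset ℕ)
    (hT : ∀ j ∈ T, Before d c j ∧ Before d j u ∧ κ c ≤ κ j ∧ κ u ≤ κ j ∧ ok c j ∧ ok j u)
    (hsep : Separated ok T) (hK : T.card ≤ K) : T.card ≤ (innerDir n t κ ok K d c u).length := by
  rw [innerDir, List.length_take]
  refine le_min hK ?_
  cases d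
  · refine H.card_le_inner hs.symm T (fun j hj => ?_) hsep
    obtain ⟨h1, h2, h3, h4, h5, h6⟩ := hT j hj
    exact ⟨h2, h1, h4, h3, H.symm _ _ h6, H.symm _ _ h5⟩
  · refine H.card_le_inner hs T (fun j hj => ?_) hsep
    obtain ⟨h1, h2, h3, h4, h5, h6⟩ := hT j hj
    exact ⟨h1, h2, h3, h4, h5, h6⟩

/-- All members but the first one `x` of a separated family are far from each vertex `v` that is `x`
or precedes it. -/
lemma of_mem_erase {d : Bool} {T : Finset ℕ} {v x y : ℕ} (hvx : v = x ∨ Before d v x)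
    (hvs : ∀ j ∈ T, Same n t v j) (hsep : Separated ok T) (hxT : x ∈ T)
    (hx : ∀ j ∈ T, j = x ∨ Before d x j) (hyT : y ∈ T) (hy : ∀ j ∈ T, j = y ∨ Before d j y)
    (hκ : κ x ≤ κ y) : ∀ j ∈ T.erase x, Before d v j ∧ Same n t v j ∧ κ v ≤ κ j ∧ ok v j := by
  intro j hj
  have hjT := mem_of_mem_erase hj
  have hne := ne_of_mem_erase hj
  have hxj := (hx j hjT).resolve_left hne
  have svj := hvs j hjT
  have hκj : κ x ≤ κ j := by
    rcases hy j hjT with rfl | h4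
    · exact hκ
    · exact H.le_of_le hxj h4 ((hvs x hxT).symm.trans (hvs y hyT)) le_rfl hκ
  rcases hvx with rfl | hvx
  · exact ⟨hxj, svj, hκj, hsep v hxT j hjT hne.symm⟩
  · have hvκ := H.lt_of_le_right hvx hxj svj hκj
    exact ⟨hvx.trans hxj, svj, hvκ.le.trans hκj, H.mono hvx hxj svj hvκ.le hκj
      (Or.inr (hsep x hxT j hjT hne.symm))⟩

/-- Greedy chains are optimal: a separated family `T` after `c` whose last member could be given
by the rule is matched by some chain. -/
lemma family_complete {d : Bool} {p : ℕ → Prop} {rule : ℕ → Option ℕ} {q : ℕ → Prop}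
    (hqs : ∀ i j, Same n t i j → q i → q j)
    (hr : RuleSound n t κ ok d p rule q)
    (hrc : RuleComplete n t κ ok d p rule q) {c y : ℕ} (hq : q c) (T : Finset ℕ)
    (hT : ∀ j ∈ T, Before d c j ∧ Same n t c j ∧ κ c ≤ κ j ∧ ok c j)
    (hsep : Separated ok T) (hyT : y ∈ T) (hy : ∀ j ∈ T, j = y ∨ Before d j y) (hp : p y)
    (hK : T.card ≤ K) : ∃ m < T.card, ∃ l, family n t κ ok K d rule m c = some l ∧
      T.card + 1 ≤ l.length := by
  induction h : T.card using Nat.strong_induction_on generalizing c T with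
  | _ N ih =>
  obtain ⟨x, hxT, hx⟩ := exists_first d ⟨y, hyT⟩
  obtain ⟨x1, x2, x3, x4⟩ := hT x hxT
  have hNpos : 0 < T.card := card_pos.2 ⟨y, hyT⟩
  by_cases hcase : x ≠ y ∧ κ x ≤ κ y
  · obtain ⟨hxy, hκ⟩ := hcase
    have hbxy : Before d x y := (hy x hxT).resolve_left hxy
    obtain ⟨v, hv, hvx⟩ := H.advance_complete x1 x2 x3 x4
    obtain ⟨v1, v2, v3, v4⟩ := H.advance_sound x2.1 hv
    have hT' := H.of_mem_erase hvx (fun j hj => v2.symm.trans (hT j hj).2.1) hsep hxT hx hyT hy hκ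
    have hcard := card_erase_add_one hxT
    obtain ⟨m, hm, l, hl, hlen⟩ := ih (T.erase x).card (by omega) (hqs _ _ v2 hq) (T.erase x) hT'
      (fun i hi j hj => hsep i (mem_of_mem_erase hi) j (mem_of_mem_erase hj))
      (mem_erase.2 ⟨hxy.symm, hyT⟩) (fun j hj => hy j (mem_of_mem_erase hj))
      (by omega) rfl
    refine ⟨m + 1, by omega, c :: l, by simp [family, hv, hl], ?_⟩
    simp only [List.length_cons]; omega
  · obtain ⟨y1, y2, y3, y4⟩ := hT y hyT
    obtain ⟨u, hu, huy⟩ := hrc c y hq y1 y2 y3 y4 hp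
    obtain ⟨u1, u2, u3, u4, u5⟩ := hr c u x2.1 hq hu
    refine ⟨0, by omega, _, by simp only [family, hu, Option.map_some]; rfl, ?_⟩
    have h3 : (T.erase y).card ≤ (innerDir n t κ ok K d c u).length := by
      refine H.card_le_innerDir u2 _ (fun j hj => ?_)
        (fun i hi j hj => hsep i (mem_of_mem_erase hi) j (mem_of_mem_erase hj))
        ((card_le_card (erase_subset _ _)).trans hK)
      have hjT := mem_of_mem_erase hj
      have hne := ne_of_mem_erase hj
      have hjy := (hy j hjT).resolve_left hne
      obtain ⟨j1, j2, j3, j4⟩ := hT j hjT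
      have hκy : κ y ≤ κ j := by
        have hxy : x ≠ y := by
          rintro rfl
          rcases hx j hjT with h5 | h5
          · exact hne h5
          · exact Before.irrefl (h5.trans hjy)
        have h6 : κ y ≤ κ x := by
          by_contra! h7
          exact hcase ⟨hxy, h7.le⟩
        rcases hx j hjT with rfl | h5
        · exact h6
        · exact H.le_of_le h5 hjy (x2.symm.trans y2) h6 le_rfl
      rcases huy with rfl | huy
      · exact ⟨j1, hjy, j3, hκy, j4, hsep j hjT u hyT hne⟩
      · have sju := j2.symm.trans u2
        have huκ : κ u < κ y := H.lt_of_le_left hjy huy sju hκy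
        refine ⟨j1, hjy.trans huy, j3, huκ.le.trans hκy, j4, H.symm _ _ ?_⟩
        exact H.mono (d := !d) (before_not.2 huy) (before_not.2 hjy) sju.symm huκ.le hκy
          (Or.inr (hsep y hyT j hjT hne.symm))
    have := card_erase_add_one hyT
    simp only [List.length_cons]; omega

/-! ### The rules for the two sides -/

lemma prev_prev {lo hi s : ℕ} (hlo : t ≤ lo) (hle : lo ≤ hi) (hn : hi < n) (hs : s ≤ t)
    (h : 0 < prev (ok hi) (prev (ok lo) s)) :
    ok lo (prev (ok hi) (prev (ok lo) s) - 1) ∧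
      ok hi (prev (ok hi) (prev (ok lo) s) - 1) := by
  set e₁ := prev (ok lo) s with h1
  set e₂ := prev (ok hi) e₁ with h2
  have l1 : e₁ ≤ s := prev_le
  have l2 : e₂ ≤ e₁ := prev_le
  have p2 : ok hi (e₂ - 1) := prev_spec (h2 ▸ h)
  have p1 : ok lo (e₁ - 1) := prev_spec (h1 ▸ (by omega : 0 < e₁))
  refine ⟨?_, p2⟩
  rcases l2.eq_or_lt with h3 | h3
  · rw [h3]; exact p1
  have hn1 : ¬ ok hi (e₁ - 1) := not_of_prev_le (e := e₁) (by omega) (by omega)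
  have hne : lo ≠ hi := by rintro rfl; exact hn1 p1
  rcases H.cross (e₂ - 1) (e₁ - 1) lo hi (by omega) (by omega) (by omega) hn
    (Or.inr ⟨H.symm _ _ p1, H.symm _ _ p2⟩) with h4 | h4
  · exact H.symm _ _ h4
  · exact absurd (H.symm _ _ h4) hn1

lemma next_next {lo hi s : ℕ} (hlo : t ≤ lo) (hle : lo ≤ hi) (hn : hi < n)
    (h : next (ok lo) n (next (ok hi) n s) < t) :
    ok lo (next (ok lo) n (next (ok hi) n s)) ∧
      ok hi (next (ok lo) n (next (ok hi) n s)) := by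
  have ht := H.lt
  set u₁ := next (ok hi) n s with h1
  set u₂ := next (ok lo) n u₁ with h2
  have l2 : u₁ ≤ u₂ := le_next next_le
  have p2 : ok lo u₂ := (next_spec (h2 ▸ (by omega : u₂ < n))).2
  have p1 : ok hi u₁ := (next_spec (h1 ▸ (by omega : u₁ < n))).2
  refine ⟨p2, ?_⟩
  rcases l2.eq_or_lt with h3 | h3
  · rw [← h3]; exact p1
  have hn1 : ¬ ok lo u₁ := not_of_lt_next le_rfl h3
  have hne : lo ≠ hi := by rintro rfl; exact hn1 p1
  rcases H.cross u₁ u₂ lo hi h3 (by omega) (by omega) hn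
    (Or.inr ⟨H.symm _ _ p2, H.symm _ _ p1⟩) with h4 | h4
  · exact absurd (H.symm _ _ h4) hn1
  · exact H.symm _ _ h4

lemma rightStart_sound {d : Bool} {lo hi v : ℕ} (hlo : t ≤ lo) (hle : lo ≤ hi) (hn : hi < n)
    (h : rightStart n t ok d lo hi = some v) : v < t ∧ ok lo v ∧ ok hi v := by
  cases d
  · simp only [rightStart, Option.ite_none_right_eq_some, Option.some.injEq] at h
    obtain ⟨h1, rfl⟩ := h
    refine ⟨?_, H.prev_prev hlo hle hn le_rfl h1⟩
    have l1 : prev (ok lo) t ≤ t := prev_le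
    have l2 : prev (ok hi) (prev (ok lo) t) ≤ prev (ok lo) t := prev_le
    omega
  · simp only [rightStart, Option.ite_none_right_eq_some, Option.some.injEq] at h
    obtain ⟨h1, rfl⟩ := h
    exact ⟨h1, H.next_next hlo hle hn h1⟩

lemma rightStart_complete (d : Bool) {lo hi x : ℕ} (hx : x < t) (h1 : ok lo x) (h2 : ok hi x) :
    ∃ v, rightStart n t ok d lo hi = some v ∧ (v = x ∨ Before d v x) := by
  have ht := H.lt
  cases d
  · have : x < prev (ok hi) (prev (ok lo) t) :=
      lt_prev_of (lt_prev_of hx h1) h2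
    exact ⟨_, by simp only [rightStart]; rw [if_pos (by omega)],
      by simp only [Before, cond]; omega⟩
  · have : next (ok lo) n (next (ok hi) n 0) ≤ x :=
      next_le_of (next_le_of (Nat.zero_le _) (by omega) h2) (by omega) h1
    exact ⟨_, by simp only [rightStart]; rw [if_pos (by omega)],
      by simp only [Before, cond]; omega⟩

lemma rightRule_sound {d : Bool} {lo hi : ℕ} (hlo : t ≤ lo) (hle : lo ≤ hi) (hn : hi < n) :
    RuleSound n t κ ok d (fun u => ok lo u ∧ ok hi u) (rightRule n t κ ok d lo hi)
      (fun c => c < t) := by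
  have ht := H.lt
  intro c u hc hct h
  cases d
  · simp only [rightRule, Option.ite_none_right_eq_some, Option.some.injEq] at h
    set s := firstFar n t κ c with hs
    set u₂ := next (ok lo) n (next (ok hi) n s) with hu₂
    obtain ⟨h1, hu⟩ := h
    rw [hu] at h1
    have l1 : u₂ ≤ u := hu ▸ le_next next_le
    have l2 : next (ok hi) n s ≤ u₂ := le_next next_le
    have l3 : s ≤ next (ok hi) n s := (next_spec (by omega)).1
    obtain ⟨p1, p2⟩ := H.next_next hlo hle hn (hu₂ ▸ (by omega : u₂ < t))
    rw [← hu₂] at p1 p2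
    have p3 : ok c u := hu ▸ (next_spec (hu.symm ▸ (by omega : u < n))).2
    refine ⟨h1, ⟨by omega, by omega, by omega⟩, H.le_of_firstFar_le (by omega) h1.le hc, p3, ?_⟩
    rcases l1.eq_or_lt with h3 | h3
    · rw [← h3]; exact ⟨p1, p2⟩
    have hn1 : ¬ ok c u₂ := not_of_lt_next le_rfl (hu.symm ▸ h3)
    have key : ∀ g, t ≤ g → g < n → ok g u₂ → ok g u := fun g g1 g2 g3 => by
      rcases H.cross u₂ u c g h3 h1 (by omega) g2 (Or.inr ⟨H.symm _ _ p3, H.symm _ _ g3⟩) with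
        h4 | h4
      · exact absurd (H.symm _ _ h4) hn1
      · exact H.symm _ _ h4
    exact ⟨key lo hlo (by omega) p1, key hi (by omega) hn p2⟩
  · simp only [rightRule, Option.ite_none_right_eq_some, Option.some.injEq] at h
    set s := lastFar n t κ c with hs
    set e₂ := prev (ok hi) (prev (ok lo) s) with he₂
    set e := prev (ok c) e₂ with he
    obtain ⟨h1, hu⟩ := h
    have l1 : e ≤ e₂ := prev_le
    have l2 : e₂ ≤ prev (ok lo) s := prev_le
    have l3 : prev (ok lo) s ≤ s := prev_le
    have l4 : s ≤ t := by
      have : s ≤ sideEnd n t c := prev_le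
      rwa [sideEnd, if_pos hct] at this
    obtain ⟨p1, p2⟩ := H.prev_prev hlo hle hn l4 (he₂ ▸ (by omega : 0 < e₂))
    rw [← he₂] at p1 p2
    have p3 : ok c u := hu ▸ prev_spec (he ▸ (by omega : 0 < e))
    refine ⟨show c < u by omega, ⟨by omega, by omega, by omega⟩,
      H.le_of_lt_lastFar (by omega) (by omega) hc, p3, ?_⟩
    rcases l1.eq_or_lt with h3 | h3
    · rw [← hu, h3]; exact ⟨p1, p2⟩
    have hn1 : ¬ ok c (e₂ - 1) := not_of_prev_le (e := e₂) (by omega) (by omega)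
    have key : ∀ g, t ≤ g → g < n → ok g (e₂ - 1) → ok g u := fun g g1 g2 g3 => by
      rcases H.cross c u (e₂ - 1) g (by omega) (by omega) (by omega) g2
        (Or.inl ⟨p3, H.symm _ _ g3⟩) with h4 | h4
      · exact absurd h4 hn1
      · exact H.symm _ _ h4
    exact ⟨key lo hlo (by omega) p1, key hi (by omega) hn p2⟩

lemma rightRule_complete {d : Bool} {lo hi : ℕ} (c y : ℕ) (_ : c < t)
    (h1 : Before d c y) (h2 : Same n t c y) (h3 : κ c ≤ κ y) (h4 : ok c y)
    (h5 : ok lo y ∧ ok hi y) :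
    ∃ u, rightRule n t κ ok d lo hi c = some u ∧ (u = y ∨ Before d y u) := by
  have ht := H.lt
  cases d
  · have : next (ok c) n (next (ok lo) n (next (ok hi) n (firstFar n t κ c))) ≤ y :=
      next_le_of (next_le_of (next_le_of (firstFar_le h2 h3) h2.2.1 h5.2)
        h2.2.1 h5.1) h2.2.1 h4
    have h6 : y < c := h1
    exact ⟨_, by simp only [rightRule]; rw [if_pos (by omega)],
      by simp only [Before, cond]; omega⟩
  · have : y < prev (ok c) (prev (ok hi) (prev (ok lo) (lastFar n t κ c))) :=
      lt_prev_of (lt_prev_of (lt_prev_of (lt_lastFar h2 h3) h5.1) h5.2) h4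
    have h6 : c < y := h1
    exact ⟨_, by simp only [rightRule]; rw [if_pos (by omega)],
      by simp only [Before, cond]; omega⟩

omit H in
lemma leftRule_sound {d : Bool} {g : ℕ} (hg : t ≤ g) (hn : g < n) :
    RuleSound n t κ ok d (fun u => u = g) (leftRule κ ok d g) (fun c => t ≤ c) := by
  intro c u hc hct h
  simp only [leftRule, Option.ite_none_right_eq_some, Option.some.injEq] at h
  obtain ⟨⟨h1, h2, h3⟩, rfl⟩ := h
  exact ⟨h1, ⟨hc, hn, by omega⟩, h2, h3, rfl⟩

omit H in
lemma leftRule_complete {d : Bool} {g : ℕ} (c y : ℕ) (h1 : Before d c y) (h3 : κ c ≤ κ y)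
    (h4 : ok c y) (h5 : y = g) : ∃ u, leftRule κ ok d g c = some u ∧ (u = y ∨ Before d y u) := by
  subst h5
  exact ⟨y, by rw [leftRule, if_pos ⟨h1, h3, h4⟩], Or.inl rfl⟩

/-! ### Soundness and completeness of the search -/

lemma sideFamily_sound {d : Bool} {p r : ℕ → Prop} {rule : ℕ → Option ℕ}
    (hr : RuleSound n t κ ok d p rule r) (hrs : ∀ i j, Same n t i j → r i → r j) (m : ℕ)
    {start : Option ℕ} (hst : ∀ c, start = some c → c < n ∧ r c) :
    (∀ j ∈ sideFamily n t κ ok K d rule start m, ∃ c, start = some c ∧ Same n t c j ∧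
      (j = c ∨ p j ∨ ∃ u, p u ∧ Same n t c u ∧ Before d c j ∧ Before d j u ∧ ok c j ∧ ok j u)) ∧
      (sideFamily n t κ ok K d rule start m).Pairwise (fun a b => a ≠ b ∧ ok a b) := by
  rcases start with _ | c
  · cases m <;> simp [sideFamily]
  obtain ⟨hc, hrc⟩ := hst c rfl
  rcases m with _ | m
  · simp [sideFamily, Same, hc]
  simp only [sideFamily, Option.bind_some]
  rcases hf : family n t κ ok K d rule m c with _ | l
  · simp
  obtain ⟨u, l', rfl, h1, h2, h3, h4, h5⟩ := H.family_sound hr hrs m hc hrc hf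
  simp only [Option.getD_some]
  refine ⟨fun j hj => ⟨c, rfl, ?_⟩, List.pairwise_cons.2 ⟨fun j hj => ?_, h5⟩⟩
  · rcases List.mem_cons.1 hj with rfl | hj
    · exact ⟨⟨hc, hc, Iff.rfl⟩, Or.inl rfl⟩
    · obtain ⟨k1, k2, k3, k4⟩ := h4 j hj
      rcases k4 with rfl | ⟨k4, k5⟩
      · exact ⟨h3, Or.inr (Or.inl h2)⟩
      · exact ⟨h3.of_between k1 k4, Or.inr (Or.inr ⟨u, h2, h3, k1, k4, k3, k5⟩)⟩
  · refine ⟨?_, (h4 j hj).2.2.1⟩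
    rintro rfl
    exact Before.irrefl (h4 _ hj).1

lemma opposite' {d : Bool} {i j l m : ℕ} (h1 : Before d i j) (h2 : Before d j l)
    (hs : Same n t i l) (hm : m < n) (h : m < t ↔ ¬ i < t) (h3 : ok i j) (h4 : ok j l)
    (h5 : ok i m) (h6 : ok l m) : ok j m := by
  cases d
  · exact H.opposite l j i m h2 h1 hs.1 hm hs.2.2.symm (by rw [h, hs.2.2]) (H.symm _ _ h4)
      (H.symm _ _ h3) h6 h5
  · exact H.opposite i j l m h1 h2 hs.2.1 hm hs.2.2 h h3 h4 h5 h6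

/-- Every candidate is separated. -/
lemma candidate_sound (d d' : Bool) {lo hi : ℕ} (m m' : ℕ) (hlo : t ≤ lo) (hle : lo ≤ hi)
    (hn : hi < n) :
    (∀ j ∈ candidate n t κ ok K d d' lo hi m m', j < n) ∧
    (candidate n t κ ok K d d' lo hi m m').Pairwise (fun a b => a ≠ b ∧ ok a b) := by
  have ht := H.lt
  unfold candidate
  obtain ⟨l1, l2⟩ := H.sideFamily_sound (leftRule_sound (d := d) (g := cond d hi lo) (κ := κ)
    (ok := ok) (n := n) (t := t) (by cases d <;> simp <;> omega) (by cases d <;> simp <;> omega))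
    (fun i j hs h => by have := hs.2.2; omega) m
    (start := some (cond d lo hi)) (by cases d <;> simp <;> omega)
  obtain ⟨r1, r2⟩ := H.sideFamily_sound (H.rightRule_sound (d := d') hlo hle hn)
    (fun i j hs h => hs.2.2.1 h) m' (start := rightStart n t ok d' lo hi)
    (fun c hc => ⟨(H.rightStart_sound hlo hle hn hc).1.trans ht,
      (H.rightStart_sound hlo hle hn hc).1⟩)
  have hright : ∀ j ∈ sideFamily n t κ ok K d' (rightRule n t κ ok d' lo hi)
      (rightStart n t ok d' lo hi) m', j < t ∧ ok lo j ∧ ok hi j := by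
    intro j hj
    obtain ⟨c, hc, hs, h1⟩ := r1 j hj
    obtain ⟨h2, h3, h4⟩ := H.rightStart_sound hlo hle hn hc
    refine ⟨hs.2.2.1 h2, ?_⟩
    rcases h1 with rfl | h1 | ⟨u, hu, su, b1, b2, o1, o2⟩
    · exact ⟨h3, h4⟩
    · exact h1
    · constructor
      · exact H.symm _ _ (H.opposite' b1 b2 su (by omega) (by omega) o1 o2 (H.symm _ _ h3)
          (H.symm _ _ hu.1))
      · exact H.symm _ _ (H.opposite' b1 b2 su (by omega) (by omega) o1 o2 (H.symm _ _ h4)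
          (H.symm _ _ hu.2))
  have hleft : ∀ j ∈ sideFamily n t κ ok K d (leftRule κ ok d (cond d hi lo))
      (some (cond d lo hi)) m, t ≤ j ∧ j < n ∧ ∀ i, i < t → ok lo i → ok hi i → ok j i := by
    intro j hj
    obtain ⟨c, hc, hs, h1⟩ := l1 j hj
    have hct : t ≤ c := by
      cases d <;> simp at hc <;> omega
    have := hs.2.2
    refine ⟨by omega, hs.2.1, fun i hit h2 h3 => ?_⟩
    have hcases : ∀ g, g = lo ∨ g = hi → ok g i := by
      rintro g (rfl | rfl) <;> assumption
    have hc' : c = lo ∨ c = hi := by cases d <;> simp at hc <;> omega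
    have hg : ∀ u, u = cond d hi lo → u = lo ∨ u = hi := by
      rintro u rfl; cases d <;> simp
    rcases h1 with rfl | h1 | ⟨u, hu, su, b1, b2, o1, o2⟩
    · exact hcases _ hc'
    · exact hcases _ (hg _ h1)
    · exact H.opposite' b1 b2 su (by omega) (by omega) o1 o2 (hcases _ hc') (hcases _ (hg _ hu))
  refine ⟨fun j hj => ?_, List.pairwise_append.2 ⟨l2, r2, fun a ha b hb => ?_⟩⟩
  · rcases List.mem_append.1 hj with hj | hj
    · exact (hleft j hj).2.1
    · exact (hright j hj).1.trans ht
  · obtain ⟨a1, a2, a3⟩ := hleft a ha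
    obtain ⟨b1, b2, b3⟩ := hright b hb
    exact ⟨by omega, a3 b b1 b2 b3⟩

lemma sideFamily_complete {d : Bool} {p q : ℕ → Prop} {rule : ℕ → Option ℕ}
    (hqs : ∀ i j, Same n t i j → q i → q j) (hr : RuleSound n t κ ok d p rule q)
    (hrc : RuleComplete n t κ ok d p rule q) {T : Finset ℕ} {v x y : ℕ} (hv : q v)
    (hvx : v = x ∨ Before d v x) (hvs : Same n t v x) (hxT : x ∈ T)
    (hT : ∀ j ∈ T, Same n t x j) (hsep : Separated ok T)
    (hx : ∀ j ∈ T, j = x ∨ Before d x j) (hyT : y ∈ T)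
    (hy : ∀ j ∈ T, j = y ∨ Before d j y) (hκ : κ x ≤ κ y) (hp : p y) (hK : T.card ≤ K) :
    ∃ m < T.card, T.card ≤ (sideFamily n t κ ok K d rule (some v) m).length := by
  have hcard := card_erase_add_one hxT
  by_cases hxy : y = x
  · have : T = {x} := by
      ext j; rw [mem_singleton]
      refine ⟨fun hj => ?_, fun h => h ▸ hxT⟩
      rcases hx j hj with h | h
      · exact h
      · rcases hy j hj with h' | h'
        · rw [h', hxy]
        · rw [hxy] at h'; exact absurd (h.trans h') Before.irrefl
    refine ⟨0, by omega, ?_⟩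
    rw [this]; simp [sideFamily]
  · obtain ⟨m, hm, l, hl, hlen⟩ := H.family_complete (K := K) hqs hr hrc hv (T.erase x)
      (H.of_mem_erase hvx (fun j hj => hvs.trans (hT j hj)) hsep hxT hx hyT hy hκ)
      (fun i hi j hj => hsep i (mem_of_mem_erase hi) j (mem_of_mem_erase hj))
      (mem_erase.2 ⟨hxy, hyT⟩) (fun j hj => hy j (mem_of_mem_erase hj)) hp
      (by omega)
    exact ⟨m + 1, by omega, by
      simp only [sideFamily, Option.bind_some, hl, Option.getD_some]; omega⟩

omit H in
lemma exists_direction {T : Finset ℕ} (hT : T.Nonempty) : ∃ (d : Bool) (x y : ℕ), x ∈ T ∧ y ∈ T ∧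
    (∀ j ∈ T, j = x ∨ Before d x j) ∧ (∀ j ∈ T, j = y ∨ Before d j y) ∧ κ x ≤ κ y := by
  obtain ⟨x, hx, hx'⟩ := exists_first true hT
  obtain ⟨y, hy, hy'⟩ := exists_first false hT
  rcases le_total (κ x) (κ y) with h | h
  · exact ⟨true, x, y, hx, hy, hx', hy', h⟩
  · exact ⟨false, y, x, hy, hx, hy', hx', h⟩

lemma exists_candidate_of_left {T : Finset ℕ} (hn : ∀ j ∈ T, j < n) (hsep : Separated ok T)
    {z : ℕ} (hz : z ∈ T) (hzt : t ≤ z) (hK : T.card ≤ K) :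
    ∃ lo hi d d' m m', t ≤ lo ∧ lo ≤ hi ∧ hi < n ∧ m < T.card ∧ m' < T.card ∧
      T.card ≤ (candidate n t κ ok K d d' lo hi m m').length := by
  have ht := H.lt
  set L := T.filter (fun j => t ≤ j) with hL
  set R := T.filter (fun j => ¬ t ≤ j) with hR
  have hcard : L.card + R.card = T.card := card_filter_add_card_filter_not _
  have hLT : ∀ j ∈ L, j ∈ T ∧ t ≤ j := fun j hj => mem_filter.1 hj
  have hRT : ∀ j ∈ R, j ∈ T ∧ j < t := fun j hj => by simpa [hR] using hj
  have hLne : L.Nonempty := ⟨z, mem_filter.2 ⟨hz, hzt⟩⟩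
  have hLpos := card_pos.2 hLne
  have hLsep : Separated ok L := fun i hi j hj => hsep i (hLT i hi).1 j (hLT j hj).1
  have hRsep : Separated ok R := fun i hi j hj => hsep i (hRT i hi).1 j (hRT j hj).1
  obtain ⟨d, x, y, hx, hy, hx', hy', hκ⟩ := exists_direction (κ := κ) hLne
  have hxt := (hLT x hx).2
  have hyt := (hLT y hy).2
  have hxn := hn x (hLT x hx).1
  have hyn := hn y (hLT y hy).1
  obtain ⟨m, hm, hlen⟩ := H.sideFamily_complete (K := K) (d := d) (p := fun u => u = y)
    (q := fun c => t ≤ c) (rule := leftRule κ ok d y) (v := x)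
    (fun i j hs h => by have := hs.2.2; omega) (leftRule_sound hyt hyn)
    (fun c y' _ h1 _ h3 h4 h5 => leftRule_complete c y' h1 h3 h4 h5) hxt (Or.inl rfl)
    ⟨hxn, hxn, Iff.rfl⟩ hx
    (fun j hj => ⟨hxn, hn j (hLT j hj).1, by have := (hLT j hj).2; omega⟩) hLsep hx' hy hy' hκ rfl
    (by omega)
  -- the gates in increasing order
  obtain ⟨lo, hi, hlh, hx2, hy2, hlo, hhi⟩ : ∃ lo hi, lo ≤ hi ∧ x = cond d lo hi ∧
      y = cond d hi lo ∧ lo ∈ L ∧ hi ∈ L := by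
    cases d
    · refine ⟨y, x, ?_, rfl, rfl, hy, hx⟩
      rcases hx' y hy with h | h
      · exact h.le
      · exact (show y < x from h).le
    · refine ⟨x, y, ?_, rfl, rfl, hx, hy⟩
      rcases hx' y hy with h | h
      · exact h.ge
      · exact (show x < y from h).le
  have hlot := (hLT lo hlo).2
  have hhin := hn hi (hLT hi hhi).1
  rw [hx2, hy2] at hlen
  rcases R.eq_empty_or_nonempty with hRe | hRne
  · rw [hRe, card_empty] at hcard
    exact ⟨lo, hi, d, true, m, 0, hlot, hlh, hhin, by omega, by omega, by
      rw [candidate, List.length_append]; omega⟩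
  · obtain ⟨d', x', y', gx, gy, gx', gy', gκ⟩ := exists_direction (κ := κ) hRne
    have gate : ∀ j ∈ R, ok lo j ∧ ok hi j := fun j hj => by
      have := (hRT j hj).2
      have := (hLT hi hhi).2
      exact ⟨hsep lo (hLT lo hlo).1 j (hRT j hj).1 (by omega),
        hsep hi (hLT hi hhi).1 j (hRT j hj).1 (by omega)⟩
    obtain ⟨v, hv, hvx⟩ := H.rightStart_complete d' (hRT x' gx).2 (gate x' gx).1 (gate x' gx).2
    obtain ⟨v1, v2, v3⟩ := H.rightStart_sound hlot hlh hhin hv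
    have sR : ∀ i j, i < t → j < t → Same n t i j := fun i j h1 h2 =>
      ⟨h1.trans ht, h2.trans ht, by omega⟩
    obtain ⟨m', hm', hlen'⟩ := H.sideFamily_complete (K := K) (d := d')
      (rule := rightRule n t κ ok d' lo hi) (fun i j hs h => hs.2.2.1 h)
      (H.rightRule_sound (d := d') hlot hlh hhin)
      (fun c y hc h1 h2 h3 h4 h5 => H.rightRule_complete c y hc h1 h2 h3 h4 h5) v1 hvx
      (sR _ _ v1 (hRT x' gx).2) gx (fun j hj => sR _ _ (hRT x' gx).2 (hRT j hj).2) hRsep gx' gy gy'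
      gκ (gate y' gy) (by omega)
    exact ⟨lo, hi, d, d', m, m', hlot, hlh, hhin, by omega, by omega, by
      rw [candidate, List.length_append, hv]; omega⟩

/-- A separated family is matched by some candidate. If it has no member on the left side, the one
nearest to the axis can be exchanged for the top or the end of the left side. -/
lemma exists_candidate {T : Finset ℕ} (hT : T.Nonempty) (hn : ∀ j ∈ T, j < n)
    (hsep : Separated ok T) (hK : T.card ≤ K) :
    ∃ lo hi d d' m m', t ≤ lo ∧ lo ≤ hi ∧ hi < n ∧ m < T.card ∧ m' < T.card ∧
      T.card ≤ (candidate n t κ ok K d d' lo hi m m').length := by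
  have ht := H.lt
  by_cases hL : ∃ z ∈ T, t ≤ z
  · obtain ⟨z, hz, hzt⟩ := hL
    exact H.exists_candidate_of_left hn hsep hz hzt hK
  push Not at hL
  obtain ⟨d, x, y, hx, hy, hx', hy', hκ⟩ := exists_direction (κ := κ) hT
  have sx : ∀ i ∈ T, ∀ j ∈ T, Same n t i j := fun i hi j hj =>
    ⟨hn i hi, hn j hj, by have := hL i hi; have := hL j hj; omega⟩
  obtain ⟨w, hw, hwn, hok⟩ : ∃ w, t ≤ w ∧ w < n ∧ ∀ j ∈ T, j ≠ x → ok j w := by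
    have hmin : ∀ j ∈ T, κ x ≤ κ j := fun j hj => by
      rcases hx' j hj with rfl | h1
      · exact le_rfl
      · rcases hy' j hj with rfl | h2
        · exact hκ
        · exact H.le_of_le h1 h2 (sx x hx y hy) le_rfl hκ
    cases d
    · refine ⟨t, le_rfl, ht, fun j hj hne => ?_⟩
      exact H.top j x ((hx' j hj).resolve_left hne) (hL x hx) (hmin j hj) (hsep j hj x hx hne)
    · refine ⟨n - 1, by omega, by omega, fun j hj hne => ?_⟩
      exact H.bottom x j ((hx' j hj).resolve_left hne) (hL j hj) (hmin j hj)
        (hsep x hx j hj hne.symm)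
  have hwT : w ∉ T := fun h => by have := hL w h; omega
  have hcard : (insert w (T.erase x)).card = T.card := by
    rw [card_insert_of_notMem (fun h => hwT (mem_of_mem_erase h)),
      card_erase_add_one hx]
  have := H.exists_candidate_of_left (K := K) (T := insert w (T.erase x)) (z := w) (by
    intro j hj
    rcases mem_insert.1 hj with rfl | hj
    · exact hwn
    · exact hn j (mem_of_mem_erase hj)) (by
    intro i hi j hj hne
    rcases mem_insert.1 hi with rfl | gi
    · rcases mem_insert.1 hj with rfl | gj
      · exact absurd rfl hne
      · exact H.symm _ _ (hok j (mem_of_mem_erase gj) (ne_of_mem_erase gj))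
    · rcases mem_insert.1 hj with rfl | gj
      · exact hok i (mem_of_mem_erase gi) (ne_of_mem_erase gi)
      · exact hsep i (mem_of_mem_erase gi) j (mem_of_mem_erase gj) hne)
    (mem_insert_self _ _) hw (by omega)
  rwa [hcard] at this

end Split

/-! ### Convex polygons over a base of minimum width -/

/-- Twice the signed area of the triangle with vertices number `a`, `b`, `c`. -/
def orient (X Y : ℕ → ℝ) (a b c : ℕ) : ℝ :=
  (X b - X a) * (Y c - Y a) - (Y b - Y a) * (X c - X a)

/-- Coordinates of the vertices of a strictly convex polygon in counterclockwise order, starting at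
the right end of a horizontal base, which is the edge from the last vertex to the first. The height
`W` over the base is at most the width of the polygon over any other edge. -/
structure Frame (n : ℕ) (X Y : ℕ → ℝ) (W : ℝ) : Prop where
  conv : ∀ a b c, a < b → b < c → c < n → 0 < orient X Y a b c
  three : 3 ≤ n
  first : Y 0 = 0
  last : Y (n - 1) = 0
  base : X (n - 1) < X 0
  le_height : ∀ i, i < n → Y i ≤ W
  width : ∀ i, i + 1 < n →
    ∃ l < n, W * √((X (i + 1) - X i) ^ 2 + (Y (i + 1) - Y i) ^ 2) ≤ orient X Y i (i + 1) l

namespace Frame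

variable {n : ℕ} {X Y : ℕ → ℝ} {W : ℝ} (F : Frame n X Y W)

lemma orient_nonneg_of_conv (conv : ∀ a b c, a < b → b < c → c < n → 0 < orient X Y a b c)
    {e l : ℕ} (he : e + 1 < n) (hl : l < n) : 0 ≤ orient X Y e (e + 1) l := by
  rcases lt_trichotomy l e with h | rfl | h
  · have := conv l e (e + 1) h (by omega) he
    unfold orient at *; linarith
  · unfold orient; linarith
  · rcases (show e + 1 ≤ l from h).eq_or_lt with h' | h'
    · rw [← h']; unfold orient; linarith
    · exact (conv e (e + 1) l (by omega) h' hl).le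

include F

lemma pos {i : ℕ} (h0 : 0 < i) (h1 : i < n - 1) : 0 < Y i := by
  have h := F.conv 0 i (n - 1) h0 h1 (by omega)
  unfold orient at h
  rw [F.first, F.last] at h
  have h2 := F.base
  by_contra! h3
  nlinarith [mul_nonneg (neg_nonneg.2 h3) (sub_nonneg.2 h2.le)]

lemma nonneg {i : ℕ} (h : i < n) : 0 ≤ Y i := by
  rcases Nat.eq_zero_or_pos i with rfl | h0
  · rw [F.first]
  · rcases (show i ≤ n - 1 by omega).eq_or_lt with h1 | h1
    · rw [h1, F.last]
    · exact (F.pos h0 h1).le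

lemma mirror : Frame n (fun i => -X (n - 1 - i)) (fun i => Y (n - 1 - i)) W where
  conv a b c h1 h2 h3 := by
    have := F.conv (n - 1 - c) (n - 1 - b) (n - 1 - a) (by omega) (by omega) (by omega)
    unfold orient at *; linarith
  three := F.three
  first := F.last
  last := by rw [Nat.sub_self]; exact F.first
  base := by rw [Nat.sub_self]; exact neg_lt_neg F.base
  le_height i h := F.le_height _ (by omega)
  width i h := by
    obtain ⟨l, hl, h1⟩ := F.width (n - 1 - (i + 1)) (by omega)
    have e1 : n - 1 - (i + 1) + 1 = n - 1 - i := by omega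
    rw [e1] at h1
    refine ⟨n - 1 - l, by omega, ?_⟩
    have e2 : n - 1 - (n - 1 - l) = l := by omega
    have e3 : (-X (n - 1 - (i + 1)) - -X (n - 1 - i)) ^ 2 =
      (X (n - 1 - i) - X (n - 1 - (i + 1))) ^ 2 := by ring
    have e4 : (Y (n - 1 - (i + 1)) - Y (n - 1 - i)) ^ 2 =
      (Y (n - 1 - i) - Y (n - 1 - (i + 1))) ^ 2 := by ring
    simp only [orient, e2, e3, e4] at h1 ⊢
    linarith

omit F in
/-- The diagonals of a convex quadrilateral meet: suitable averages of the two ends coincide. -/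
lemma crossing (conv : ∀ a b c, a < b → b < c → c < n → 0 < orient X Y a b c) {a b c d : ℕ}
    (h1 : a < b) (h2 : b < c) (h3 : c < d) (h4 : d < n) :
    ∃ α β γ δ : ℝ, 0 < α ∧ 0 < β ∧ 0 < γ ∧ 0 < δ ∧ α + γ = 1 ∧ β + δ = 1 ∧
      α * X a + γ * X c = β * X b + δ * X d ∧ α * Y a + γ * Y c = β * Y b + δ * Y d := by
  have o1 := conv b c d h2 h3 h4
  have o2 := conv a c d (h1.trans h2) h3 h4
  have o3 := conv a b d h1 (h2.trans h3) h4
  have o4 := conv a b c h1 h2 (h3.trans h4)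
  have hS : 0 < orient X Y b c d + orient X Y a b d := by linarith
  have e : orient X Y b c d + orient X Y a b d = orient X Y a c d + orient X Y a b c := by
    unfold orient; ring
  refine ⟨orient X Y b c d / (orient X Y b c d + orient X Y a b d),
    orient X Y a c d / (orient X Y b c d + orient X Y a b d),
    orient X Y a b d / (orient X Y b c d + orient X Y a b d),
    orient X Y a b c / (orient X Y b c d + orient X Y a b d), by positivity, by positivity,
    by positivity, by positivity, ?_, ?_, ?_, ?_⟩
  · rw [← add_div, div_self hS.ne']
  · rw [← add_div, ← e, div_self hS.ne']
  · rw [div_mul_eq_mul_div, div_mul_eq_mul_div, div_mul_eq_mul_div, div_mul_eq_mul_div, ← add_div,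
      ← add_div]
    congr 1; unfold orient; ring
  · rw [div_mul_eq_mul_div, div_mul_eq_mul_div, div_mul_eq_mul_div, div_mul_eq_mul_div, ← add_div,
      ← add_div]
    congr 1; unfold orient; ring

omit F in
/-- An average of two numbers is not below an average of two others that are no larger; equality
forces all four to agree. -/
lemma eq_of_averages {α β γ δ a b c d m : ℝ} (hα : 0 < α) (hβ : 0 < β) (hγ : 0 < γ) (hδ : 0 < δ)
    (h1 : α + γ = 1) (h2 : β + δ = 1) (h : α * a + γ * c = β * b + δ * d) (ha : m ≤ a) (hc : m ≤ c)
    (hb : b ≤ m) (hd : d ≤ m) : a = m ∧ b = m ∧ c = m ∧ d = m := by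
  have e : α * (a - m) + γ * (c - m) + β * (m - b) + δ * (m - d) = 0 := by
    linear_combination h - m * h1 + m * h2
  have p1 := mul_nonneg hα.le (sub_nonneg.2 ha)
  have p2 := mul_nonneg hγ.le (sub_nonneg.2 hc)
  have p3 := mul_nonneg hβ.le (sub_nonneg.2 hb)
  have p4 := mul_nonneg hδ.le (sub_nonneg.2 hd)
  have q1 : α * (a - m) = 0 := by linarith
  have q2 : γ * (c - m) = 0 := by linarith
  have q3 : β * (m - b) = 0 := by linarith
  have q4 : δ * (m - d) = 0 := by linarith
  have r1 := (mul_eq_zero.1 q1).resolve_left hα.ne'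
  have r2 := (mul_eq_zero.1 q2).resolve_left hγ.ne'
  have r3 := (mul_eq_zero.1 q3).resolve_left hβ.ne'
  have r4 := (mul_eq_zero.1 q4).resolve_left hδ.ne'
  exact ⟨by linarith, by linarith, by linarith, by linarith⟩

/-- Up to a highest vertex `t`, the heights increase. -/
lemma height_lt {t i j : ℕ} (ht : ∀ l < n, Y l ≤ Y t) (htn : t < n - 1) (h1 : i < j)
    (h2 : j < t) : Y i < Y j := by
  rcases Nat.eq_zero_or_pos i with rfl | h0
  · rw [F.first]; exact F.pos h1 (by omega)
  by_contra! h
  obtain ⟨α, β, γ, δ, p1, p2, p3, p4, s1, s2, -, e⟩ :=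
    crossing F.conv h1 h2 htn (by omega : n - 1 < n)
  have hi := F.pos h0 (by omega)
  have := (eq_of_averages p1 p2 p3 p4 s1 s2 e le_rfl (ht i (by omega)) h
    (by rw [F.last]; exact hi.le)).2.2.2
  rw [F.last] at this
  linarith

/-- From a last highest vertex `t` on, the heights decrease. -/
lemma lt_height {t i j : ℕ} (ht : ∀ l < n, Y l ≤ Y t) (ht' : ∀ l < n, t < l → Y l < Y t)
    (ht0 : 0 < t) (hi : t ≤ i) (h1 : i < j) (h2 : j < n) : Y j < Y i := by
  rcases hi.eq_or_lt with rfl | hi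
  · exact ht' j h2 h1
  by_contra! h
  obtain ⟨α, β, γ, δ, p1, p2, p3, p4, s1, s2, -, e⟩ := crossing F.conv ht0 hi h1 h2
  have hi0 := F.pos (by omega : 0 < i) (by omega)
  have := (eq_of_averages p2 p1 p4 p3 s2 s1 e.symm (h.trans (ht j h2)) h
    (by rw [F.first]; exact hi0.le) le_rfl).2.1
  rw [F.first] at this
  linarith

/-- Over a base of minimum width the last highest vertex is not to the right of the base:
otherwise the strip could be turned about that vertex and the right end of the base, and would
become narrower until one of its lines contains another edge. -/
lemma top_le_first {t : ℕ} (ht : ∀ l < n, Y l ≤ Y t) (ht' : ∀ l < n, t < l → Y l < Y t)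
    (ht0 : 0 < t) (htn : t < n - 1) : X t ≤ X 0 := by
  by_contra! h
  have hWt : Y t ≤ W := F.le_height t (by omega)
  have hYt : 0 < Y t := F.pos ht0 htn
  have hn := F.three
  set u₁ := X 1 - X 0 with hu₁
  set u₂ := Y 1 - Y 0 with hu₂
  set v₁ := X t - X (t + 1) with hv₁
  set v₂ := Y t - Y (t + 1) with hv₂
  have u2 : 0 < u₂ := by rw [hu₂, F.first, sub_zero]; exact F.pos one_pos (by omega)
  have v2 : 0 < v₂ := sub_pos.2 (ht' _ (by omega) (by omega))
  have hbd : ∀ a b s : ℝ, 0 < b → Y t * √(a ^ 2 + b ^ 2) ≤ s → a * Y t - b * (X t - X 0) < s := by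
    intro a b s hb hs
    have h1 : a ≤ √(a ^ 2 + b ^ 2) := Real.le_sqrt_of_sq_le (by linarith [sq_nonneg b])
    linarith [mul_le_mul_of_nonneg_left h1 hYt.le, mul_pos hb (sub_pos.2 h)]
  rcases le_or_gt 0 (u₁ * v₂ - u₂ * v₁) with hc | hc
  · obtain ⟨l, hl, h1⟩ := F.width 0 (by omega)
    have h2 := hbd _ _ _ u2 ((mul_le_mul_of_nonneg_right hWt (Real.sqrt_nonneg _)).trans h1)
    have h3 := orient_nonneg_of_conv F.conv (e := t) (l := l) (by omega) hl
    have h4 := ht l hl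
    have e1 : v₂ * (u₁ * (Y t - Y l) - u₂ * (X t - X l)) =
        (u₁ * v₂ - u₂ * v₁) * (Y t - Y l) + u₂ * orient X Y t (t + 1) l := by
      unfold orient; rw [hv₁, hv₂]; ring
    have h5 : 0 ≤ v₂ * (u₁ * (Y t - Y l) - u₂ * (X t - X l)) := by
      rw [e1]
      exact add_nonneg (mul_nonneg hc (sub_nonneg.2 h4)) (mul_nonneg u2.le h3)
    have h6 := nonneg_of_mul_nonneg_right h5 v2
    have e2 : orient X Y 0 (0 + 1) l = u₁ * Y l - u₂ * (X l - X 0) := by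
      unfold orient; rw [zero_add, F.first, ← hu₁, sub_zero, sub_zero, hu₂, F.first, sub_zero]
    rw [e2] at h2
    linarith
  · obtain ⟨l, hl, h1⟩ := F.width t (by omega)
    have e0 : (X (t + 1) - X t) ^ 2 + (Y (t + 1) - Y t) ^ 2 = v₁ ^ 2 + v₂ ^ 2 := by
      rw [hv₁, hv₂]; ring
    rw [e0] at h1
    have h2 := hbd _ _ _ v2 ((mul_le_mul_of_nonneg_right hWt (Real.sqrt_nonneg _)).trans h1)
    have h3 := orient_nonneg_of_conv F.conv (e := 0) (l := l) (by omega) hl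
    have h4 := F.nonneg hl
    have e2 : orient X Y 0 (0 + 1) l = u₁ * Y l - u₂ * (X l - X 0) := by
      unfold orient; rw [zero_add, F.first, ← hu₁, sub_zero, sub_zero, hu₂, F.first, sub_zero]
    rw [e2] at h3
    have e1 : u₂ * (v₁ * Y l - v₂ * (X l - X 0)) =
        (u₂ * v₁ - u₁ * v₂) * Y l + v₂ * (u₁ * Y l - u₂ * (X l - X 0)) := by ring
    have h5 : 0 ≤ u₂ * (v₁ * Y l - v₂ * (X l - X 0)) := by
      rw [e1]
      exact add_nonneg (mul_nonneg (by linarith) h4) (mul_nonneg v2.le h3)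
    have h6 := nonneg_of_mul_nonneg_right h5 u2
    have e3 : orient X Y t (t + 1) l = v₁ * (Y t - Y l) - v₂ * (X t - X l) := by
      unfold orient; rw [hv₁, hv₂]; ring
    rw [e3] at h2
    linarith

lemma last_le_top {t : ℕ} (ht : ∀ l < n, Y l ≤ Y t) (ht' : ∀ l < n, l < t → Y l < Y t)
    (ht0 : 0 < t) (htn : t < n - 1) : X (n - 1) ≤ X t := by
  have := F.mirror.top_le_first (t := n - 1 - t) (fun l hl => by
      rw [show n - 1 - (n - 1 - t) = t by omega]; exact ht _ (by omega))
    (fun l hl h => by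
      rw [show n - 1 - (n - 1 - t) = t by omega]; exact ht' _ (by omega) (by omega))
    (by omega) (by omega)
  rw [show n - 1 - (n - 1 - t) = t by omega, Nat.sub_zero] at this
  linarith

omit F in
/-- `t` is the last highest vertex. -/
structure Top (n : ℕ) (Y : ℕ → ℝ) (t : ℕ) : Prop where
  lt : t < n
  le : ∀ l < n, Y l ≤ Y t
  lt_of_lt : ∀ l < n, t < l → Y l < Y t

variable {t : ℕ} (T : Top n Y t)
include T

lemma top_pos : 0 < t := by
  by_contra! h
  have h0 : t = 0 := by omega
  have h1 := T.le 1 (by have := F.three; omega)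
  rw [h0, F.first] at h1
  have := F.pos one_pos (by have := F.three; omega)
  linarith

lemma top_lt : t < n - 1 := by
  by_contra! h
  have h0 : t = n - 1 := by have := T.lt; omega
  have h1 := T.le 1 (by have := F.three; omega)
  rw [h0, F.last] at h1
  have := F.pos one_pos (by have := F.three; omega)
  linarith

lemma last_le_right {i : ℕ} (hi : i < t) : X (n - 1) ≤ X i := by
  have t0 := F.top_pos T
  have t1 := F.top_lt T
  rcases Nat.eq_zero_or_pos i with rfl | hi0
  · exact F.base.le
  -- the first highest vertex is `t` or its predecessor
  obtain ⟨s, hs, hsX⟩ : ∃ s, i ≤ s ∧ s < n - 1 ∧ X (n - 1) ≤ X s := by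
    rcases (T.le (t - 1) (by omega)).lt_or_eq with h | h
    · refine ⟨t, hi.le, t1, F.last_le_top T.le (fun l hl hlt => ?_) t0 t1⟩
      rcases (show l ≤ t - 1 by omega).eq_or_lt with h2 | h2
      · rw [h2]; exact h
      · exact (F.height_lt T.le t1 h2 (by omega)).trans h
    · refine ⟨t - 1, by omega, by omega, F.last_le_top (fun l hl => by rw [h]; exact T.le l hl)
        (fun l hl hlt => F.height_lt T.le t1 hlt (by omega)) (by omega) (by omega)⟩
  rcases hs.eq_or_lt with rfl | hs
  · exact hsX.2
  by_contra! h
  obtain ⟨α, β, γ, δ, p1, p2, p3, p4, s1, s2, e, -⟩ :=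
    crossing F.conv hi0 hs hsX.1 (by omega : n - 1 < n)
  have := (eq_of_averages p1 p2 p3 p4 s1 s2 e F.base.le hsX.2 h.le le_rfl).1
  linarith [F.base]

lemma top_le_right {i : ℕ} (hi : i < t) : X t ≤ X i := by
  have t0 := F.top_pos T
  have t1 := F.top_lt T
  have h0 := F.top_le_first T.le T.lt_of_lt t0 t1
  rcases Nat.eq_zero_or_pos i with rfl | hi0
  · exact h0
  by_contra! h
  have h2 := F.last_le_right T hi
  obtain ⟨α, β, γ, δ, p1, p2, p3, p4, s1, s2, e, -⟩ :=
    crossing F.conv hi0 hi t1 (by omega : n - 1 < n)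
  have := (eq_of_averages p1 p2 p3 p4 s1 s2 e h0 le_rfl h.le (h2.trans h.le)).2.1
  linarith

/-- The left side lies to the left of the right side. -/
lemma left_le_right {i j : ℕ} (hi : i < t) (hj : t ≤ j) (hn : j < n) : X j ≤ X i := by
  have t0 := F.top_pos T
  have t1 := F.top_lt T
  have h1 := F.last_le_right T hi
  have h2 := F.top_le_right T hi
  rcases hj.eq_or_lt with rfl | hj
  · exact h2
  rcases (show j ≤ n - 1 by omega).eq_or_lt with rfl | hn
  · exact h1
  by_contra! h
  obtain ⟨α, β, γ, δ, p1, p2, p3, p4, s1, s2, e, -⟩ :=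
    crossing F.conv t0 hj hn (by omega : n - 1 < n)
  have h3 := F.base
  have h4 := F.top_le_first T.le T.lt_of_lt t0 t1
  have h5 : max (X t) (X (n - 1)) ≤ X i := max_le h2 h1
  have := (eq_of_averages p1 p2 p3 p4 s1 s2 e (m := max (X t) (X (n - 1))) (max_le h4 h3.le)
    (h5.trans h.le) (le_max_left _ _) (le_max_right _ _)).2.2.1
  linarith

end Frame

namespace ShortDiagonal

open Real

/-- The configuration of `false_of_unit_diagonal`, where the polygon lies between the lines at
heights `-k` and `k'` and has points at distance `W` from the two supporting lines. -/
lemma false_of_unit_diagonal_of_far {G y p q p' q' a b k k' W x₁ y₁ x₂ y₂ : ℝ} (hG : 0 ≤ G)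
    (hGy : G ^ 2 + y ^ 2 = 1) (hpG : p ≤ G) (hpG' : p' ≤ G) (hq : 0 < q) (hq' : 0 < q')
    (hk : q' ≤ k) (hk' : q ≤ k') (hW : k + k' = W) (ha : a * (q - y) ≤ G - p)
    (ha' : -(a * (q' + y)) ≤ G - p') (hb : b * q ≤ p) (hb' : -(b * q') ≤ p')
    (h1 : -k ≤ y₁) (h1' : y₁ ≤ k') (hx1 : x₁ ≤ -(b * y₁))
    (w1 : W * √(1 + a ^ 2) ≤ x₁ + G - a * (y₁ - y))
    (h2 : -k ≤ y₂) (h2' : y₂ ≤ k') (hx2 : a * (y₂ - y) - G ≤ x₂)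
    (w2 : W * √(1 + b ^ 2) ≤ -(b * y₂) - x₂)
    (d1 : 1 < p ^ 2 + q ^ 2) (d2 : 1 < p' ^ 2 + q' ^ 2) (d3 : 1 < (G - p) ^ 2 + (q - y) ^ 2)
    (d4 : 1 < (G - p') ^ 2 + (q' + y) ^ 2)
    (c1 : 0 < G * q' + y * p') (c2 : 0 < G * q - y * p) (c4 : 0 < p * q' + q * p')
    (c3 : p * q' + q * p' < (G * q' + y * p') + (G * q - y * p)) : False := by
  rcases le_total 0 (a + b) with hab | hab
  · have m1 := mul_le_mul_of_nonneg_left h1 hab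
    have m2 := mul_le_mul_of_nonneg_left h2 hab
    exact false_of_unit_diagonal (G := G) (y := y) (p := p) (q := q) (p' := p') (q' := q') (a := a)
      (b := b) (k := k) (W := W) hG hGy hpG hpG' hq hq' hk ha hb hb' (by linarith) (by linarith)
      (by linarith) d1 d2 d3 d4 c1 c2 c4 c3
  · have m1 := mul_le_mul_of_nonpos_left h1' hab
    have m2 := mul_le_mul_of_nonpos_left h2' hab
    exact false_of_unit_diagonal (G := G) (y := -y) (p := p') (q := q') (p' := p) (q' := q)
      (a := -a) (b := -b) (k := k') (W := W) hG (by linarith) hpG' hpG hq' hq hk' (by linarith)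
      (by linarith) (by linarith) (by linarith) (by rw [neg_sq]; linarith)
      (by rw [neg_sq]; linarith) d2 d1 (by rw [sub_neg_eq_add]; exact d4)
      (by rw [← sub_eq_add_neg]; exact d3) (by linarith) (by linarith) (by linarith) (by linarith)

end ShortDiagonal

/-- The squared distance of the vertices number `i` and `j`. -/
def sqDist (X Y : ℕ → ℝ) (i j : ℕ) : ℝ := (X i - X j) ^ 2 + (Y i - Y j) ^ 2

lemma sqDist_comm (X Y : ℕ → ℝ) (i j : ℕ) : sqDist X Y i j = sqDist X Y j i := by
  unfold sqDist; ring

namespace Frame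

variable {n : ℕ} {X Y : ℕ → ℝ} {W : ℝ} (F : Frame n X Y W)
include F

/-- An edge that goes up supports the polygon from the right. -/
lemma exists_right_line {f j : ℕ} (hf : f + 1 < n) (h : Y f < Y (f + 1)) (hj : j = f ∨ j = f + 1) :
    ∃ b : ℝ, (∀ v < n, X v - X j ≤ -(b * (Y v - Y j))) ∧
      ∃ v < n, W * √(1 + b ^ 2) ≤ -(b * (Y v - Y j)) - (X v - X j) := by
  set u := Y (f + 1) - Y f with hu
  have hu0 : 0 < u := sub_pos.2 h
  set b := -(X (f + 1) - X f) / u with hb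
  have hbu : b * u = -(X (f + 1) - X f) := by rw [hb]; field_simp
  clear_value u b
  have hlin : ∀ v, orient X Y f (f + 1) v = u * (-(b * (Y v - Y j)) - (X v - X j)) := by
    intro v
    unfold orient
    rcases hj with rfl | rfl
    · rw [← hu]; linear_combination (Y v - Y j) * hbu
    · rw [← hu]
      linear_combination (Y v - Y (f + 1)) * hbu + (X f - X (f + 1)) * hu
  refine ⟨b, fun v hv => ?_, ?_⟩
  · have := orient_nonneg_of_conv F.conv hf hv
    rw [hlin] at this
    linarith [nonneg_of_mul_nonneg_right this hu0]
  · obtain ⟨v, hv, hw⟩ := F.width f hf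
    refine ⟨v, hv, ?_⟩
    have e : √((X (f + 1) - X f) ^ 2 + (Y (f + 1) - Y f) ^ 2) = u * √(1 + b ^ 2) := by
      rw [← hu, show (X (f + 1) - X f) ^ 2 + u ^ 2 = u ^ 2 * (1 + b ^ 2) by
        linear_combination (-(b * u) + (X (f + 1) - X f)) * hbu, Real.sqrt_mul (sq_nonneg u),
        Real.sqrt_sq hu0.le]
    rw [hlin, e] at hw
    refine le_of_mul_le_mul_left ?_ hu0
    linarith

/-- An edge that goes down supports the polygon from the left. -/
lemma exists_left_line {f j : ℕ} (hf : f + 1 < n) (h : Y (f + 1) < Y f) (hj : j = f ∨ j = f + 1) :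
    ∃ a : ℝ, (∀ v < n, a * (Y v - Y j) ≤ X v - X j) ∧
      ∃ v < n, W * √(1 + a ^ 2) ≤ (X v - X j) - a * (Y v - Y j) := by
  have e1 : n - 1 - (n - 1 - (f + 1)) = f + 1 := by omega
  have e2 : n - 1 - (n - 1 - (f + 1) + 1) = f := by omega
  have e3 : n - 1 - (n - 1 - j) = j := by omega
  obtain ⟨a, h1, v, hv, h2⟩ := F.mirror.exists_right_line (f := n - 1 - (f + 1)) (j := n - 1 - j)
    (by omega) (by rw [e1, e2]; exact h) (by omega)
  refine ⟨a, fun v hv => ?_, n - 1 - v, by omega, ?_⟩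
  · have := h1 (n - 1 - v) (by omega)
    rw [show n - 1 - (n - 1 - v) = v by omega, e3] at this
    linarith
  · rw [e3] at h2; linarith

/-- In a convex quadrilateral with consecutive vertices `i`, `j`, `l`, `m`, where the first three go
up and `m` is to the left of them, the diagonal from `j` to `m` is not the only short distance. -/
lemma diagonal_long {i j l m e f : ℕ} (hij : i < j) (hjl : j < l) (hlm : l < m) (hm : m < n)
    (yij : Y i < Y j) (yjl : Y j < Y l) (hf : f + 1 < n) (yf : Y f < Y (f + 1))
    (hjf : j = f ∨ j = f + 1) (he : e + 1 < n) (ye : Y (e + 1) < Y e) (hme : m = e ∨ m = e + 1)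
    (xi : X m ≤ X i) (xj : X m ≤ X j) (xl : X m ≤ X l) {ρ : ℝ} (dij : ρ ≤ sqDist X Y i j)
    (djl : ρ ≤ sqDist X Y j l) (dim : ρ ≤ sqDist X Y i m) (dlm : ρ ≤ sqDist X Y l m) :
    ρ ≤ sqDist X Y j m := by
  by_contra! hd
  have hin : i < n := by omega
  have hjn : j < n := by omega
  have hln : l < n := by omega
  have o1 := F.conv i j m hij (hjl.trans hlm) hm
  have o2 := F.conv j l m hjl hlm hm
  have o3 := F.conv i l m (hij.trans hjl) hlm hm
  have o4 := F.conv i j l hij hjl (hlm.trans hm)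
  obtain ⟨b, hb, v₂, hv₂, w₂⟩ := F.exists_right_line hf yf hjf
  obtain ⟨a, ha, v₁, hv₁, w₁⟩ := F.exists_left_line he ye hme
  set s := √(sqDist X Y j m) with hs
  have hD : 0 < sqDist X Y j m := by
    by_contra! h0
    unfold sqDist at h0
    have e1 : X j - X m = 0 := by
      have := sq_nonneg (X j - X m); have := sq_nonneg (Y j - Y m)
      exact pow_eq_zero_iff two_ne_zero |>.1 (by linarith)
    have e2 : Y j - Y m = 0 := by
      have := sq_nonneg (X j - X m); have := sq_nonneg (Y j - Y m)
      exact pow_eq_zero_iff two_ne_zero |>.1 (by linarith)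
    have e1' : X j = X m := by linarith
    have e2' : Y j = Y m := by linarith
    unfold orient at o1
    rw [e1', e2'] at o1
    linarith
  have hs0 : 0 < s := Real.sqrt_pos.2 hD
  have hs2 : s ^ 2 = sqDist X Y j m := Real.sq_sqrt hD.le
  set r := s⁻¹ with hr
  have hr0 : 0 < r := inv_pos.2 hs0
  have hr2 : r ^ 2 * sqDist X Y j m = 1 := by rw [← hs2, hr]; field_simp
  have hrr : 0 < r ^ 2 := by positivity
  have hdist : ∀ x, ρ ≤ x → 1 < r ^ 2 * x := fun x hx => by
    rw [← hr2]; exact mul_lt_mul_of_pos_left (hd.trans_le hx) hrr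
  have D1 := hdist _ djl
  have D2 := hdist _ dij
  have D3 := hdist _ dlm
  have D4 := hdist _ dim
  have M := fun {x y : ℝ} (h : x ≤ y) => mul_le_mul_of_nonneg_left h hr0.le
  have M' := fun {x y : ℝ} (h : x < y) => mul_lt_mul_of_pos_left h hr0
  have N := fun {x : ℝ} (h : 0 < x) => mul_pos hrr h
  have A1 := M (ha l hln)
  have A2 := M (ha i hin)
  have A3 := M (ha v₂ hv₂)
  have B1 := M (hb l hln)
  have B2 := M (hb i hin)
  have B3 := M (hb v₁ hv₁)
  have W1 := M w₁
  have W2 := M w₂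
  have O1 := N o1
  have O2 := N o2
  have O3 := N o3
  have O4 := N o4
  have Y0i := M (F.nonneg hin)
  have YlW := M (F.le_height l hln)
  have Y1 := M (F.nonneg hv₁)
  have Y1' := M (F.le_height v₁ hv₁)
  have Y2 := M (F.nonneg hv₂)
  have Y2' := M (F.le_height v₂ hv₂)
  have Xi := M xi
  have Xj := M xj
  have Xl := M xl
  have Yij := M' yij
  have Yjl := M' yjl
  unfold sqDist at D1 D2 D3 D4 hr2
  unfold orient at O1 O2 O3 O4
  refine ShortDiagonal.false_of_unit_diagonal_of_far (G := r * (X j - X m)) (y := r * (Y m - Y j))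
    (p := r * (X j - X l)) (q := r * (Y l - Y j)) (p' := r * (X j - X i)) (q' := r * (Y j - Y i))
    (a := a) (b := b) (k := r * Y j) (k' := r * (W - Y j)) (W := r * W)
    (x₁ := r * (X v₁ - X j)) (y₁ := r * (Y v₁ - Y j)) (x₂ := r * (X v₂ - X j))
    (y₂ := r * (Y v₂ - Y j)) ?_ ?_ ?_ ?_ ?_ ?_ ?_ ?_ ?_ ?_ ?_ ?_ ?_ ?_ ?_ ?_ ?_ ?_ ?_ ?_ ?_ ?_ ?_
    ?_ ?_ ?_ ?_ ?_ ?_ <;> linarith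

omit F in
/-- The signed distance of the vertex `i` from the vertical axis, towards its own side. -/
noncomputable def sideDist (t : ℕ) (X : ℕ → ℝ) (i : ℕ) : ℝ := if i < t then X i else -X i

omit F in
lemma sideDist_of_lt {t : ℕ} (X : ℕ → ℝ) {i : ℕ} (h : i < t) : sideDist t X i = X i := if_pos h

omit F in
lemma sideDist_of_le {t : ℕ} (X : ℕ → ℝ) {i : ℕ} (h : t ≤ i) : sideDist t X i = -X i :=
  if_neg (by omega)

omit F in
lemma sqDist_mono {i j l : ℕ} {x : ℝ} (h : (X i ≤ X j ∧ X j ≤ X l) ∨ (X l ≤ X j ∧ X j ≤ X i))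
    (h' : (Y i ≤ Y j ∧ Y j ≤ Y l) ∨ (Y l ≤ Y j ∧ Y j ≤ Y i))
    (hx : x ≤ sqDist X Y i j ∨ x ≤ sqDist X Y j l) : x ≤ sqDist X Y i l := by
  have key : ∀ a b c : ℝ, (a ≤ b ∧ b ≤ c) ∨ (c ≤ b ∧ b ≤ a) →
      (a - b) ^ 2 ≤ (a - c) ^ 2 ∧ (b - c) ^ 2 ≤ (a - c) ^ 2 := by
    intro a b c h
    rcases h with ⟨h1, h2⟩ | ⟨h1, h2⟩ <;>
      constructor <;> linarith [mul_nonneg (sub_nonneg.2 h1) (sub_nonneg.2 h2),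
        sq_nonneg (a - b), sq_nonneg (b - c)]
  have k1 := key _ _ _ h
  have k2 := key _ _ _ h'
  unfold sqDist at *
  rcases hx with hx | hx
  · exact hx.trans (add_le_add k1.1 k2.1)
  · exact hx.trans (add_le_add k1.2 k2.2)

variable {t : ℕ} (T : Top n Y t)
include T

lemma right_quasi {i j l : ℕ} (h1 : i < j) (h2 : j < l) (h3 : l < t) :
    min (X i) (X l) < X j := by
  have t1 := F.top_lt T
  by_contra! h
  obtain ⟨α, β, γ, δ, p1, p2, p3, p4, s1, s2, e, -⟩ :=
    crossing F.conv h1 h2 (h3.trans t1) (by omega : n - 1 < n)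
  obtain ⟨e1, e2, e3, -⟩ := eq_of_averages p1 p2 p3 p4 s1 s2 e (min_le_left _ _)
    (min_le_right _ _) h (le_min (F.last_le_right T (by omega)) (F.last_le_right T h3))
  have := F.conv i j l h1 h2 (by omega)
  unfold orient at this
  rw [e2.trans e1.symm, e3.trans e1.symm] at this
  linarith

lemma left_quasi {i j l : ℕ} (h0 : t ≤ i) (h1 : i < j) (h2 : j < l) (h3 : l < n) :
    X j < max (X i) (X l) := by
  have t0 := F.top_pos T
  by_contra! h
  obtain ⟨α, β, γ, δ, p1, p2, p3, p4, s1, s2, e, -⟩ := crossing F.conv (t0.trans_le h0) h1 h2 h3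
  obtain ⟨-, e1, e2, e3⟩ := eq_of_averages p1 p2 p3 p4 s1 s2 e
    (max_le (F.left_le_right T t0 h0 (by omega)) (F.left_le_right T t0 (by omega) h3)) h
    (le_max_left _ _) (le_max_right _ _)
  have := F.conv i j l h1 h2 (by omega)
  unfold orient at this
  rw [e2.trans e1.symm, e3.trans e1.symm] at this
  linarith

omit T F in
lemma dist_crossing (conv : ∀ a b c, a < b → b < c → c < n → 0 < orient X Y a b c)
    {i j k l : ℕ} (h1 : i < j) (h2 : j < k) (h3 : k < l) (h4 : l < n) {ρ : ℝ}
    (h : (ρ ≤ sqDist X Y i j ∧ ρ ≤ sqDist X Y k l) ∨ (ρ ≤ sqDist X Y j k ∧ ρ ≤ sqDist X Y i l)) :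
    ρ ≤ sqDist X Y i k ∨ ρ ≤ sqDist X Y j l := by
  obtain ⟨α, β, γ, δ, p1, p2, p3, p4, s1, s2, e, e'⟩ := crossing conv h1 h2 h3 h4
  by_contra! hc
  set z : ℕ → ℂ := fun i => ⟨X i, Y i⟩ with hz
  have hd : ∀ a b, sqDist X Y a b = ‖z a - z b‖ ^ 2 := by
    intro a b
    rw [Complex.sq_norm, Complex.normSq_apply, hz]
    simp only [Complex.sub_re, Complex.sub_im]
    unfold sqDist; ring
  set w : ℂ := α * z i + γ * z k with hw
  have hw' : w = β * z j + δ * z l := by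
    apply Complex.ext
    · simp [hw, hz]; exact e
    · simp [hw, hz]; exact e'
  have hαc : (α : ℂ) + γ = 1 := by exact_mod_cast s1
  have hβc : (β : ℂ) + δ = 1 := by exact_mod_cast s2
  have n1 : ‖z i - w‖ = γ * ‖z i - z k‖ := by
    rw [show z i - w = (γ : ℂ) * (z i - z k) by rw [hw]; linear_combination (-(z i)) * hαc,
      norm_mul, Complex.norm_real, Real.norm_of_nonneg p3.le]
  have n2 : ‖w - z k‖ = α * ‖z i - z k‖ := by
    rw [show w - z k = (α : ℂ) * (z i - z k) by rw [hw]; linear_combination (z k) * hαc,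
      norm_mul, Complex.norm_real, Real.norm_of_nonneg p1.le]
  have n3 : ‖z j - w‖ = δ * ‖z j - z l‖ := by
    rw [show z j - w = (δ : ℂ) * (z j - z l) by rw [hw']; linear_combination (-(z j)) * hβc,
      norm_mul, Complex.norm_real, Real.norm_of_nonneg p4.le]
  have n4 : ‖w - z l‖ = β * ‖z j - z l‖ := by
    rw [show w - z l = (β : ℂ) * (z j - z l) by rw [hw']; linear_combination (z l) * hβc,
      norm_mul, Complex.norm_real, Real.norm_of_nonneg p2.le]
  have t1 : ‖z i - z j‖ ≤ ‖z i - w‖ + ‖z j - w‖ := by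
    rw [show z i - z j = (z i - w) - (z j - w) by ring]; exact norm_sub_le _ _
  have t2 : ‖z k - z l‖ ≤ ‖w - z k‖ + ‖w - z l‖ := by
    rw [show z k - z l = (w - z l) - (w - z k) by ring, add_comm]; exact norm_sub_le _ _
  have t3 : ‖z j - z k‖ ≤ ‖z j - w‖ + ‖w - z k‖ := by
    rw [show z j - z k = (z j - w) + (w - z k) by ring]; exact norm_add_le _ _
  have t4 : ‖z i - z l‖ ≤ ‖z i - w‖ + ‖w - z l‖ := by
    rw [show z i - z l = (z i - w) + (w - z l) by ring]; exact norm_add_le _ _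
  rw [hd, hd] at hc
  have m1 : γ * ‖z i - z k‖ + α * ‖z i - z k‖ = ‖z i - z k‖ := by
    rw [← add_mul, add_comm γ, s1, one_mul]
  have m2 : δ * ‖z j - z l‖ + β * ‖z j - z l‖ = ‖z j - z l‖ := by
    rw [← add_mul, add_comm δ, s2, one_mul]
  have fin : ∀ x y : ℝ, 0 ≤ x → ρ ≤ x ^ 2 → y ^ 2 < ρ → y < x := fun x y hx h h' =>
    lt_of_pow_lt_pow_left₀ 2 hx (h'.trans_le h)
  rcases h with ⟨g1, g2⟩ | ⟨g1, g2⟩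
  · rw [hd] at g1 g2
    have f1 := fin _ _ (norm_nonneg _) g1 hc.1
    have f2 := fin _ _ (norm_nonneg _) g2 hc.2
    linarith
  · rw [hd] at g1 g2
    have f1 := fin _ _ (norm_nonneg _) g1 hc.1
    have f2 := fin _ _ (norm_nonneg _) g2 hc.2
    linarith

lemma opposite_right {i j l m : ℕ} (hij : i < j) (hjl : j < l) (hl : l < t) (hm : t ≤ m)
    (hmn : m < n) {ρ : ℝ} (dij : ρ ≤ sqDist X Y i j) (djl : ρ ≤ sqDist X Y j l)
    (dim : ρ ≤ sqDist X Y i m) (dlm : ρ ≤ sqDist X Y l m) : ρ ≤ sqDist X Y j m := by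
  have t0 := F.top_pos T
  have t1 := F.top_lt T
  obtain ⟨e, he, he', hme⟩ : ∃ e, t ≤ e ∧ e + 1 < n ∧ (m = e ∨ m = e + 1) := by
    by_cases h : m + 1 < n
    · exact ⟨m, hm, h, Or.inl rfl⟩
    · exact ⟨m - 1, by omega, by omega, Or.inr (by omega)⟩
  exact F.diagonal_long hij hjl (hl.trans_le hm) hmn (F.height_lt T.le t1 hij (by omega))
    (F.height_lt T.le t1 hjl hl) (f := j) (by omega) (F.height_lt T.le t1 (by omega) (by omega))
    (Or.inl rfl) he' (F.lt_height T.le T.lt_of_lt t0 he (by omega) he') hme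
    (F.left_le_right T (by omega) hm hmn) (F.left_le_right T (by omega) hm hmn)
    (F.left_le_right T (by omega) hm hmn) dij djl dim dlm

lemma opposite_left {i j l m : ℕ} (hi : t ≤ i) (hij : i < j) (hjl : j < l) (hl : l < n)
    (hm : m < t) {ρ : ℝ} (dij : ρ ≤ sqDist X Y i j) (djl : ρ ≤ sqDist X Y j l)
    (dim : ρ ≤ sqDist X Y i m) (dlm : ρ ≤ sqDist X Y l m) : ρ ≤ sqDist X Y j m := by
  have t0 := F.top_pos T
  have t1 := F.top_lt T
  obtain ⟨e, he, hme, hy⟩ : ∃ e, e + 1 ≤ t ∧ (m = e ∨ m = e + 1) ∧ Y e < Y (e + 1) := by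
    rcases (show m + 1 ≤ t by omega).lt_or_eq with h | h
    · exact ⟨m, hm, Or.inl rfl, F.height_lt T.le t1 (by omega) h⟩
    · rcases (T.le m (by omega)).lt_or_eq with h2 | h2
      · exact ⟨m, hm, Or.inl rfl, by rw [h]; exact h2⟩
      · have hm0 : 0 < m := by
          by_contra! h3
          have h4 : m = 0 := by omega
          rw [h4, F.first] at h2
          have := F.pos t0 t1
          linarith
        exact ⟨m - 1, by omega, Or.inr (by omega), F.height_lt T.le t1 (by omega) (by omega)⟩
  have R : ∀ a, a < n → n - 1 - (n - 1 - a) = a := fun a ha => by omega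
  have hD : ∀ a b, a < n → b < n → sqDist (fun i => -X (n - 1 - i)) (fun i => Y (n - 1 - i))
      (n - 1 - a) (n - 1 - b) = sqDist X Y a b := by
    intro a b ha hb
    unfold sqDist
    simp only [R a ha, R b hb]; ring
  have := F.mirror.diagonal_long (i := n - 1 - l) (j := n - 1 - j) (l := n - 1 - i)
    (m := n - 1 - m) (e := n - 1 - (e + 1)) (f := n - 1 - j) (ρ := ρ) (by omega) (by omega)
    (by omega) (by omega)
    (by rw [R l hl, R j (by omega)]; exact F.lt_height T.le T.lt_of_lt t0 (by omega) hjl hl)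
    (by rw [R i (by omega), R j (by omega)]
        exact F.lt_height T.le T.lt_of_lt t0 hi hij (by omega)) (by omega)
    (by
      rw [R j (by omega), show n - 1 - (n - 1 - j + 1) = j - 1 by omega]
      exact F.lt_height T.le T.lt_of_lt t0 (by omega) (by omega) (by omega)) (Or.inl rfl) (by omega)
    (by
      rw [R (e + 1) (by omega), show n - 1 - (n - 1 - (e + 1) + 1) = e by omega]; exact hy)
    (by omega)
    (by rw [R l hl, R m (by omega)]; exact neg_le_neg (F.left_le_right T hm (by omega) hl))
    (by rw [R j (by omega), R m (by omega)]
        exact neg_le_neg (F.left_le_right T hm (by omega) (by omega)))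
    (by rw [R i (by omega), R m (by omega)]
        exact neg_le_neg (F.left_le_right T hm (by omega) (by omega)))
    (by rw [hD l j hl (by omega), sqDist_comm]; exact djl)
    (by rw [hD j i (by omega) (by omega), sqDist_comm]; exact dij)
    (by rw [hD l m hl (by omega)]; exact dlm) (by rw [hD i m (by omega) (by omega)]; exact dim)
  rwa [hD j m (by omega) (by omega)] at this

/-- A convex polygon over a base of minimum width has the combinatorial properties on which the
search relies, for every threshold. -/
lemma split (ρ : ℝ) : Split n t (sideDist t X) (fun i j => ρ ≤ sqDist X Y i j) where
  lt := T.lt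
  symm i j h := by rwa [sqDist_comm]
  quasi i j l h1 h2 h3 hs := by
    by_cases hi : i < t
    · have hl := hs.1 hi
      rw [sideDist_of_lt X hi, sideDist_of_lt X hl, sideDist_of_lt X (h2.trans hl)]
      exact F.right_quasi T h1 h2 hl
    · rw [sideDist_of_le X (by omega), sideDist_of_le X (by omega), sideDist_of_le X (by omega),
        min_neg_neg]
      exact neg_lt_neg (F.left_quasi T (by omega) h1 h2 h3)
  up i j l h1 h2 h3 hs k1 k2 h := by
    have t0 := F.top_pos T
    have t1 := F.top_lt T
    refine sqDist_mono ?_ ?_ h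
    · by_cases hi : i < t
      · rw [sideDist_of_lt X hi, sideDist_of_lt X (by omega)] at k1
        rw [sideDist_of_lt X (by omega), sideDist_of_lt X (by omega)] at k2
        exact Or.inl ⟨k1, k2⟩
      · rw [sideDist_of_le X (by omega), sideDist_of_le X (by omega)] at k1 k2
        exact Or.inr ⟨by linarith, by linarith⟩
    · by_cases hi : i < t
      · exact Or.inl ⟨(F.height_lt T.le t1 h1 (by omega)).le,
          (F.height_lt T.le t1 h2 (by omega)).le⟩
      · exact Or.inr ⟨(F.lt_height T.le T.lt_of_lt t0 (by omega) h2 h3).le,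
          (F.lt_height T.le T.lt_of_lt t0 (by omega) h1 (by omega)).le⟩
  down i j l h1 h2 h3 hs k1 k2 h := by
    have t0 := F.top_pos T
    have t1 := F.top_lt T
    refine sqDist_mono ?_ ?_ h
    · by_cases hi : i < t
      · rw [sideDist_of_lt X (by omega), sideDist_of_lt X (by omega)] at k1 k2
        exact Or.inr ⟨k2, k1⟩
      · rw [sideDist_of_le X (by omega), sideDist_of_le X (by omega)] at k1 k2
        exact Or.inl ⟨by linarith, by linarith⟩
    · by_cases hi : i < t
      · exact Or.inl ⟨(F.height_lt T.le t1 h1 (by omega)).le,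
          (F.height_lt T.le t1 h2 (by omega)).le⟩
      · exact Or.inr ⟨(F.lt_height T.le T.lt_of_lt t0 (by omega) h2 h3).le,
          (F.lt_height T.le T.lt_of_lt t0 (by omega) h1 (by omega)).le⟩
  cross i j k l h1 h2 h3 h4 h := dist_crossing F.conv h1 h2 h3 h4 h
  opposite i j l m h1 h2 h3 hm hs hs' dij djl dim dlm := by
    by_cases hi : i < t
    · exact F.opposite_right T h1 h2 (by omega) (by omega) hm dij djl dim dlm
    · exact F.opposite_left T (by omega) h1 h2 h3 (by omega) dij djl dim dlm
  top i j h1 h2 hκ h := by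
    have t1 := F.top_lt T
    rw [sideDist_of_lt X h2, sideDist_of_lt X (h1.trans h2)] at hκ
    exact sqDist_mono (Or.inr ⟨F.top_le_right T h2, hκ⟩)
      (Or.inl ⟨(F.height_lt T.le t1 h1 h2).le, T.le j (by omega)⟩) (Or.inl h)
  bottom i j h1 h2 hκ h := by
    have t1 := F.top_lt T
    rw [sideDist_of_lt X h2, sideDist_of_lt X (h1.trans h2)] at hκ
    refine sqDist_mono (j := i) (Or.inr ⟨F.last_le_right T (by omega), hκ⟩)
      (Or.inr ⟨?_, (F.height_lt T.le t1 h1 h2).le⟩) (Or.inl (by rwa [sqDist_comm]))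
    rw [F.last]; exact F.nonneg (by omega)

end Frame

/-! ### The cyclic order of points in convex position -/

/-- No point is a convex combination of three others. -/
def ConvexPosition (n : ℕ) (x y : ℕ → ℝ) : Prop :=
  ∀ a b c e, a < n → b < n → c < n → e < n → b ≠ a → b ≠ c → b ≠ e →
    ∀ u v w : ℝ, 0 ≤ u → 0 ≤ v → 0 ≤ w → u + v + w = 1 →
      x b = u * x a + v * x c + w * x e → y b = u * y a + v * y c + w * y e → False

namespace ConvexPosition

open Finset

variable {n : ℕ} {x y : ℕ → ℝ} (h : ConvexPosition n x y)
include h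

lemma injective {a b : ℕ} (ha : a < n) (hb : b < n) (hab : a ≠ b) (hx : x a = x b) :
    y a ≠ y b := fun hy =>
  h a b a a ha hb ha ha hab.symm hab.symm hab.symm 1 0 0 one_pos.le le_rfl le_rfl (by norm_num)
    (by linarith) (by linarith)

lemma sqDist_pos {a b : ℕ} (ha : a < n) (hb : b < n) (hab : a ≠ b) : 0 < sqDist x y a b := by
  by_contra! h0
  unfold sqDist at h0
  have h1 := sq_nonneg (x a - x b)
  have h2 := sq_nonneg (y a - y b)
  have e1 : x a - x b = 0 := pow_eq_zero_iff two_ne_zero |>.1 (by linarith)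
  have e2 : y a - y b = 0 := pow_eq_zero_iff two_ne_zero |>.1 (by linarith)
  exact h.injective ha hb hab (by linarith) (by linarith)

lemma orient_ne_zero {a b c : ℕ} (ha : a < n) (hb : b < n) (hc : c < n) (hab : a ≠ b)
    (hbc : b ≠ c) (hac : a ≠ c) : orient x y a b c ≠ 0 := by
  intro ho
  unfold orient at ho
  have hD := h.sqDist_pos hb ha hab.symm
  unfold sqDist at hD
  set D := (x b - x a) ^ 2 + (y b - y a) ^ 2 with hDd
  set s := ((x b - x a) * (x c - x a) + (y b - y a) * (y c - y a)) / D with hs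
  have hsD : s * D = (x b - x a) * (x c - x a) + (y b - y a) * (y c - y a) := by
    rw [hs]; field_simp
  have ex : x c - x a = s * (x b - x a) := by
    have : D * (x c - x a - s * (x b - x a)) = 0 := by
      rw [mul_sub, ← mul_assoc, mul_comm D s, hsD, hDd]
      linear_combination (-(y b - y a)) * ho
    linarith [(mul_eq_zero.1 this).resolve_left hD.ne']
  have ey : y c - y a = s * (y b - y a) := by
    have : D * (y c - y a - s * (y b - y a)) = 0 := by
      rw [mul_sub, ← mul_assoc, mul_comm D s, hsD, hDd]
      linear_combination (x b - x a) * ho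
    linarith [(mul_eq_zero.1 this).resolve_left hD.ne']
  clear_value s
  rcases lt_or_ge s 0 with h1 | h1
  · have h2 : 0 < 1 - s := by linarith
    refine h b a c c hb ha hc hc hab hac hac (-s / (1 - s)) (1 / (1 - s)) 0
      (div_nonneg (by linarith) h2.le) (by positivity) le_rfl (by field_simp; ring) ?_ ?_
    · field_simp; linarith
    · field_simp; linarith
  rcases le_or_gt s 1 with h2 | h2
  · exact h a c b b ha hc hb hb hac.symm hbc.symm hbc.symm (1 - s) s 0 (by linarith) h1 le_rfl
      (by ring) (by linarith) (by linarith)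
  · have h3 : 0 < s := by linarith
    refine h a b c c ha hb hc hc hab.symm hbc hbc ((s - 1) / s) (1 / s) 0
      (div_nonneg (by linarith) h3.le) (by positivity) le_rfl (by field_simp; ring) ?_ ?_
    · field_simp; linarith
    · field_simp; linarith

lemma fan {B i j k : ℕ} (hB : B < n) (hi : i < n) (hj : j < n) (hk : k < n)
    (h1 : 0 < orient x y B i j) (h2 : 0 < orient x y B j k) (h3 : 0 < orient x y B i k) :
    0 < orient x y i j k := by
  by_contra! h4
  have n1 : j ≠ B := by rintro rfl; unfold orient at h2; linarith
  have n2 : j ≠ i := by rintro rfl; unfold orient at h1; linarith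
  have n3 : j ≠ k := by rintro rfl; unfold orient at h2; linarith
  refine h B j i k hB hj hi hk n1 n2 n3 (-orient x y i j k / orient x y B i k)
    (orient x y B j k / orient x y B i k) (orient x y B i j / orient x y B i k)
    (div_nonneg (by linarith) h3.le) (by positivity) (by positivity) ?_ ?_ ?_
  · rw [← add_div, ← add_div, div_eq_one_iff_eq h3.ne']; unfold orient; ring
  · have := h3.ne'
    field_simp; unfold orient; ring
  · have := h3.ne'
    field_simp; unfold orient; ring

omit h in
/-- `B` is the lowest point, and the leftmost one of these. -/
def Lowest (n : ℕ) (x y : ℕ → ℝ) (B : ℕ) : Prop :=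
  B < n ∧ ∀ j < n, j ≠ B → y B < y j ∨ (y B = y j ∧ x B < x j)

omit h in
/-- `j` comes before `i` when the points are sorted by angle about `B`, beginning with `B`. -/
def Precedes (x y : ℕ → ℝ) (B j i : ℕ) : Prop := i ≠ B ∧ (j = B ∨ 0 < orient x y B j i)

open Classical in
omit h in
/-- The number of points that precede `i`. -/
noncomputable def rank (n : ℕ) (x y : ℕ → ℝ) (B i : ℕ) : ℕ :=
  ((range n).filter (fun j => Precedes x y B j i)).card

variable {B : ℕ} (hB : Lowest n x y B)
include hB

omit h in
lemma precedes_trans {i j k : ℕ} (hi : i < n) (hj : j < n) (hk : k < n)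
    (h1 : Precedes x y B i j) (h2 : Precedes x y B j k) : Precedes x y B i k := by
  refine ⟨h2.1, ?_⟩
  rcases h1.2 with h3 | h3
  · exact Or.inl h3
  by_cases hiB : i = B
  · exact Or.inl hiB
  have h4 := h2.2.resolve_left h1.1
  right
  have bi := hB.2 i hi hiB
  have bj := hB.2 j hj h1.1
  have bk := hB.2 k hk h2.1
  unfold orient at *
  have e : (y j - y B) * ((x i - x B) * (y k - y B) - (y i - y B) * (x k - x B)) =
      (y i - y B) * ((x j - x B) * (y k - y B) - (y j - y B) * (x k - x B)) +
      (y k - y B) * ((x i - x B) * (y j - y B) - (y i - y B) * (x j - x B)) := by ring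
  rcases bj with bj | ⟨bj, bj'⟩
  · have p0 : 0 < y j - y B := sub_pos.2 bj
    refine pos_of_mul_pos_right (a := y j - y B) ?_ p0.le
    rw [e]
    rcases bi with bi | ⟨bi, bi'⟩
    · have hk0 : 0 ≤ y k - y B := by rcases bk with bk | ⟨bk, -⟩ <;> linarith
      exact add_pos_of_pos_of_nonneg (mul_pos (sub_pos.2 bi) h4) (mul_nonneg hk0 h3.le)
    · rcases bk with bk | ⟨bk, bk'⟩
      · have e0 : (y i - y B) * ((x j - x B) * (y k - y B) - (y j - y B) * (x k - x B)) = 0 := by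
          rw [← bi, sub_self, zero_mul]
        rw [e0, zero_add]
        exact mul_pos (sub_pos.2 bk) h3
      · rw [← bk, sub_self] at h4
        have := mul_pos p0 (sub_pos.2 bk')
        linarith
  · have hi0 : 0 ≤ y i - y B := by rcases bi with bi | ⟨bi, -⟩ <;> linarith
    rw [← bj, sub_self] at h3
    have := mul_nonneg hi0 (sub_pos.2 bj').le
    linarith

lemma precedes_or {i j : ℕ} (hi : i < n) (hj : j < n) (hij : i ≠ j) :
    Precedes x y B i j ∨ Precedes x y B j i := by
  by_cases h1 : i = B
  · exact Or.inl ⟨fun h2 => hij (h1.trans h2.symm), Or.inl h1⟩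
  by_cases h2 : j = B
  · exact Or.inr ⟨h1, Or.inl h2⟩
  rcases lt_or_gt_of_ne (h.orient_ne_zero hB.1 hi hj (Ne.symm h1) hij (Ne.symm h2)) with h3 | h3
  · right
    refine ⟨h1, Or.inr ?_⟩
    unfold orient at *; linarith
  · exact Or.inl ⟨h2, Or.inr h3⟩

omit h hB in
lemma not_precedes_self {i : ℕ} : ¬ Precedes x y B i i := by
  rintro ⟨h1, h2 | h2⟩
  · exact h1 h2
  · unfold orient at h2; linarith

omit h in
open Classical in
lemma rank_lt_rank {i j : ℕ} (hi : i < n) (hj : j < n) (hij : Precedes x y B i j) :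
    rank n x y B i < rank n x y B j := by
  apply card_lt_card
  refine ssubset_iff_of_subset (fun l hl => ?_) |>.2 ⟨i, ?_, ?_⟩
  · obtain ⟨h1, h2⟩ := mem_filter.1 hl
    exact mem_filter.2 ⟨h1, precedes_trans hB (mem_range.1 h1) hi hj h2 hij⟩
  · exact mem_filter.2 ⟨mem_range.2 hi, hij⟩
  · intro hl
    exact not_precedes_self (mem_filter.1 hl).2

omit h hB in
lemma rank_lt {i : ℕ} (hi : i < n) : rank n x y B i < n := by
  classical
  have : ((range n).filter (fun j => Precedes x y B j i)) ⊂ range n := by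
    refine ssubset_iff_of_subset (filter_subset _ _) |>.2
      ⟨i, mem_range.2 hi, fun hl => not_precedes_self (mem_filter.1 hl).2⟩
  have := card_lt_card this
  rwa [card_range] at this

lemma rank_injective {i j : ℕ} (hi : i < n) (hj : j < n)
    (hr : rank n x y B i = rank n x y B j) : i = j := by
  by_contra hij
  rcases h.precedes_or hB hi hj hij with h1 | h1
  · exact absurd (rank_lt_rank hB hi hj h1) (by omega)
  · exact absurd (rank_lt_rank hB hj hi h1) (by omega)

lemma exists_rank_eq {r : ℕ} (hr : r < n) : ∃ i < n, rank n x y B i = r := by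
  have : (range n).image (rank n x y B) = range n := by
    apply eq_of_subset_of_card_le
    · intro l hl
      obtain ⟨i, hi, rfl⟩ := mem_image.1 hl
      exact mem_range.2 (rank_lt (mem_range.1 hi))
    · rw [card_image_of_injOn]
      intro i hi j hj hij
      exact h.rank_injective hB (mem_range.1 hi) (mem_range.1 hj) hij
  have hm : r ∈ (range n).image (rank n x y B) := by rw [this]; exact mem_range.2 hr
  obtain ⟨i, hi, hir⟩ := mem_image.1 hm
  exact ⟨i, mem_range.1 hi, hir⟩

omit h hB in
/-- `C` lists the points in counterclockwise order. -/
structure Ring (n : ℕ) (x y : ℕ → ℝ) (C : ℕ → ℕ) : Prop where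
  lt : ∀ i < n, C i < n
  inj : ∀ i < n, ∀ j < n, C i = C j → i = j
  conv : ∀ a b c, a < b → b < c → c < n → 0 < orient x y (C a) (C b) (C c)

lemma ring_of_rank {C : ℕ → ℕ} (hC : ∀ i < n, C (rank n x y B i) = i) : Ring n x y C := by
  have key : ∀ r < n, C r < n ∧ rank n x y B (C r) = r := by
    intro r hr
    obtain ⟨i, hi, rfl⟩ := h.exists_rank_eq hB hr
    rw [hC i hi]; exact ⟨hi, rfl⟩
  have lt : ∀ a b, a < b → b < n → Precedes x y B (C a) (C b) := by
    intro a b hab hb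
    have ka := key a (hab.trans hb)
    have kb := key b hb
    rcases h.precedes_or hB ka.1 kb.1 (fun he => by rw [he, kb.2] at ka; omega) with h1 | h1
    · exact h1
    · have := rank_lt_rank hB kb.1 ka.1 h1
      omega
  refine ⟨fun i hi => (key i hi).1, fun i hi j hj hij => ?_, fun a b c hab hbc hc => ?_⟩
  · rw [← (key i hi).2, ← (key j hj).2, hij]
  · have h1 := lt a b hab (hbc.trans hc)
    have h2 := lt b c hbc hc
    have h3 := lt a c (hab.trans hbc) hc
    have h2' := h2.2.resolve_left h1.1
    by_cases ha : C a = B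
    · rw [ha]; exact h2'
    · exact h.fan hB.1 (key a (by omega)).1 (key b (by omega)).1 (key c hc).1
        (h1.2.resolve_left ha) h2' (h3.2.resolve_left ha)

end ConvexPosition

open ConvexPosition in
lemma ConvexPosition.Ring.rotate {n : ℕ} {x y : ℕ → ℝ} {C : ℕ → ℕ} (R : Ring n x y C) {s : ℕ}
    (hs : s < n) : Ring n x y (fun i => C ((s + i) % n)) := by
  have hmod : ∀ i < n, (s + i) % n = if s + i < n then s + i else s + i - n := by
    intro i hi
    split_ifs with h
    · exact Nat.mod_eq_of_lt h
    · rw [Nat.mod_eq_sub_mod (by omega), Nat.mod_eq_of_lt (by omega)]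
  refine ⟨fun i hi => R.lt _ (Nat.mod_lt _ (by omega)), fun i hi j hj hij => ?_,
    fun a b c hab hbc hc => ?_⟩
  · have := R.inj _ (Nat.mod_lt _ (by omega)) _ (Nat.mod_lt _ (by omega)) hij
    rw [hmod i hi, hmod j hj] at this
    split_ifs at this <;> omega
  · simp only [hmod a (by omega), hmod b (by omega), hmod c hc]
    have rot : ∀ u v w, orient x y u v w = orient x y w u v := fun u v w => by unfold orient; ring
    by_cases h1 : s + a < n
    · by_cases h2 : s + b < n
      · by_cases h3 : s + c < n
        · rw [if_pos h1, if_pos h2, if_pos h3]; exact R.conv _ _ _ (by omega) (by omega) h3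
        · rw [if_pos h1, if_pos h2, if_neg h3, rot]
          exact R.conv _ _ _ (by omega) (by omega) (by omega)
      · rw [if_pos h1, if_neg h2, if_neg (by omega), rot, rot]
        exact R.conv _ _ _ (by omega) (by omega) (by omega)
    · rw [if_neg h1, if_neg (by omega), if_neg (by omega)]
      exact R.conv _ _ _ (by omega) (by omega) (by omega)

/-! ### The frame over the edge of minimum width -/

/-- Coordinates with the first point as origin and the first axis pointing to it from the last. -/
noncomputable def frameX (x y : ℕ → ℝ) (q : ℕ → ℕ) (n i : ℕ) : ℝ :=
  ((x (q i) - x (q 0)) * (x (q 0) - x (q (n - 1))) +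
    (y (q i) - y (q 0)) * (y (q 0) - y (q (n - 1)))) / √(sqDist x y (q (n - 1)) (q 0))

/-- The coordinate orthogonal to `frameX`. -/
noncomputable def frameY (x y : ℕ → ℝ) (q : ℕ → ℕ) (n i : ℕ) : ℝ :=
  ((x (q 0) - x (q (n - 1))) * (y (q i) - y (q 0)) -
    (y (q 0) - y (q (n - 1))) * (x (q i) - x (q 0))) / √(sqDist x y (q (n - 1)) (q 0))

section

variable {n : ℕ} {x y : ℕ → ℝ} {q : ℕ → ℕ}

lemma sqDist_frame (hD : 0 < sqDist x y (q (n - 1)) (q 0)) (i j : ℕ) :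
    sqDist (frameX x y q n) (frameY x y q n) i j = sqDist x y (q i) (q j) := by
  have hs2 := Real.sq_sqrt hD.le
  set s := √(sqDist x y (q (n - 1)) (q 0)) with hs
  have hs0 : 0 < s := Real.sqrt_pos.2 hD
  unfold sqDist frameX frameY
  rw [← hs, div_sub_div_same, div_sub_div_same, div_pow, div_pow, ← add_div,
    div_eq_iff (by positivity), hs2]
  unfold sqDist; ring

lemma orient_frame (hD : 0 < sqDist x y (q (n - 1)) (q 0)) (a b c : ℕ) :
    orient (frameX x y q n) (frameY x y q n) a b c = orient x y (q a) (q b) (q c) := by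
  have hs2 := Real.sq_sqrt hD.le
  set s := √(sqDist x y (q (n - 1)) (q 0)) with hs
  have hs0 : 0 < s := Real.sqrt_pos.2 hD
  unfold orient frameX frameY
  rw [← hs, div_sub_div_same, div_sub_div_same, div_sub_div_same, div_sub_div_same,
    div_mul_div_comm, div_mul_div_comm, ← sub_div, ← sq, hs2, div_eq_iff hD.ne']
  unfold sqDist; ring

lemma frame_of_ring (h : ConvexPosition n x y) (hn : 3 ≤ n) (R : ConvexPosition.Ring n x y q)
    {W : ℝ} (hW : ∀ l < n, orient x y (q (n - 1)) (q 0) (q l) ≤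
      W * √(sqDist x y (q (n - 1)) (q 0)))
    (hE : ∀ i, i + 1 < n → ∃ l < n, W * √(sqDist x y (q i) (q (i + 1))) ≤
      orient x y (q i) (q (i + 1)) (q l)) :
    Frame n (frameX x y q n) (frameY x y q n) W := by
  have hne : q (n - 1) ≠ q 0 := fun h0 => by
    have := R.inj _ (by omega) _ (by omega) h0
    omega
  have hD := h.sqDist_pos (R.lt _ (by omega)) (R.lt _ (by omega)) hne
  have hs0 := Real.sqrt_pos.2 hD
  refine ⟨fun a b c h1 h2 h3 => ?_, hn, ?_, ?_, ?_, fun i hi => ?_, fun i hi => ?_⟩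
  · rw [orient_frame hD]; exact R.conv a b c h1 h2 h3
  · simp [frameY]
  · unfold frameY; rw [div_eq_zero_iff]; left; ring
  · unfold frameX
    rw [div_lt_div_iff_of_pos_right hs0]
    unfold sqDist at hD
    linarith
  · unfold frameY
    rw [div_le_iff₀ hs0]
    have := hW i hi
    unfold orient at this
    linarith
  · obtain ⟨l, hl, h1⟩ := hE i hi
    refine ⟨l, hl, ?_⟩
    rw [orient_frame hD]
    change W * √(sqDist (frameX x y q n) (frameY x y q n) (i + 1) i) ≤ _
    rw [sqDist_comm, sqDist_frame hD]
    exact h1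

end

/-! ### Convexly independent families -/

/-- The coordinate number `c` of the point number `i` (zero if there is no such point). -/
noncomputable def coord {n : ℕ} (P : Fin n → EuclideanSpace ℝ (Fin 2)) (c : Fin 2) (i : ℕ) : ℝ :=
  if h : i < n then P ⟨i, h⟩ c else 0

lemma convexPosition_of_convexIndependent {n : ℕ} {P : Fin n → EuclideanSpace ℝ (Fin 2)}
    (h : ConvexIndependent ℝ P) : ConvexPosition n (coord P 0) (coord P 1) := by
  intro a b c e ha hb hc he hba hbc hbe u v w hu hv hw hs hx hy
  simp only [coord, ha, hb, hc, he, dite_true] at hx hy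
  have hmem : P ⟨b, hb⟩ ∈ convexHull ℝ (P '' {⟨a, ha⟩, ⟨c, hc⟩, ⟨e, he⟩}) := by
    have hP : P ⟨b, hb⟩ = u • P ⟨a, ha⟩ + v • P ⟨c, hc⟩ + w • P ⟨e, he⟩ := by
      ext i
      fin_cases i
      · simpa using hx
      · simpa using hy
    rw [hP]
    have hsub := subset_convexHull ℝ (P '' {⟨a, ha⟩, ⟨c, hc⟩, ⟨e, he⟩})
    have hconv := convex_convexHull ℝ (P '' {⟨a, ha⟩, ⟨c, hc⟩, ⟨e, he⟩})
    have m1 := hsub (Set.mem_image_of_mem P (show (⟨a, ha⟩ : Fin n) ∈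
      ({⟨a, ha⟩, ⟨c, hc⟩, ⟨e, he⟩} : Set (Fin n)) by simp))
    have m2 := hsub (Set.mem_image_of_mem P (show (⟨c, hc⟩ : Fin n) ∈
      ({⟨a, ha⟩, ⟨c, hc⟩, ⟨e, he⟩} : Set (Fin n)) by simp))
    have m3 := hsub (Set.mem_image_of_mem P (show (⟨e, he⟩ : Fin n) ∈
      ({⟨a, ha⟩, ⟨c, hc⟩, ⟨e, he⟩} : Set (Fin n)) by simp))
    have := hconv.sum_mem (t := Finset.univ) (w := ![u, v, w])
      (z := ![P ⟨a, ha⟩, P ⟨c, hc⟩, P ⟨e, he⟩]) (by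
        intro i _; fin_cases i <;> simpa) (by simp [Fin.sum_univ_three, hs]) (by
        intro i _; fin_cases i <;> simpa)
    simpa [Fin.sum_univ_three] using this
  have := h _ _ hmem
  simp only [Set.mem_insert_iff, Set.mem_singleton_iff, Fin.mk.injEq] at this
  omega

namespace Structured

/-- Sequential composition. -/
infixr:65 " ;; " => Cmd.seq

/-- The natural register `i`. -/
abbrev r (i : ℕ) : NExp := .reg i

/-- The real register `i`. -/
abbrev f (i : ℕ) : RExp := .reg i

instance : Add NExp := ⟨.add⟩
instance : Sub NExp := ⟨.sub⟩
instance (c : ℕ) : OfNat NExp c := ⟨.con c⟩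
instance : Add RExp := ⟨.add⟩
instance : Sub RExp := ⟨.sub⟩
instance : Mul RExp := ⟨.mul⟩
instance : Div RExp := ⟨.div⟩
instance (c : ℕ) : OfNat RExp c := ⟨.con c⟩

@[simp] lemma NExp.eval_add (σ : Store) (a b : NExp) : (a + b).eval σ = a.eval σ + b.eval σ := rfl
@[simp] lemma NExp.eval_sub (σ : Store) (a b : NExp) : (a - b).eval σ = a.eval σ - b.eval σ := rfl
@[simp] lemma NExp.eval_ofNat (σ : Store) (c : ℕ) : (OfNat.ofNat c : NExp).eval σ = c := rfl
@[simp] lemma RExp.eval_add (σ : Store) (a b : RExp) : (a + b).eval σ = a.eval σ + b.eval σ := rfl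
@[simp] lemma RExp.eval_sub (σ : Store) (a b : RExp) : (a - b).eval σ = a.eval σ - b.eval σ := rfl
@[simp] lemma RExp.eval_mul (σ : Store) (a b : RExp) : (a * b).eval σ = a.eval σ * b.eval σ := rfl
@[simp] lemma RExp.eval_div (σ : Store) (a b : RExp) : (a / b).eval σ = a.eval σ / b.eval σ := rfl
@[simp] lemma RExp.eval_ofNat (σ : Store) (c : ℕ) :
    (OfNat.ofNat c : RExp).eval σ = ((c : ℚ) : ℝ) := rfl

@[simp] lemma NExp.eval_zero (σ : Store) : (0 : NExp).eval σ = 0 := rfl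
@[simp] lemma NExp.eval_one (σ : Store) : (1 : NExp).eval σ = 1 := rfl
@[simp] lemma RExp.eval_zero (σ : Store) : (0 : RExp).eval σ = 0 :=
  (RExp.eval_ofNat σ 0).trans (by simp)
@[simp] lemma RExp.eval_two (σ : Store) : (2 : RExp).eval σ = 2 :=
  (RExp.eval_ofNat σ 2).trans (by simp)

namespace Cmd

@[simp] lemma eval_skip (σ : Store) : skip.eval σ = σ := rfl
@[simp] lemma eval_setV (d : ℕ) (e : NExp) (σ : Store) :
    (setV d e).eval σ = σ.setV d (e.eval σ) := rfl
@[simp] lemma eval_setX (d : ℕ) (e : RExp) (σ : Store) :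
    (setX d e).eval σ = σ.setX d (e.eval σ) := rfl
@[simp] lemma eval_stA (a : ℕ) (i e : NExp) (σ : Store) :
    (stA a i e).eval σ = σ.setA a (i.eval σ) (e.eval σ) := rfl
@[simp] lemma eval_stB (a : ℕ) (i : NExp) (e : RExp) (σ : Store) :
    (stB a i e).eval σ = σ.setB a (i.eval σ) (e.eval σ) := rfl
@[simp] lemma eval_rawSt (i e : NExp) (σ : Store) :
    (rawSt i e).eval σ = σ.setA (i.eval σ % 16) (i.eval σ / 16) (e.eval σ) := rfl
@[simp] lemma eval_seq (c₁ c₂ : Cmd) (σ : Store) : (c₁ ;; c₂).eval σ = c₂.eval (c₁.eval σ) := rfl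
@[simp] lemma eval_ifN (a b : NExp) (c₁ c₂ : Cmd) (σ : Store) :
    (ifN a b c₁ c₂).eval σ = if a.eval σ ≤ b.eval σ then c₁.eval σ else c₂.eval σ := rfl
@[simp] lemma eval_ifR (a b : RExp) (c₁ c₂ : Cmd) (σ : Store) :
    (ifR a b c₁ c₂).eval σ = if a.eval σ ≤ b.eval σ then c₁.eval σ else c₂.eval σ := rfl

end Cmd

/-- The part of the store that the program does not write is the same in both stores. -/
structure Unchanged (c : Cmd) (σ τ : Store) : Prop where
  v : ∀ i, c.mods (.v i) = false → τ.v i = σ.v i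
  x : ∀ i, c.mods (.x i) = false → τ.x i = σ.x i
  A : ∀ i, c.mods (.A i) = false → τ.A i = σ.A i
  B : ∀ i, c.mods (.B i) = false → τ.B i = σ.B i

lemma unchanged (c : Cmd) (σ : Store) : Unchanged c σ (c.eval σ) :=
  ⟨fun _ h => Cmd.same_eval h σ, fun _ h => Cmd.same_eval h σ, fun _ h => Cmd.same_eval h σ,
    fun _ h => Cmd.same_eval h σ⟩

lemma loop_induction {d b : ℕ} {body : Cmd} {σ : Store} (P : ℕ → Store → Prop) (h0 : P 0 σ)
    (hs : ∀ i < σ.v b, ∀ τ, Unchanged (.loop d b body) σ τ → P i τ →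
      P (i + 1) (body.eval (τ.setV d i))) :
    P (σ.v b) ((Cmd.loop d b body).eval σ) := by
  refine (iter_induction (fun i τ => Unchanged (.loop d b body) σ τ ∧ P i τ)
    ⟨⟨fun _ _ => rfl, fun _ _ => rfl, fun _ _ => rfl, fun _ _ => rfl⟩, h0⟩
    fun i hi τ hτ => ⟨?_, hs i hi τ hτ.1 hτ.2⟩).2
  obtain ⟨⟨h1, h2, h3, h4⟩, -⟩ := hτ
  have hu := unchanged body (τ.setV d i)
  refine ⟨fun j hj => ?_, fun j hj => ?_, fun j hj => ?_, fun j hj => ?_⟩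
  · have hj' := hj
    simp only [Cmd.mods, Bool.or_eq_false_iff, beq_eq_false_iff_ne] at hj'
    rw [hu.v j hj'.2, Store.setV_v, if_neg (Ne.symm hj'.1), h1 j hj]
  · rw [hu.x j hj, Store.setV_x, h2 j hj]
  · rw [hu.A j hj, Store.setV_A, h3 j hj]
  · rw [hu.B j hj, Store.setV_B, h4 j hj]

/-! ### Reading the input and simple tables -/

/-- Doubles register 11 and counts this in register 12 unless register 11 has reached
register 10. -/
def double : Cmd := .ifN (r 10) (r 11) .skip (.setV 11 (r 11 + r 11) ;; .setV 12 (r 12 + 1))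

/-- Computes the square of `n` and the least power of two that is no smaller. -/
def sizes : Cmd :=
  .setV 10 0 ;; .loop 13 0 (.setV 10 (r 10 + r 0)) ;; .setV 11 1 ;; .setV 12 0 ;;
    .loop 13 0 double ;; double

/-- Puts the loop bounds into place. -/
def bounds : Cmd := .setV 2 (r 0 + 1) ;; .setV 3 (r 11) ;; .setV 4 (r 12) ;; .setV 5 (r 10)

lemma sizes_spec (σ : Store) :
    let n := σ.v 0
    let τ := sizes.eval σ
    τ.v 10 = n * n ∧ τ.v 11 = 2 ^ τ.v 12 ∧ n * n ≤ τ.v 11 ∧ τ.v 11 ≤ max 1 (2 * (n * n)) := by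
  intro n τ
  have h1 : ((Cmd.loop 13 0 (.setV 10 (r 10 + r 0))).eval (σ.setV 10 0)).v 10 = n * n := by
    refine loop_induction (fun i τ => τ.v 10 = i * n) (by simp) fun i _ τ hu h => ?_
    have := hu.v 0 rfl
    simp at this
    simp [Cmd.eval, h, this]; ring
  set σ₁ := (Cmd.loop 13 0 (.setV 10 (r 10 + r 0))).eval (σ.setV 10 0) with hσ₁
  have h0 : σ₁.v 0 = n := by
    have := (unchanged (Cmd.loop 13 0 (.setV 10 (r 10 + r 0))) (σ.setV 10 0)).v 0 rfl
    simpa using this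
  have hdouble : ∀ (i : ℕ) (τ : Store), τ.v 10 = n * n →
      (τ.v 11 = 2 ^ τ.v 12 ∧ (n * n ≤ τ.v 11 ∨ τ.v 12 = i) ∧ τ.v 11 ≤ max 1 (2 * (n * n))) →
      ((double.eval τ).v 11 = 2 ^ (double.eval τ).v 12 ∧
        (n * n ≤ (double.eval τ).v 11 ∨ (double.eval τ).v 12 = i + 1) ∧
        (double.eval τ).v 11 ≤ max 1 (2 * (n * n))) := by
    intro i τ h10 ⟨g1, g2, g3⟩
    by_cases hc : n * n ≤ τ.v 11
    · have e : double.eval τ = τ := by simp [double, Cmd.eval, h10, hc]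
      rw [e]
      exact ⟨g1, Or.inl hc, g3⟩
    · have e : τ.v 12 = i := g2.resolve_left hc
      simp only [double, Cmd.eval, NExp.eval, h10, hc, if_false, Store.setV_v]
      simp only [Nat.reduceEqDiff, if_false, if_true]
      refine ⟨by rw [g1, pow_succ]; ring, Or.inr (by rw [e]), by omega⟩
  set σ₂ := (σ₁.setV 11 1).setV 12 0 with hσ₂
  have h2 := loop_induction (d := 13) (b := 0) (body := double) (σ := σ₂)
    (fun i τ => τ.v 11 = 2 ^ τ.v 12 ∧ (n * n ≤ τ.v 11 ∨ τ.v 12 = i) ∧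
      τ.v 11 ≤ max 1 (2 * (n * n))) (by simp [hσ₂]) (fun i _ τ hu h => by
      have h10 : τ.v 10 = n * n := by rw [hu.v 10 rfl, hσ₂]; simpa using h1
      exact hdouble i (τ.setV 13 i) (by simpa using h10) (by simpa using h))
  have hn2 : σ₂.v 0 = n := by rw [hσ₂]; simpa using h0
  rw [hn2] at h2
  have h10 : ((Cmd.loop 13 0 double).eval σ₂).v 10 = n * n := by
    rw [(unchanged (Cmd.loop 13 0 double) σ₂).v 10 rfl, hσ₂]; simpa using h1
  have h3 := hdouble n _ h10 h2
  have hτ : τ = double.eval ((Cmd.loop 13 0 double).eval σ₂) := rfl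
  rw [← hτ] at h3
  refine ⟨by rw [hτ, (unchanged double _).v 10 rfl, h10], h3.1, ?_, h3.2.2⟩
  rcases h3.2.1 with h4 | h4
  · exact h4
  · rw [h3.1, h4]
    clear * -
    induction n with
    | zero => simp
    | succ m ih =>
      rw [pow_succ]
      rcases Nat.lt_or_ge m 3 with h | h
      · interval_cases m <;> norm_num
      · nlinarith

/-- Moves the input into two arrays, beginning with the last point. -/
def copyIn : Cmd := .loop 13 0 (.setV 14 (r 0 - 1 - r 13) ;; .setX 10 (.raw (r 14 + r 14)) ;;
  .setX 11 (.raw (r 14 + r 14 + 1)) ;; .stB 0 (r 14) (f 10) ;; .stB 1 (r 14) (f 11))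

lemma copyIn_spec (σ : Store) (x y : ℕ → ℝ)
    (hx : ∀ i < σ.v 0, σ.B ((i + i) % 16) ((i + i) / 16) = x i)
    (hy : ∀ i < σ.v 0, σ.B ((i + i + 1) % 16) ((i + i + 1) / 16) = y i) :
    ∀ i < σ.v 0, (copyIn.eval σ).B 0 i = x i ∧ (copyIn.eval σ).B 1 i = y i := by
  have := loop_induction (d := 13) (b := 0) (body := .setV 14 (r 0 - 1 - r 13) ;;
    .setX 10 (.raw (r 14 + r 14)) ;; .setX 11 (.raw (r 14 + r 14 + 1)) ;;
    .stB 0 (r 14) (f 10) ;; .stB 1 (r 14) (f 11)) (σ := σ)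
    (fun s τ => (∀ i < σ.v 0, σ.v 0 - s ≤ i → τ.B 0 i = x i ∧ τ.B 1 i = y i) ∧
      ∀ i, i < σ.v 0 - s → τ.B ((i + i) % 16) ((i + i) / 16) = x i ∧
        τ.B ((i + i + 1) % 16) ((i + i + 1) / 16) = y i)
    ⟨fun i hi h => by omega, fun i hi => ⟨hx i (by omega), hy i (by omega)⟩⟩ (by
    intro s hs τ hu ⟨h1, h2⟩
    have h0 := hu.v 0 rfl
    obtain ⟨a1, a2⟩ := h2 (σ.v 0 - 1 - s) (by omega)
    constructor
    · intro i hi hi'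
      simp [Cmd.eval, h0, a1, a2]
      by_cases h : i = σ.v 0 - 1 - s
      · simp [h]
      · simp only [h, if_false]
        exact h1 i hi (by omega)
    · intro i hi
      have := h2 i (by omega)
      simp [Cmd.eval, h0, a1, a2]
      constructor
      · rw [if_neg (by omega), if_neg (by omega)]; exact this.1
      · rw [if_neg (by omega), if_neg (by omega)]; exact this.2)
  intro i hi
  exact this.1 i hi (by omega)

/-- Computes the offsets of the rows of tables with `n + 1` columns. -/
def rows : Cmd := .setV 14 0 ;; .loop 13 0 (.stA 0 (r 13) (r 14) ;; .setV 14 (r 14 + r 2))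

lemma rows_spec (σ : Store) (hS : σ.v 2 = σ.v 0 + 1) :
    ∀ i < σ.v 0, (rows.eval σ).A 0 i = i * (σ.v 0 + 1) := by
  have := loop_induction (d := 13) (b := 0) (body := .stA 0 (r 13) (r 14) ;;
    .setV 14 (r 14 + r 2)) (σ := σ.setV 14 0)
    (fun s τ => τ.v 14 = s * (σ.v 0 + 1) ∧ ∀ i < s, τ.A 0 i = i * (σ.v 0 + 1)) (by simp) (by
    intro s hs τ hu ⟨h1, h2⟩
    have h0 := hu.v 2 rfl
    simp [hS] at h0
    simp [Cmd.eval, h0, h1]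
    refine ⟨by ring, fun i hi => ?_⟩
    by_cases h : i = s
    · simp [h]
    · simp only [h, if_false]; exact h2 i (by omega))
  simpa [rows, Cmd.eval] using this.2

/-- Finds the lowest point. -/
def lowest : Cmd := .setV 15 0 ;; .loop 13 0 (
  .ifR (.ld 1 (r 15)) (.ld 1 (r 13))
    (.ifR (.ld 1 (r 13)) (.ld 1 (r 15))
      (.ifR (.ld 0 (r 15)) (.ld 0 (r 13)) .skip (.setV 15 (r 13))) .skip)
    (.setV 15 (r 13)))

lemma lowest_spec (σ : Store) (hn : 0 < σ.v 0)
    (h : ConvexPosition (σ.v 0) (σ.B 0) (σ.B 1)) :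
    ConvexPosition.Lowest (σ.v 0) (σ.B 0) (σ.B 1) ((lowest.eval σ).v 15) := by
  have := loop_induction (d := 13) (b := 0) (body := .ifR (.ld 1 (r 15)) (.ld 1 (r 13))
    (.ifR (.ld 1 (r 13)) (.ld 1 (r 15))
      (.ifR (.ld 0 (r 15)) (.ld 0 (r 13)) .skip (.setV 15 (r 13))) .skip)
    (.setV 15 (r 13))) (σ := σ.setV 15 0)
    (fun s τ => τ.v 15 < σ.v 0 ∧ ∀ i < s, σ.B 1 (τ.v 15) < σ.B 1 i ∨
      (σ.B 1 (τ.v 15) = σ.B 1 i ∧ σ.B 0 (τ.v 15) ≤ σ.B 0 i)) (by simpa) (by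
    intro s hs τ hu ⟨h1, h2⟩
    have hs' : s < σ.v 0 := by simpa using hs
    have b0 := hu.B 0 rfl
    have b1 := hu.B 1 rfl
    simp only [Store.setV_B] at b0 b1
    simp only [Cmd.eval, RExp.eval, NExp.eval, Store.setV_B, Store.setV_v, b0, b1]
    simp only [Nat.reduceEqDiff, if_false, if_true]
    split_ifs with c1 c2 c3
    · refine ⟨by simpa using h1, fun i hi => ?_⟩
      simp only [Store.setV_v, Nat.reduceEqDiff, if_false]
      rcases Nat.lt_succ_iff_lt_or_eq.1 hi with hi | rfl
      · exact h2 i hi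
      · exact Or.inr ⟨le_antisymm c1 c2, c3⟩
    · refine ⟨by simpa using hs', fun i hi => ?_⟩
      simp only [Store.setV_v, if_true]
      rcases Nat.lt_succ_iff_lt_or_eq.1 hi with hi | rfl
      · rcases h2 i hi with h3 | h3
        · left; linarith
        · right; exact ⟨by linarith, by linarith⟩
      · exact Or.inr ⟨rfl, le_rfl⟩
    · refine ⟨by simpa using h1, fun i hi => ?_⟩
      simp only [Store.setV_v, Nat.reduceEqDiff, if_false]
      rcases Nat.lt_succ_iff_lt_or_eq.1 hi with hi | rfl
      · exact h2 i hi
      · exact Or.inl (not_le.1 c2)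
    · refine ⟨by simpa using hs', fun i hi => ?_⟩
      simp only [Store.setV_v, if_true]
      rcases Nat.lt_succ_iff_lt_or_eq.1 hi with hi | rfl
      · rcases h2 i hi with h3 | h3 <;> left <;> linarith
      · exact Or.inr ⟨rfl, le_rfl⟩)
  obtain ⟨h1, h2⟩ := this
  refine ⟨h1, fun j hj hne => ?_⟩
  rcases h2 j (by simpa using hj) with h3 | ⟨h3, h4⟩
  · exact Or.inl h3
  · refine Or.inr ⟨h3, lt_of_le_of_ne h4 fun h5 => ?_⟩
    exact h.injective h1 hj (Ne.symm hne) h5 h3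

/-! ### The cyclic order and the frame -/

/-- Twice the signed area of a triangle of input points. -/
def orientE (a b c : NExp) : RExp :=
  (.ld 0 b - .ld 0 a) * (.ld 1 c - .ld 1 a) - (.ld 1 b - .ld 1 a) * (.ld 0 c - .ld 0 a)

/-- The squared distance of two input points. -/
def distE (a b : NExp) : RExp :=
  (.ld 0 a - .ld 0 b) * (.ld 0 a - .ld 0 b) + (.ld 1 a - .ld 1 b) * (.ld 1 a - .ld 1 b)

@[simp] lemma eval_orientE (σ : Store) (a b c : NExp) :
    (orientE a b c).eval σ = orient (σ.B 0) (σ.B 1) (a.eval σ) (b.eval σ) (c.eval σ) := rfl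

@[simp] lemma eval_distE (σ : Store) (a b : NExp) :
    (distE a b).eval σ = sqDist (σ.B 0) (σ.B 1) (a.eval σ) (b.eval σ) := by
  simp [distE, sqDist, sq]

/-- Test for equality. -/
def ifEq (a b : NExp) (c₁ c₂ : Cmd) : Cmd := .ifN a b (.ifN b a c₁ c₂) c₂

lemma eval_ifEq (a b : NExp) (c₁ c₂ : Cmd) (σ : Store) :
    (ifEq a b c₁ c₂).eval σ = if a.eval σ = b.eval σ then c₁.eval σ else c₂.eval σ := by
  simp only [ifEq, Cmd.eval]
  split_ifs <;> first | rfl | omega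

/-- Counts in register 14 whether point number register 16 precedes point number register 13. -/
def countOne : Cmd := ifEq (r 16) (r 15) (.setV 14 (r 14 + 1))
  (.ifR (orientE (r 15) (r 16) (r 13)) 0 .skip (.setV 14 (r 14 + 1)))

/-- Computes in register 14 the rank of point number register 13. -/
def countAll : Cmd := .setV 14 0 ;; ifEq (r 13) (r 15) .skip (.loop 16 0 countOne)

/-- Sorts the points by angle about the lowest one. -/
def ranks : Cmd := .loop 13 0 (countAll ;; .stA 1 (r 14) (r 13))

open ConvexPosition in
lemma countAll_spec (σ : Store) :
    (countAll.eval σ).v 14 = rank (σ.v 0) (σ.B 0) (σ.B 1) (σ.v 15) (σ.v 13) := by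
  classical
  simp only [countAll, Cmd.eval_seq, Cmd.eval_setV, Cmd.eval_skip, eval_ifEq, NExp.eval,
    Store.setV_v,
    Nat.reduceEqDiff, if_false]
  split_ifs with h
  · simp only [Store.setV_v, if_true, rank]
    symm
    rw [Finset.card_eq_zero, Finset.filter_eq_empty_iff]
    intro j _ hj
    exact hj.1 h
  · have := loop_induction (d := 16) (b := 0) (body := countOne) (σ := σ.setV 14 0)
      (fun s τ => τ.v 14 = ((Finset.range s).filter
        (fun j => Precedes (σ.B 0) (σ.B 1) (σ.v 15) j (σ.v 13))).card) (by simp) (by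
      intro s hs τ hu h1
      have b0 := hu.B 0 rfl
      have b1 := hu.B 1 rfl
      have v15 := hu.v 15 rfl
      have v13 := hu.v 13 rfl
      simp only [Store.setV_B, Store.setV_v, Nat.reduceEqDiff, if_false] at b0 b1 v15 v13
      rw [Finset.range_add_one, Finset.filter_insert]
      have hP : Precedes (σ.B 0) (σ.B 1) (σ.v 15) s (σ.v 13) ↔
          (s = σ.v 15 ∨ 0 < orient (σ.B 0) (σ.B 1) (σ.v 15) s (σ.v 13)) := by
        simp [Precedes, h]
      simp only [countOne, eval_ifEq, Cmd.eval, NExp.eval, Store.setV_v, eval_orientE, b0, b1,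
        Store.setV_B, RExp.eval_zero, v15, v13, Nat.reduceEqDiff, if_false, if_true,
        hP]
      have hc : (insert s ((Finset.range s).filter
        (fun j => Precedes (σ.B 0) (σ.B 1) (σ.v 15) j (σ.v 13)))).card = τ.v 14 + 1 := by
        rw [Finset.card_insert_of_notMem (by simp), h1]
      by_cases c1 : s = σ.v 15
      · rw [if_pos c1, if_pos (Or.inl c1), hc]; simp
      · by_cases c2 : orient (σ.B 0) (σ.B 1) (σ.v 15) s (σ.v 13) ≤ 0
        · rw [if_neg c1, if_pos c2, if_neg (by rintro (h | h); exacts [c1 h, not_lt.2 c2 h])]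
          simp [h1]
        · rw [if_neg c1, if_neg c2, if_pos (Or.inr (not_le.1 c2)), hc]; simp)
    exact this

open ConvexPosition in
lemma ranks_spec (σ : Store) (h : ConvexPosition (σ.v 0) (σ.B 0) (σ.B 1))
    (hB : Lowest (σ.v 0) (σ.B 0) (σ.B 1) (σ.v 15)) :
    Ring (σ.v 0) (σ.B 0) (σ.B 1) ((ranks.eval σ).A 1) := by
  refine h.ring_of_rank hB ?_
  refine loop_induction (d := 13) (b := 0) (σ := σ) (fun s τ => ∀ i < s,
    τ.A 1 (rank (σ.v 0) (σ.B 0) (σ.B 1) (σ.v 15) i) = i) (by simp) (fun s hs τ hu h1 => ?_)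
  have b0 := hu.B 0 rfl
  have b1 := hu.B 1 rfl
  have v15 := hu.v 15 rfl
  have v0 := hu.v 0 rfl
  have hc := countAll_spec (τ.setV 13 s)
  have hA := (unchanged countAll (τ.setV 13 s)).A 1 rfl
  have h13 := (unchanged countAll (τ.setV 13 s)).v 13 rfl
  rw [Cmd.eval_seq, Cmd.eval_stA]
  simp only [Store.setA_A, NExp.eval, hc, hA, h13]
  simp only [Store.setV_v, Store.setV_B, Store.setV_A, b0, b1, v15, v0, Nat.reduceEqDiff, if_false,
    if_true, true_and]
  intro i hi
  split_ifs with h2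
  · exact h.rank_injective hB (by omega) hs h2 |>.symm
  · rcases Nat.lt_succ_iff_lt_or_eq.1 hi with hi | rfl
    · exact h1 i hi
    · exact absurd rfl h2

/-- Puts the ends of the edge that begins with vertex number register 13 into registers 14
and 18. -/
def edge : Cmd := .setV 14 (.ld 1 (r 13)) ;; .setV 16 (r 13 + 1) ;;
  .ifN (r 0) (r 16) (.setV 16 0) .skip ;; .setV 18 (.ld 1 (r 16)) ;; .setX 10 0

/-- Computes in real register 10 the width of the polygon over the edge that begins with vertex
number register 13. -/
def widthOne : Cmd := edge ;; .loop 19 0 (.setX 11 (orientE (r 14) (r 18) (r 19)) ;;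
  .ifR (f 11) (f 10) .skip (.setX 10 (f 11))) ;; .setX 10 (f 10 / .sqrt (distE (r 14) (r 18)))

/-- Keeps the smallest width found so far, and its edge. -/
def keepWidth : Cmd := .setX 12 (f 10) ;; .setV 17 (r 13)

/-- Finds the edge of minimum width. -/
def widths : Cmd := .loop 13 0 (widthOne ;;
  .ifN (r 13) 0 keepWidth (.ifR (f 12) (f 10) .skip keepWidth))

lemma mod_succ {i n : ℕ} (h : i < n) : (i + 1) % n = if n ≤ i + 1 then 0 else i + 1 := by
  split_ifs with h1
  · rw [show i + 1 = n by omega, Nat.mod_self]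
  · exact Nat.mod_eq_of_lt (by omega)

lemma widthOne_spec (σ : Store) (C : ℕ → ℕ) (hA : σ.A 1 = C)
    (hR : ConvexPosition.Ring (σ.v 0) (σ.B 0) (σ.B 1) C)
    (hP : ConvexPosition (σ.v 0) (σ.B 0) (σ.B 1)) (h3 : 3 ≤ σ.v 0) (h13 : σ.v 13 < σ.v 0) :
    let a := C (σ.v 13)
    let b := C ((σ.v 13 + 1) % σ.v 0)
    let W := (widthOne.eval σ).x 10
    (∀ l < σ.v 0, orient (σ.B 0) (σ.B 1) a b l ≤ W * √(sqDist (σ.B 0) (σ.B 1) a b)) ∧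
      ∃ l < σ.v 0, W * √(sqDist (σ.B 0) (σ.B 1) a b) ≤ orient (σ.B 0) (σ.B 1) a b l := by
  intro a b W
  have hu := unchanged edge σ
  set σ₁ := edge.eval σ with hσ₁
  have v0 := hu.v 0 rfl
  have b0 := hu.B 0 rfl
  have b1 := hu.B 1 rfl
  have v14 : σ₁.v 14 = a := by
    by_cases h : σ.v 0 ≤ σ.v 13 + 1 <;> simp [hσ₁, edge, hA, a, h]
  have v18 : σ₁.v 18 = b := by
    have := mod_succ h13
    simp only [b, this, ← hA]
    by_cases h : σ.v 0 ≤ σ.v 13 + 1 <;> simp [hσ₁, edge, h]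
  have x10 : σ₁.x 10 = 0 := by simp [hσ₁, edge]
  have haa : orient (σ.B 0) (σ.B 1) a b a = 0 := by unfold orient; ring
  have ha : a < σ.v 0 := hR.lt _ h13
  have hb : b < σ.v 0 := hR.lt _ (Nat.mod_lt _ (by omega))
  have hab : a ≠ b := fun h => by
    have h1 := hR.inj _ h13 _ (Nat.mod_lt _ (by omega)) h
    rw [mod_succ h13] at h1
    split_ifs at h1 <;> omega
  have hs := Real.sqrt_pos.2 (hP.sqDist_pos ha hb hab)
  set body := (Cmd.setX 11 (orientE (r 14) (r 18) (r 19)) ;;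
    .ifR (f 11) (f 10) .skip (.setX 10 (f 11))) with hbody
  have hloop := loop_induction (d := 19) (b := 0) (body := body) (σ := σ₁)
    (fun s τ => (∀ l < s, orient (σ.B 0) (σ.B 1) a b l ≤ τ.x 10) ∧
      ∃ l < σ.v 0, τ.x 10 = orient (σ.B 0) (σ.B 1) a b l)
    ⟨by simp, a, ha, by rw [haa, x10]⟩ (by
    intro s hs τ hu ⟨h1, l₀, hl₀, h2⟩
    have e14 := hu.v 14 rfl
    have e18 := hu.v 18 rfl
    have c0 := hu.B 0 rfl
    have c1 := hu.B 1 rfl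
    rw [v14] at e14
    rw [v18] at e18
    rw [b0] at c0
    rw [b1] at c1
    simp only [hbody, Cmd.eval, eval_orientE, NExp.eval, RExp.eval, Store.setV_v, Store.setV_B, c0,
      c1, e14, e18, Nat.reduceEqDiff, if_false, if_true, Store.setX_x, Store.setV_x]
    split_ifs with h3
    · simp only [Store.setX_x, Nat.reduceEqDiff, if_false, Store.setV_x]
      refine ⟨fun l hl => ?_, l₀, hl₀, h2⟩
      rcases Nat.lt_succ_iff_lt_or_eq.1 hl with hl | rfl
      · exact h1 l hl
      · exact h3
    · simp only [Store.setX_x, if_true]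
      refine ⟨fun l hl => ?_, s, by rwa [v0] at hs, rfl⟩
      rcases Nat.lt_succ_iff_lt_or_eq.1 hl with hl | rfl
      · exact (h1 l hl).trans (not_le.1 h3).le
      · exact le_rfl)
  have hu2 := unchanged (Cmd.loop 19 0 body) σ₁
  set σ₂ := (Cmd.loop 19 0 body).eval σ₁ with hσ₂
  have hW : W = σ₂.x 10 / √(sqDist (σ.B 0) (σ.B 1) a b) := by
    have : W = ((Cmd.setX 10 (f 10 / .sqrt (distE (r 14) (r 18)))).eval σ₂).x 10 := rfl
    rw [this]
    simp only [Cmd.eval, Store.setX_x, if_true, RExp.eval_div, RExp.eval, eval_distE, NExp.eval,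
      hu2.v 14 rfl, hu2.v 18 rfl, hu2.B 0 rfl, hu2.B 1 rfl, v14, v18, b0, b1]
  rw [hW, div_mul_cancel₀ _ hs.ne']
  obtain ⟨g1, l₀, g2, g3⟩ := hloop
  rw [v0] at g1
  exact ⟨g1, l₀, g2, g3.le⟩

lemma widths_spec (σ : Store) (C : ℕ → ℕ) (hA : σ.A 1 = C)
    (hR : ConvexPosition.Ring (σ.v 0) (σ.B 0) (σ.B 1) C)
    (hP : ConvexPosition (σ.v 0) (σ.B 0) (σ.B 1)) (h3 : 3 ≤ σ.v 0) :
    let m := (widths.eval σ).v 17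
    let o := fun e => orient (σ.B 0) (σ.B 1) (C e) (C ((e + 1) % σ.v 0))
    let u := fun e => √(sqDist (σ.B 0) (σ.B 1) (C e) (C ((e + 1) % σ.v 0)))
    m < σ.v 0 ∧ ∃ W : ℝ, (∀ l < σ.v 0, o m l ≤ W * u m) ∧
      ∀ e < σ.v 0, ∃ l < σ.v 0, W * u e ≤ o e l := by
  intro m o u
  have key := loop_induction (d := 13) (b := 0) (body := widthOne ;;
    .ifN (r 13) 0 keepWidth (.ifR (f 12) (f 10) .skip keepWidth)) (σ := σ)
    (fun s τ => (s = 0 ∨ τ.v 17 < σ.v 0 ∧ ∀ l < σ.v 0, o (τ.v 17) l ≤ τ.x 12 * u (τ.v 17)) ∧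
      ∀ e < s, ∃ l < σ.v 0, τ.x 12 * u e ≤ o e l) (by simp) (by
    intro s hs τ hu ⟨h1, h2⟩
    have v0 := hu.v 0 rfl
    have b0 := hu.B 0 rfl
    have b1 := hu.B 1 rfl
    have a1 := hu.A 1 rfl
    have hw := widthOne_spec (τ.setV 13 s) C (by simpa [a1] using hA)
      (by simpa [v0, b0, b1] using hR) (by simpa [v0, b0, b1] using hP) (by simpa [v0] using h3)
      (by simpa [v0] using hs)
    have hu1 := unchanged widthOne (τ.setV 13 s)
    have u13 := hu1.v 13 rfl
    have u17 := hu1.v 17 rfl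
    have u12 := hu1.x 12 rfl
    rw [Cmd.eval]
    set τ₁ := widthOne.eval (τ.setV 13 s)
    simp only [Store.setV_v, Store.setV_B, v0, b0, b1, if_true, Nat.reduceEqDiff, if_false,
      Store.setV_x] at hw u13 u17 u12
    obtain ⟨w1, l₀, hl₀, w2⟩ := hw
    simp only [Cmd.eval_ifN, Cmd.eval_ifR, Cmd.eval_skip, NExp.eval, RExp.eval, u13, u12]
    have keep : (s = 0 ∨ τ₁.x 10 ≤ τ.x 12) → ((False ∨ (keepWidth.eval τ₁).v 17 < σ.v 0 ∧
      ∀ l < σ.v 0, o ((keepWidth.eval τ₁).v 17) l ≤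
        (keepWidth.eval τ₁).x 12 * u ((keepWidth.eval τ₁).v 17)) ∧
      ∀ e < s + 1, ∃ l < σ.v 0, (keepWidth.eval τ₁).x 12 * u e ≤ o e l) := by
      intro hle
      have k17 : (keepWidth.eval τ₁).v 17 = s := by simp [keepWidth, Cmd.eval, u13]
      have k12 : (keepWidth.eval τ₁).x 12 = τ₁.x 10 := by simp [keepWidth, Cmd.eval]
      rw [k17, k12]
      refine ⟨Or.inr ⟨hs, w1⟩, fun e he => ?_⟩
      rcases Nat.lt_succ_iff_lt_or_eq.1 he with he | rfl
      · obtain ⟨l, hl, h4⟩ := h2 e he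
        refine ⟨l, hl, le_trans (mul_le_mul_of_nonneg_right ?_ (Real.sqrt_nonneg _)) h4⟩
        exact hle.resolve_left (by omega)
      · exact ⟨l₀, hl₀, w2⟩
    split_ifs with c1 c2
    · exact keep (Or.inl (by omega))
    · rw [u17, u12]
      refine ⟨Or.inr (h1.resolve_left (by omega)), fun e he => ?_⟩
      rcases Nat.lt_succ_iff_lt_or_eq.1 he with he | rfl
      · exact h2 e he
      · exact ⟨l₀, hl₀, (mul_le_mul_of_nonneg_right c2 (Real.sqrt_nonneg _)).trans w2⟩
    · exact keep (Or.inr (not_le.1 c2).le))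
  obtain ⟨h1, h2⟩ := key
  have h1' := h1.resolve_left (by omega)
  exact ⟨h1'.1, _, h1'.2, h2⟩

/-- Puts into register 16 the vertex after vertex number register `i`. -/
def turn (i : ℕ) : Cmd := .setV 16 (r i + 1) ;; .ifN (r 0) (r 16) (.setV 16 0) .skip

/-- Numbers the vertices from the right end of the base. -/
def rotate : Cmd := turn 17 ;; .loop 13 0 (.stA 2 (r 13) (.ld 1 (r 16)) ;; turn 16)

lemma rotate_spec (σ : Store) (h17 : σ.v 17 < σ.v 0) :
    ∀ i < σ.v 0, (rotate.eval σ).A 2 i = σ.A 1 (((σ.v 17 + 1) % σ.v 0 + i) % σ.v 0) := by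
  have hn : 0 < σ.v 0 := by omega
  set s₀ := (σ.v 17 + 1) % σ.v 0 with hs₀
  have hu1 := unchanged (turn 17) σ
  set σ₁ := (turn 17).eval σ with hσ₁
  have v16 : σ₁.v 16 = s₀ := by
    rw [hs₀, mod_succ h17]
    by_cases h : σ.v 0 ≤ σ.v 17 + 1 <;> simp [hσ₁, turn, h]
  have v0 := hu1.v 0 rfl
  have key := loop_induction (d := 13) (b := 0) (body := .stA 2 (r 13) (.ld 1 (r 16)) ;;
    turn 16) (σ := σ₁)
    (fun s τ => τ.v 16 = (s₀ + s) % σ.v 0 ∧ ∀ i < s, τ.A 2 i = σ.A 1 ((s₀ + i) % σ.v 0))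
    ⟨by rw [v16, add_zero, Nat.mod_eq_of_lt (Nat.mod_lt _ hn)], by simp⟩ (by
    intro s hs τ hu ⟨h1, h2⟩
    have e0 := hu.v 0 rfl
    have e1 := hu.A 1 rfl
    rw [v0] at e0
    rw [hu1.A 1 rfl] at e1
    have hlt : τ.v 16 < σ.v 0 := by rw [h1]; exact Nat.mod_lt _ hn
    constructor
    · rw [show s₀ + (s + 1) = s₀ + s + 1 by omega, Nat.add_mod_eq_add_mod_right 1
        (Nat.mod_mod (s₀ + s) (σ.v 0)).symm, ← h1, mod_succ hlt]
      by_cases h : σ.v 0 ≤ τ.v 16 + 1 <;> simp [turn, e0, h]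
    · rw [Cmd.eval_seq, (unchanged (turn 16) _).A 2 rfl]
      intro i hi
      simp only [Cmd.eval, NExp.eval, Store.setA_A, Store.setV_v, Store.setV_A, Nat.reduceEqDiff,
        if_false, if_true, true_and, e1, h1]
      split_ifs with h3
      · rw [h3]
      · exact h2 i (by omega))
  rw [v0] at key
  exact key.2

open Split Scan

/-! ### Coordinates, heights and distances -/

/-- Computes the coordinates of one vertex with respect to the base. -/
def frameOne : Cmd := .setV 18 (.ld 2 (r 13)) ;; .setX 13 (.ld 0 (r 18) - .ld 0 (r 14)) ;;
  .setX 14 (.ld 1 (r 18) - .ld 1 (r 14)) ;;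
  .stB 2 (r 13) ((f 13 * f 11 + f 14 * f 12) / f 10) ;;
  .stB 3 (r 13) ((f 11 * f 14 - f 12 * f 13) / f 10)

/-- Prepares the computation of the coordinates. -/
def frameInit : Cmd := .setV 14 (.ld 2 0) ;; .setV 16 (.ld 2 (r 0 - 1)) ;;
  .setX 10 (.sqrt (distE (r 16) (r 14))) ;; .setX 11 (.ld 0 (r 14) - .ld 0 (r 16)) ;;
  .setX 12 (.ld 1 (r 14) - .ld 1 (r 16))

/-- Computes the coordinates of the vertices with respect to the base. -/
def frame : Cmd := frameInit ;; .loop 13 0 frameOne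

lemma frame_spec (σ : Store) : ∀ i < σ.v 0,
    (frame.eval σ).B 2 i = frameX (σ.B 0) (σ.B 1) (σ.A 2) (σ.v 0) i ∧
    (frame.eval σ).B 3 i = frameY (σ.B 0) (σ.B 1) (σ.A 2) (σ.v 0) i := by
  have hu1 := unchanged frameInit σ
  have e14 : (frameInit.eval σ).v 14 = σ.A 2 0 := by simp [frameInit]
  have e10 : (frameInit.eval σ).x 10 =
      √(sqDist (σ.B 0) (σ.B 1) (σ.A 2 (σ.v 0 - 1)) (σ.A 2 0)) := by simp [frameInit]
  have e11 : (frameInit.eval σ).x 11 = σ.B 0 (σ.A 2 0) - σ.B 0 (σ.A 2 (σ.v 0 - 1)) := by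
    simp [frameInit]
  have e12 : (frameInit.eval σ).x 12 = σ.B 1 (σ.A 2 0) - σ.B 1 (σ.A 2 (σ.v 0 - 1)) := by
    simp [frameInit]
  have key := loop_induction (d := 13) (b := 0) (body := frameOne) (σ := frameInit.eval σ)
    (fun s τ => ∀ i < s, τ.B 2 i = frameX (σ.B 0) (σ.B 1) (σ.A 2) (σ.v 0) i ∧
      τ.B 3 i = frameY (σ.B 0) (σ.B 1) (σ.A 2) (σ.v 0) i) (by simp) (by
    intro s hs τ hu h i hi
    have v14 := (hu.v 14 rfl).trans e14
    have x10 := (hu.x 10 rfl).trans e10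
    have x11 := (hu.x 11 rfl).trans e11
    have x12 := (hu.x 12 rfl).trans e12
    have b0 := (hu.B 0 rfl).trans (hu1.B 0 rfl)
    have b1 := (hu.B 1 rfl).trans (hu1.B 1 rfl)
    have a2 := (hu.A 2 rfl).trans (hu1.A 2 rfl)
    by_cases hi' : i = s
    · subst hi'
      simp [frameOne, v14, x10, x11, x12, b0, b1, a2, frameX, frameY]
    · have := h i (by omega)
      simpa [frameOne, hi'] using this)
  rw [hu1.v 0 rfl] at key
  exact key

/-- Finds the last highest vertex. -/
def top : Cmd := .setV 10 0 ;;
  .loop 13 0 (.ifR (.ld 3 (r 10)) (.ld 3 (r 13)) (.setV 10 (r 13)) .skip)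

lemma top_spec (σ : Store) (hn : 0 < σ.v 0) :
    Frame.Top (σ.v 0) (σ.B 3) ((top.eval σ).v 10) := by
  have key := loop_induction (d := 13) (b := 0)
    (body := .ifR (.ld 3 (r 10)) (.ld 3 (r 13)) (.setV 10 (r 13)) .skip) (σ := σ.setV 10 0)
    (fun s τ => τ.v 10 < σ.v 0 ∧ ∀ l < s, σ.B 3 l ≤ σ.B 3 (τ.v 10) ∧
      (τ.v 10 < l → σ.B 3 l < σ.B 3 (τ.v 10))) (by simpa) (by
    intro s hs τ hu ⟨h1, h2⟩
    have hs' : s < σ.v 0 := by simpa using hs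
    have b3 := hu.B 3 rfl
    simp only [Store.setV_B] at b3
    by_cases hc : σ.B 3 (τ.v 10) ≤ σ.B 3 s
    · simp only [Cmd.eval_ifR, Cmd.eval_setV, Cmd.eval_skip, RExp.eval, NExp.eval, Store.setV_v,
        Store.setV_B, b3]
      simp only [Nat.reduceEqDiff, if_false, if_true, hc, Store.setV_v]
      refine ⟨hs', fun l hl => ⟨?_, fun hl' => by omega⟩⟩
      rcases Nat.lt_succ_iff_lt_or_eq.1 hl with hl | rfl
      · exact (h2 l hl).1.trans hc
      · exact le_rfl
    · simp only [Cmd.eval_ifR, Cmd.eval_setV, Cmd.eval_skip, RExp.eval, NExp.eval, Store.setV_v,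
        Store.setV_B, b3]
      simp only [Nat.reduceEqDiff, if_false, if_true, hc, Store.setV_v]
      refine ⟨h1, fun l hl => ?_⟩
      rcases Nat.lt_succ_iff_lt_or_eq.1 hl with hl | rfl
      · exact h2 l hl
      · exact ⟨(not_le.1 hc).le, fun _ => not_le.1 hc⟩)
  have h := key.2
  exact ⟨key.1, fun l hl => (h l (by simpa using hl)).1, fun l hl => (h l (by simpa using hl)).2⟩

/-- Computes the signed distances from the axis. -/
def axis : Cmd := .loop 13 0 (.ifN (r 10) (r 13) (.stB 4 (r 13) (0 - .ld 2 (r 13)))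
  (.stB 4 (r 13) (.ld 2 (r 13))))

lemma axis_spec (σ : Store) :
    ∀ i < σ.v 0, (axis.eval σ).B 4 i = Frame.sideDist (σ.v 10) (σ.B 2) i := by
  refine loop_induction (d := 13) (b := 0) (σ := σ)
    (fun s τ => ∀ i < s, τ.B 4 i = Frame.sideDist (σ.v 10) (σ.B 2) i) (by simp) ?_
  intro s hs τ hu h i hi
  have v10 := hu.v 10 rfl
  have b2 := hu.B 2 rfl
  by_cases hi' : i = s
  · subst hi'
    by_cases hc : σ.v 10 ≤ i
    · simp [v10, b2, hc, Frame.sideDist, not_lt.2 hc]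
    · simp [v10, b2, hc, Frame.sideDist, not_le.1 hc]
  · have := h i (by omega)
    by_cases hc : σ.v 10 ≤ s <;> simpa [v10, hc, hi'] using this

lemma cell_inj {n i j i' j' : ℕ} (hj : j < n) (hj' : j' < n) :
    i * n + j = i' * n + j' ↔ i = i' ∧ j = j' := by
  refine ⟨fun h => ?_, by rintro ⟨rfl, rfl⟩; rfl⟩
  have h1 := congrArg (· / n) h
  have h2 := congrArg (· % n) h
  have hn : 0 < n := by omega
  simp only [mul_comm _ n, Nat.mul_add_div hn, Nat.mul_add_mod, Nat.mod_eq_of_lt, hj, hj',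
    Nat.div_eq_of_lt hj, Nat.div_eq_of_lt hj', add_zero] at h1 h2
  exact ⟨h1, h2⟩

/-- Tabulates the squared distances of the vertices. -/
def distances : Cmd := .loop 13 0 (.setV 14 (.ld 0 (r 13)) ;; .setV 15 (.ld 2 (r 13)) ;;
  .loop 16 0 (.stB 5 (r 14 + r 16) (distE (r 15) (.ld 2 (r 16)))))

lemma distances_spec (σ : Store) (hrow : ∀ i < σ.v 0, σ.A 0 i = i * (σ.v 0 + 1)) :
    ∀ i < σ.v 0, ∀ j < σ.v 0, (distances.eval σ).B 5 (i * (σ.v 0 + 1) + j) =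
      sqDist (σ.B 0) (σ.B 1) (σ.A 2 i) (σ.A 2 j) := by
  refine loop_induction (d := 13) (b := 0) (σ := σ)
    (fun s τ => ∀ i < s, ∀ j < σ.v 0, τ.B 5 (i * (σ.v 0 + 1) + j) =
      sqDist (σ.B 0) (σ.B 1) (σ.A 2 i) (σ.A 2 j)) (by simp) ?_
  intro s hs τ hu h
  have v0 := hu.v 0 rfl
  have b0 := hu.B 0 rfl
  have b1 := hu.B 1 rfl
  have a2 := hu.A 2 rfl
  have a0 := hu.A 0 rfl
  simp only [Cmd.eval_seq]
  set τ₁ := (Cmd.setV 15 (.ld 2 (r 13))).eval ((Cmd.setV 14 (.ld 0 (r 13))).eval (τ.setV 13 s))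
    with hτ₁
  have v14 : τ₁.v 14 = s * (σ.v 0 + 1) := by simp [hτ₁, a0, hrow s hs]
  have v15 : τ₁.v 15 = σ.A 2 s := by simp [hτ₁, a2]
  have key := loop_induction (d := 16) (b := 0)
    (body := .stB 5 (r 14 + r 16) (distE (r 15) (.ld 2 (r 16)))) (σ := τ₁)
    (fun s' τ' => ∀ i < s + 1, ∀ j < σ.v 0, (i < s ∨ j < s') → τ'.B 5 (i * (σ.v 0 + 1) + j) =
      sqDist (σ.B 0) (σ.B 1) (σ.A 2 i) (σ.A 2 j))
    (fun i hi j hj hij => by simpa [hτ₁] using h i (by omega) j hj) (by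
    intro s' hs' τ' hu' h' i hi j hj hij
    have hs'' : s' < σ.v 0 := by simpa [hτ₁, v0] using hs'
    have w14 := (hu'.v 14 rfl).trans v14
    have w15 := (hu'.v 15 rfl).trans v15
    have c0 : τ'.B 0 = σ.B 0 := (hu'.B 0 rfl).trans (by simpa [hτ₁] using b0)
    have c1 : τ'.B 1 = σ.B 1 := (hu'.B 1 rfl).trans (by simpa [hτ₁] using b1)
    have c2 : τ'.A 2 = σ.A 2 := (hu'.A 2 rfl).trans (by simpa [hτ₁] using a2)
    simp only [Cmd.eval_stB, Store.setB_B, NExp.eval, Store.setV_v, eval_distE,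
      Store.setV_B, Store.setV_A, c0, c1, c2, w14, w15, true_and, if_true, Nat.reduceEqDiff,
      if_false]
    simp only [cell_inj (by omega : j < σ.v 0 + 1) (by omega : s' < σ.v 0 + 1)]
    split_ifs with hc
    · rw [hc.1, hc.2]
    · exact h' i hi j hj (by omega))
  intro i hi j hj
  have hv : τ₁.v 0 = σ.v 0 := by simpa [hτ₁] using v0
  rw [hv] at key
  exact key i hi j hj (Or.inr hj)

/-! ### Extreme vertices far from the axis -/

/-- Tabulates the values that `c` computes in register 15. -/
lemma tabulate {c : Cmd} {a : ℕ} {F : ℕ → ℕ} {σ : Store} (hA : c.mods (.A a) = false)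
    (h13 : c.mods (.v 13) = false) (h : ∀ s < σ.v 0, ∀ τ,
      Unchanged (.loop 13 0 (c ;; .stA a (r 13) (r 15))) σ τ → (c.eval (τ.setV 13 s)).v 15 = F s) :
    ∀ i < σ.v 0, ((Cmd.loop 13 0 (c ;; .stA a (r 13) (r 15))).eval σ).A a i = F i := by
  refine loop_induction (d := 13) (b := 0) (σ := σ) (fun s τ => ∀ i < s, τ.A a i = F i) (by simp) ?_
  intro s hs τ hu h1 i hi
  have hu2 := unchanged c (τ.setV 13 s)
  simp only [Cmd.eval_seq, Cmd.eval_stA, Store.setA_A, NExp.eval, hu2.v 13 h13, hu2.A a hA,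
    h s hs τ hu,
    Store.setV_v, Store.setV_A, if_true, true_and]
  split_ifs with hc
  · rw [hc]
  · exact h1 i (by omega)

/-- Puts the first vertex of the side of the vertex in register 13 into register 14. -/
def firstInit : Cmd := .setV 14 0 ;; .ifN (r 10) (r 13) (.setV 14 (r 10)) .skip ;; .setV 15 (r 0)

/-- One step of the computation of `firstFar`; the vertices are searched in descending order. -/
def firstStep : Cmd := .setV 17 (r 0 - 1 - r 16) ;;
  .ifN (r 14) (r 17) (.ifR (.ld 4 (r 13)) (.ld 4 (r 17)) (.setV 15 (r 17)) .skip) .skip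

/-- Tabulates `firstFar`. -/
def firstFars : Cmd := .loop 13 0 ((firstInit ;; .loop 16 0 firstStep) ;; .stA 3 (r 13) (r 15))

lemma firstFars_spec (σ : Store) (κ : ℕ → ℝ) (hκ : ∀ i < σ.v 0, σ.B 4 i = κ i)
    (ht : σ.v 10 < σ.v 0) :
    ∀ i < σ.v 0, (firstFars.eval σ).A 3 i = firstFar (σ.v 0) (σ.v 10) κ i := by
  classical
  refine tabulate rfl rfl fun s hs τ hu => ?_
  have v0 := hu.v 0 rfl
  have hu1 := unchanged firstInit (τ.setV 13 s)
  set S := sideStart (σ.v 10) s with hS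
  have hst : S < σ.v 0 := by rw [hS]; unfold sideStart; split_ifs <;> omega
  rw [Cmd.eval_seq]
  have e14 : (firstInit.eval (τ.setV 13 s)).v 14 = S := by
    simp only [hS, sideStart, ← not_le]
    by_cases hc : σ.v 10 ≤ s <;> simp [firstInit, hu.v 10 rfl, hc]
  have e15 : (firstInit.eval (τ.setV 13 s)).v 15 = σ.v 0 := by
    by_cases hc : τ.v 10 ≤ s <;> simp [firstInit, hc, v0]
  set τ₁ := firstInit.eval (τ.setV 13 s)
  have hv0 : τ₁.v 0 = σ.v 0 := (hu1.v 0 rfl).trans v0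
  have key := loop_induction (d := 16) (b := 0) (body := firstStep) (σ := τ₁)
    (fun s' τ' => τ'.v 15 = next (fun j => κ s ≤ κ j) (σ.v 0) (max S (σ.v 0 - s')))
    (by rw [e15, Nat.sub_zero, next_eq_of_le (le_max_right _ _)]) (by
    intro s' hs' τ' hu' h'
    rw [hv0] at hs'
    have w0 := (hu'.v 0 rfl).trans hv0
    have w13 : τ'.v 13 = s := (hu'.v 13 rfl).trans ((hu1.v 13 rfl).trans (by simp))
    have w14 := (hu'.v 14 rfl).trans e14
    have c4 : τ'.B 4 = σ.B 4 := (hu'.B 4 rfl).trans ((hu1.B 4 rfl).trans (hu.B 4 rfl))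
    by_cases hc : S ≤ σ.v 0 - 1 - s'
    · rw [max_eq_right (by omega : _ ≤ σ.v 0 - (s' + 1)),
        next_step (by omega : σ.v 0 - (s' + 1) < σ.v 0),
        show σ.v 0 - (s' + 1) + 1 = σ.v 0 - s' by omega,
        show σ.v 0 - (s' + 1) = σ.v 0 - 1 - s' by omega]
      rw [max_eq_right (by omega : _ ≤ σ.v 0 - s')] at h'
      by_cases hk : κ s ≤ κ (σ.v 0 - 1 - s') <;>
      simp [firstStep, w0, w13, w14, c4, hc, hκ s hs, hκ (σ.v 0 - 1 - s') (by omega), hk, h']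
    · rw [max_eq_left (by omega : σ.v 0 - (s' + 1) ≤ _)]
      rw [max_eq_left (by omega : σ.v 0 - s' ≤ _)] at h'
      simp [firstStep, w0, w14, hc, h'])
  rw [hv0, Nat.sub_self, max_eq_left (Nat.zero_le _)] at key
  exact key

/-- Puts the end of the side of the vertex in register 13 into register 14. -/
def lastInit : Cmd := .setV 14 (r 10) ;; .ifN (r 10) (r 13) (.setV 14 (r 0)) .skip ;; .setV 15 0

/-- One step of the computation of `lastFar`; the vertices are searched in ascending order. -/
def lastStep : Cmd := .ifN (r 14) (r 16) .skip
  (.ifR (.ld 4 (r 13)) (.ld 4 (r 16)) (.setV 15 (r 16 + 1)) .skip)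

/-- Tabulates `lastFar`. -/
def lastFars : Cmd := .loop 13 0 ((lastInit ;; .loop 16 0 lastStep) ;; .stA 4 (r 13) (r 15))

lemma lastFars_spec (σ : Store) (κ : ℕ → ℝ) (hκ : ∀ i < σ.v 0, σ.B 4 i = κ i)
    (ht : σ.v 10 < σ.v 0) :
    ∀ i < σ.v 0, (lastFars.eval σ).A 4 i = lastFar (σ.v 0) (σ.v 10) κ i := by
  classical
  refine tabulate rfl rfl fun s hs τ hu => ?_
  have v0 := hu.v 0 rfl
  have hu1 := unchanged lastInit (τ.setV 13 s)
  set S := sideEnd (σ.v 0) (σ.v 10) s with hS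
  have hst : S ≤ σ.v 0 := by rw [hS]; unfold sideEnd; split_ifs <;> omega
  rw [Cmd.eval_seq]
  have e14 : (lastInit.eval (τ.setV 13 s)).v 14 = S := by
    simp only [hS, sideEnd, ← not_le]
    by_cases hc : σ.v 10 ≤ s <;> simp [lastInit, hu.v 10 rfl, v0, hc]
  have e15 : (lastInit.eval (τ.setV 13 s)).v 15 = 0 := by simp [lastInit]
  set τ₁ := lastInit.eval (τ.setV 13 s)
  have hv0 : τ₁.v 0 = σ.v 0 := (hu1.v 0 rfl).trans v0
  have key := loop_induction (d := 16) (b := 0) (body := lastStep) (σ := τ₁)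
    (fun s' τ' => τ'.v 15 = prev (fun j => κ s ≤ κ j) (min S s')) (by rw [e15, Nat.min_zero, prev])
      (by
    intro s' hs' τ' hu' h'
    rw [hv0] at hs'
    have w13 : τ'.v 13 = s := (hu'.v 13 rfl).trans ((hu1.v 13 rfl).trans (by simp))
    have w14 := (hu'.v 14 rfl).trans e14
    have c4 : τ'.B 4 = σ.B 4 := (hu'.B 4 rfl).trans ((hu1.B 4 rfl).trans (hu.B 4 rfl))
    by_cases hc : S ≤ s'
    · rw [min_eq_left (by omega : _ ≤ s' + 1)]
      rw [min_eq_left (by omega : _ ≤ s')] at h'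
      simp [lastStep, w14, hc, h']
    · rw [min_eq_right (by omega : s' + 1 ≤ _), prev]
      rw [min_eq_right (by omega : s' ≤ _)] at h'
      by_cases hk : κ s ≤ κ s' <;>
      simp [lastStep, w13, w14, c4, hc, hκ s hs, hκ s' hs', hk, h'])
  rw [hv0, min_eq_left hst] at key
  exact key

variable {n k t : ℕ} {κ : ℕ → ℝ} {D : ℕ → ℕ → ℝ} {ρ : ℝ} {lo hi : ℕ} {c : Cmd}
  {σ τ : Store}

/-! ### Tables for a threshold -/

/-- The data on which the search for separated families relies: the numbers `n` and `k`, the highest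
vertex `t`, the offsets of the rows of tables, the extreme vertices far from the axis, the distances
from the axis, and the squared distances. -/
structure Env (n k t : ℕ) (κ : ℕ → ℝ) (D : ℕ → ℕ → ℝ) (σ : Store) : Prop where
  v0 : σ.v 0 = n
  v1 : σ.v 1 = k
  v10 : σ.v 10 = t
  lt : t < n
  row : ∀ i < n, σ.A 0 i = i * (n + 1)
  first : ∀ i < n, σ.A 3 i = firstFar n t κ i
  last : ∀ i < n, σ.A 4 i = lastFar n t κ i
  side : ∀ i < n, σ.B 4 i = κ i
  dist : ∀ i < n, ∀ j < n, σ.B 5 (i * (n + 1) + j) = D i j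

/-- The program does not write the data of `Env`. -/
def Cmd.keepsEnv (c : Cmd) : Bool :=
  !(c.mods (.v 0) || c.mods (.v 1) || c.mods (.v 10) || c.mods (.A 0) || c.mods (.A 3) ||
    c.mods (.A 4) || c.mods (.B 4) || c.mods (.B 5))

lemma Env.of_unchanged
    (h : Env n k t κ D σ) (hu : Unchanged c σ τ) (hc : c.keepsEnv = true) : Env n k t κ D τ := by
  simp only [Cmd.keepsEnv, Bool.not_eq_true', Bool.or_eq_false_iff] at hc
  obtain ⟨⟨⟨⟨⟨⟨⟨h0, h1⟩, h2⟩, h3⟩, h4⟩, h5⟩, h6⟩, h7⟩ := hc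
  obtain ⟨e0, e1, e2, e3, e4, e5, e6, e7, e8⟩ := h
  refine ⟨?_, ?_, ?_, e3, ?_, ?_, ?_, ?_, ?_⟩
  · rw [hu.v 0 h0, e0]
  · rw [hu.v 1 h1, e1]
  · rw [hu.v 10 h2, e2]
  · rw [hu.A 0 h3]; exact e4
  · rw [hu.A 3 h4]; exact e5
  · rw [hu.A 4 h5]; exact e6
  · rw [hu.B 4 h6]; exact e7
  · rw [hu.B 5 h7]; exact e8

/-- The relation of being far apart. -/
def Far (ρ : ℝ) (D : ℕ → ℕ → ℝ) (i j : ℕ) : Prop := ρ ≤ D i j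

/-- Fills array `a` with the values `G i s` for `i < n` and `s ≤ n` if `init` deals with the first
entry of a row and `step` with each further one; `pos u` is the place of entry number `u` in a
row. -/
lemma table_spec {init step : Cmd} {a : ℕ} {G : ℕ → ℕ → ℕ} {pos : ℕ → ℕ}
    (hpos : ∀ u ≤ n, pos u ≤ n) (hsurj : ∀ s ≤ n, ∃ u ≤ n, pos u = s) (E : Env n k t κ D σ)
    (hk : (Cmd.loop 13 0 (init ;; .loop 16 0 step)).keepsEnv = true) (hk₁ : init.keepsEnv = true)
    (hk₂ : (Cmd.loop 16 0 step).keepsEnv = true)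
    (hx : (Cmd.loop 13 0 (init ;; .loop 16 0 step)).mods (.x 1) = false)
    (hx₁ : init.mods (.x 1) = false)
    (hx₂ : (Cmd.loop 16 0 step).mods (.x 1) = false)
    (h14 : (Cmd.loop 16 0 step).mods (.v 14) = false)
    (hinit : ∀ i < n, ∀ τ, Env n k t κ D τ → τ.v 13 = i →
      (init.eval τ).v 14 = i * (n + 1) ∧ (init.eval τ).v 15 = G i (pos 0) ∧
      ∀ c, (init.eval τ).A a c = if c = i * (n + 1) + pos 0 then G i (pos 0) else τ.A a c)
    (hstep : ∀ i < n, ∀ s < n, ∀ τ, Env n k t κ D τ → τ.x 1 = σ.x 1 → τ.v 14 = i * (n + 1) →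
      τ.v 15 = G i (pos s) → τ.v 16 = s → (step.eval τ).v 15 = G i (pos (s + 1)) ∧
      ∀ c, (step.eval τ).A a c =
        if c = i * (n + 1) + pos (s + 1) then G i (pos (s + 1)) else τ.A a c) :
    ∀ g < n, ∀ s ≤ n,
      ((Cmd.loop 13 0 (init ;; .loop 16 0 step)).eval σ).A a (g * (n + 1) + s) = G g s := by
  have key := loop_induction (d := 13) (b := 0) (σ := σ) (body := init ;; .loop 16 0 step)
    (fun i τ => ∀ g < i, ∀ u ≤ n, τ.A a (g * (n + 1) + pos u) = G g (pos u)) (by simp) (by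
    intro i hi τ hu h
    rw [E.v0] at hi
    have E1 : Env n k t κ D (τ.setV 13 i) := (E.of_unchanged hu hk).of_unchanged
      (unchanged (.setV 13 (.con i)) τ) rfl
    obtain ⟨f1, f2, f3⟩ := hinit i hi _ E1 (by simp)
    have E2 := E1.of_unchanged (unchanged init _) hk₁
    have y1 := ((unchanged init (τ.setV 13 i)).x 1 hx₁).trans (hu.x 1 hx)
    rw [Cmd.eval_seq]
    set τ₁ := init.eval (τ.setV 13 i)
    have key := loop_induction (d := 16) (b := 0) (σ := τ₁) (body := step)
      (fun s τ' => τ'.v 15 = G i (pos s) ∧ ∀ g < i + 1, ∀ u ≤ n, (g < i ∨ u ≤ s) →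
        τ'.A a (g * (n + 1) + pos u) = G g (pos u))
      ⟨f2, fun g hg u hu hgu => by
        rw [f3]
        simp only [cell_inj (Nat.lt_succ_of_le (hpos u hu)) (Nat.lt_succ_of_le (hpos 0 n.zero_le))]
        split_ifs with hc
        · rw [hc.1, hc.2]
        · rcases hgu with hgu | hgu
          · exact h g hgu u hu
          · rw [Nat.le_zero.1 hgu] at hc ⊢
            exact h g (by omega) 0 n.zero_le⟩ (by
      intro s hs τ' hu' ⟨h1, h2⟩
      rw [E2.v0] at hs
      obtain ⟨g1, g2⟩ := hstep i hi s hs (τ'.setV 16 s) ((E2.of_unchanged hu' hk₂).of_unchanged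
        (unchanged (.setV 16 (.con s)) τ') rfl) ((hu'.x 1 hx₂).trans y1)
        (by simpa using (hu'.v 14 h14).trans f1) (by simpa using h1) (by simp)
      refine ⟨g1, fun g hg u hu hgu => ?_⟩
      rw [g2]
      simp only [cell_inj (Nat.lt_succ_of_le (hpos u hu)) (Nat.lt_succ_of_le (hpos (s + 1) hs))]
      split_ifs with hc
      · rw [hc.1, hc.2]
      · refine h2 g hg u hu ?_
        by_contra! h3
        exact hc ⟨by omega, by rw [show u = s + 1 by omega]⟩)
    rw [E2.v0] at key
    exact fun g hg u hu => key.2 g hg u hu (Or.inr hu))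
  rw [E.v0] at key
  intro g hg s hs
  obtain ⟨u, hu, rfl⟩ := hsurj s hs
  exact key g hg u hu

/-- The next vertex far from a given one, for every vertex and every position. -/
def nextTable : Cmd := .loop 13 0 ((.setV 14 (.ld 0 (r 13)) ;; .setV 15 (r 0) ;;
  .stA 5 (r 14 + r 0) (r 0)) ;;
  .loop 16 0 (.setV 17 (r 0 - 1 - r 16) ;;
    .ifR (f 1) (.ld 5 (r 14 + r 17)) (.setV 15 (r 17)) .skip ;; .stA 5 (r 14 + r 17) (r 15)))

lemma nextTable_spec (E : Env n k t κ D σ) : ∀ g < n, ∀ s ≤ n,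
    (nextTable.eval σ).A 5 (g * (n + 1) + s) = next (Far (σ.x 1) D g) n s := by
  refine table_spec (pos := (n - ·)) (fun u _ => n.sub_le u)
    (fun s hs => ⟨n - s, n.sub_le s, Nat.sub_sub_self hs⟩) E rfl rfl rfl rfl rfl rfl rfl
    (fun i hi τ E' h => ?_) fun i hi s hs τ E' hx h14 h15 h16 => ?_
  · simp [E'.row i hi, E'.v0, h, next_eq_of_le]
  · have hd := E'.dist i hi (n - 1 - s) (by omega)
    have h1 := next_step (p := Far (σ.x 1) D i) (by omega : n - (s + 1) < n)
    rw [show n - (s + 1) + 1 = n - s by omega, ← h15] at h1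
    simp only [h1]
    simp only [show n - (s + 1) = n - 1 - s by omega, Far]
    by_cases hk : σ.x 1 ≤ D i (n - 1 - s) <;> simp [E'.v0, h14, h16, hx, hd, hk]

/-- The previous vertex far from a given one, for every vertex and every position. -/
def prevTable : Cmd := .loop 13 0 ((.setV 14 (.ld 0 (r 13)) ;; .setV 15 0 ;; .stA 6 (r 14) 0) ;;
  .loop 16 0 (.ifR (f 1) (.ld 5 (r 14 + r 16)) (.setV 15 (r 16 + 1)) .skip ;;
    .stA 6 (r 14 + (r 16 + 1)) (r 15)))

lemma prevTable_spec (E : Env n k t κ D σ) : ∀ g < n, ∀ s ≤ n,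
    (prevTable.eval σ).A 6 (g * (n + 1) + s) = prev (Far (σ.x 1) D g) s := by
  refine table_spec (pos := id) (fun u h => h) (fun s hs => ⟨s, hs, rfl⟩) E rfl rfl rfl rfl rfl rfl
    rfl (fun i hi τ E' h => ?_) fun i hi s hs τ E' hx h14 h15 h16 => ?_
  · simp [E'.row i hi, h, prev]
  · have hd := E'.dist i hi s hs
    simp only [id, prev, Far] at h15 ⊢
    by_cases hk : σ.x 1 ≤ D i s <;> simp [h14, h15, h16, hx, hd, hk]

/-- The data of `Env` together with the tables for the threshold `ρ`. -/
structure Tables (n k t : ℕ) (κ : ℕ → ℝ) (D : ℕ → ℕ → ℝ) (ρ : ℝ) (σ : Store) : Prop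
    extends Env n k t κ D σ where
  x1 : σ.x 1 = ρ
  next : ∀ g < n, ∀ s ≤ n, σ.A 5 (g * (n + 1) + s) = next (Far ρ D g) n s
  prev : ∀ g < n, ∀ s ≤ n, σ.A 6 (g * (n + 1) + s) = prev (Far ρ D g) s

/-- The program does not write the data of `Tables`. -/
def Cmd.keepsTables (c : Cmd) : Bool := c.keepsEnv && !(c.mods (.x 1) || c.mods (.A 5) ||
  c.mods (.A 6))

lemma Tables.of_unchanged
    (h : Tables n k t κ D ρ σ) (hu : Unchanged c σ τ) (hc : c.keepsTables = true) :
    Tables n k t κ D ρ τ := by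
  simp only [Cmd.keepsTables, Bool.not_eq_true', Bool.or_eq_false_iff, Bool.and_eq_true] at hc
  obtain ⟨h0, ⟨h1, h2⟩, h3⟩ := hc
  refine ⟨h.toEnv.of_unchanged hu h0, ?_, ?_, ?_⟩
  · rw [hu.x 1 h1, h.x1]
  · rw [hu.A 5 h2]; exact h.next
  · rw [hu.A 6 h3]; exact h.prev

/-- Both tables for the threshold in real register 1. -/
def farTables : Cmd := nextTable ;; prevTable

lemma farTables_spec
    (E : Env n k t κ D σ) : Tables n k t κ D (σ.x 1) (farTables.eval σ) := by
  have E1 := E.of_unchanged (unchanged nextTable σ) rfl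
  have E2 := E1.of_unchanged (unchanged prevTable _) rfl
  have x1 := (unchanged nextTable σ).x 1 rfl
  refine ⟨E2, ?_, ?_, ?_⟩
  · exact ((unchanged prevTable _).x 1 rfl).trans x1
  · change ∀ g < n, ∀ s ≤ n, (prevTable.eval (nextTable.eval σ)).A 5 _ = _
    rw [(unchanged prevTable _).A 5 rfl]
    exact nextTable_spec E
  · have := prevTable_spec E1
    rw [x1] at this
    exact this

/-! ### Greedy families between two gates -/

/-- The two candidates between the gates in registers 23 and 24. -/
def stepCand : Cmd := .setV 28 (r 23 + 1) ;; .setV 29 (.ld 3 (r 24)) ;;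
  .ifN (r 28) (r 29) (.setV 28 (r 29)) .skip ;;
  .setV 28 (.ld 5 (.ld 0 (r 23) + r 28)) ;; .setV 28 (.ld 5 (.ld 0 (r 24) + r 28)) ;;
  .setV 29 (.ld 4 (r 23)) ;; .ifN (r 24) (r 29) (.setV 29 (r 24)) .skip ;;
  .setV 29 (.ld 6 (.ld 0 (r 24) + r 29)) ;; .setV 29 (.ld 6 (.ld 0 (r 23) + r 29)) ;; .setV 25 0

/-- Tries the first candidate. -/
def stepLo : Cmd := .ifN (r 24) (r 28) .skip (.ifR (.ld 4 (r 23)) (.ld 4 (r 28))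
  (.setV 25 (1 + .ld 7 (.ld 0 (r 28) + r 24)) ;; .setV 26 (r 28) ;; .setV 27 (r 28) ;;
    .setV 30 (r 24)) .skip)

/-- Tries the last candidate. -/
def stepHi : Cmd := .ifN (r 29) (r 23 + 1) .skip (.setV 29 (r 29 - 1) ;;
  .ifR (.ld 4 (r 24)) (.ld 4 (r 29)) (.setV 31 (1 + .ld 7 (.ld 0 (r 23) + r 29)) ;;
    .ifN (r 31) (r 25) .skip (.setV 25 (r 31) ;; .setV 26 (r 29) ;; .setV 27 (r 23) ;;
      .setV 30 (r 29))) .skip)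

/-- The head of the greedy family between the gates in registers 23 and 24, the gates of its tail
(registers 27 and 30), and the size of the family (register 25). -/
def greedyStep : Cmd := stepCand ;; stepLo ;; stepHi

lemma greedyStep_spec
    (T : Tables n k t κ D ρ σ) (h23 : σ.v 23 = lo) (h24 : σ.v 24 = hi) (hlt : lo < hi)
    (hn : hi < n) (hc : ∀ lo' hi', lo ≤ lo' → hi' ≤ hi → lo' < hi' → hi' - lo' < hi - lo →
      σ.A 7 (lo' * (n + 1) + hi') = (inner n t κ (Far ρ D) lo' hi').length) :
    (greedyStep.eval σ).v 25 = (inner n t κ (Far ρ D) lo hi).length ∧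
      (0 < (greedyStep.eval σ).v 25 → (greedyStep.eval σ).v 27 < (greedyStep.eval σ).v 30 ∧
        (greedyStep.eval σ).v 30 < n ∧ inner n t κ (Far ρ D) lo hi =
          (greedyStep.eval σ).v 26 ::
            inner n t κ (Far ρ D) ((greedyStep.eval σ).v 27) ((greedyStep.eval σ).v 30)) := by
  classical
  have hlo : lo < n := by omega
  have hff : firstFar n t κ hi ≤ n := Scan.next_le
  set a := candLo n t κ (Far ρ D) lo hi with ha
  set b := candHi n t κ (Far ρ D) lo hi with hb
  have hla : lo + 1 ≤ a := le_candLo hlo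
  have hbh : b ≤ hi := candHi_le
  set σ₁ := stepCand.eval σ with hσ₁
  have T1 := T.of_unchanged (unchanged stepCand σ) rfl
  rw [← hσ₁] at T1
  have f23 : σ₁.v 23 = lo := ((unchanged stepCand σ).v 23 rfl).trans h23
  have f24 : σ₁.v 24 = hi := ((unchanged stepCand σ).v 24 rfl).trans h24
  have fA : σ₁.A 7 = σ.A 7 := (unchanged stepCand σ).A 7 rfl
  have f25 : σ₁.v 25 = 0 := by simp [hσ₁, stepCand]
  have f28 : σ₁.v 28 = a := by
    have e1 := T.next lo hlo (max (lo + 1) (firstFar n t κ hi)) (by omega)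
    have e2 := T.next hi hn _ (Scan.next_le (p := Far ρ D lo)
      (s := max (lo + 1) (firstFar n t κ hi)))
    rw [ha, candLo, ← e2, ← e1]
    by_cases hm : lo + 1 ≤ firstFar n t κ hi
    · by_cases hm' : hi ≤ σ.A 4 lo <;>
      simp [hσ₁, stepCand, h23, h24, T.first hi hn, T.row lo hlo, T.row hi hn, hm, hm']
    · rw [max_eq_left (by omega)]
      by_cases hm' : hi ≤ σ.A 4 lo <;>
      simp [hσ₁, stepCand, h23, h24, T.first hi hn, T.row lo hlo, T.row hi hn, hm, hm']
  have f29 : σ₁.v 29 = b := by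
    have e1 := T.prev hi hn (min hi (lastFar n t κ lo)) (by omega)
    have e2 := T.prev lo hlo (Scan.prev (Far ρ D hi) (min hi (lastFar n t κ lo)))
      (Scan.prev_le.trans (by omega))
    rw [hb, candHi, ← e2, ← e1]
    by_cases hm : lo + 1 ≤ σ.A 3 hi
    · by_cases hm' : hi ≤ lastFar n t κ lo
      · simp [hσ₁, stepCand, h23, h24, T.last lo hlo, T.row lo hlo, T.row hi hn, hm, hm']
      · rw [min_eq_right (by omega)]
        simp [hσ₁, stepCand, h23, h24, T.last lo hlo, T.row lo hlo, T.row hi hn, hm, hm']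
    · by_cases hm' : hi ≤ lastFar n t κ lo
      · simp [hσ₁, stepCand, h23, h24, T.last lo hlo, T.row lo hlo, T.row hi hn, hm, hm']
      · rw [min_eq_right (by omega)]
        simp [hσ₁, stepCand, h23, h24, T.last lo hlo, T.row lo hlo, T.row hi hn, hm, hm']
  set L := if ValidLo n t κ (Far ρ D) lo hi then a :: inner n t κ (Far ρ D) a hi else [] with hL
  set R := if ValidHi n t κ (Far ρ D) lo hi then
    (b - 1) :: inner n t κ (Far ρ D) lo (b - 1) else [] with hR
  have hinner : inner n t κ (Far ρ D) lo hi = if R.length ≤ L.length then L else R := by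
    rw [Split.inner]
    simp only [hlo, hlt, true_and, dite_eq_ite]
    rfl
  set σ₂ := stepLo.eval σ₁ with hσ₂
  have T2 := T1.of_unchanged (unchanged stepLo σ₁) rfl
  rw [← hσ₂] at T2
  have g23 : σ₂.v 23 = lo := ((unchanged stepLo σ₁).v 23 rfl).trans f23
  have g24 : σ₂.v 24 = hi := ((unchanged stepLo σ₁).v 24 rfl).trans f24
  have g29 : σ₂.v 29 = b := ((unchanged stepLo σ₁).v 29 rfl).trans f29
  have gA : σ₂.A 7 = σ.A 7 := ((unchanged stepLo σ₁).A 7 rfl).trans fA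
  have hlo2 : σ₂.v 25 = L.length ∧ (0 < σ₂.v 25 → σ₂.v 27 < σ₂.v 30 ∧ σ₂.v 30 < n ∧
      L = σ₂.v 26 :: inner n t κ (Far ρ D) (σ₂.v 27) (σ₂.v 30)) := by
    by_cases h1 : hi ≤ a
    · have : ¬ ValidLo n t κ (Far ρ D) lo hi := fun h => absurd h.1 (by omega)
      have h2 : σ₂.v 25 = 0 := by simp [hσ₂, stepLo, f24, f28, h1, f25]
      rw [hL, if_neg this, h2]; simp
    · by_cases h2 : κ lo ≤ κ a
      · have hv : ValidLo n t κ (Far ρ D) lo hi := ⟨by omega, h2⟩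
        have k1 := T1.side lo hlo
        have k2 := T1.side a (by omega)
        have k3 := hc a hi (by omega) le_rfl (by omega) (by omega)
        rw [hL, if_pos hv]
        simp [hσ₂, stepLo, f23, f24, f28, h1, k1, k2, h2, T1.row a (by omega), fA, k3]
        omega
      · have hv : ¬ ValidLo n t κ (Far ρ D) lo hi := fun h => h2 h.2
        have k1 := T1.side lo hlo
        have k2 := T1.side a (by omega)
        have h3 : σ₂.v 25 = 0 := by simp [hσ₂, stepLo, f23, f24, f28, h1, f25, k1, k2, h2]
        rw [hL, if_neg hv, h3]; simp
  change (stepHi.eval σ₂).v 25 = _ ∧ (0 < (stepHi.eval σ₂).v 25 → (stepHi.eval σ₂).v 27 <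
    (stepHi.eval σ₂).v 30 ∧ (stepHi.eval σ₂).v 30 < n ∧ _ = (stepHi.eval σ₂).v 26 ::
      inner n t κ (Far ρ D) ((stepHi.eval σ₂).v 27) ((stepHi.eval σ₂).v 30))
  rw [hinner]
  by_cases h1 : b ≤ lo + 1
  · have hv : ¬ ValidHi n t κ (Far ρ D) lo hi := fun h => absurd h.1 (by omega)
    have : stepHi.eval σ₂ = σ₂ := by simp [stepHi, g29, g23, h1]
    rw [this, hR, if_neg hv, if_pos (by simp)]
    exact hlo2
  · have k1 := T2.side hi hn
    have k2 := T2.side (b - 1) (by omega)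
    by_cases h2 : κ hi ≤ κ (b - 1)
    · have hv : ValidHi n t κ (Far ρ D) lo hi := ⟨by omega, h2⟩
      have k3 := hc lo (b - 1) le_rfl (by omega) (by omega) (by omega)
      have hRl : R.length = 1 + (inner n t κ (Far ρ D) lo (b - 1)).length := by
        rw [hR, if_pos hv, List.length_cons, add_comm]
      by_cases h3 : R.length ≤ L.length
      · rw [if_pos h3]
        rw [hRl, ← hlo2.1] at h3
        simp [stepHi, g29, g23, g24, h1, k1, k2, h2, T2.row lo hlo, gA, k3, h3]
        exact hlo2
      · rw [if_neg h3, hR, if_pos hv]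
        rw [hRl, ← hlo2.1] at h3
        simp [stepHi, g29, g23, g24, h1, k1, k2, h2, T2.row lo hlo, gA, k3, h3]
        omega
    · have hv : ¬ ValidHi n t κ (Far ρ D) lo hi := fun h => h2 h.2
      have : ∀ i, i ≠ 29 → (stepHi.eval σ₂).v i = σ₂.v i := by
        intro i hi
        simp [stepHi, g29, g23, g24, h1, k1, k2, h2, hi]
      rw [this _ (by omega), this _ (by omega), this _ (by omega), this _ (by omega), hR, if_neg hv,
        if_pos (by simp)]
      exact hlo2

/-- The data of `Tables` together with the sizes of the greedy families. -/
structure Counts (n k t : ℕ) (κ : ℕ → ℝ) (D : ℕ → ℕ → ℝ) (ρ : ℝ) (σ : Store) : Prop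
    extends Tables n k t κ D ρ σ where
  count : ∀ lo hi, lo < hi → hi < n → σ.A 7 (lo * (n + 1) + hi) =
    (Split.inner n t κ (Far ρ D) lo hi).length

/-- The program does not write the data of `Counts`. -/
def Cmd.keepsCounts (c : Cmd) : Bool := c.keepsTables && !c.mods (.A 7)

lemma Counts.of_unchanged
    (h : Counts n k t κ D ρ σ) (hu : Unchanged c σ τ) (hc : c.keepsCounts = true) :
    Counts n k t κ D ρ τ := by
  simp only [Cmd.keepsCounts, Bool.not_eq_true', Bool.and_eq_true] at hc
  refine ⟨h.toTables.of_unchanged hu hc.1, ?_⟩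
  rw [hu.A 7 hc.2]; exact h.count

/-- Tabulates the sizes of the greedy families between two gates. -/
def countTable : Cmd := .loop 13 0 (.setV 23 (r 0 - 1 - r 13) ;; .setV 32 (.ld 0 (r 23)) ;;
  .loop 14 0 (.setV 24 (r 14) ;; .ifN (r 24) (r 23) .skip
    (greedyStep ;; .stA 7 (r 32 + r 24) (r 25))))

lemma countTable_spec
    (T : Tables n k t κ D ρ σ) : Counts n k t κ D ρ (countTable.eval σ) := by
  refine ⟨T.of_unchanged (unchanged countTable σ) rfl, ?_⟩
  set body : Cmd := .setV 24 (r 14) ;; .ifN (r 24) (r 23) .skip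
    (greedyStep ;; .stA 7 (r 32 + r 24) (r 25)) with hbody
  have key := loop_induction (d := 13) (b := 0) (σ := σ)
    (body := .setV 23 (r 0 - 1 - r 13) ;; .setV 32 (.ld 0 (r 23)) ;; .loop 14 0 body)
    (fun s τ => ∀ lo hi, lo < hi → hi < n → n - s ≤ lo → τ.A 7 (lo * (n + 1) + hi) =
      (Split.inner n t κ (Far ρ D) lo hi).length) (fun lo hi h1 h2 h3 => by omega) (by
    intro s hs τ hu h
    rw [T.v0] at hs
    have T1 := T.of_unchanged hu rfl
    set pre : Cmd := .setV 23 (r 0 - 1 - r 13) ;; .setV 32 (.ld 0 (r 23)) with hpre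
    change ∀ lo hi, lo < hi → hi < n → n - (s + 1) ≤ lo →
      ((Cmd.loop 14 0 body).eval (pre.eval (τ.setV 13 s))).A 7 (lo * (n + 1) + hi) = _
    set τ₁ := pre.eval (τ.setV 13 s) with hτ₁
    have T2 : Tables n k t κ D ρ τ₁ := (T1.of_unchanged (unchanged (.setV 13 (.con s)) τ)
      rfl).of_unchanged (unchanged pre _) rfl
    set l := n - 1 - s with hl
    have e23 : τ₁.v 23 = l := by simp [hτ₁, hpre, T1.v0, hl]
    have e32 : τ₁.v 32 = l * (n + 1) := by
      simp [hτ₁, hpre, T1.v0, ← hl, T1.row l (by omega)]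
    have eA : τ₁.A 7 = τ.A 7 := by simp [hτ₁, hpre]
    have key := loop_induction (d := 14) (b := 0) (σ := τ₁) (body := body)
      (fun s' τ' => ∀ lo hi, lo < hi → hi < n → (n - s ≤ lo ∨ lo = l ∧ hi < s') →
        τ'.A 7 (lo * (n + 1) + hi) = (Split.inner n t κ (Far ρ D) lo hi).length)
      (fun lo hi h1 h2 h3 => by rw [eA]; exact h lo hi h1 h2 (by omega)) (by
      intro s' hs' τ' hu' h'
      rw [T2.v0] at hs'
      have T3 := T2.of_unchanged hu' rfl
      have f23 := (hu'.v 23 rfl).trans e23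
      have f32 := (hu'.v 32 rfl).trans e32
      intro lo hi h1 h2 h3
      by_cases hle : s' ≤ l
      · have : (body.eval (τ'.setV 14 s')).A 7 = τ'.A 7 := by simp [hbody, f23, hle]
        rw [this]
        exact h' lo hi h1 h2 (by omega)
      · set τ₂ := (τ'.setV 14 s').setV 24 s' with hτ₂
        have T4 : Tables n k t κ D ρ τ₂ := (T3.of_unchanged (unchanged (.setV 14 (.con s')) τ')
          rfl).of_unchanged (unchanged (.setV 24 (.con s')) _) rfl
        have hb : body.eval (τ'.setV 14 s') =
            (Cmd.stA 7 (r 32 + r 24) (r 25)).eval (greedyStep.eval τ₂) := by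
          simp [hbody, f23, hle, hτ₂]
        have hu2 := unchanged greedyStep τ₂
        have hg := (greedyStep_spec T4 (lo := l) (hi := s') (by simp [hτ₂, f23]) (by simp [hτ₂])
          (by omega) (by omega) (fun lo' hi' g1 g2 g3 g4 => by
            rw [show τ₂.A 7 = τ'.A 7 from rfl]
            exact h' lo' hi' g3 (by omega) (by omega))).1
        have g32 : (greedyStep.eval τ₂).v 32 = l * (n + 1) := by
          rw [hu2.v 32 rfl]; simp [hτ₂, f32]
        have g24 : (greedyStep.eval τ₂).v 24 = s' := by
          rw [hu2.v 24 rfl]; simp [hτ₂]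
        rw [hb]
        simp only [Cmd.eval_stA, Store.setA_A, NExp.eval, g32, g24, hg, true_and,
          hu2.A 7 rfl]
        simp only [cell_inj (by omega : hi < n + 1) (by omega : s' < n + 1)]
        split_ifs with hc
        · rw [hc.1, hc.2]
        · exact h' lo hi h1 h2 (by omega))
    rw [T2.v0] at key
    intro lo hi h1 h2 h3
    exact key lo hi h1 h2 (by omega))
  rw [T.v0] at key
  intro lo hi h1 h2
  exact key lo hi h1 h2 (by omega)

/-! ### Lists in memory -/

/-- The list that array 8 holds; its length is in register 34. -/
def out (σ : Store) : List ℕ := (List.range (σ.v 34)).map (σ.A 8)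

/-- Appends a value to this list. -/
def emit (e : NExp) : Cmd := .stA 8 (r 34) e ;; .setV 34 (r 34 + 1)

lemma out_emit (e : NExp) (σ : Store) : out ((emit e).eval σ) = out σ ++ [e.eval σ] := by
  have h1 : ((emit e).eval σ).v 34 = σ.v 34 + 1 := by simp [emit]
  have h2 : ∀ i, ((emit e).eval σ).A 8 i = if i = σ.v 34 then e.eval σ else σ.A 8 i := by
    intro i; simp [emit]
  rw [out, h1, List.range_succ, List.map_append]
  congr 1
  · refine List.map_congr_left fun i hi => ?_
    rw [h2, if_neg (by have := List.mem_range.1 hi; omega)]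
  · simp [h2]

lemma out_congr (hv : τ.v 34 = σ.v 34) (hA : τ.A 8 = σ.A 8) : out τ = out σ := by
  rw [out, hv, hA, out]

lemma out_of_unchanged (hu : Unchanged c σ τ)
    (hc : (!(c.mods (.v 34) || c.mods (.A 8))) = true) : out τ = out σ := by
  simp only [Bool.not_eq_true', Bool.or_eq_false_iff] at hc
  exact out_congr (hu.v 34 hc.1) (hu.A 8 hc.2)

lemma length_out (σ : Store) : (out σ).length = σ.v 34 := by simp [out]

lemma out_setV (σ : Store) {b : ℕ} (hb : b ≤ σ.v 34) : out (σ.setV 34 b) = (out σ).take b := by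
  rw [out, out, ← List.map_take, List.take_range, min_eq_left hb]
  simp

/-- Appends the head of the greedy family between the gates in registers 23 and 24, if there is one,
and goes on to the gates of its tail. -/
def walkStep : Cmd := greedyStep ;; .ifN (r 25) 0 .skip
    (emit (r 26) ;; .setV 23 (r 27) ;; .setV 24 (r 30))

/-- Appends the first `k` members of the greedy family between the gates in registers 23 and 24. -/
def walk : Cmd := .loop 33 1 walkStep

lemma walk_spec
    (T : Counts n k t κ D ρ σ) (h23 : σ.v 23 = lo) (h24 : σ.v 24 = hi) (hlt : lo < hi)
    (hn : hi < n) :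
    out (walk.eval σ) = out σ ++ (Split.inner n t κ (Far ρ D) lo hi).take k := by
  have key := loop_induction (d := 33) (b := 1) (σ := σ) (body := walkStep)
    (fun s τ => τ.v 23 < τ.v 24 ∧ τ.v 24 < n ∧
      out τ ++ (Split.inner n t κ (Far ρ D) (τ.v 23) (τ.v 24)).take (k - s) =
        out σ ++ (Split.inner n t κ (Far ρ D) lo hi).take k)
    ⟨by omega, by omega, by rw [h23, h24, Nat.sub_zero]⟩ (by
    intro s hs τ hu ⟨h1, h2, h3⟩
    rw [T.v1] at hs
    have T1 := T.of_unchanged hu rfl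
    have T2 : Counts n k t κ D ρ (τ.setV 33 s) :=
      T1.of_unchanged (unchanged (.setV 33 (.con s)) τ) rfl
    have hg := greedyStep_spec T2.toTables (lo := τ.v 23) (hi := τ.v 24) (by simp) (by simp) h1 h2
      (fun lo' hi' _ g2 g3 _ => T2.count lo' hi' g3 (by omega))
    have hu2 := unchanged greedyStep (τ.setV 33 s)
    set τ₁ := greedyStep.eval (τ.setV 33 s) with hτ₁
    have hb : walkStep.eval (τ.setV 33 s) =
      (Cmd.ifN (r 25) 0 .skip (emit (r 26) ;; .setV 23 (r 27) ;; .setV 24 (r 30))).eval τ₁ := rfl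
    have ho : out τ₁ = out τ := (out_of_unchanged hu2 rfl).trans (out_congr (by simp) rfl)
    by_cases h0 : τ₁.v 25 = 0
    · have hb' : walkStep.eval (τ.setV 33 s) = τ₁ := by rw [hb]; simp [h0]
      have v23 : τ₁.v 23 = τ.v 23 := by rw [hu2.v 23 rfl]; simp
      have v24 : τ₁.v 24 = τ.v 24 := by rw [hu2.v 24 rfl]; simp
      have hnil : Split.inner n t κ (Far ρ D) (τ.v 23) (τ.v 24) = [] := by
        apply List.eq_nil_of_length_eq_zero; rw [← hg.1, h0]
      rw [hb', v23, v24, ho, hnil]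
      rw [hnil] at h3
      exact ⟨h1, h2, by simpa using h3⟩
    · obtain ⟨g1, g2, g3⟩ := hg.2 (by omega)
      have hb' : walkStep.eval (τ.setV 33 s) = (Cmd.setV 24 (r 30)).eval
          ((Cmd.setV 23 (r 27)).eval ((emit (r 26)).eval τ₁)) := by
        rw [hb]; simp [h0]
      have w23 : (walkStep.eval (τ.setV 33 s)).v 23 = τ₁.v 27 := by rw [hb']; simp [emit]
      have w24 : (walkStep.eval (τ.setV 33 s)).v 24 = τ₁.v 30 := by rw [hb']; simp [emit]
      have wo : out (walkStep.eval (τ.setV 33 s)) = out τ ++ [τ₁.v 26] := by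
        rw [hb', out_of_unchanged (unchanged (.setV 24 (r 30)) _) rfl,
          out_of_unchanged (unchanged (.setV 23 (r 27)) _) rfl, out_emit, ho]
        rfl
      rw [w23, w24, wo]
      refine ⟨g1, g2, ?_⟩
      rw [← h3, g3, show k - s = (k - (s + 1)) + 1 by omega, List.take_succ_cons,
        List.append_assoc]
      rfl)
  rw [T.v1] at key
  have h := key.2.2
  rw [Nat.sub_self, List.take_zero, List.append_nil] at h
  exact h

/-! ### Families on one side -/

/-- The data of `Counts` together with two left gates in registers 46 and 47. -/
structure Gates (n k t : ℕ) (κ : ℕ → ℝ) (D : ℕ → ℕ → ℝ) (ρ : ℝ) (lo hi : ℕ) (σ : Store) : Prop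
    extends Counts n k t κ D ρ σ where
  v46 : σ.v 46 = lo
  v47 : σ.v 47 = hi
  lo_lt : lo < n
  hi_lt : hi < n

/-- The program does not write the data of `Gates`. -/
def Cmd.keepsGates (c : Cmd) : Bool := c.keepsCounts && !(c.mods (.v 46) || c.mods (.v 47))

lemma Gates.of_unchanged (h : Gates n k t κ D ρ lo hi σ)
    (hu : Unchanged c σ τ) (hc : c.keepsGates = true) : Gates n k t κ D ρ lo hi τ := by
  simp only [Cmd.keepsGates, Bool.not_eq_true', Bool.or_eq_false_iff, Bool.and_eq_true] at hc
  refine ⟨h.toCounts.of_unchanged hu hc.1, ?_, ?_, h.lo_lt, h.hi_lt⟩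
  · rw [hu.v 46 hc.2.1]; exact h.v46
  · rw [hu.v 47 hc.2.2]; exact h.v47

lemma Gates.eval (h : Gates n k t κ D ρ lo hi σ)
    (hc : c.keepsGates = true) : Gates n k t κ D ρ lo hi (c.eval σ) :=
  h.of_unchanged (unchanged c σ) hc

/-- The vertex in register 35, if register 36 says that it is valid. -/
def cur (σ : Store) : Option ℕ := if σ.v 36 = 0 then none else some (σ.v 35)

/-- The vertex in register 43, if register 42 says that it is valid. -/
def target (σ : Store) : Option ℕ := if σ.v 42 = 0 then none else some (σ.v 43)

/-- The next vertex of the chain in the direction `d`. -/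
def advance : Bool → Cmd
  | true => .setV 40 (.ld 5 (.ld 0 (r 35) + (r 35 + 1))) ;; .setV 41 (r 10) ;;
      .ifN (r 10) (r 35) (.setV 41 (r 0)) .skip ;; .setV 36 0 ;;
      .ifN (r 41) (r 40) .skip
        (.ifR (.ld 4 (r 35)) (.ld 4 (r 40)) (.setV 35 (r 40) ;; .setV 36 1) .skip)
  | false => .setV 40 (.ld 6 (.ld 0 (r 35) + r 35)) ;; .setV 41 0 ;;
      .ifN (r 10) (r 35) (.setV 41 (r 10)) .skip ;; .setV 36 0 ;;
      .ifN (r 40) (r 41) .skip (.setV 40 (r 40 - 1) ;;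
        .ifR (.ld 4 (r 35)) (.ld 4 (r 40)) (.setV 35 (r 40) ;; .setV 36 1) .skip)

lemma advance_spec (d : Bool) (T : Tables n k t κ D ρ σ) {c : ℕ} (hc : c < n)
    (h35 : σ.v 35 = c) :
    cur ((advance d).eval σ) = Split.advance n t κ (Far ρ D) d c ∧
      ∀ c' ∈ Split.advance n t κ (Far ρ D) d c, c' < n := by
  classical
  have v0 := T.v0
  have v10 := T.v10
  have hrow := T.row c hc
  have hκ := T.side c hc
  have ht := T.lt
  cases d
  · have hp := T.prev c hc c hc.le
    have hle : prev (Far ρ D c) c ≤ c := prev_le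
    set e := prev (Far ρ D c) c with he
    have hκ' := T.side (e - 1) (by omega)
    refine ⟨?_, fun c' h => ?_⟩
    · simp only [Split.advance, ← he, sideStart, ← not_le]
      by_cases h1 : t ≤ c <;> by_cases h2 : e ≤ t <;> by_cases h4 : e ≤ 0 <;>
        by_cases h3 : κ c ≤ κ (e - 1) <;>
        simp [cur, advance, h35, hrow, hp, v10, h1, h2, hκ, hκ', h3, Nat.le_zero.1, h4]
    · simp only [Split.advance, Option.mem_def, Option.ite_none_right_eq_some,
        Option.some.injEq] at h
      omega
  · have hp := T.next c hc (c + 1) (by omega)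
    set e := next (Far ρ D c) n (c + 1) with he
    refine ⟨?_, fun c' h => ?_⟩
    · simp only [Split.advance, ← he, sideEnd]
      by_cases h1 : t ≤ c <;> simp only [h1, ← not_le]
      · by_cases h2 : n ≤ e
        · simp [cur, advance, h35, hrow, hp, v10, h1, h2, v0]
        · have hκ' := T.side e (by omega)
          by_cases h3 : κ c ≤ κ e <;>
          simp [cur, advance, h35, hrow, hp, v10, h1, h2, hκ, hκ', h3, v0]
      · by_cases h2 : t ≤ e
        · simp [cur, advance, h35, hrow, hp, v10, h1, h2]
        · have hκ' := T.side e (by omega)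
          by_cases h3 : κ c ≤ κ e <;>
          simp [cur, advance, h35, hrow, hp, v10, h1, h2, hκ, hκ', h3]
    · simp only [Split.advance, Option.mem_def, Option.ite_none_right_eq_some,
        Option.some.injEq] at h
      have : sideEnd n t c ≤ n := by unfold sideEnd; split_ifs <;> omega
      omega

/-- The first vertex of the family on the left (for `true`) or right side. -/
def start : Bool → Bool → Cmd
  | true, true => .setV 35 (r 46) ;; .setV 36 1
  | true, false => .setV 35 (r 47) ;; .setV 36 1
  | false, true => .setV 35 (.ld 5 (.ld 0 (r 47) + 0)) ;; .setV 35 (.ld 5 (.ld 0 (r 46) + r 35)) ;;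
      .setV 36 0 ;; .ifN (r 10) (r 35) .skip (.setV 36 1)
  | false, false => .setV 35 (.ld 6 (.ld 0 (r 46) + r 10)) ;;
      .setV 35 (.ld 6 (.ld 0 (r 47) + r 35)) ;; .setV 36 0 ;;
      .ifN (r 35) 0 .skip (.setV 35 (r 35 - 1) ;; .setV 36 1)

/-- The vertex that `start` computes. -/
noncomputable def startOf (n t : ℕ) (ok : ℕ → ℕ → Prop) (left d : Bool) (lo hi : ℕ) : Option ℕ :=
  cond left (some (cond d lo hi)) (rightStart n t ok d lo hi)

lemma start_spec (left d : Bool) (T : Gates n k t κ D ρ lo hi σ) :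
    cur ((start left d).eval σ) = startOf n t (Far ρ D) left d lo hi ∧
      ∀ c ∈ startOf n t (Far ρ D) left d lo hi, c < n := by
  have h46 := T.v46
  have h47 := T.v47
  have v10 := T.v10
  have rlo := T.row lo T.lo_lt
  have rhi := T.row hi T.hi_lt
  have ht := T.lt
  cases left <;> cases d
  · have e1 := T.prev lo T.lo_lt t ht.le
    have hle1 : prev (Far ρ D lo) t ≤ t := prev_le
    have e2 := T.prev hi T.hi_lt (prev (Far ρ D lo) t) (by omega)
    have hle2 : prev (Far ρ D hi) (prev (Far ρ D lo) t) ≤ _ := prev_le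
    refine ⟨?_, fun c hc => ?_⟩
    · by_cases h : prev (Far ρ D hi) (prev (Far ρ D lo) t) = 0 <;>
      simp [cur, start, startOf, rightStart, h46, h47, v10, rlo, rhi, e1, e2, h,
        Nat.pos_iff_ne_zero]
    · simp only [startOf, cond, rightStart, Option.mem_def, Option.ite_none_right_eq_some,
        Option.some.injEq] at hc
      omega
  · have e1 := T.next hi T.hi_lt 0 (by omega)
    rw [add_zero] at e1
    have e2 := T.next lo T.lo_lt (next (Far ρ D hi) n 0) next_le
    refine ⟨?_, fun c hc => ?_⟩
    · simp only [startOf, cond, rightStart, ← not_le]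
      by_cases h : t ≤ next (Far ρ D lo) n (next (Far ρ D hi) n 0) <;>
      simp [cur, start, h46, h47, v10, rlo, rhi, e1, e2, h]
    · simp only [startOf, cond, rightStart, Option.mem_def, Option.ite_none_right_eq_some,
        Option.some.injEq] at hc
      omega
  · refine ⟨by simp [cur, start, startOf, h47], fun c hc => ?_⟩
    simp only [startOf, cond, Option.mem_def, Option.some.injEq] at hc
    rw [← hc]; exact T.hi_lt
  · refine ⟨by simp [cur, start, startOf, h46], fun c hc => ?_⟩
    simp only [startOf, cond, Option.mem_def, Option.some.injEq] at hc
    rw [← hc]; exact T.lo_lt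

/-- Checks a target in register 43 on the left side. -/
def checkTarget : Cmd := .ifR (.ld 4 (r 35)) (.ld 4 (r 43))
  (.ifR (f 1) (.ld 5 (.ld 0 (r 35) + r 43)) (.setV 42 1) .skip) .skip

/-- The vertex at which the family ends, on the left (for `true`) or right side. -/
def rule : Bool → Bool → Cmd
  | true, true => .setV 43 (r 47) ;; .setV 42 0 ;; .ifN (r 43) (r 35) .skip checkTarget
  | true, false => .setV 43 (r 46) ;; .setV 42 0 ;; .ifN (r 35) (r 43) .skip checkTarget
  | false, true => .setV 43 (.ld 4 (r 35)) ;; .setV 43 (.ld 6 (.ld 0 (r 46) + r 43)) ;;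
      .setV 43 (.ld 6 (.ld 0 (r 47) + r 43)) ;; .setV 43 (.ld 6 (.ld 0 (r 35) + r 43)) ;;
      .setV 42 0 ;; .ifN (r 43) (r 35 + 1) .skip (.setV 43 (r 43 - 1) ;; .setV 42 1)
  | false, false => .setV 43 (.ld 3 (r 35)) ;; .setV 43 (.ld 5 (.ld 0 (r 47) + r 43)) ;;
      .setV 43 (.ld 5 (.ld 0 (r 46) + r 43)) ;; .setV 43 (.ld 5 (.ld 0 (r 35) + r 43)) ;;
      .setV 42 0 ;; .ifN (r 35) (r 43) .skip (.setV 42 1)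

/-- The vertex that `rule` computes. -/
noncomputable def ruleOf (n t : ℕ) (κ : ℕ → ℝ) (ok : ℕ → ℕ → Prop) (left d : Bool) (lo hi : ℕ) :
    ℕ → Option ℕ :=
  cond left (leftRule κ ok d (cond d hi lo)) (rightRule n t κ ok d lo hi)

lemma rule_spec (left d : Bool) (T : Gates n k t κ D ρ lo hi σ) {c : ℕ} (hc : c < n)
    (h35 : σ.v 35 = c) :
    target ((rule left d).eval σ) = ruleOf n t κ (Far ρ D) left d lo hi c ∧
      ∀ u ∈ ruleOf n t κ (Far ρ D) left d lo hi c, u < n ∧ cond d (c < u) (u < c) := by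
  classical
  have h46 := T.v46
  have h47 := T.v47
  have rlo := T.row lo T.lo_lt
  have rhi := T.row hi T.hi_lt
  have rc := T.row c hc
  have x1 := T.x1
  have kc := T.side c hc
  have klo := T.side lo T.lo_lt
  have khi := T.side hi T.hi_lt
  cases left <;> cases d
  · have e0 := T.first c hc
    have e1 := T.next hi T.hi_lt (firstFar n t κ c) next_le
    have e2 := T.next lo T.lo_lt (next (Far ρ D hi) n (firstFar n t κ c)) next_le
    have e3 := T.next c hc (next (Far ρ D lo) n (next (Far ρ D hi) n
      (firstFar n t κ c))) next_le
    set u := next (Far ρ D c) n (next (Far ρ D lo) n (next (Far ρ D hi) n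
      (firstFar n t κ c))) with hu
    refine ⟨?_, fun v hv => ?_⟩
    · simp only [ruleOf, rightRule, ← hu, cond, ← not_le]
      by_cases h : c ≤ u <;>
      simp [target, rule, h35, h46, h47, rlo, rhi, rc, e0, e1, e2, e3, h]
    · simp only [ruleOf, cond, rightRule, Option.mem_def, Option.ite_none_right_eq_some,
        Option.some.injEq] at hv ⊢
      omega
  · have e0 := T.last c hc
    have hl : lastFar n t κ c ≤ n := by
      have h1 : lastFar n t κ c ≤ sideEnd n t c := prev_le
      have h2 : sideEnd n t c ≤ n := by
        have := T.lt
        unfold sideEnd; split_ifs <;> omega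
      omega
    have e1 := T.prev lo T.lo_lt (lastFar n t κ c) hl
    have l1 : prev (Far ρ D lo) (lastFar n t κ c) ≤ _ := prev_le
    have e2 := T.prev hi T.hi_lt (prev (Far ρ D lo) (lastFar n t κ c)) (by omega)
    have l2 : prev (Far ρ D hi) (prev (Far ρ D lo) (lastFar n t κ c)) ≤ _ :=
      prev_le
    have e3 := T.prev c hc (prev (Far ρ D hi) (prev (Far ρ D lo)
      (lastFar n t κ c))) (by omega)
    have l3 : prev (Far ρ D c) (prev (Far ρ D hi) (prev (Far ρ D lo)
      (lastFar n t κ c))) ≤ _ := prev_le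
    set u := prev (Far ρ D c) (prev (Far ρ D hi) (prev (Far ρ D lo)
      (lastFar n t κ c))) with hu
    refine ⟨?_, fun v hv => ?_⟩
    · simp only [ruleOf, rightRule, ← hu, cond, ← not_le]
      by_cases h : u ≤ c + 1 <;>
      simp [target, rule, h35, h46, h47, rlo, rhi, rc, e0, e1, e2, e3, h]
    · simp only [ruleOf, cond, rightRule, Option.mem_def, Option.ite_none_right_eq_some,
        Option.some.injEq] at hv ⊢
      omega
  · have hd := T.dist c hc lo T.lo_lt
    refine ⟨?_, fun v hv => ?_⟩
    · simp only [ruleOf, leftRule, cond, Far, ← not_le]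
      by_cases h : c ≤ lo <;> by_cases h1 : κ c ≤ κ lo <;> by_cases h2 : ρ ≤ D c lo <;>
      simp [target, rule, checkTarget, h35, h46, h, rc, kc, klo, x1, hd, h1, h2]
    · simp only [ruleOf, cond, leftRule, Option.mem_def, Option.ite_none_right_eq_some,
        Option.some.injEq] at hv ⊢
      have := T.lo_lt
      omega
  · have hd := T.dist c hc hi T.hi_lt
    refine ⟨?_, fun v hv => ?_⟩
    · simp only [ruleOf, leftRule, cond, Far, ← not_le]
      by_cases h : hi ≤ c <;> by_cases h1 : κ c ≤ κ hi <;> by_cases h2 : ρ ≤ D c hi <;>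
      simp [target, rule, checkTarget, h35, h47, h, rc, kc, khi, x1, hd, h1, h2]
    · simp only [ruleOf, cond, leftRule, Option.mem_def, Option.ite_none_right_eq_some,
        Option.some.injEq] at hv ⊢
      have := T.hi_lt
      omega

/-- One step of the chain, which has as many members as register 37 says. -/
def chainStep (d : Bool) : Cmd := .ifN (r 37) (r 38 + 1) .skip
  (.ifN (r 36) 0 .skip (emit (r 35) ;; advance d))

/-- Puts the last two vertices found into the registers for gates. -/
def setGates : Bool → Cmd
  | true => .setV 23 (r 35) ;; .setV 24 (r 43)
  | false => .setV 23 (r 43) ;; .setV 24 (r 35)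

/-- The part of the family after the chain. -/
def finish (left d : Bool) : Cmd := .ifN (r 36) 0 (.setV 34 (r 39)) (emit (r 35) ;; rule left d ;;
  .ifN (r 42) 0 (.setV 34 (r 39)) (emit (r 43) ;; setGates d ;; walk))

lemma finish_spec (left d : Bool) (T : Gates n k t κ D ρ lo hi σ)
    (hc : ∀ c ∈ cur σ, c < n) {L l : List ℕ} (hL : out σ = L ++ l) (h39 : σ.v 39 = L.length) :
    out ((finish left d).eval σ) = (((cur σ).bind fun c => (family n t κ (Far ρ D) k d
      (ruleOf n t κ (Far ρ D) left d lo hi) 0 c)).map (out σ ++ ·)).getD L := by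
  have htake : ∀ τ : Store, (∃ l', out τ = L ++ l') → τ.v 39 = L.length →
      out ((Cmd.setV 34 (r 39)).eval τ) = L := by
    rintro τ ⟨l', hl'⟩ h
    have h1 := length_out τ
    rw [hl', List.length_append] at h1
    rw [Cmd.eval_setV, NExp.eval, h, out_setV _ (by omega), hl', List.take_left' rfl]
  by_cases h36 : σ.v 36 = 0
  · have e1 : cur σ = none := by rw [cur, if_pos h36]
    have e2 : (finish left d).eval σ = (Cmd.setV 34 (r 39)).eval σ := by simp [finish, h36]
    rw [e1, e2, htake σ ⟨l, hL⟩ h39]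
    rfl
  set c := σ.v 35 with hc35
  have e1 : cur σ = some c := by rw [cur, if_neg h36]
  have hcn : c < n := hc c (by rw [e1]; rfl)
  set σ₁ := (emit (r 35)).eval σ with hσ₁
  have T1 : Gates n k t κ D ρ lo hi σ₁ := T.eval rfl
  have o1 : out σ₁ = out σ ++ [c] := out_emit _ _
  obtain ⟨r1, r2⟩ := rule_spec left d T1 hcn rfl
  set σ₂ := (rule left d).eval σ₁ with hσ₂
  have hu2 := unchanged (rule left d) σ₁
  rw [← hσ₂] at hu2
  have T2 : Gates n k t κ D ρ lo hi σ₂ := T1.of_unchanged hu2 (by cases left <;> cases d <;> rfl)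
  have o2 : out σ₂ = out σ ++ [c] :=
    (out_of_unchanged hu2 (by cases left <;> cases d <;> rfl)).trans o1
  have w39 : σ₂.v 39 = L.length := (hu2.v 39 (by cases left <;> cases d <;> rfl)).trans h39
  have w35 : σ₂.v 35 = c := hu2.v 35 (by cases left <;> cases d <;> rfl)
  have e2 : (finish left d).eval σ = (Cmd.ifN (r 42) 0 (.setV 34 (r 39))
      (emit (r 43) ;; setGates d ;; walk)).eval σ₂ := by
    rw [finish, Cmd.eval_ifN, if_neg (by simp [h36])]
    rfl
  rw [e2, e1]
  simp only [Option.bind_some, family]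
  by_cases h42 : σ₂.v 42 = 0
  · have e3 : target σ₂ = none := by rw [target, if_pos h42]
    rw [← r1, e3, Cmd.eval_ifN, if_pos (by simp [h42]),
      htake σ₂ ⟨l ++ [c], by rw [o2, hL, List.append_assoc]⟩ w39]
    rfl
  · set u := σ₂.v 43 with hu
    have e3 : target σ₂ = some u := by rw [target, if_neg h42]
    obtain ⟨hun, hcu⟩ := r2 u (by rw [← r1, e3]; rfl)
    rw [← r1, e3, Cmd.eval_ifN, if_neg (by simp [h42])]
    set σ₃ := (emit (r 43)).eval σ₂ with hσ₃
    have o3 : out σ₃ = out σ ++ [c] ++ [u] := by rw [hσ₃, out_emit, o2]; rfl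
    have v35 : σ₃.v 35 = c := by rw [hσ₃, (unchanged (emit (r 43)) _).v 35 rfl, w35]
    have v43 : σ₃.v 43 = u := by rw [hσ₃, (unchanged (emit (r 43)) _).v 43 rfl]
    have T3 : Gates n k t κ D ρ lo hi σ₃ := T2.eval rfl
    set σ₄ := (setGates d).eval σ₃ with hσ₄
    have T4 : Gates n k t κ D ρ lo hi σ₄ := T3.eval (by cases d <;> rfl)
    have o4 : out σ₄ = out σ ++ [c] ++ [u] :=
      (out_of_unchanged (unchanged (setGates d) _) (by cases d <;> rfl)).trans o3
    change out (walk.eval σ₄) = _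
    simp only [Option.map_some, Option.getD_some, Split.innerDir]
    cases d
    · rw [walk_spec T4.toCounts (lo := u) (hi := c) (by simp [hσ₄, setGates, v43])
        (by simp [hσ₄, setGates, v35]) hcu hcn, o4]
      simp
    · rw [walk_spec T4.toCounts (lo := c) (hi := u) (by simp [hσ₄, setGates, v35])
        (by simp [hσ₄, setGates, v43]) hcu hun, o4]
      simp

/-- Appends the family on one side; the size of its chain is in register 37. -/
def side (left d : Bool) : Cmd := start left d ;; .setV 39 (r 34) ;;
  .ifN (r 37) 0 (.ifN (r 36) 0 .skip (emit (r 35))) (.loop 38 1 (chainStep d) ;; finish left d)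

lemma side_spec (left d : Bool) (T : Gates n k t κ D ρ lo hi σ) {m : ℕ}
    (h37 : σ.v 37 = m) (hm : m ≤ k) :
    out ((side left d).eval σ) = out σ ++ sideFamily n t κ (Far ρ D) k d
      (ruleOf n t κ (Far ρ D) left d lo hi) (startOf n t (Far ρ D) left d lo hi) m := by
  obtain ⟨s1, s2⟩ := start_spec left d T
  have hu1 := unchanged (start left d) σ
  set σ₁ := (start left d).eval σ with hσ₁
  have T1 : Gates n k t κ D ρ lo hi σ₁ := T.of_unchanged hu1 (by cases left <;> cases d <;> rfl)
  have o1 : out σ₁ = out σ := out_of_unchanged hu1 (by cases left <;> cases d <;> rfl)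
  have w37 : σ₁.v 37 = m := (hu1.v 37 (by cases left <;> cases d <;> rfl)).trans h37
  set σ₂ := (Cmd.setV 39 (r 34)).eval σ₁ with hσ₂
  have T2 : Gates n k t κ D ρ lo hi σ₂ := T1.eval rfl
  have o2 : out σ₂ = out σ := (out_of_unchanged (unchanged (.setV 39 (r 34)) _) rfl).trans o1
  have v39 : σ₂.v 39 = (out σ).length := by rw [← o1, length_out]; simp [hσ₂]
  have v37 : σ₂.v 37 = m := by simp [hσ₂, w37]
  have c2 : cur σ₂ = startOf n t (Far ρ D) left d lo hi := by rw [← s1]; simp [cur, hσ₂]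
  set ruleF := ruleOf n t κ (Far ρ D) left d lo hi with hruleF
  set startF := startOf n t (Far ρ D) left d lo hi with hstartF
  change out ((Cmd.ifN (r 37) 0 (.ifN (r 36) 0 .skip (emit (r 35)))
    (.loop 38 1 (chainStep d) ;; finish left d)).eval σ₂) = _
  rcases Nat.eq_zero_or_pos m with rfl | hm0
  · rw [Cmd.eval_ifN, if_pos (by simp [v37]), sideFamily, ← c2]
    by_cases h36 : σ₂.v 36 = 0
    · simp [h36, cur, o2]
    · simp [h36, cur, out_emit, o2]
  rw [Cmd.eval_ifN, if_neg (by simp [v37]; omega)]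
  have key := loop_induction (d := 38) (b := 1) (σ := σ₂) (body := chainStep d)
    (fun s τ => (cur τ).bind (fun c => (family n t κ (Far ρ D) k d ruleF (m - 1 - s) c).map
        (out τ ++ ·)) = (startF.bind (family n t κ (Far ρ D) k d ruleF (m - 1))).map
        (out σ ++ ·) ∧ (∀ c ∈ cur τ, c < n) ∧ ∃ l, out τ = out σ ++ l)
    ⟨by rw [c2, o2, Nat.sub_zero, Option.map_bind]; rfl, by rw [c2]; exact s2, [], by simp [o2]⟩ (by
    intro s hs τ hu ⟨h1, h2, l, h3⟩
    have T3 : Gates n k t κ D ρ lo hi τ := T2.of_unchanged hu (by cases d <;> rfl)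
    have w37 := (hu.v 37 (by cases d <;> rfl)).trans v37
    set τ₁ := τ.setV 38 s with hτ₁
    have T4 : Gates n k t κ D ρ lo hi τ₁ := T3.of_unchanged (unchanged (.setV 38 (.con s)) τ) rfl
    have ho : out τ₁ = out τ := out_congr (by simp [hτ₁]) rfl
    have hcur : cur τ₁ = cur τ := by simp [cur, hτ₁]
    by_cases hsm : m ≤ s + 1
    · have : (chainStep d).eval τ₁ = τ₁ := by simp [chainStep, hτ₁, w37, hsm]
      rw [this, ho, hcur, show m - 1 - (s + 1) = m - 1 - s by omega]
      exact ⟨h1, h2, l, h3⟩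
    · by_cases h36 : τ.v 36 = 0
      · have e1 : cur τ = none := by rw [cur, if_pos h36]
        have : (chainStep d).eval τ₁ = τ₁ := by simp [chainStep, hτ₁, w37, hsm, h36]
        rw [this, ho, hcur]
        rw [e1] at h1 h2 ⊢
        exact ⟨h1, h2, l, h3⟩
      · have e1 : cur τ = some (τ.v 35) := by rw [cur, if_neg h36]
        have hb : (chainStep d).eval τ₁ = (advance d).eval ((emit (r 35)).eval τ₁) := by
          simp [chainStep, hτ₁, w37, hsm, h36]
        set τ₂ := (emit (r 35)).eval τ₁ with hτ₂
        have T5 : Gates n k t κ D ρ lo hi τ₂ := T4.eval rfl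
        have o2 : out τ₂ = out τ ++ [τ.v 35] := by rw [hτ₂, out_emit, ho]; simp [hτ₁]
        have w35 : τ₂.v 35 = τ.v 35 := by simp [hτ₂, emit, hτ₁]
        obtain ⟨a1, a2⟩ := advance_spec d T5.toTables (h2 _ (by rw [e1]; rfl)) w35
        have o3 : out ((advance d).eval τ₂) = out τ ++ [τ.v 35] :=
          (out_of_unchanged (unchanged (advance d) _) (by cases d <;> rfl)).trans o2
        rw [hb, a1, o3]
        refine ⟨?_, a2, l ++ [τ.v 35], by rw [h3, List.append_assoc]⟩
        rw [← h1, e1, Option.bind_some, show m - 1 - s = (m - 1 - (s + 1)) + 1 by omega,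
          family, Option.map_bind]
        congr 1
        funext c'
        simp [Function.comp_def])
  have hu3 := unchanged (Cmd.loop 38 1 (chainStep d)) σ₂
  set σ₃ := (Cmd.loop 38 1 (chainStep d)).eval σ₂ with hσ₃
  have T3 : Gates n k t κ D ρ lo hi σ₃ := T2.of_unchanged hu3 (by cases d <;> rfl)
  obtain ⟨k1, k2, l, k3⟩ := key
  rw [T2.v1, show m - 1 - k = 0 by omega] at k1
  have hf := finish_spec left d T3 k2 k3 ((hu3.v 39 (by cases d <;> rfl)).trans v39)
  rw [Cmd.eval_seq, ← hσ₃, hf, Option.map_bind]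
  have k1' : ((cur σ₃).bind ((Option.map fun x => out σ₃ ++ x) ∘ fun c =>
      family n t κ (Far ρ D) k d ruleF 0 c)) =
      (startF.bind (family n t κ (Far ρ D) k d ruleF (m - 1))).map (out σ ++ ·) := k1
  rw [k1', show m = (m - 1) + 1 by omega, sideFamily, Nat.add_sub_cancel]
  cases startF.bind (family n t κ (Far ρ D) k d ruleF (m - 1)) <;> simp

/-! ### The decision procedure -/

/-- The first `k` entries of array 9, which is to receive a solution. -/
def result (k : ℕ) (σ : Store) : List ℕ := (List.range k).map (σ.A 9)

/-- Array 9 holds the beginning of a candidate family of sufficient size. -/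
def Solved (n k t : ℕ) (κ : ℕ → ℝ) (D : ℕ → ℕ → ℝ) (ρ : ℝ) (σ : Store) : Prop :=
  ∃ lo hi d d' m m', t ≤ lo ∧ lo ≤ hi ∧ hi < n ∧
    k ≤ (candidate n t κ (Far ρ D) k d d' lo hi m m').length ∧
    result k σ = (candidate n t κ (Far ρ D) k d d' lo hi m m').take k

/-- Register 50 says that a solution has been found; this is the case if `Q` holds. -/
def Found (n k t : ℕ) (κ : ℕ → ℝ) (D : ℕ → ℕ → ℝ) (ρ : ℝ) (Q : Prop) (σ : Store) : Prop :=
  (σ.v 50 ≠ 0 → Solved n k t κ D ρ σ) ∧ (Q → σ.v 50 ≠ 0)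

lemma Found.mono {Q Q' : Prop} (h : Found n k t κ D ρ Q σ) (hQ : Q' → Q) :
    Found n k t κ D ρ Q' σ := ⟨h.1, fun q => h.2 (hQ q)⟩

lemma Found.of_unchanged {Q : Prop} (h : Found n k t κ D ρ Q σ)
    (hu : Unchanged c σ τ) (hc : (!(c.mods (.v 50) || c.mods (.A 9))) = true) :
    Found n k t κ D ρ Q τ := by
  simp only [Bool.not_eq_true', Bool.or_eq_false_iff] at hc
  unfold Found Solved result
  rw [hu.v 50 hc.1, hu.A 9 hc.2]
  exact h

lemma Found.setV {Q : Prop} (h : Found n k t κ D ρ Q σ) {d : ℕ} (hd : d ≠ 50)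
    (i : ℕ) : Found n k t κ D ρ Q (σ.setV d i) := by
  unfold Found Solved result at *
  simpa [Ne.symm hd] using h

/-- A search by a loop. -/
lemma Found.loop {d b : ℕ} {body : Cmd} {Q : Prop} (Q' : ℕ → Prop)
    (h : Found n k t κ D ρ Q σ) (hs : ∀ i < σ.v b, ∀ τ, Unchanged (.loop d b body) σ τ →
      ∀ P, Found n k t κ D ρ P τ → Found n k t κ D ρ (P ∨ Q' i) (body.eval (τ.setV d i))) :
    Found n k t κ D ρ (Q ∨ ∃ i < σ.v b, Q' i) ((Cmd.loop d b body).eval σ) := by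
  refine loop_induction (fun s τ => Found n k t κ D ρ (Q ∨ ∃ i < s, Q' i) τ)
    (h.mono (by rintro (h | ⟨i, h, -⟩); exacts [h, absurd h (by omega)])) fun s hs' τ hu h' => ?_
  refine (hs s hs' τ hu _ h').mono ?_
  rintro (h | ⟨i, h1, h2⟩)
  · exact Or.inl (Or.inl h)
  · rcases Nat.lt_succ_iff_lt_or_eq.1 h1 with h1 | rfl
    · exact Or.inl (Or.inr ⟨i, h1, h2⟩)
    · exact Or.inr h2

/-- Copies the list in array 8 into array 9 if it has `k` members. -/
def keep : Cmd := .ifN (r 1) (r 34) (.setV 50 1 ;; .loop 38 1 (.stA 9 (r 38) (.ld 8 (r 38)))) .skip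

lemma keep_spec (σ : Store) :
    (σ.v 1 ≤ σ.v 34 → (keep.eval σ).v 50 = 1 ∧
      result (σ.v 1) (keep.eval σ) = (out σ).take (σ.v 1)) ∧
    (¬ σ.v 1 ≤ σ.v 34 → keep.eval σ = σ) := by
  refine ⟨fun h => ?_, fun h => by simp [keep, h]⟩
  have e : keep.eval σ = (Cmd.loop 38 1 (.stA 9 (r 38) (.ld 8 (r 38)))).eval (σ.setV 50 1) := by
    simp [keep, h]
  rw [e]
  refine ⟨?_, ?_⟩
  · rw [(unchanged (.loop 38 1 (.stA 9 (r 38) (.ld 8 (r 38)))) _).v 50 rfl]; simp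
  · have key := loop_induction (d := 38) (b := 1) (σ := σ.setV 50 1)
      (body := .stA 9 (r 38) (.ld 8 (r 38))) (fun s τ => ∀ i < s, τ.A 9 i = σ.A 8 i) (by simp) (by
      intro s hs τ hu h i hi
      have a8 := hu.A 8 rfl
      by_cases h1 : i = s
      · subst h1; simp [a8]
      · have := h i (by omega)
        simpa [h1] using this)
    rw [result, out, ← List.map_take, List.take_range, min_eq_left h]
    refine List.map_congr_left fun i hi => key i ?_
    simpa using List.mem_range.1 hi

/-- Tries the candidate family with the given directions; the sizes of the chains are in registers
48 and 49. -/
def attempt (d d' : Bool) : Cmd := .setV 34 0 ;; .setV 37 (r 48) ;; side true d ;;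
  .setV 37 (r 49) ;; side false d' ;; keep

lemma attempt_spec (d d' : Bool) (T : Gates n k t κ D ρ lo hi σ) (htl : t ≤ lo)
    (hlh : lo ≤ hi) {m m' : ℕ} (h48 : σ.v 48 = m) (h49 : σ.v 49 = m') (hm : m < k) (hm' : m' < k)
    {Q : Prop} (h : Found n k t κ D ρ Q σ) :
    Found n k t κ D ρ (Q ∨ k ≤ (candidate n t κ (Far ρ D) k d d' lo hi m m').length)
      ((attempt d d').eval σ) := by
  have T0 : Gates n k t κ D ρ lo hi ((Cmd.setV 34 0 ;; .setV 37 (r 48)).eval σ) := T.eval rfl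
  have F0 := h.of_unchanged (unchanged (.setV 34 0 ;; .setV 37 (r 48)) σ) rfl
  set σ₁ := (Cmd.setV 34 0 ;; .setV 37 (r 48)).eval σ with hσ₁
  have o1 : out σ₁ = [] := by simp [out, hσ₁]
  have v37 : σ₁.v 37 = m := by simp [hσ₁, h48]
  have v49 : σ₁.v 49 = m' := by simp [hσ₁, h49]
  have o2 := side_spec true d T0 v37 hm.le
  have hu2 := unchanged (side true d) σ₁
  have T2 : Gates n k t κ D ρ lo hi ((side true d).eval σ₁) :=
    T0.of_unchanged hu2 (by cases d <;> rfl)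
  have F2 := F0.of_unchanged hu2 (by cases d <;> rfl)
  have w49 := (hu2.v 49 (by cases d <;> rfl)).trans v49
  set σ₂ := (side true d).eval σ₁ with hσ₂
  set σ₃ := (Cmd.setV 37 (r 49)).eval σ₂ with hσ₃
  have T3 : Gates n k t κ D ρ lo hi σ₃ := T2.eval rfl
  have F3 := F2.of_unchanged (unchanged (.setV 37 (r 49)) σ₂) rfl
  rw [← hσ₃] at F3
  have o3 : out σ₃ = out σ₂ := out_of_unchanged (unchanged (.setV 37 (r 49)) _) rfl
  have o4 := side_spec false d' T3 (m := m') (by simp [hσ₃, w49]) hm'.le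
  have hu4 := unchanged (side false d') σ₃
  have T4 : Gates n k t κ D ρ lo hi ((side false d').eval σ₃) :=
    T3.of_unchanged hu4 (by cases d' <;> rfl)
  have F4 := F3.of_unchanged hu4 (by cases d' <;> rfl)
  set σ₄ := (side false d').eval σ₃ with hσ₄
  rw [o3, o2, o1, List.nil_append] at o4
  have o5 : out σ₄ = candidate n t κ (Far ρ D) k d d' lo hi m m' := o4
  change Found n k t κ D ρ _ (keep.eval σ₄)
  obtain ⟨k1, k2⟩ := keep_spec σ₄
  have hl := length_out σ₄
  rw [o5] at hl
  rw [T4.v1, ← hl] at k1 k2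
  rw [hl, ← hl]
  by_cases hk : k ≤ (candidate n t κ (Far ρ D) k d d' lo hi m m').length
  · obtain ⟨k3, k4⟩ := k1 hk
    refine ⟨fun _ => ⟨lo, hi, d, d', m, m', htl, hlh, T.hi_lt, hk, by rw [k4, o5]⟩, fun _ => ?_⟩
    rw [k3]; exact one_ne_zero
  · rw [k2 hk]
    exact F4.mono (by rintro (h | h); exacts [h, absurd h hk])

/-- Tries all directions. -/
def attempts : Cmd := attempt true true ;; attempt true false ;; attempt false true ;;
  attempt false false

/-- There is a candidate family of sufficient size with the given gates and sizes of chains. -/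
def Hit (n k t : ℕ) (κ : ℕ → ℝ) (D : ℕ → ℕ → ℝ) (ρ : ℝ) (lo hi m m' : ℕ) : Prop :=
  ∃ d d', k ≤ (candidate n t κ (Far ρ D) k d d' lo hi m m').length

lemma attempts_spec (T : Gates n k t κ D ρ lo hi σ) (htl : t ≤ lo)
    (hlh : lo ≤ hi) {m m' : ℕ} (h48 : σ.v 48 = m) (h49 : σ.v 49 = m') (hm : m < k) (hm' : m' < k)
    {Q : Prop} (h : Found n k t κ D ρ Q σ) :
    Found n k t κ D ρ (Q ∨ Hit n k t κ D ρ lo hi m m') (attempts.eval σ) := by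
  have key : ∀ (d d' : Bool) (τ : Store), (Gates n k t κ D ρ lo hi τ ∧ τ.v 48 = m ∧ τ.v 49 = m') →
      Gates n k t κ D ρ lo hi ((attempt d d').eval τ) ∧ ((attempt d d').eval τ).v 48 = m ∧
        ((attempt d d').eval τ).v 49 = m' := by
    intro d d' τ ⟨h1, h2, h3⟩
    have hu := unchanged (attempt d d') τ
    exact ⟨h1.of_unchanged hu (by cases d <;> cases d' <;> rfl),
      (hu.v 48 (by cases d <;> cases d' <;> rfl)).trans h2,
      (hu.v 49 (by cases d <;> cases d' <;> rfl)).trans h3⟩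
  have g0 : Gates n k t κ D ρ lo hi σ ∧ σ.v 48 = m ∧ σ.v 49 = m' := ⟨T, h48, h49⟩
  have g1 := key true true _ g0
  have g2 := key true false _ g1
  have g3 := key false true _ g2
  have f1 := attempt_spec true true g0.1 htl hlh g0.2.1 g0.2.2 hm hm' h
  have f2 := attempt_spec true false g1.1 htl hlh g1.2.1 g1.2.2 hm hm' f1
  have f3 := attempt_spec false true g2.1 htl hlh g2.2.1 g2.2.2 hm hm' f2
  have f4 := attempt_spec false false g3.1 htl hlh g3.2.1 g3.2.2 hm hm' f3
  refine f4.mono ?_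
  rintro (hq | ⟨d, d', hd⟩)
  · exact Or.inl (Or.inl (Or.inl (Or.inl hq)))
  · cases d <;> cases d' <;> simp only [hd, true_or, or_true]

/-- Searches for a candidate family of sufficient size. -/
def search : Cmd := .loop 46 0 (.ifN (r 10) (r 46) (.loop 47 0 (.ifN (r 46) (r 47)
  (.loop 48 1 (.loop 49 1 attempts)) .skip)) .skip)

lemma search_spec (T : Counts n k t κ D ρ σ) {Q : Prop}
    (h : Found n k t κ D ρ Q σ) :
    Found n k t κ D ρ (Q ∨ ∃ lo < n, ∃ hi < n, t ≤ lo ∧ lo ≤ hi ∧ ∃ m < k, ∃ m' < k,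
      Hit n k t κ D ρ lo hi m m') (search.eval σ) := by
  rw [← T.v0]
  refine Found.loop (fun lo => ∃ hi < σ.v 0, t ≤ lo ∧ lo ≤ hi ∧ ∃ m < k, ∃ m' < k,
    Hit (σ.v 0) k t κ D ρ lo hi m m') (T.v0.symm ▸ h) ?_
  obtain rfl := T.v0
  intro lo hlo τ hu P hP
  have T1 : Counts (σ.v 0) k t κ D ρ τ := T.of_unchanged hu rfl
  have T2 : Counts (σ.v 0) k t κ D ρ (τ.setV 46 lo) :=
    T1.of_unchanged (unchanged (.setV 46 (.con lo)) τ) rfl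
  have F2 := hP.setV (d := 46) (by omega) lo
  have h46 : (τ.setV 46 lo).v 46 = lo := by simp
  set τ₁ := τ.setV 46 lo
  rw [Cmd.eval_ifN]
  simp only [NExp.eval, T2.v10, h46]
  split_ifs with htl
  · refine Found.mono (Q := P ∨ ∃ hi < τ₁.v 0, lo ≤ hi ∧ ∃ m < k, ∃ m' < k,
      Hit (σ.v 0) k t κ D ρ lo hi m m') (Found.loop (fun hi => lo ≤ hi ∧ ∃ m < k, ∃ m' < k,
      Hit (σ.v 0) k t κ D ρ lo hi m m') F2 ?_) (by
        rw [T2.v0]; exact Or.imp_right fun ⟨hi, h1, _, h2⟩ => ⟨hi, h1, h2⟩)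
    intro hi hhi τ' hu' P' hP'
    rw [T2.v0] at hhi
    have T3 : Counts (σ.v 0) k t κ D ρ τ' := T2.of_unchanged hu' rfl
    have T4 : Counts (σ.v 0) k t κ D ρ (τ'.setV 47 hi) :=
      T3.of_unchanged (unchanged (.setV 47 (.con hi)) τ') rfl
    have F4 := hP'.setV (d := 47) (by omega) hi
    have g46 : (τ'.setV 47 hi).v 46 = lo := by
      simp only [Store.setV_v, Nat.reduceEqDiff, if_false]; rw [hu'.v 46 rfl, h46]
    have g47 : (τ'.setV 47 hi).v 47 = hi := by simp
    set τ₂ := τ'.setV 47 hi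
    have G : Gates (σ.v 0) k t κ D ρ lo hi τ₂ := ⟨T4, g46, g47, hlo, hhi⟩
    rw [Cmd.eval_ifN]
    simp only [NExp.eval, g46, g47]
    split_ifs with hlh
    · refine Found.mono (Q := P' ∨ ∃ m < τ₂.v 1, ∃ m' < k,
        Hit (σ.v 0) k t κ D ρ lo hi m m') (Found.loop (fun m => ∃ m' < k,
        Hit (σ.v 0) k t κ D ρ lo hi m m') F4 ?_) (by rw [T4.v1]; tauto)
      intro m hm τ'' hu'' P'' hP''
      rw [T4.v1] at hm
      have G1 : Gates (σ.v 0) k t κ D ρ lo hi τ'' := G.of_unchanged hu'' rfl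
      have G2 : Gates (σ.v 0) k t κ D ρ lo hi (τ''.setV 48 m) :=
        G1.of_unchanged (unchanged (.setV 48 (.con m)) τ'') rfl
      have F5 := hP''.setV (d := 48) (by omega) m
      have g48 : (τ''.setV 48 m).v 48 = m := by simp
      set τ₃ := τ''.setV 48 m
      refine Found.mono (Q := P'' ∨ ∃ m' < τ₃.v 1,
        Hit (σ.v 0) k t κ D ρ lo hi m m') (Found.loop (fun m' =>
        Hit (σ.v 0) k t κ D ρ lo hi m m') F5 ?_) (by rw [G2.v1]; tauto)
      intro m' hm' τ₄ hu₄ P₄ hP₄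
      rw [G2.v1] at hm'
      have G3 : Gates (σ.v 0) k t κ D ρ lo hi τ₄ := G2.of_unchanged hu₄ rfl
      have G4 : Gates (σ.v 0) k t κ D ρ lo hi (τ₄.setV 49 m') :=
        G3.of_unchanged (unchanged (.setV 49 (.con m')) τ₄) rfl
      exact attempts_spec G4 htl hlh (by simp [hu₄.v 48 rfl, g48]) (by simp) hm hm'
        (hP₄.setV (by omega) m')
    · exact F4.mono (by tauto)
  · exact F2.mono (by tauto)

/-- Decides whether there are `k` vertices with squared distances at least the threshold in real
register 1. -/
def decision : Cmd := .setV 50 0 ;; farTables ;; countTable ;; search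

lemma decision_spec (E : Env n k t κ D σ) :
    Found n k t κ D (σ.x 1) (∃ lo < n, ∃ hi < n, t ≤ lo ∧ lo ≤ hi ∧ ∃ m < k, ∃ m' < k,
      Hit n k t κ D (σ.x 1) lo hi m m') (decision.eval σ) := by
  have E1 : Env n k t κ D (σ.setV 50 0) := E.of_unchanged (unchanged (.setV 50 0) σ) rfl
  have T := countTable_spec (farTables_spec E1)
  have F : Found n k t κ D (σ.x 1) False
      ((farTables ;; countTable).eval (σ.setV 50 0)) := by
    refine Found.of_unchanged (σ := σ.setV 50 0) ?_ (unchanged _ _) rfl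
    exact ⟨fun h => absurd (by simp) h, False.elim⟩
  exact (search_spec T F).mono Or.inr

/-- If the decision procedure answers yes, it has found `k` vertices far from one another. -/
lemma decision_sound (E : Env n k t κ D σ)
    (H : Split n t κ (Far (σ.x 1) D)) (h : (decision.eval σ).v 50 ≠ 0) :
    (∀ j ∈ result k (decision.eval σ), j < n) ∧
      (result k (decision.eval σ)).Pairwise (fun a b => a ≠ b ∧ Far (σ.x 1) D a b) := by
  obtain ⟨lo, hi, d, d', m, m', h1, h2, h3, -, h5⟩ := (decision_spec E).1 h
  obtain ⟨s1, s2⟩ := H.candidate_sound (K := k) d d' m m' h1 h2 h3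
  rw [h5]
  exact ⟨fun j hj => s1 j (List.mem_of_mem_take hj), s2.sublist (List.take_sublist _ _)⟩

/-- The decision procedure answers yes if there are `k` vertices far from one another. -/
lemma decision_complete (E : Env n k t κ D σ)
    (H : Split n t κ (Far (σ.x 1) D)) {S : Finset ℕ} (hk : S.card = k) (hk0 : 0 < k)
    (hS : ∀ j ∈ S, j < n) (hsep : Separated (Far (σ.x 1) D) S) :
    (decision.eval σ).v 50 ≠ 0 := by
  obtain ⟨lo, hi, d, d', m, m', h1, h2, h3, h4, h5, h6⟩ :=
    H.exists_candidate (K := k) (Finset.card_pos.1 (by omega)) hS hsep hk.le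
  refine (decision_spec E).2 ⟨lo, by omega, hi, h3, h1, h2, m, by omega, m', by omega, d, d', ?_⟩
  omega

end Structured

/-! ### Merging -/

namespace Merge

/-- The values of `V` at the indices from `a` on and below `c`. -/
def slice (V : ℕ → ℝ) (a c : ℕ) : List ℝ := (List.Ico a c).map V

variable {V V' : ℕ → ℝ} {a c w M : ℕ} {x : ℝ}

lemma mem_slice : x ∈ slice V a c ↔ ∃ i, a ≤ i ∧ i < c ∧ V i = x := by
  simp [slice, and_assoc]

lemma slice_cons (h : a < c) : slice V a c = V a :: slice V (a + 1) c := by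
  rw [slice, List.Ico.eq_cons h, List.map_cons, slice]

lemma slice_nil (h : c ≤ a) : slice V a c = [] := by
  rw [slice, List.Ico.eq_nil_of_le h, List.map_nil]

lemma slice_succ (h : a ≤ c) : slice V a (c + 1) = slice V a c ++ [V c] := by
  rw [slice, List.Ico.succ_top h, List.map_append, slice]; rfl

lemma slice_congr (h : ∀ i, a ≤ i → i < c → V i = V' i) : slice V a c = slice V' a c :=
  List.map_congr_left fun i hi => by
    rw [List.Ico.mem] at hi
    exact h i hi.1 hi.2

/-- Merges two lists. -/
noncomputable def merge (l l' : List ℝ) : List ℝ := l.merge l' fun a b => decide (a ≤ b)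

/-- What the block number `c` of length `2 * w` is to become. -/
noncomputable def merged (V : ℕ → ℝ) (w c : ℕ) : List ℝ :=
  merge (slice V (2 * w * c) (2 * w * c + w)) (slice V (2 * w * c + w) (2 * w * c + 2 * w))

lemma mem_merged :
    x ∈ merged V w c ↔ x ∈ slice V (2 * w * c) (2 * w * c + 2 * w) := by
  rw [merged, merge, List.mem_merge, mem_slice, mem_slice, mem_slice]
  constructor
  · rintro (⟨i, h1, h2, h3⟩ | ⟨i, h1, h2, h3⟩) <;> exact ⟨i, by omega, by omega, h3⟩
  · rintro ⟨i, h1, h2, h3⟩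
    by_cases h : i < 2 * w * c + w
    · exact Or.inl ⟨i, h1, h, h3⟩
    · exact Or.inr ⟨i, by omega, h2, h3⟩

/-- All blocks of length `w` are sorted. -/
def SortedBlocks (V : ℕ → ℝ) (w M : ℕ) : Prop :=
  ∀ c, w * c + w ≤ M → (slice V (w * c) (w * c + w)).Pairwise (· ≤ ·)

lemma merged_sorted (h : SortedBlocks V w M) (hc : 2 * w * c + 2 * w ≤ M) :
    (merged V w c).Pairwise (· ≤ ·) := by
  have h1 := h (2 * c) (by nlinarith)
  have h2 := h (2 * c + 1) (by nlinarith)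
  rw [show w * (2 * c) = 2 * w * c by ring] at h1
  rw [show w * (2 * c + 1) = 2 * w * c + w by ring,
    show 2 * w * c + w + w = 2 * w * c + 2 * w by ring] at h2
  have := List.pairwise_merge (le := fun a b : ℝ => decide (a ≤ b))
    (fun a b c h h' => by simp only [decide_eq_true_eq] at *; exact h.trans h')
    (fun a b => by simpa using le_total a b) _ _ (h1.imp fun h => by simpa using h)
    (h2.imp fun h => by simpa using h)
  exact this.imp fun h => by simpa using h

/-- The state of a pass over all blocks at position `p`: within block number `c` the heads of the
two halves are at `i` and `j`. -/
structure Pass (V buf : ℕ → ℝ) (w M c p i j : ℕ) : Prop where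
  lo : 2 * w * c ≤ i
  mid : i ≤ 2 * w * c + w
  mid' : 2 * w * c + w ≤ j
  hi : j ≤ 2 * w * c + 2 * w
  sum : i + j = p + (2 * w * c + w)
  top : 2 * w * c + 2 * w ≤ M
  done : ∀ c' < c, slice buf (2 * w * c') (2 * w * c' + 2 * w) = merged V w c'
  cur : slice buf (2 * w * c) p ++
    merge (slice V i (2 * w * c + w)) (slice V j (2 * w * c + 2 * w)) = merged V w c

variable {buf : ℕ → ℝ} {p i j : ℕ}

lemma Pass.init (h : 2 * w ≤ M) : Pass V buf w M 0 0 0 w where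
  lo := by simp
  mid := by simp
  mid' := by simp
  hi := by omega
  sum := by simp
  top := by simpa
  done := by simp
  cur := by simp [slice_nil, merged]

lemma Pass.finished (h : Pass V buf w M c p i j) (hp : 2 * w * c + 2 * w ≤ p) :
    ∀ c' < c + 1, slice buf (2 * w * c') (2 * w * c' + 2 * w) = merged V w c' := by
  intro c' hc'
  rcases Nat.lt_succ_iff_lt_or_eq.1 hc' with h1 | rfl
  · exact h.done c' h1
  · obtain ⟨h2, h3, h4, h5, h6, -, -, h1⟩ := h
    rw [slice_nil (a := i) (by omega), slice_nil (a := j) (by omega), merge, List.nil_merge,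
      List.append_nil] at h1
    rw [show 2 * w * c' + 2 * w = p by omega]; exact h1

lemma Pass.next (h : Pass V buf w M c p i j) (hp : 2 * w * c + 2 * w ≤ p)
    (hM : 2 * w * c + 2 * w + 2 * w ≤ M) : Pass V buf w M (c + 1) p p (p + w) := by
  have ⟨h2, h3, h4, h5, h6, _, _, _⟩ := h
  have e : 2 * w * (c + 1) = p := by rw [mul_add, mul_one]; omega
  refine ⟨by omega, by omega, by omega, by omega, by omega, by omega, h.finished hp, ?_⟩
  rw [merged, e, slice_nil (c := p) le_rfl, List.nil_append]

lemma Pass.take {i' j' : ℕ} {v : ℝ} (h : Pass V buf w M c p i j) (hi : i ≤ i') (hj : j ≤ j')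
    (hi' : i' ≤ 2 * w * c + w) (hj' : j' ≤ 2 * w * c + 2 * w) (hs : i' + j' = i + j + 1)
    (hm : merge (slice V i (2 * w * c + w)) (slice V j (2 * w * c + 2 * w)) =
      v :: merge (slice V i' (2 * w * c + w)) (slice V j' (2 * w * c + 2 * w))) :
    Pass V (Function.update buf p v) w M c (p + 1) i' j' := by
  have ⟨h2, h3, h4, h5, h6, _, hd, hc⟩ := h
  refine ⟨by omega, hi', by omega, hj', by omega, h.top, fun c' hc' => ?_, ?_⟩
  · rw [← hd c' hc']
    refine slice_congr fun l _ hl => Function.update_of_ne ?_ _ _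
    have : 2 * w * c' + 2 * w ≤ 2 * w * c := by
      rw [← Nat.mul_succ]; exact Nat.mul_le_mul_left _ hc'
    omega
  · rw [← hc, hm, slice_succ (by omega), Function.update_self, List.append_assoc,
      slice_congr (V' := buf) fun l _ hl => Function.update_of_ne (by omega) _ _]
    rfl

lemma Pass.take_left (h : Pass V buf w M c p i j)
    (hi : i < 2 * w * c + w) (hj : j < 2 * w * c + 2 * w → V i ≤ V j) :
    Pass V (Function.update buf p (V i)) w M c (p + 1) (i + 1) j := by
  refine h.take (by omega) le_rfl hi h.hi (by omega) ?_
  rw [slice_cons hi]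
  by_cases hj' : j < 2 * w * c + 2 * w
  · rw [slice_cons hj', merge, merge, List.cons_merge_cons, if_pos (by simpa using hj hj')]
  · rw [slice_nil (a := j) (by omega), merge, merge, List.merge_right, List.merge_right]

lemma Pass.take_right (h : Pass V buf w M c p i j)
    (hj : j < 2 * w * c + 2 * w) (hi : i < 2 * w * c + w → ¬ V i ≤ V j) :
    Pass V (Function.update buf p (V j)) w M c (p + 1) i (j + 1) := by
  refine h.take le_rfl (by omega) h.mid hj (by omega) ?_
  rw [slice_cons hj]
  by_cases hi' : i < 2 * w * c + w
  · rw [slice_cons hi', merge, merge, List.cons_merge_cons, if_neg (by simpa using hi hi')]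
  · rw [slice_nil (a := i) (by omega), merge, merge, List.nil_merge, List.nil_merge]

lemma sortedBlocks_of_pass {q : ℕ} (h : SortedBlocks V w (2 * w * q))
    (hb : ∀ c < q, slice buf (2 * w * c) (2 * w * c + 2 * w) = merged V w c) (hw : 0 < w) :
    SortedBlocks buf (2 * w) (2 * w * q) := by
  intro c hc
  have hcq : c < q := by
    have : 2 * w * (c + 1) ≤ 2 * w * q := by rw [mul_add, mul_one]; exact hc
    exact Nat.le_of_mul_le_mul_left this (by omega)
  rw [hb c hcq]
  exact merged_sorted h hc

lemma mem_of_pass {q : ℕ}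
    (hb : ∀ c < q, slice buf (2 * w * c) (2 * w * c + 2 * w) = merged V w c) (hw : 0 < w) (x : ℝ) :
    x ∈ slice buf 0 (2 * w * q) ↔ x ∈ slice V 0 (2 * w * q) := by
  have key : ∀ U : ℕ → ℝ, x ∈ slice U 0 (2 * w * q) ↔
      ∃ c < q, x ∈ slice U (2 * w * c) (2 * w * c + 2 * w) := by
    intro U
    simp only [mem_slice]
    constructor
    · rintro ⟨i, -, h2, h3⟩
      have h4 := Nat.div_add_mod i (2 * w)
      have h5 := Nat.mod_lt i (show 0 < 2 * w by omega)
      exact ⟨i / (2 * w), Nat.div_lt_of_lt_mul h2, i, by omega, by omega, h3⟩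
    · rintro ⟨c, hc, i, h1, h2, h3⟩
      have : 2 * w * c + 2 * w ≤ 2 * w * q := by
        rw [← Nat.mul_succ]; exact Nat.mul_le_mul_left _ hc
      exact ⟨i, by omega, by omega, h3⟩
  rw [key, key]
  refine exists_congr fun c => and_congr_right fun hc => ?_
  rw [hb c hc, mem_merged]

end Merge

namespace Structured

open Split Scan

variable {n k t : ℕ} {κ : ℕ → ℝ} {D : ℕ → ℕ → ℝ} {ρ : ℝ} {lo hi : ℕ} {c : Cmd}
  {σ τ : Store}

open Merge

/-! ### Sorting the distances -/

/-- Takes the next value from the first half of the block. -/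
def takeLeft : Cmd := .stB 7 (r 58) (.ld 6 (r 53)) ;; .setV 53 (r 53 + 1)

/-- Takes the next value from the second half of the block. -/
def takeRight : Cmd := .stB 7 (r 58) (.ld 6 (r 55)) ;; .setV 55 (r 55 + 1)

/-- Goes on to the next block. -/
def nextBlock : Cmd := .setV 53 (r 56) ;; .setV 54 (r 56 + r 52) ;; .setV 55 (r 54) ;;
  .setV 56 (r 54 + r 52)

/-- Takes the next value. -/
def takeOne : Cmd := .ifN (r 54) (r 53) takeRight (.ifN (r 56) (r 55) takeLeft
  (.ifR (.ld 6 (r 53)) (.ld 6 (r 55)) takeLeft takeRight))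

/-- Merges the halves of all blocks of length twice register 52. -/
def mergePass : Cmd := .setV 53 0 ;; .setV 54 (r 52) ;; .setV 55 (r 52) ;; .setV 56 (r 52 + r 52) ;;
  .loop 58 3 (.ifN (r 56) (r 58) nextBlock .skip ;; takeOne)

/-- The registers hold the state of a pass. -/
def InPass (V : ℕ → ℝ) (w M p : ℕ) (σ : Store) : Prop :=
  ∃ c, σ.v 52 = w ∧ σ.v 54 = 2 * w * c + w ∧ σ.v 56 = 2 * w * c + 2 * w ∧ σ.B 6 = V ∧
    Pass V (σ.B 7) w M c p (σ.v 53) (σ.v 55)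

lemma takeOne_spec {V : ℕ → ℝ} {w M p : ℕ} (h : InPass V w M p σ) (h58 : σ.v 58 = p)
    (hp : p < σ.v 56) : InPass V w M (p + 1) (takeOne.eval σ) := by
  obtain ⟨c, h52, h54, h56, h6, hP⟩ := h
  have hl : ∀ τ, takeLeft.eval σ = τ → σ.v 53 < 2 * w * c + w →
      (σ.v 55 < 2 * w * c + 2 * w → V (σ.v 53) ≤ V (σ.v 55)) → InPass V w M (p + 1) τ := by
    rintro τ rfl h1 h2
    refine ⟨c, by simp [takeLeft, h52], by simp [takeLeft, h54], by simp [takeLeft, h56],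
      by rw [← h6]; funext i; simp [takeLeft], ?_⟩
    have e : (takeLeft.eval σ).B 7 = Function.update (σ.B 7) p (V (σ.v 53)) := by
      funext i; simp [takeLeft, h58, h6, Function.update_apply]
    have e1 : (takeLeft.eval σ).v 53 = σ.v 53 + 1 := by simp [takeLeft]
    have e2 : (takeLeft.eval σ).v 55 = σ.v 55 := by simp [takeLeft]
    rw [e, e1, e2]
    exact hP.take_left h1 h2
  have hr : ∀ τ, takeRight.eval σ = τ → σ.v 55 < 2 * w * c + 2 * w →
      (σ.v 53 < 2 * w * c + w → ¬ V (σ.v 53) ≤ V (σ.v 55)) → InPass V w M (p + 1) τ := by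
    rintro τ rfl h1 h2
    refine ⟨c, by simp [takeRight, h52], by simp [takeRight, h54], by simp [takeRight, h56],
      by rw [← h6]; funext i; simp [takeRight], ?_⟩
    have e : (takeRight.eval σ).B 7 = Function.update (σ.B 7) p (V (σ.v 55)) := by
      funext i; simp [takeRight, h58, h6, Function.update_apply]
    have e1 : (takeRight.eval σ).v 53 = σ.v 53 := by simp [takeRight]
    have e2 : (takeRight.eval σ).v 55 = σ.v 55 + 1 := by simp [takeRight]
    rw [e, e1, e2]
    exact hP.take_right h1 h2
  have ⟨_, g2, _, g3, g1, _, _, _⟩ := hP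
  simp only [takeOne, Cmd.eval_ifN, Cmd.eval_ifR, NExp.eval, RExp.eval, h54, h56, h6]
  split_ifs with c1 c2 c3
  · exact hr _ rfl (by omega) (fun h => by omega)
  · exact hl _ rfl (by omega) (fun h => by omega)
  · exact hl _ rfl (by omega) (fun _ => c3)
  · exact hr _ rfl (by omega) (fun _ => c3)

lemma mergePass_spec {w q : ℕ} (hw : 0 < w) (hq : 0 < q) (h52 : σ.v 52 = w)
    (h3 : σ.v 3 = 2 * w * q) : ∀ c < q,
    slice ((mergePass.eval σ).B 7) (2 * w * c) (2 * w * c + 2 * w) = merged (σ.B 6) w c := by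
  set pre : Cmd := .setV 53 0 ;; .setV 54 (r 52) ;; .setV 55 (r 52) ;; .setV 56 (r 52 + r 52)
    with hpre
  have hM : 2 * w ≤ 2 * w * q := Nat.le_mul_of_pos_right _ hq
  have key := loop_induction (d := 58) (b := 3) (σ := pre.eval σ)
    (body := .ifN (r 56) (r 58) nextBlock .skip ;; takeOne)
    (fun p τ => InPass (σ.B 6) w (2 * w * q) p τ)
    ⟨0, by simp [hpre, h52], by simp [hpre, h52], by simp [hpre, h52, two_mul], by simp [hpre], by
      rw [show (pre.eval σ).v 53 = 0 by simp [hpre], show (pre.eval σ).v 55 = w by simp [hpre, h52]]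
      exact Pass.init hM⟩ (by
    intro p hp τ hu ⟨c, g52, g54, g56, g6, hP⟩
    have hp' : p < 2 * w * q := by
      rw [(unchanged pre σ).v 3 rfl, h3] at hp; exact hp
    rw [Cmd.eval_seq]
    by_cases hc : 2 * w * c + 2 * w ≤ p
    · have e : (Cmd.ifN (r 56) (r 58) nextBlock .skip).eval (τ.setV 58 p) =
          nextBlock.eval (τ.setV 58 p) := by simp [g56, hc]
      have ⟨_, g2, _, g3, g1, _, _, _⟩ := hP
      have hpe : p = 2 * w * c + 2 * w := by omega
      have hcq : 2 * w * c + 2 * w + 2 * w ≤ 2 * w * q := by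
        have h4 : 2 * w * (c + 1) < 2 * w * q := by rw [mul_add, mul_one]; omega
        have h5 : c + 1 < q := Nat.lt_of_mul_lt_mul_left h4
        have h6 : 2 * w * (c + 1 + 1) ≤ 2 * w * q := Nat.mul_le_mul_left _ h5
        rw [mul_add, mul_add, mul_one] at h6; exact h6
      have e1 : 2 * w * (c + 1) = 2 * w * c + 2 * w := by ring
      rw [e]
      refine takeOne_spec ⟨c + 1, ?_, ?_, ?_, ?_, ?_⟩ ?_ ?_
      · simp [nextBlock, g52]
      · simp [nextBlock, g52, g56, e1]
      · simp [nextBlock, g52, g56, e1]; ring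
      · simp [nextBlock, g6]
      · rw [show (nextBlock.eval (τ.setV 58 p)).v 53 = p by simp [nextBlock, g56, hpe],
          show (nextBlock.eval (τ.setV 58 p)).v 55 = p + w by simp [nextBlock, g52, g56, hpe],
          show (nextBlock.eval (τ.setV 58 p)).B 7 = τ.B 7 by simp [nextBlock]]
        exact hP.next hc hcq
      · simp [nextBlock]
      · simp [nextBlock, g52, g56]; omega
    · have e : (Cmd.ifN (r 56) (r 58) nextBlock .skip).eval (τ.setV 58 p) =
          τ.setV 58 p := by simp [g56, hc]
      rw [e]
      refine takeOne_spec ⟨c, by simp [g52], by simp [g54], by simp [g56], by simp [g6], ?_⟩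
        (by simp) (by simp [g56]; omega)
      simpa using hP)
  rw [(unchanged pre σ).v 3 rfl, h3] at key
  change ∀ c < q, slice (((Cmd.loop 58 3 _).eval (pre.eval σ)).B 7) _ _ = _
  obtain ⟨c, -, -, -, -, hP⟩ := key
  have ⟨_, g2, _, g3, g1, g4, _, _⟩ := hP
  have e1 : 2 * w * (c + 1) = 2 * w * c + 2 * w := by ring
  have hcq : c + 1 = q := Nat.eq_of_mul_eq_mul_left (show 0 < 2 * w by omega) (by omega)
  rw [← hcq]
  exact hP.finished (by omega)

/-- Copies the merged values back and doubles the length of the blocks. -/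
def copyBack : Cmd := .loop 58 3 (.stB 6 (r 58) (.ld 7 (r 58))) ;; .setV 52 (r 52 + r 52)

lemma copyBack_spec (σ : Store) : ∀ i < σ.v 3, (copyBack.eval σ).B 6 i = σ.B 7 i := by
  have key := loop_induction (d := 58) (b := 3) (σ := σ) (body := .stB 6 (r 58) (.ld 7 (r 58)))
    (fun s τ => ∀ i < s, τ.B 6 i = σ.B 7 i) (by simp) (by
    intro s hs τ hu h i hi
    have b7 := hu.B 7 rfl
    by_cases h1 : i = s
    · subst h1; simp [b7]
    · have := h i (by omega)
      simpa [h1] using this)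
  exact key

/-- Sorts array 6. -/
def sort : Cmd := .setV 52 1 ;; .loop 57 4 (mergePass ;; copyBack)

lemma sort_spec {L : ℕ} (h4 : σ.v 4 = L) (h3 : σ.v 3 = 2 ^ L) :
    (∀ i j, i ≤ j → j < 2 ^ L → (sort.eval σ).B 6 i ≤ (sort.eval σ).B 6 j) ∧
      ∀ x, (∃ i < 2 ^ L, (sort.eval σ).B 6 i = x) ↔ ∃ i < 2 ^ L, σ.B 6 i = x := by
  have key := loop_induction (d := 57) (b := 4) (σ := σ.setV 52 1) (body := mergePass ;; copyBack)
    (fun l τ => τ.v 52 = 2 ^ l ∧ SortedBlocks (τ.B 6) (2 ^ l) (2 ^ L) ∧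
      ∀ x, x ∈ slice (τ.B 6) 0 (2 ^ L) ↔ x ∈ slice (σ.B 6) 0 (2 ^ L))
    ⟨by simp, fun c _ => by
      rw [pow_zero, one_mul, slice_succ le_rfl, slice_nil le_rfl]; simp, fun x => by simp⟩ (by
    intro l hl τ hu ⟨g1, g2, g3⟩
    simp only [Store.setV_v, Nat.reduceEqDiff, if_false, h4] at hl
    have hL : 2 ^ L = 2 * 2 ^ l * 2 ^ (L - 1 - l) := by
      rw [← pow_succ', ← pow_add]; congr 1; omega
    have w3 : (τ.setV 57 l).v 3 = 2 ^ L := by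
      have := hu.v 3 rfl
      simp [this, h3]
    have hb := mergePass_spec (σ := τ.setV 57 l) (w := 2 ^ l) (q := 2 ^ (L - 1 - l))
      (Nat.two_pow_pos _) (Nat.two_pow_pos _) (by simp [g1]) (by rw [w3, hL])
    rw [Cmd.eval_seq]
    have hu2 := unchanged mergePass (τ.setV 57 l)
    set τ₁ := mergePass.eval (τ.setV 57 l)
    have hcopy := copyBack_spec τ₁
    rw [hu2.v 3 rfl, w3] at hcopy
    have hb' : ∀ c < 2 ^ (L - 1 - l), slice ((copyBack.eval τ₁).B 6) (2 * 2 ^ l * c)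
        (2 * 2 ^ l * c + 2 * 2 ^ l) = merged (τ.B 6) (2 ^ l) c := by
      intro c hc
      rw [← show (τ.setV 57 l).B 6 = τ.B 6 from rfl, ← hb c hc]
      refine slice_congr fun i _ hi => hcopy i ?_
      have : 2 * 2 ^ l * (c + 1) ≤ 2 * 2 ^ l * 2 ^ (L - 1 - l) := Nat.mul_le_mul_left _ hc
      rw [mul_add, mul_one] at this
      omega
    refine ⟨?_, ?_, fun x => ?_⟩
    · have h52 : τ₁.v 52 = 2 ^ l := by rw [hu2.v 52 rfl]; simp [g1]
      have : (copyBack.eval τ₁).v 52 = τ₁.v 52 + τ₁.v 52 := by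
        have := (unchanged (.loop 58 3 (.stB 6 (r 58) (.ld 7 (r 58)))) τ₁).v 52 rfl
        simp [copyBack, this]
      rw [this, h52, pow_succ]; ring
    · rw [hL] at g2 ⊢
      rw [pow_succ']
      exact sortedBlocks_of_pass g2 hb' (Nat.two_pow_pos _)
    · rw [← g3, hL]
      exact mem_of_pass hb' (Nat.two_pow_pos _) x)
  have e4 : (σ.setV 52 1).v 4 = L := by simp [h4]
  rw [e4, show (Cmd.loop 57 4 (mergePass ;; copyBack)).eval (σ.setV 52 1) = sort.eval σ from rfl]
    at key
  obtain ⟨-, k1, k2⟩ := key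
  refine ⟨fun i j hij hj => ?_, fun x => ?_⟩
  · have := k1 0 (by simp)
    rw [mul_zero, zero_add, slice, List.pairwise_map] at this
    rcases hij.lt_or_eq with h | rfl
    · rw [List.pairwise_iff_getElem] at this
      have h5 := this i j (by simp [List.Ico.length]; omega) (by simpa [List.Ico.length] using hj) h
      simpa [List.Ico] using h5
    · exact le_rfl
  · simpa [mem_slice] using k2 x

/-! ### Search among the distances -/

/-- Puts zeros and all squared distances into array 6. -/
def collect : Cmd := .loop 58 3 (.stB 6 (r 58) 0) ;; .setV 14 0 ;;
  .loop 13 0 (.loop 16 0 (.stB 6 (r 14) (.ld 5 (.ld 0 (r 13) + r 16)) ;; .setV 14 (r 14 + 1)))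

lemma collect_spec (E : Env n k t κ D σ) (h3 : n * n ≤ σ.v 3)
    (hD : ∀ i < n, D i i = 0) (x : ℝ) :
    (∃ a < σ.v 3, (collect.eval σ).B 6 a = x) ↔ ∃ i < n, ∃ j < n, D i j = x := by
  have hn : 0 < n := by have := E.lt; omega
  have hz := loop_induction (d := 58) (b := 3) (σ := σ) (body := .stB 6 (r 58) 0)
    (fun s τ => ∀ a < s, τ.B 6 a = 0) (by simp) (by
    intro s hs τ hu h a ha
    by_cases h1 : a = s
    · subst h1; simp
    · have := h a (by omega)
      simpa [h1] using this)
  set σ₁ := (Cmd.setV 14 0).eval ((Cmd.loop 58 3 (.stB 6 (r 58) 0)).eval σ) with hσ₁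
  have E1 : Env n k t κ D σ₁ := (E.of_unchanged (unchanged (.loop 58 3 (.stB 6 (r 58) 0)) σ)
    rfl).of_unchanged (unchanged (.setV 14 0) _) rfl
  have hz1 : ∀ a < σ.v 3, σ₁.B 6 a = 0 := hz
  have key := loop_induction (d := 13) (b := 0) (σ := σ₁)
    (body := .loop 16 0 (.stB 6 (r 14) (.ld 5 (.ld 0 (r 13) + r 16)) ;; .setV 14 (r 14 + 1)))
    (fun s τ => τ.v 14 = s * n ∧ (∀ i < s, ∀ j < n, τ.B 6 (i * n + j) = D i j) ∧
      ∀ a < σ.v 3, s * n ≤ a → τ.B 6 a = 0)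
    ⟨by simp [hσ₁], by simp, fun a ha _ => hz1 a ha⟩ (by
    intro i hi τ hu ⟨g1, g2, g3⟩
    rw [E1.v0] at hi
    have E2 := E1.of_unchanged hu rfl
    have E3 : Env n k t κ D (τ.setV 13 i) := E2.of_unchanged (unchanged (.setV 13 (.con i)) τ) rfl
    have key := loop_induction (d := 16) (b := 0) (σ := τ.setV 13 i)
      (body := .stB 6 (r 14) (.ld 5 (.ld 0 (r 13) + r 16)) ;; .setV 14 (r 14 + 1))
      (fun s τ => τ.v 14 = i * n + s ∧ (∀ i' < i + 1, ∀ j < n, (i' < i ∨ j < s) →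
        τ.B 6 (i' * n + j) = D i' j) ∧ ∀ a < σ.v 3, i * n + s ≤ a → τ.B 6 a = 0)
      ⟨by simp [g1], fun i' _ j hj h => g2 i' (by omega) j hj, fun a ha h => g3 a ha (by omega)⟩ (by
      intro s hs τ' hu' ⟨f1, f2, f3⟩
      rw [E3.v0] at hs
      have E4 := E3.of_unchanged hu' rfl
      have v13 := hu'.v 13 rfl
      simp only [Store.setV_v, if_true] at v13
      have hd := E4.dist i hi s hs
      have hrow := E4.row i hi
      have hB : ((Cmd.stB 6 (r 14) (.ld 5 (.ld 0 (r 13) + r 16)) ;; .setV 14 (r 14 + 1)).eval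
          (τ'.setV 16 s)).B 6 = fun a => if a = i * n + s then D i s else τ'.B 6 a := by
        funext a; simp [v13, hrow, hd, f1]
      refine ⟨by simp [f1, add_assoc], fun i' hi' j hj h => ?_, fun a ha h => ?_⟩
      · rw [hB]
        simp only [cell_inj hj hs]
        split_ifs with hc
        · rw [hc.1, hc.2]
        · exact f2 i' hi' j hj (by omega)
      · rw [hB]
        simp only
        rw [if_neg (by omega)]
        exact f3 a ha (by omega))
    rw [E3.v0] at key
    obtain ⟨k1, k2, k3⟩ := key
    refine ⟨by rw [k1]; ring, fun i' hi' j hj => k2 i' hi' j hj (Or.inr hj), fun a ha h => ?_⟩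
    exact k3 a ha (by rw [add_mul, one_mul] at h; exact h))
  rw [E1.v0] at key
  obtain ⟨-, k2, k3⟩ := key
  change (∃ a < σ.v 3, ((Cmd.loop 13 0 _).eval σ₁).B 6 a = x) ↔ _
  constructor
  · rintro ⟨a, ha, rfl⟩
    by_cases hc : n * n ≤ a
    · exact ⟨0, hn, 0, hn, by rw [k3 a ha hc, hD 0 hn]⟩
    · have h1 := Nat.div_add_mod a n
      have h2 := Nat.mod_lt a hn
      have h3 : a / n < n := Nat.div_lt_of_lt_mul (by omega)
      exact ⟨a / n, h3, a % n, h2, by rw [← k2 _ h3 _ h2, mul_comm, h1]⟩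
  · rintro ⟨i, hi, j, hj, rfl⟩
    refine ⟨i * n + j, ?_, k2 i hi j hj⟩
    nlinarith

/-- Tabulates the powers of two. -/
def powers : Cmd := .setV 14 1 ;; .loop 13 4 (.stA 10 (r 13) (r 14) ;; .setV 14 (r 14 + r 14))

lemma powers_spec (σ : Store) : ∀ i < σ.v 4, (powers.eval σ).A 10 i = 2 ^ i := by
  have key := loop_induction (d := 13) (b := 4) (σ := σ.setV 14 1)
    (body := .stA 10 (r 13) (r 14) ;; .setV 14 (r 14 + r 14))
    (fun s τ => τ.v 14 = 2 ^ s ∧ ∀ i < s, τ.A 10 i = 2 ^ i) (by simp) (by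
    intro s hs τ hu ⟨h1, h2⟩
    refine ⟨by simp [h1, pow_succ, mul_two], fun i hi => ?_⟩
    by_cases h : i = s
    · subst h; simp [h1]
    · have := h2 i (by omega)
      simpa [h] using this)
  exact key.2

/-- There are `k` vertices with squared distances at least `ρ`. -/
def Feasible (n k : ℕ) (D : ℕ → ℕ → ℝ) (ρ : ℝ) : Prop :=
  ∃ S : Finset ℕ, S.card = k ∧ (∀ j ∈ S, j < n) ∧ Separated (Far ρ D) S

lemma Feasible.mono {ρ ρ' : ℝ} (h : Feasible n k D ρ) (hρ : ρ' ≤ ρ) : Feasible n k D ρ' := by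
  obtain ⟨S, h1, h2, h3⟩ := h
  exact ⟨S, h1, h2, fun i hi j hj hij => hρ.trans (h3 i hi j hj hij)⟩

/-- The result lists `k` vertices with squared distances at least `ρ`. -/
def Reports (n k : ℕ) (D : ℕ → ℕ → ℝ) (ρ : ℝ) (σ : Store) : Prop :=
  (∀ j ∈ result k σ, j < n) ∧ (result k σ).Pairwise (fun a b => a ≠ b ∧ Far ρ D a b)

lemma length_result (k : ℕ) (σ : Store) : (result k σ).length = k := by simp [result]

lemma Reports.feasible (hs : ∀ i j, D i j = D j i)
    (h : Reports n k D ρ σ) : Feasible n k D ρ := by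
  obtain ⟨h1, h2⟩ := h
  have hnd : (result k σ).Nodup := h2.imp fun h => h.1
  refine ⟨(result k σ).toFinset, by rw [List.toFinset_card_of_nodup hnd, length_result],
    fun j hj => h1 j (List.mem_toFinset.1 hj), fun i hi j hj hij => ?_⟩
  rw [List.mem_toFinset] at hi hj
  have p1 : (result k σ).Pairwise (fun a b => a ≠ b → Far ρ D a b) := h2.imp fun h _ => h.2
  have p2 : (result k σ).Pairwise (flip fun a b => a ≠ b → Far ρ D a b) := h2.imp fun h _ => by
    have := h.2
    rwa [Far, hs] at this
  exact p1.forall_of_forall_of_flip (fun x _ h => absurd rfl h) p2 hi hj hij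

/-- Binary search for the largest feasible squared distance. -/
def binarySearch : Cmd := .setV 51 0 ;;
  .loop 57 4 (.setV 59 (r 51 + .ld 10 (r 4 - 1 - r 57)) ;; .setX 1 (.ld 6 (r 59)) ;; decision ;;
    .ifN (r 50) 0 .skip (.setV 51 (r 59))) ;; .setX 1 (.ld 6 (r 51)) ;; decision

lemma decision_iff (E : Env n k t κ D σ) (hs : ∀ i j, D i j = D j i) (hk : 0 < k)
    (H : Split n t κ (Far (σ.x 1) D)) :
    (decision.eval σ).v 50 ≠ 0 ↔ Feasible n k D (σ.x 1) :=
  ⟨fun h => Reports.feasible hs (decision_sound E H h), fun ⟨_, h1, h2, h3⟩ =>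
    decision_complete E H h1 hk h2 h3⟩

lemma binarySearch_spec (E : Env n k t κ D σ) (hs : ∀ i j, D i j = D j i) (hk : 0 < k)
    (H : ∀ ρ, Split n t κ (Far ρ D)) {L : ℕ} (h4 : σ.v 4 = L)
    (hpow : ∀ i < L, σ.A 10 i = 2 ^ i)
    (hmono : ∀ i j, i ≤ j → j < 2 ^ L → σ.B 6 i ≤ σ.B 6 j) (h0 : Feasible n k D (σ.B 6 0)) :
    ∃ p < 2 ^ L, (binarySearch.eval σ).x 1 = σ.B 6 p ∧
      Reports n k D (σ.B 6 p) (binarySearch.eval σ) ∧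
      ∀ q < 2 ^ L, Feasible n k D (σ.B 6 q) → σ.B 6 q ≤ σ.B 6 p := by
  set body : Cmd := .setV 59 (r 51 + .ld 10 (r 4 - 1 - r 57)) ;; .setX 1 (.ld 6 (r 59)) ;;
    decision ;; .ifN (r 50) 0 .skip (.setV 51 (r 59)) with hbody
  have key := loop_induction (d := 57) (b := 4) (σ := σ.setV 51 0) (body := body)
    (fun l τ => τ.v 51 + 2 ^ (L - l) ≤ 2 ^ L ∧ Feasible n k D (σ.B 6 (τ.v 51)) ∧
      ∀ q < 2 ^ L, τ.v 51 + 2 ^ (L - l) ≤ q → ¬ Feasible n k D (σ.B 6 q))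
    ⟨by simp, by simpa using h0, fun q hq h => by simp at h; omega⟩ (by
    intro l hl τ hu ⟨g1, g2, g3⟩
    simp only [Store.setV_v, Nat.reduceEqDiff, if_false, h4] at hl
    have v4 := hu.v 4 rfl
    have a10 := hu.A 10 rfl
    have b6 := hu.B 6 rfl
    simp only [Store.setV_v, Store.setV_A, Store.setV_B, Nat.reduceEqDiff, if_false] at v4 a10 b6
    set s := 2 ^ (L - (l + 1)) with hsd
    have hpos : 0 < s := Nat.two_pow_pos _
    have h2s : 2 ^ (L - l) = s + s := by
      rw [hsd, show L - l = L - (l + 1) + 1 by omega, pow_succ]; ring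
    rw [h2s] at g1 g3
    set pre : Cmd := .setV 59 (r 51 + .ld 10 (r 4 - 1 - r 57)) ;; .setX 1 (.ld 6 (r 59)) with hpre
    have E1 : Env n k t κ D τ := (E.of_unchanged (unchanged (.setV 51 0) σ) rfl).of_unchanged hu rfl
    have E2 : Env n k t κ D (pre.eval (τ.setV 57 l)) :=
      (E1.of_unchanged (unchanged (.setV 57 (.con l)) τ) rfl).of_unchanged (unchanged pre _) rfl
    have e59 : (pre.eval (τ.setV 57 l)).v 59 = τ.v 51 + s := by
      simp [hpre, v4, h4, a10, hpow _ (show L - 1 - l < L by omega), hsd,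
        show L - (l + 1) = L - 1 - l by omega]
    have ex : (pre.eval (τ.setV 57 l)).x 1 = σ.B 6 (τ.v 51 + s) := by
      simp [hpre, v4, h4, a10, hpow _ (show L - 1 - l < L by omega), hsd,
        show L - (l + 1) = L - 1 - l by omega, b6]
    have e51 : (pre.eval (τ.setV 57 l)).v 51 = τ.v 51 := by simp [hpre]
    set τ₁ := pre.eval (τ.setV 57 l)
    have hd := decision_iff E2 hs hk (H _)
    rw [ex] at hd
    have hu2 := unchanged decision τ₁
    have f51 := (hu2.v 51 rfl).trans e51
    have f59 := (hu2.v 59 rfl).trans e59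
    set τ₂ := decision.eval τ₁
    have hb : body.eval (τ.setV 57 l) = (Cmd.ifN (r 50) 0 .skip (.setV 51 (r 59))).eval τ₂ := rfl
    by_cases h50 : τ₂.v 50 = 0
    · have e : (body.eval (τ.setV 57 l)).v 51 = τ.v 51 := by rw [hb]; simp [h50, f51]
      rw [e]
      refine ⟨by omega, g2, fun q hq hqs hf => ?_⟩
      exact absurd (hd.2 (hf.mono (hmono _ _ hqs hq))) (by simpa using h50)
    · have e : (body.eval (τ.setV 57 l)).v 51 = τ.v 51 + s := by rw [hb]; simp [h50, f59]
      rw [e]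
      exact ⟨by omega, hd.1 h50, fun q hq hqs => g3 q hq (by omega)⟩)
  have e4 : (σ.setV 51 0).v 4 = L := by simp [h4]
  rw [e4, Nat.sub_self, pow_zero] at key
  have hu := unchanged (Cmd.loop 57 4 body) (σ.setV 51 0)
  set τ := (Cmd.loop 57 4 body).eval (σ.setV 51 0)
  obtain ⟨k1, k2, k3⟩ := key
  have E1 : Env n k t κ D τ := (E.of_unchanged (unchanged (.setV 51 0) σ) rfl).of_unchanged hu rfl
  set τ₁ := (Cmd.setX 1 (.ld 6 (r 51))).eval τ with hτ₁
  have E2 : Env n k t κ D τ₁ := E1.of_unchanged (unchanged _ τ) rfl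
  have ex : τ₁.x 1 = σ.B 6 (τ.v 51) := by
    have b6 : τ.B 6 = σ.B 6 := hu.B 6 rfl
    simp [hτ₁, b6]
  have hd := decision_iff E2 hs hk (H _)
  have hf : binarySearch.eval σ = decision.eval τ₁ := rfl
  rw [hf]
  refine ⟨τ.v 51, by omega, ((unchanged decision τ₁).x 1 rfl).trans ex, ?_, fun q hq hq' => ?_⟩
  · rw [ex] at hd
    have := decision_sound E2 (H _) (hd.2 k2)
    rw [ex] at this
    exact this
  · by_contra h
    refine k3 q hq ?_ hq'
    by_contra h'
    exact h (hmono q _ (by omega) (by omega))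

/-- Puts half the square root of the threshold into real register 0 and the original indices of the
result into the output cells. -/
def output : Cmd := .setX 0 (.sqrt (f 1) / 2) ;;
  .loop 13 1 (.stA 9 (r 13) (.ld 2 (.ld 9 (r 13)))) ;;
  .loop 13 1 (.rawSt (r 13) (.ld 9 (r 13)))

lemma output_spec (σ : Store) : (output.eval σ).x 0 = √(σ.x 1) / 2 ∧
    ∀ i < σ.v 1, (output.eval σ).A (i % 16) (i / 16) = σ.A 2 (σ.A 9 i) := by
  have k1 := loop_induction (d := 13) (b := 1) (σ := σ.setX 0 (√(σ.x 1) / 2))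
    (body := .stA 9 (r 13) (.ld 2 (.ld 9 (r 13))))
    (fun s τ => (∀ i < s, τ.A 9 i = σ.A 2 (σ.A 9 i)) ∧ ∀ i, s ≤ i → τ.A 9 i = σ.A 9 i)
    (by simp) (by
    intro s hs τ hu ⟨h1, h2⟩
    have a2 := hu.A 2 rfl
    refine ⟨fun i hi => ?_, fun i hi => ?_⟩
    · by_cases h : i = s
      · subst h; simp [a2, h2 i le_rfl]
      · have := h1 i (by omega)
        simpa [h] using this
    · have := h2 i (by omega)
      simpa [show i ≠ s by omega] using this)
  have e1 : (σ.setX 0 (√(σ.x 1) / 2)).v 1 = σ.v 1 := by simp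
  rw [e1] at k1
  have hu1 := unchanged (Cmd.loop 13 1 (.stA 9 (r 13) (.ld 2 (.ld 9 (r 13)))))
    (σ.setX 0 (√(σ.x 1) / 2))
  set τ₁ := (Cmd.loop 13 1 (.stA 9 (r 13) (.ld 2 (.ld 9 (r 13))))).eval (σ.setX 0 (√(σ.x 1) / 2))
    with hτ₁
  have v1 : τ₁.v 1 = σ.v 1 := hu1.v 1 rfl
  have k2 := loop_induction (d := 13) (b := 1) (σ := τ₁) (body := .rawSt (r 13) (.ld 9 (r 13)))
    (fun s τ => (∀ i < s, τ.A (i % 16) (i / 16) = τ₁.A 9 i) ∧ ∀ i, s ≤ i → τ.A 9 i = τ₁.A 9 i)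
    (by simp) (by
    intro s hs τ hu ⟨h1, h2⟩
    refine ⟨fun i hi => ?_, fun i hi => ?_⟩
    · by_cases h : i = s
      · subst h; simp [h2 i le_rfl]
      · have := h1 i (by omega)
        have h' : ¬ (i % 16 = s % 16 ∧ i / 16 = s / 16) := by omega
        simpa [h'] using this
    · have := h2 i (by omega)
      have h' : ¬ (9 = s % 16 ∧ i = s / 16) := by omega
      simpa [h'] using this)
  rw [v1] at k2
  have ho : output.eval σ = (Cmd.loop 13 1 (.rawSt (r 13) (.ld 9 (r 13)))).eval τ₁ := by
    simp [output, hτ₁]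
  rw [ho]
  refine ⟨?_, fun i hi => ?_⟩
  · rw [(unchanged (Cmd.loop 13 1 (.rawSt (r 13) (.ld 9 (r 13)))) τ₁).x 0 rfl, hτ₁, hu1.x 0 rfl]
    simp
  · rw [k2.1 i hi, k1.1 i hi]

/-! ### The polygon of the input -/

lemma exists_of_injective {n : ℕ} {q : ℕ → ℕ} (hq : ∀ i < n, q i < n)
    (hinj : ∀ i < n, ∀ j < n, q i = q j → i = j) {l : ℕ} (hl : l < n) : ∃ i < n, q i = l := by
  have h : Set.SurjOn q (Finset.range n) (Finset.range n) :=
    Finset.surjOn_of_injOn_of_card_le q (fun i hi => by simpa using hq i (by simpa using hi))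
      (fun i hi j hj => hinj i (by simpa using hi) j (by simpa using hj)) le_rfl
  simpa using h (show l ∈ (Finset.range n : Set ℕ) by simpa using hl)

lemma ring_congr {n : ℕ} {x y : ℕ → ℝ} {C C' : ℕ → ℕ} (R : ConvexPosition.Ring n x y C)
    (h : ∀ i < n, C' i = C i) : ConvexPosition.Ring n x y C' where
  lt i hi := by rw [h i hi]; exact R.lt i hi
  inj i hi j hj hij := R.inj i hi j hj (by rw [← h i hi, ← h j hj, hij])
  conv a b c hab hbc hc := by
    rw [h a (by omega), h b (by omega), h c hc]; exact R.conv a b c hab hbc hc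

lemma top_congr {n t : ℕ} {Y Y' : ℕ → ℝ} (T : Frame.Top n Y t) (h : ∀ i < n, Y i = Y' i) :
    Frame.Top n Y' t where
  lt := T.lt
  le l hl := by rw [← h l hl, ← h t T.lt]; exact T.le l hl
  lt_of_lt l hl hl' := by rw [← h l hl, ← h t T.lt]; exact T.lt_of_lt l hl hl'

/-- Sorts the points into cyclic order, beginning with the right end of a base of minimum width. -/
def cyclicOrder : Cmd := lowest ;; ranks ;; widths ;; rotate

lemma cyclicOrder_spec {σ : Store} (h3 : 3 ≤ σ.v 0)
    (hP : ConvexPosition (σ.v 0) (σ.B 0) (σ.B 1)) :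
    let q := (cyclicOrder.eval σ).A 2
    ConvexPosition.Ring (σ.v 0) (σ.B 0) (σ.B 1) q ∧
      ∃ W, Frame (σ.v 0) (frameX (σ.B 0) (σ.B 1) q (σ.v 0))
        (frameY (σ.B 0) (σ.B 1) q (σ.v 0)) W := by
  intro q
  set n := σ.v 0 with hn
  set x := σ.B 0 with hx
  set y := σ.B 1 with hy
  have l1 := lowest_spec σ (by omega) hP
  have hu1 := unchanged lowest σ
  set σ₁ := lowest.eval σ
  have n1 : σ₁.v 0 = n := hu1.v 0 rfl
  have x1 : σ₁.B 0 = x := hu1.B 0 rfl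
  have y1 : σ₁.B 1 = y := hu1.B 1 rfl
  have l2 := ranks_spec σ₁ (by rw [n1, x1, y1]; exact hP) (by rw [n1, x1, y1]; exact l1)
  rw [n1, x1, y1] at l2
  have hu2 := unchanged ranks σ₁
  set σ₂ := ranks.eval σ₁
  have n2 : σ₂.v 0 = n := (hu2.v 0 rfl).trans n1
  have x2 : σ₂.B 0 = x := (hu2.B 0 rfl).trans x1
  have y2 : σ₂.B 1 = y := (hu2.B 1 rfl).trans y1
  have l3 := widths_spec σ₂ (σ₂.A 1) rfl (by rw [n2, x2, y2]; exact l2)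
    (by rw [n2, x2, y2]; exact hP) (by rw [n2]; exact h3)
  have hu3 := unchanged widths σ₂
  simp only [n2, x2, y2] at l3
  set σ₃ := widths.eval σ₂
  have n3 : σ₃.v 0 = n := (hu3.v 0 rfl).trans n2
  have a3 : σ₃.A 1 = σ₂.A 1 := hu3.A 1 rfl
  obtain ⟨hm, W, hW, hE⟩ := l3
  set m := σ₃.v 17
  have l4 := rotate_spec σ₃ (by rw [n3]; exact hm)
  rw [n3, a3] at l4
  have hq : (rotate.eval σ₃).A 2 = q := rfl
  rw [hq] at l4
  change ∀ i < n, q i = σ₂.A 1 (((m + 1) % n + i) % n) at l4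
  set s := (m + 1) % n with hs
  have hsn : s < n := Nat.mod_lt _ (by omega)
  have R : ConvexPosition.Ring n x y q := ring_congr (l2.rotate hsn) fun i hi => by
    rw [l4 i hi]
  refine ⟨R, W, ?_⟩
  have e0 : q 0 = σ₂.A 1 s := by rw [l4 0 (by omega), add_zero, Nat.mod_eq_of_lt hsn]
  have e1 : q (n - 1) = σ₂.A 1 m := by
    rw [l4 (n - 1) (by omega), hs, mod_succ hm]
    congr 1
    split_ifs with h
    · rw [zero_add, Nat.mod_eq_of_lt (by omega)]; omega
    · rw [show m + 1 + (n - 1) = m + n by omega, Nat.add_mod_right, Nat.mod_eq_of_lt hm]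
  refine frame_of_ring hP h3 R (fun l hl => by rw [e0, e1]; exact hW _ (R.lt l hl)) fun i hi => ?_
  have hj : (s + i) % n < n := Nat.mod_lt _ (by omega)
  have := hE _ hj
  rw [← l4 i (by omega)] at this
  have e2 : q (i + 1) = σ₂.A 1 (((s + i) % n + 1) % n) := by
    rw [l4 (i + 1) hi, ← add_assoc]
    exact congrArg _ (Nat.mod_add_mod (s + i) n 1).symm
  rw [← e2] at this
  obtain ⟨l, hl, h⟩ := this
  obtain ⟨l', hl', rfl⟩ := exists_of_injective R.lt R.inj hl
  exact ⟨l', hl', h⟩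

/-- Computes the data on which the search relies. -/
def prepare : Cmd := frame ;; top ;; axis ;; distances ;; firstFars ;; lastFars

lemma prepare_spec {σ : Store} {W : ℝ} (hrow : ∀ i < σ.v 0, σ.A 0 i = i * (σ.v 0 + 1))
    (hP : ConvexPosition (σ.v 0) (σ.B 0) (σ.B 1))
    (R : ConvexPosition.Ring (σ.v 0) (σ.B 0) (σ.B 1) (σ.A 2))
    (F : Frame (σ.v 0) (frameX (σ.B 0) (σ.B 1) (σ.A 2) (σ.v 0))
      (frameY (σ.B 0) (σ.B 1) (σ.A 2) (σ.v 0)) W) :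
    ∃ t κ, Env (σ.v 0) (σ.v 1) t κ (fun i j => sqDist (σ.B 0) (σ.B 1) (σ.A 2 i) (σ.A 2 j))
      (prepare.eval σ) ∧ ∀ ρ, Split (σ.v 0) t κ
        (Far ρ fun i j => sqDist (σ.B 0) (σ.B 1) (σ.A 2 i) (σ.A 2 j)) := by
  set n := σ.v 0 with hn
  set x := σ.B 0 with hx
  set y := σ.B 1 with hy
  set q := σ.A 2 with hq
  have h3 := F.three
  have l1 := frame_spec σ
  have hu1 := unchanged frame σ
  set σ₁ := frame.eval σ
  have n1 : σ₁.v 0 = n := hu1.v 0 rfl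
  have l2 := top_spec σ₁ (by omega)
  have hu2 := unchanged top σ₁
  set σ₂ := top.eval σ₁
  set t := σ₂.v 10 with ht
  rw [n1] at l2
  have T : Frame.Top n (frameY x y q n) t := top_congr l2 fun i hi => (l1 i hi).2
  have n2 : σ₂.v 0 = n := (hu2.v 0 rfl).trans n1
  have l3 := axis_spec σ₂
  rw [n2, show σ₂.B 2 = σ₁.B 2 from hu2.B 2 rfl] at l3
  set κ := Frame.sideDist t (frameX x y q n) with hκ
  have l3' : ∀ i < n, (axis.eval σ₂).B 4 i = κ i := by
    intro i hi
    rw [l3 i hi, hκ]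
    unfold Frame.sideDist
    rw [(l1 i hi).1]
  have hu3 := unchanged axis σ₂
  set σ₃ := axis.eval σ₂
  have n3 : σ₃.v 0 = n := (hu3.v 0 rfl).trans n2
  have t3 : σ₃.v 10 = t := hu3.v 10 rfl
  have hu := unchanged (frame ;; top ;; axis) σ
  have x3 : σ₃.B 0 = x := hu.B 0 rfl
  have y3 : σ₃.B 1 = y := hu.B 1 rfl
  have q3 : σ₃.A 2 = q := hu.A 2 rfl
  have r3 : σ₃.A 0 = σ.A 0 := hu.A 0 rfl
  have l4 := distances_spec σ₃ (by rw [n3, r3]; exact hrow)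
  rw [n3, x3, y3, q3] at l4
  have hu4 := unchanged distances σ₃
  set σ₄ := distances.eval σ₃
  have n4 : σ₄.v 0 = n := (hu4.v 0 rfl).trans n3
  have t4 : σ₄.v 10 = t := (hu4.v 10 rfl).trans t3
  have k4 : σ₄.B 4 = σ₃.B 4 := hu4.B 4 rfl
  have l5 := firstFars_spec σ₄ κ (by rw [n4, k4]; exact l3') (by rw [n4, t4]; exact T.lt)
  rw [n4, t4] at l5
  have hu5 := unchanged firstFars σ₄
  set σ₅ := firstFars.eval σ₄
  have n5 : σ₅.v 0 = n := (hu5.v 0 rfl).trans n4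
  have t5 : σ₅.v 10 = t := (hu5.v 10 rfl).trans t4
  have k5 : σ₅.B 4 = σ₃.B 4 := (hu5.B 4 rfl).trans k4
  have l6 := lastFars_spec σ₅ κ (by rw [n5, k5]; exact l3') (by rw [n5, t5]; exact T.lt)
  rw [n5, t5] at l6
  have hu6 := unchanged lastFars σ₅
  refine ⟨t, κ, ⟨(hu6.v 0 rfl).trans n5, ?_, (hu6.v 10 rfl).trans t5, T.lt, ?_, ?_, l6, ?_, ?_⟩,
    fun ρ => ?_⟩
  · exact (unchanged prepare σ).v 1 rfl
  · rw [(unchanged prepare σ).A 0 rfl]; exact hrow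
  · change ∀ i < n, (lastFars.eval σ₅).A 3 i = _
    rw [hu6.A 3 rfl]; exact l5
  · change ∀ i < n, (lastFars.eval σ₅).B 4 i = _
    rw [hu6.B 4 rfl, k5]; exact l3'
  · change ∀ i < n, ∀ j < n, (lastFars.eval σ₅).B 5 _ = _
    rw [hu6.B 5 rfl, hu5.B 5 rfl]; exact l4
  · have hne : q (n - 1) ≠ q 0 := fun h0 => by
      have := R.inj _ (by omega) _ (by omega) h0
      omega
    have hD := hP.sqDist_pos (R.lt _ (by omega)) (R.lt _ (by omega)) hne
    have := F.split T ρ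
    simp only [sqDist_frame hD] at this
    exact this

/-- Finds an optimal set, the data of `Env` being given. -/
def solve : Cmd := collect ;; sort ;; powers ;; binarySearch ;; output

lemma feasible_of_le {n k : ℕ} {D : ℕ → ℕ → ℝ} {ρ : ℝ} (hkn : k ≤ n)
    (h : ∀ i < n, ∀ j < n, ρ ≤ D i j) : Feasible n k D ρ :=
  ⟨Finset.range k, by simp, fun j hj => by have := Finset.mem_range.1 hj; omega,
    fun i hi j hj _ => by
      rw [Finset.mem_range] at hi hj
      exact h i (by omega) j (by omega)⟩

lemma Reports.apart {n k : ℕ} {D : ℕ → ℕ → ℝ} {ρ : ℝ} {σ : Store} (hs : ∀ i j, D i j = D j i)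
    (h : Reports n k D ρ σ) {i j : ℕ} (hi : i < k) (hj : j < k) (hij : i ≠ j) :
    σ.A 9 i ≠ σ.A 9 j ∧ ρ ≤ D (σ.A 9 i) (σ.A 9 j) := by
  have hp := h.2
  rw [result, List.pairwise_map, List.pairwise_iff_getElem] at hp
  rcases lt_or_gt_of_ne hij with h | h
  · have := hp i j (by simpa) (by simpa) h
    simp only [List.getElem_range] at this
    exact this
  · have := hp j i (by simpa) (by simpa) h
    simp only [List.getElem_range] at this
    exact ⟨this.1.symm, by rw [hs]; exact this.2⟩

lemma Reports.lt {n k : ℕ} {D : ℕ → ℕ → ℝ} {ρ : ℝ} {σ : Store}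
    (h : Reports n k D ρ σ) {i : ℕ} (hi : i < k) : σ.A 9 i < n :=
  h.1 _ (List.mem_map.2 ⟨i, List.mem_range.2 hi, rfl⟩)

lemma solve_spec {n k t : ℕ} {κ : ℕ → ℝ} {D : ℕ → ℕ → ℝ} {σ : Store} (E : Env n k t κ D σ)
    (hs : ∀ i j, D i j = D j i) (hD : ∀ i < n, D i i = 0) (hD0 : ∀ i j, 0 ≤ D i j) (hk : 0 < k)
    (hkn : k ≤ n) (H : ∀ ρ, Split n t κ (Far ρ D)) {L : ℕ} (h4 : σ.v 4 = L) (h3 : σ.v 3 = 2 ^ L)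
    (hnL : n * n ≤ 2 ^ L) :
    ∃ (ρ : ℝ) (w : ℕ → ℕ), (solve.eval σ).x 0 = √ρ / 2 ∧
      (∀ i < k, (solve.eval σ).A (i % 16) (i / 16) = σ.A 2 (w i)) ∧ (∀ i < k, w i < n) ∧
      (∀ i < k, ∀ j < k, i ≠ j → w i ≠ w j ∧ ρ ≤ D (w i) (w j)) ∧
      ∀ i < n, ∀ j < n, Feasible n k D (D i j) → D i j ≤ ρ := by
  have hn : 0 < n := by omega
  have c1 := collect_spec E (by rw [h3]; exact hnL) hD
  rw [h3] at c1
  have hu1 := unchanged collect σ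
  have E1 : Env n k t κ D (collect.eval σ) := E.of_unchanged hu1 rfl
  set σ₁ := collect.eval σ
  obtain ⟨s1, s2⟩ := sort_spec (σ := σ₁) (L := L) ((hu1.v 4 rfl).trans h4) ((hu1.v 3 rfl).trans h3)
  have hu2 := unchanged sort σ₁
  have E2 : Env n k t κ D (sort.eval σ₁) := E1.of_unchanged hu2 rfl
  set σ₂ := sort.eval σ₁
  have p1 := powers_spec σ₂
  have v42 : σ₂.v 4 = L := (hu2.v 4 rfl).trans ((hu1.v 4 rfl).trans h4)
  rw [v42] at p1
  have hu3 := unchanged powers σ₂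
  have E3 : Env n k t κ D (powers.eval σ₂) := E2.of_unchanged hu3 rfl
  set σ₃ := powers.eval σ₂
  have b3 : σ₃.B 6 = σ₂.B 6 := hu3.B 6 rfl
  have hval : ∀ x, (∃ a < 2 ^ L, σ₃.B 6 a = x) ↔ ∃ i < n, ∃ j < n, D i j = x := by
    intro x; rw [b3, s2, c1]
  have h0 : Feasible n k D (σ₃.B 6 0) := by
    refine feasible_of_le hkn fun i hi j hj => ?_
    obtain ⟨a, ha, ha'⟩ := (hval 0).2 ⟨0, hn, 0, hn, hD 0 hn⟩
    have := s1 0 a (by omega) ha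
    rw [← b3, ha'] at this
    exact this.trans (hD0 i j)
  obtain ⟨p, -, q2, q3, q4⟩ := binarySearch_spec E3 hs hk H ((hu3.v 4 rfl).trans v42) p1
    (by rw [b3]; exact s1) h0
  have hu4 := unchanged binarySearch σ₃
  have E4 : Env n k t κ D (binarySearch.eval σ₃) := E3.of_unchanged hu4 (by decide +kernel)
  set σ₄ := binarySearch.eval σ₃
  have a2 : σ₄.A 2 = σ.A 2 := (hu4.A 2 (by decide +kernel)).trans
    ((hu3.A 2 rfl).trans ((hu2.A 2 rfl).trans (hu1.A 2 rfl)))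
  obtain ⟨o1, o2⟩ := output_spec σ₄
  rw [q2] at o1
  rw [E4.v1, a2] at o2
  have ho : solve.eval σ = output.eval σ₄ := rfl
  rw [ho]
  refine ⟨σ₃.B 6 p, σ₄.A 9, o1, o2, fun i hi => q3.lt hi,
    fun i hi j hj hij => q3.apart hs hi hj hij,
    fun i hi j hj hf => ?_⟩
  obtain ⟨a, ha, ha'⟩ := (hval (D i j)).2 ⟨i, hi, j, hj, rfl⟩
  rw [← ha'] at hf ⊢
  exact q4 a ha hf

open RealRAM

/-! ### The running time -/

namespace Cmd

/-- The order of magnitude of the loop bound in register `b`: the exponents of `n`, of `k` and of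
`log n`. -/
def order : ℕ → ℕ × ℕ × ℕ
  | 0 | 2 => (1, 0, 0)
  | 1 => (0, 1, 0)
  | 3 | 5 => (2, 0, 0)
  | 4 => (0, 0, 1)
  | _ => (0, 0, 0)

/-- On every path into nested loops, the product of the loop bounds is of order at most
`n ^ p * k ^ q * L ^ s`. -/
def fits : Cmd → ℕ → ℕ → ℕ → Bool
  | seq c₁ c₂, p, q, s | ifN _ _ c₁ c₂, p, q, s | ifR _ _ c₁ c₂, p, q, s =>
    c₁.fits p q s && c₂.fits p q s
  | loop _ b c, p, q, s => (b < 6 && (order b).1 ≤ p && (order b).2.1 ≤ q && (order b).2.2 ≤ s) &&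
      c.fits (p - (order b).1) (q - (order b).2.1) (s - (order b).2.2)
  | _, _, _, _ => true

/-- The bound for the cost is of the order of magnitude given by the nesting of the loops; the
constant is its value when all loops have two rounds. -/
lemma costBound_le {n k L : ℕ} {w : ℕ → ℕ} (hn : 0 < n) (hk : 0 < k) (hL : 0 < L)
    (hw : ∀ b < 6, w b ≤ 2 * (n ^ (order b).1 * k ^ (order b).2.1 * L ^ (order b).2.2)) {c : Cmd}
    {p q s : ℕ} (h : c.fits p q s = true) :
    c.costBound w ≤ c.costBound (fun _ => 2) * (n ^ p * k ^ q * L ^ s) := by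
  have hpos : ∀ p q s, 0 < n ^ p * k ^ q * L ^ s := fun p q s => by positivity
  induction c generalizing p q s with
  | seq c₁ c₂ ih₁ ih₂ =>
    simp only [fits, Bool.and_eq_true] at h
    have := ih₁ h.1
    have := ih₂ h.2
    simp only [costBound]
    linarith
  | ifN a b c₁ c₂ ih₁ ih₂ | ifR a b c₁ c₂ ih₁ ih₂ =>
    simp only [fits, Bool.and_eq_true] at h
    have e1 := ih₁ h.1
    have e2 := ih₂ h.2
    have e3 := Nat.le_mul_of_pos_right (2 : ℕ) (hpos p q s)
    simp only [costBound, add_mul]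
    exact add_le_add (Nat.le_mul_of_pos_right _ (hpos p q s)) (add_le_add (add_le_add e1 e2) e3)
  | loop d b c ih =>
    simp only [costBound]
    simp only [fits, Bool.and_eq_true, decide_eq_true_eq] at h
    obtain ⟨⟨⟨⟨hb, hp⟩, hq⟩, hs⟩, h⟩ := h
    have hb := hw b hb
    have hc := ih h
    set m := n ^ (order b).1 * k ^ (order b).2.1 * L ^ (order b).2.2
    set Z := n ^ (p - (order b).1) * k ^ (q - (order b).2.1) * L ^ (s - (order b).2.2) with hZ
    have hmZ : n ^ p * k ^ q * L ^ s = m * Z := by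
      rw [← Nat.add_sub_of_le hp, ← Nat.add_sub_of_le hq, ← Nat.add_sub_of_le hs]
      simp only [hZ, m, pow_add]
      ring
    have hZ0 : 0 < Z := hpos ..
    have hm0 : 0 < m := hpos ..
    rw [hmZ]
    calc 4 + w b * (6 + c.costBound w)
        ≤ 4 * (m * Z) + 2 * m * (6 * Z + c.costBound (fun _ => 2) * Z) :=
          add_le_add (Nat.le_mul_of_pos_right _ (Nat.mul_pos hm0 hZ0))
            (Nat.mul_le_mul hb (add_le_add (Nat.le_mul_of_pos_right _ hZ0) hc))
      _ = (4 + 2 * (6 + c.costBound (fun _ => 2))) * (m * Z) := by ring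
  | _ => exact Nat.le_mul_of_pos_right _ (hpos p q s)

end Cmd

/-- The algorithm, for at least three points and `2 ≤ k`, once the loop bounds are in place. -/
def work : Cmd := copyIn ;; rows ;; cyclicOrder ;; prepare ;; solve

/-- The algorithm. For `k = 1` the first point is a solution, and nothing needs to be done. -/
def main : Cmd := .ifN (r 1) 1 .skip (sizes ;; bounds ;; work)

lemma main_wf : main.wf = true := by decide +kernel

/-- The bounds that the first part of the program computes. -/
lemma bounds_spec (σ : Store) (h : 0 < σ.v 0) :
    let τ := bounds.eval (sizes.eval σ)
    ∃ L, τ.v 0 = σ.v 0 ∧ τ.v 1 = σ.v 1 ∧ τ.v 2 = σ.v 0 + 1 ∧ τ.v 3 = 2 ^ L ∧ τ.v 4 = L ∧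
      τ.v 5 = σ.v 0 * σ.v 0 ∧ σ.v 0 * σ.v 0 ≤ 2 ^ L ∧ 2 ^ L ≤ 2 * (σ.v 0 * σ.v 0) := by
  intro τ
  obtain ⟨h1, h2, h3, h4⟩ := sizes_spec σ
  have h0 := (unchanged sizes σ).v 0 rfl
  have hk := (unchanged sizes σ).v 1 rfl
  have hn := Nat.mul_pos h h
  refine ⟨(sizes.eval σ).v 12, ?_⟩
  rw [← h2]
  simp only [τ, bounds, Cmd.eval_seq, Cmd.eval_setV]
  simp [h0, hk, h1, h3]
  omega

lemma sizes_fixedBounds : sizes.fixedBounds = true := by decide +kernel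
lemma sizes_fits : sizes.fits 2 3 1 = true := by decide +kernel
lemma work_fixedBounds : work.fixedBounds = true := by decide +kernel
lemma work_fits : work.fits 2 3 1 = true := by decide +kernel

lemma cost_bounds (σ : Store) : bounds.cost σ = bounds.costBound fun _ => 2 := rfl

lemma costBound_main : main.costBound (fun _ => 2) = ((r 1).code 0 ++ NExp.code 1 1).length +
    (0 + (sizes.costBound (fun _ => 2) +
    (bounds.costBound (fun _ => 2) + work.costBound (fun _ => 2))) + 2) := by
  simp only [main, Cmd.costBound, Cmd.code, List.length_nil]

lemma cost_main_le (σ : Store) : main.cost σ ≤ ((r 1).code 0 ++ NExp.code 1 1).length +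
    (sizes.cost σ + (bounds.cost (sizes.eval σ) + work.cost (bounds.eval (sizes.eval σ))) + 2) := by
  rw [main, Cmd.cost]
  refine Nat.add_le_add_left ?_ _
  split_ifs
  · simp [Cmd.cost, Cmd.code]
  · exact le_rfl

lemma cost_main {σ : Store} {n k L : ℕ} (h0 : σ.v 0 = n) (h1 : σ.v 1 = k)
    (hv : ∀ r, 2 ≤ r → σ.v r = 0) (hn : 0 < n) (hk : 0 < k) (hL : 0 < L)
    (h4 : (bounds.eval (sizes.eval σ)).v 4 = L) :
    main.cost σ ≤ main.costBound (fun _ => 2) * (n ^ 2 * k ^ 3 * L ^ 1) := by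
  set τ := bounds.eval (sizes.eval σ) with hτ
  obtain ⟨L', b0, b1, b2, b3, b4, b5, b6, b7⟩ := bounds_spec σ (by omega)
  rw [← hτ] at b0 b1 b2 b3 b4 b5
  obtain rfl : L' = L := by rw [← b4, h4]
  rw [h0] at b0 b2 b5 b6 b7
  rw [h1] at b1
  have c1 : sizes.cost σ ≤ _ := (Cmd.cost_le sizes_fixedBounds σ.v σ fun _ _ => rfl).trans
    (Cmd.costBound_le hn hk hL (fun b hb => by
      rcases Nat.lt_or_ge b 2 with h | h
      · interval_cases b
        · simp [Cmd.order, h0]; omega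
        · simp [Cmd.order, h1]; omega
      · simp [hv b h]) sizes_fits)
  have c2 : work.cost τ ≤ _ := (Cmd.cost_le work_fixedBounds τ.v τ fun _ _ => rfl).trans
    (Cmd.costBound_le hn hk hL (fun b hb => by
      interval_cases b <;> simp [Cmd.order, b0, b1, b2, b3, h4, b5, pow_two] <;> nlinarith)
      work_fits)
  have c3 := cost_bounds (sizes.eval σ)
  have c4 := cost_main_le σ
  rw [← hτ] at c4
  rw [costBound_main]
  have hZ : 0 < n ^ 2 * k ^ 3 * L' ^ 1 := by positivity
  generalize n ^ 2 * k ^ 3 * L' ^ 1 = Z at c1 c2 hZ ⊢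
  generalize ((r 1).code 0 ++ NExp.code 1 1).length = l at c4 ⊢
  generalize bounds.costBound (fun _ => 2) = b at c3 ⊢
  have := Nat.le_mul_of_pos_right l hZ
  have := Nat.le_mul_of_pos_right b hZ
  linarith

lemma pow_three_le (k : ℕ) : k ^ 3 ≤ 8 * 2 ^ k := by
  rcases Nat.lt_or_ge k 4 with h | h
  · interval_cases k <;> norm_num
  · induction k, h using Nat.le_induction with
    | base => norm_num
    | succ k h ih =>
      have : (k + 1) ^ 3 ≤ 2 * k ^ 3 := by
        nlinarith [Nat.mul_le_mul_right (k * k) h, Nat.mul_le_mul_right k h]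
      rw [pow_succ 2 k]
      omega

/-- The loop bounds make for the required order of magnitude. -/
lemma time_le {n k L : ℕ} (hn : 2 ≤ n) (hk : 0 < k) (hL : 2 ^ L ≤ 2 * (n * n)) :
    ((n ^ 2 * k ^ 3 * L ^ 1 : ℕ) : ℝ) ≤ 40 * (2 ^ k * ((n : ℝ) ^ 2 * Real.log n +
      (n : ℝ) * Real.log n ^ 2 * Real.log k)) := by
  have hn' : (2 : ℝ) ≤ n := by exact_mod_cast hn
  have hk' : (1 : ℝ) ≤ k := by exact_mod_cast hk
  have h2 := Real.log_two_gt_d9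
  have hlog : Real.log 2 ≤ Real.log n := Real.log_le_log (by norm_num) hn'
  have hL' : (L : ℝ) ≤ 5 * Real.log n := by
    have h1 : ((2 : ℝ)) ^ L ≤ 2 * (n * n) := by exact_mod_cast hL
    have h3 := Real.log_le_log (by positivity) h1
    rw [Real.log_pow, Real.log_mul (by norm_num) (by positivity),
      Real.log_mul (by positivity) (by positivity)] at h3
    nlinarith
  have h3 : (k : ℝ) ^ 3 ≤ 8 * 2 ^ k := by exact_mod_cast pow_three_le k
  have h4 : 0 ≤ (n : ℝ) * Real.log n ^ 2 * Real.log k := by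
    have := Real.log_nonneg hk'
    positivity
  push_cast
  calc (n : ℝ) ^ 2 * k ^ 3 * L ^ 1 ≤ n ^ 2 * (8 * 2 ^ k) * (5 * Real.log n) := by
        rw [pow_one]; gcongr
    _ = 40 * (2 ^ k * (n ^ 2 * Real.log n)) := by ring
    _ ≤ _ := by gcongr; linarith

open RealRAM

/-! ### Optimality of the output -/

lemma main_eval {σ : Store} (hk : 2 ≤ σ.v 1) :
    main.eval σ = work.eval (bounds.eval (sizes.eval σ)) := by
  have : ¬ (r 1).eval σ ≤ NExp.eval σ 1 := not_le.2 hk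
  rw [main, Cmd.eval, if_neg this, Cmd.eval_seq, Cmd.eval_seq]

lemma work_spec {n k L : ℕ} {σ : Store} {x y : ℕ → ℝ} (hn : 3 ≤ n) (hk : 0 < k) (hkn : k ≤ n)
    (h0 : σ.v 0 = n) (h1 : σ.v 1 = k) (h2 : σ.v 2 = n + 1) (h3 : σ.v 3 = 2 ^ L) (h4 : σ.v 4 = L)
    (hnL : n * n ≤ 2 ^ L) (hx : ∀ i < n, σ.B ((i + i) % 16) ((i + i) / 16) = x i)
    (hy : ∀ i < n, σ.B ((i + i + 1) % 16) ((i + i + 1) / 16) = y i) (hP : ConvexPosition n x y) :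
    ∃ (ρ : ℝ) (q w : ℕ → ℕ), (∀ i < n, q i < n) ∧ (∀ i < n, ∀ j < n, q i = q j → i = j) ∧
      (work.eval σ).x 0 = √ρ / 2 ∧
      (∀ i < k, (work.eval σ).A (i % 16) (i / 16) = q (w i)) ∧ (∀ i < k, w i < n) ∧
      (∀ i < k, ∀ j < k, i ≠ j → w i ≠ w j ∧ ρ ≤ sqDist x y (q (w i)) (q (w j))) ∧
      ∀ i < n, ∀ j < n, Feasible n k (fun i j => sqDist x y (q i) (q j)) (sqDist x y (q i) (q j)) →
        sqDist x y (q i) (q j) ≤ ρ := by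
  subst h0
  have a1 := copyIn_spec σ x y hx hy
  have u1 := unchanged copyIn σ
  set σ₁ := copyIn.eval σ
  have a2 := rows_spec σ₁ (by rw [u1.v 2 rfl, u1.v 0 rfl, h2])
  have u2 := unchanged rows σ₁
  set σ₂ := rows.eval σ₁
  have n2 : σ₂.v 0 = σ.v 0 := (u2.v 0 rfl).trans (u1.v 0 rfl)
  have hB : ∀ i < σ.v 0, σ₂.B 0 i = x i ∧ σ₂.B 1 i = y i := by
    rw [u2.B 0 rfl, u2.B 1 rfl]; exact a1
  have hP2 : ConvexPosition (σ₂.v 0) (σ₂.B 0) (σ₂.B 1) := by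
    rw [n2]
    intro a b c e ha hb hc he
    rw [(hB a ha).1, (hB a ha).2, (hB b hb).1, (hB b hb).2, (hB c hc).1, (hB c hc).2, (hB e he).1,
      (hB e he).2]
    exact hP a b c e ha hb hc he
  obtain ⟨R, W, F⟩ := cyclicOrder_spec (n2.symm ▸ hn) hP2
  have u3 := unchanged cyclicOrder σ₂
  set σ₃ := cyclicOrder.eval σ₂
  have n3 : σ₃.v 0 = σ₂.v 0 := u3.v 0 (by decide +kernel)
  have b30 : σ₃.B 0 = σ₂.B 0 := u3.B 0 (by decide +kernel)
  have b31 : σ₃.B 1 = σ₂.B 1 := u3.B 1 (by decide +kernel)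
  have r3 : σ₃.A 0 = σ₂.A 0 := u3.A 0 (by decide +kernel)
  rw [← n3, ← b30, ← b31] at R F hP2
  obtain ⟨t, κ, E, hS⟩ := prepare_spec (by rw [r3, n3, n2, ← u1.v 0 rfl]; exact a2) hP2 R F
  have u4 := unchanged prepare σ₃
  set σ₄ := prepare.eval σ₃
  have q4 : σ₄.A 2 = σ₃.A 2 := u4.A 2 (by decide +kernel)
  have v1 : σ₃.v 1 = k :=
    (u3.v 1 (by decide +kernel)).trans ((u2.v 1 rfl).trans ((u1.v 1 rfl).trans h1))
  have v3 : σ₄.v 3 = 2 ^ L := (u4.v 3 (by decide +kernel)).trans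
    ((u3.v 3 (by decide +kernel)).trans ((u2.v 3 rfl).trans ((u1.v 3 rfl).trans h3)))
  have v4 : σ₄.v 4 = L := (u4.v 4 (by decide +kernel)).trans
    ((u3.v 4 (by decide +kernel)).trans ((u2.v 4 rfl).trans ((u1.v 4 rfl).trans h4)))
  rw [v1, n3, n2] at E
  rw [n3, n2] at hS R
  obtain ⟨ρ, w, e1, e2, e3, e4, e5⟩ := solve_spec E (fun i j => sqDist_comm _ _ _ _)
    (fun i _ => by simp [sqDist]) (fun i j => by unfold sqDist; positivity) hk hkn hS v4 v3 hnL
  have hD : ∀ i < σ.v 0, ∀ j < σ.v 0, sqDist (σ₃.B 0) (σ₃.B 1) (σ₃.A 2 i) (σ₃.A 2 j) =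
      sqDist x y (σ₃.A 2 i) (σ₃.A 2 j) := fun i hi j hj => by
    rw [b30, b31]
    simp only [sqDist, hB _ (R.lt i hi), hB _ (R.lt j hj)]
  have hw : work.eval σ = solve.eval σ₄ := by simp only [work, Cmd.eval_seq, σ₄, σ₃, σ₂, σ₁]
  rw [hw]
  refine ⟨ρ, σ₃.A 2, w, R.lt, R.inj, e1, by rw [← q4]; exact e2, e3, fun i hi j hj hij => ?_,
    fun i hi j hj ⟨S, s1, s2, s3⟩ => ?_⟩
  · rw [← hD _ (e3 i hi) _ (e3 j hj)]; exact e4 i hi j hj hij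
  · rw [← hD _ hi _ hj]
    refine e5 i hi j hj ⟨S, s1, s2, fun a ha b hb hab => ?_⟩
    have := s3 a ha b hb hab
    unfold Far at this ⊢
    beta_reduce at this ⊢
    rwa [hD _ hi _ hj, hD _ (s2 a ha) _ (s2 b hb)]

lemma dist_eq_sqrt_sqDist {n : ℕ} (P : Fin n → EuclideanSpace ℝ (Fin 2)) (a b : Fin n) :
    dist (P a) (P b) = √(sqDist (coord P 0) (coord P 1) a b) := by
  simp [EuclideanSpace.dist_eq, Real.dist_eq, sqDist, coord]

/-- If all `k`-element sets have two points at distance at most `√ρ`, and the pairwise distances of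
the points listed by `f` are at least `√ρ`, these points form an optimal set. -/
lemma exists_isOptimal {n k : ℕ} {P : Fin n → EuclideanSpace ℝ (Fin 2)}
    (hP : Function.Injective P) {ρ : ℝ} {f : ℕ → ℕ} (hf : ∀ i < k, f i < n)
    (hd : ∀ i < k, ∀ j < k, i ≠ j → f i ≠ f j ∧ ρ ≤ sqDist (coord P 0) (coord P 1) (f i) (f j))
    (hT : ∀ T : Finset (Fin n), T.card = k → ∃ a ∈ T, ∃ b ∈ T, a ≠ b ∧
      sqDist (coord P 0) (coord P 1) a b ≤ ρ) :
    ∃ S : Finset (Fin n), Dispersion.IsOptimal P k S ∧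
      (Finset.range k).image f = S.image (fun i : Fin n => (i : ℕ)) ∧
      (P '' (S : Set (Fin n))).infsep = √ρ := by
  set S : Finset (Fin n) := Finset.univ.filter fun a => ∃ i < k, f i = a with hS
  have hmem : ∀ a, a ∈ S ↔ ∃ i < k, f i = a := fun a => by simp [hS]
  have himage : (Finset.range k).image f = S.image (fun i : Fin n => (i : ℕ)) := by
    ext b
    simp only [Finset.mem_image, Finset.mem_range, hmem]
    constructor
    · rintro ⟨i, hi, rfl⟩
      exact ⟨⟨f i, hf i hi⟩, ⟨i, hi, rfl⟩, rfl⟩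
    · rintro ⟨a, ⟨i, hi, h⟩, rfl⟩
      exact ⟨i, hi, h⟩
  have hcard : S.card = k := by
    rw [← Finset.card_image_of_injective S Fin.val_injective, ← himage,
      Finset.card_image_of_injOn, Finset.card_range]
    intro i hi j hj h
    by_contra hij
    exact (hd i (by simpa using hi) j (by simpa using hj) hij).1 h
  have hfar : ∀ x ∈ P '' (S : Set (Fin n)), ∀ y ∈ P '' (S : Set (Fin n)), x ≠ y →
      √ρ ≤ dist x y := by
    rintro _ ⟨a, ha, rfl⟩ _ ⟨b, hb, rfl⟩ hab
    obtain ⟨i, hi, hi'⟩ := (hmem a).1 ha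
    obtain ⟨j, hj, hj'⟩ := (hmem b).1 hb
    have hij : i ≠ j := by
      rintro rfl
      exact hab (congrArg P (Fin.ext (hi'.symm.trans hj')))
    rw [dist_eq_sqrt_sqDist, ← hi', ← hj']
    exact Real.sqrt_le_sqrt (hd i hi j hj hij).2
  refine ⟨S, ⟨hcard, fun T hTk => ?_⟩, himage, ?_⟩
  · obtain ⟨a, ha, b, hb, hab, h⟩ := hT T hTk
    refine (Set.einfsep_le_edist_of_mem (Set.mem_image_of_mem P ha) (Set.mem_image_of_mem P hb)
      (hP.ne hab)).trans (le_trans ?_ (Set.le_einfsep (d := ENNReal.ofReal √ρ)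
        fun x hx y hy hxy => ?_))
    · rw [edist_dist, dist_eq_sqrt_sqDist]
      exact ENNReal.ofReal_le_ofReal (Real.sqrt_le_sqrt h)
    · rw [edist_dist]
      exact ENNReal.ofReal_le_ofReal (hfar x hx y hy hxy)
  · obtain ⟨a, ha, b, hb, hab, h⟩ := hT S hcard
    have hne : P a ≠ P b := hP.ne hab
    have ha' := Set.mem_image_of_mem P (Finset.mem_coe.2 ha)
    have hb' := Set.mem_image_of_mem P (Finset.mem_coe.2 hb)
    refine le_antisymm ?_ (Set.Nontrivial.le_infsep ⟨_, ha', _, hb', hne⟩ hfar)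
    have : Finite (P '' (S : Set (Fin n))) := ((Finset.finite_toSet S).image P).to_subtype
    refine (Set.infsep_le_dist_of_mem ha' hb' hne).trans ?_
    rw [dist_eq_sqrt_sqDist]
    exact Real.sqrt_le_sqrt h

/-- If no feasible squared distance exceeds `ρ`, any `k` points include two at squared distance at
most `ρ`: the smallest squared distance among them is feasible. -/
lemma exists_close_pair {n k : ℕ} (hk : 2 ≤ k) {x y : ℕ → ℝ} {q : ℕ → ℕ}
    (hq : ∀ i < n, q i < n) (hinj : ∀ i < n, ∀ j < n, q i = q j → i = j) {ρ : ℝ}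
    (H : ∀ i < n, ∀ j < n,
      Feasible n k (fun i j => sqDist x y (q i) (q j)) (sqDist x y (q i) (q j)) →
        sqDist x y (q i) (q j) ≤ ρ) {T : Finset (Fin n)} (hT : T.card = k) :
    ∃ a ∈ T, ∃ b ∈ T, a ≠ b ∧ sqDist x y a b ≤ ρ := by
  have hne : T.offDiag.Nonempty := by
    obtain ⟨a, ha, b, hb, hab⟩ := Finset.one_lt_card.1 (show 1 < T.card by omega)
    exact ⟨(a, b), Finset.mem_offDiag.2 ⟨ha, hb, hab⟩⟩
  obtain ⟨⟨a, b⟩, hab, hmin⟩ := T.offDiag.exists_min_image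
    (fun z => sqDist x y z.1 z.2) hne
  rw [Finset.mem_offDiag] at hab
  have hsurj : ∀ a : Fin n, ∃ i < n, q i = a := fun a => exists_of_injective hq hinj a.2
  choose g hg hgq using hsurj
  refine ⟨a, hab.1, b, hab.2.1, hab.2.2, ?_⟩
  have := H (g a) (hg a) (g b) (hg b)
  rw [hgq, hgq] at this
  refine this ⟨T.image g, ?_, ?_, ?_⟩
  · rw [Finset.card_image_of_injective, hT]
    intro c d h
    exact Fin.ext (by rw [← hgq c, ← hgq d]; exact congrArg q h)
  · intro j hj
    obtain ⟨c, -, rfl⟩ := Finset.mem_image.1 hj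
    exact hg c
  · intro i hi j hj hij
    obtain ⟨c, hc, rfl⟩ := Finset.mem_image.1 hi
    obtain ⟨d, hd, rfl⟩ := Finset.mem_image.1 hj
    have := hmin (c, d) (Finset.mem_offDiag.2 ⟨hc, hd, fun h => hij (congrArg g h)⟩)
    simpa [Far, hgq] using this

end Structured

open Structured in
theorem theorem1 :
    ∃ (prog : RealRAM.Program) (C : ℝ),
      ∀ (n k : ℕ), 0 < k → k < n →
        ∀ P : Fin n → EuclideanSpace ℝ (Fin 2), ConvexIndependent ℝ P →
          ∃ (t : ℕ) (τ : RealRAM.State),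
            (t : ℝ) ≤ C * (2 ^ k * ((n : ℝ) ^ 2 * Real.log n +
              (n : ℝ) * Real.log n ^ 2 * Real.log k)) ∧
            RealRAM.HaltsWithin prog (Dispersion.input P k) t τ ∧
            Dispersion.IsSolution P k τ := by
  refine ⟨main.code 0 0, main.costBound (fun _ => 2) * 40, fun n k hk hkn P hP => ?_⟩
  set m := Dispersion.input P k with hm
  set σ := dataOf m with hσ
  have v0 : σ.v 0 = n := rfl
  have v1 : σ.v 1 = k := rfl
  have hv : ∀ r, 2 ≤ r → σ.v r = 0 := fun r hr => by
    simp only [hσ, hm, dataOf, Dispersion.input]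
    rw [if_neg (by omega), if_neg (by omega)]
  have hx : ∀ i < n, σ.B ((i + i) % 16) ((i + i) / 16) = coord P 0 i := fun i hi => by
    simp only [hσ, hm, dataOf, Dispersion.input]
    rw [show 16 * ((i + i) / 16) + (i + i) % 16 = i + i by omega]
    simp [coord, hi, show (i + i) / 2 = i by omega, show (i + i) % 2 = 0 by omega]
  have hy : ∀ i < n, σ.B ((i + i + 1) % 16) ((i + i + 1) / 16) = coord P 1 i := fun i hi => by
    simp only [hσ, hm, dataOf, Dispersion.input]
    rw [show 16 * ((i + i + 1) / 16) + (i + i + 1) % 16 = i + i + 1 by omega]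
    simp [coord, hi, show (i + i + 1) / 2 = i by omega, show (i + i + 1) % 2 = 1 by omega]
  obtain ⟨τ, hhalt, hrel⟩ := halts main main_wf m rfl
  rw [← hσ] at hhalt hrel
  obtain ⟨L, b0, b1, b2, b3, b4, -, b6, b7⟩ := bounds_spec σ (by omega)
  rw [v0] at b0 b2 b6 b7
  have hL : 0 < L := by
    rcases Nat.eq_zero_or_pos L with rfl | h
    · nlinarith
    · exact h
  refine ⟨_, τ, ?_, hhalt, ?_⟩
  · rw [mul_assoc]
    have h1 := cost_main v0 v1 hv (by omega) hk hL b4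
    have h2 := time_le (n := n) (by omega) hk b7
    refine (Nat.cast_le.2 h1).trans ?_
    rw [Nat.cast_mul]
    exact mul_le_mul_of_nonneg_left h2 (Nat.cast_nonneg _)
  have hmem : ∀ i, τ.natMem i = (main.eval σ).A (i % 16) (i / 16) := fun i => by
    rw [← hrel.natMem (i % 16) (Nat.mod_lt _ (by norm_num)) (i / 16), Nat.div_add_mod]
  rcases Nat.lt_or_ge k 2 with h | h
  · obtain rfl : k = 1 := by omega
    have hmain : main.eval σ = σ := by
      rw [main, Cmd.eval, if_pos (show (r 1).eval σ ≤ NExp.eval σ 1 from v1.le), Cmd.eval]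
    refine ⟨{⟨0, by omega⟩}, ⟨by simp, fun T _ => by simp⟩, ?_, by omega⟩
    have : τ.natMem 0 = 0 := by rw [hmem, hmain]; rfl
    simp [this]
  · have hmain := main_eval (σ := σ) (v1.symm ▸ h)
    set σ' := bounds.eval (sizes.eval σ)
    rw [hmain] at hmem hrel
    have hB : σ'.B = σ.B := by
      funext a
      exact ((unchanged bounds (sizes.eval σ)).B a rfl).trans ((unchanged sizes σ).B a rfl)
    obtain ⟨ρ, q, w, q1, q2, w1, w2, w3, w4, w5⟩ := work_spec (k := k) (by omega) hk hkn.le b0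
      (b1.trans v1) b2 b3 b4 b6 (by rw [hB]; exact hx) (by rw [hB]; exact hy)
      (convexPosition_of_convexIndependent hP)
    obtain ⟨S, s1, s2, s3⟩ := exists_isOptimal hP.injective (f := fun i => q (w i))
      (fun i hi => q1 _ (w3 i hi)) (fun i hi j hj hij => ⟨fun hq => (w4 i hi j hj hij).1
        (q2 _ (w3 i hi) _ (w3 j hj) hq), (w4 i hi j hj hij).2⟩)
      fun T hT => exists_close_pair h q1 q2 w5 hT
    refine ⟨S, s1, ?_, fun _ => ?_⟩
    · rw [← s2]
      refine Finset.image_congr fun i hi => ?_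
      rw [hmem]
      exact w2 i (by simpa using hi)
    · rw [hrel.real 0 (by norm_num), w1, s3]
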